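/- **Setting.** Let $z_0<z_1$, $J=(z_0,z_1)$, $\Omega=\mathbb R^2\times J$, and let $\|f\|_{\infty,p}=\operatorname{ess\,sup}_{x'\in\mathbb R^2}\|f(x',\cdot)\|_{L^p(J)}$ be the norm of $L^\infty(L^p)=L^\infty(\mathbb R^2;L^p(J))$, $1\le p\le\infty$. Write $\overline f=\frac1{z_1-z_0}\int_J f\,dz$. Let $L^\infty_\sigma(L^p)$ be the space of all (real or complex) $f=(f_1,f_2)\in L^\infty(L^p)$ with $\int_{\mathbb R^2}\overline f\cdot\nabla_H\varphi\,dx'=0$ for all $\varphi\in L^1_{loc}(\mathbb R^2)$ with $\nabla_H\varphi\in L^1(\mathbb R^2)$. Put $BUC(L^p)=BUC(\mathbb R^2;L^p(J))$, $BUC(BUC)=BUC(\mathbb R^2;BUC(J))$ (with the supremum norm), $BUC_\sigma(L^p)=BUC(L^p)\cap L^\infty_\sigma(L^p)$ and $BUC_\sigma(BUC)=BUC(BUC)\cap L^\infty_\sigma(L^\infty)$. Let $S(t)=e^{t\Delta_H}\otimes e^{t\Delta_N}$ be the hydrostatic Stokes semigroup ($\Delta_H$ the Laplacian on $\mathbb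 R^2$, $\Delta_N$ the Neumann Laplacian on $J$) and $\mathbb Pf=f+\nabla_H(-\Delta_H)^{-1}\operatorname{div}_H\overline f$. For $C,T>0$, $a_1\in BUC_\sigma(L^1)$ and $a_2\in L^\infty_\sigma(L^1)$, a *local mild solution on $(0,T)$* of the primitive equations with Neumann boundary conditions and initial value $a=a_1+a_2$ is a function $v\in C((0,T);BUC_\sigma(L^1))$ with $$\sup_{0<t<T}\|v(t)\|_{\infty,1}<\infty,\qquad \sup_{0<t<T}t^{1/2}\|\nabla v(t)\|_{\infty,1}<\infty,\qquad \limsup_{t\to0}t^{1/2}\|\nabla v(t)\|_{\infty,1}\le C\|a_2\|_{\infty,1},$$ $$v(t)=S(t)a-\int_0^tS(t-s)\mathbb P\nabla\cdot(u(s)\otimes v(s))\,ds\quad(0<t<T),\qquad u=(v,w),\quad w(x',z)=\int_z^{z_1}\operatorname{div}_Hv(x',\zeta)\,d\zeta .$$ **Proposition.** For all $C>0$ and $R$ there is $\varepsilon_0>0$ such that the following holds whenever $a_1\in BUC_\sigma(L^1)$, $\|a_1\|_{\infty,1}\le R$, $a_2\in L^\infty_\sigma(L^1)$, $\|a_2\|_{\infty,1}<\varepsilon_0$,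 $T>0$, and $v$ is a local mild solution on $(0,T)$ with initial value $a=a_1+a_2$ (in the above class, with this $C$). a) If $a\in L^\infty_\sigma(L^p)$ for some $p\in(1,\infty]$, then $t^{\frac12-\frac1{2p}}v$ and $t^{1-\frac1{2p}}\partial_iv$ ($i=1,2$) belong to $L^\infty(0,T;L^\infty_\sigma(L^p))$, and $t^{1-\frac1{2p}}\partial_zv\in L^\infty(0,T;L^\infty(L^p))$. b) If $a\in BUC_\sigma(L^p)$ for some $p\in(1,\infty]$, then $t^{\frac12-\frac1{2p}}v$ and $t^{1-\frac1{2p}}\partial_iv$ ($i=1,2$) belong to $C([0,T);BUC_\sigma(L^p))$, and $t^{1-\frac1{2p}}\partial_zv\in C([0,T);BUC(L^p))$. c) If $a\in BUC_\sigma(BUC)$, then $t^{\frac12}v$ and $t\,\partial_iv$ ($i=1,2$) belong to $C([0,T);BUC_\sigma(BUC))$, and $t\,\partial_zv\in C([0,T);BUC(BUC))$. Here $1/\infty=0$, and in b) and c) the weighted functions have the value $0$ at $t=0$. -/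

import Mathlib

open MeasureTheory Set Filter Topology
open scoped ENNReal ContDiff

noncomputable section

namespace Primitive

/-- The horizontal plane `ℝ²`. -/
abbrev Plane : Type := EuclideanSpace ℝ (Fin 2)

/-- Points `(x', z)`, with `x'` horizontal and `z` vertical. Functions on the layer
`Ω = ℝ² × (z₀, z₁)` are functions on `Dom` of which only the values on `Ω` matter, and these
only up to null sets. -/
abbrev Dom : Type := Plane × ℝ

/-- Values of the horizontal velocity, real (`𝕜 = ℝ`) or complex (`𝕜 = ℂ`). -/
abbrev Vec (𝕜 : Type*) : Type _ := EuclideanSpace 𝕜 (Fin 2)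

/-! ### Function spaces -/

section Spaces

variable {F : Type*} [NormedAddCommGroup F]

/-- Lebesgue measure on the layer `ℝ² × (z₀, z₁)`. -/
def layer (z₀ z₁ : ℝ) : Measure Dom :=
  (volume : Measure Plane).prod (volume.restrict (Ioo z₀ z₁))

/-- The norm `‖f‖_{∞,p} = ess sup_{x'} ‖f(x', ·)‖_{L^p(z₀, z₁)}`. -/
def mixedNorm (z₀ z₁ : ℝ) (p : ℝ≥0∞) (f : Dom → F) : ℝ≥0∞ :=
  essSup (fun x : Plane => eLpNorm (fun z : ℝ => f (x, z)) p (volume.restrict (Ioo z₀ z₁))) volume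

/-- `f ∈ L^∞(ℝ²; L^p(z₀, z₁))`. -/
def MemLInf (z₀ z₁ : ℝ) (p : ℝ≥0∞) (f : Dom → F) : Prop :=
  AEStronglyMeasurable f (layer z₀ z₁) ∧ mixedNorm z₀ z₁ p f < ⊤

/-- `f ∈ BUC(ℝ²; L^p(z₀, z₁))`: after a change on a null set, `x' ↦ f(x', ·)` is a bounded and
uniformly continuous map into `L^p(z₀, z₁)`. -/
def MemBUC (z₀ z₁ : ℝ) (p : ℝ≥0∞) (f : Dom → F) : Prop :=
  AEStronglyMeasurable f (layer z₀ z₁) ∧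
  ∃ g : Dom → F, f =ᵐ[layer z₀ z₁] g ∧
    (∀ x : Plane, AEStronglyMeasurable (fun z : ℝ => g (x, z)) (volume.restrict (Ioo z₀ z₁))) ∧
    (∃ M : ℝ, ∀ x : Plane,
      eLpNorm (fun z : ℝ => g (x, z)) p (volume.restrict (Ioo z₀ z₁)) ≤ ENNReal.ofReal M) ∧
    ∀ ε : ℝ, 0 < ε → ∃ δ : ℝ, 0 < δ ∧ ∀ x y : Plane, dist x y < δ →
      eLpNorm (fun z : ℝ => g (x, z) - g (y, z)) p (volume.restrict (Ioo z₀ z₁))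
        ≤ ENNReal.ofReal ε

/-- `f ∈ BUC(ℝ²; BUC(z₀, z₁))`: after a change on a null set, `x' ↦ f(x', ·)` is a bounded and
uniformly continuous map into the space of bounded uniformly continuous functions on `(z₀, z₁)`
with the supremum norm. -/
def MemBUCBUC (z₀ z₁ : ℝ) (f : Dom → F) : Prop :=
  ∃ g : Dom → F, f =ᵐ[layer z₀ z₁] g ∧
    (∀ x : Plane, UniformContinuousOn (fun z : ℝ => g (x, z)) (Ioo z₀ z₁)) ∧
    (∃ M : ℝ, ∀ x : Plane, ∀ z ∈ Ioo z₀ z₁, ‖g (x, z)‖ ≤ M) ∧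
    ∀ ε : ℝ, 0 < ε → ∃ δ : ℝ, 0 < δ ∧ ∀ x y : Plane, dist x y < δ →
      ∀ z ∈ Ioo z₀ z₁, ‖g (x, z) - g (y, z)‖ ≤ ε

/-- `f ∈ L^∞(0, T; X)` for a space `X` of functions on the layer with the norm `‖·‖_{∞,p}`:
almost all values lie in `X`, the map is strongly (Bochner) measurable, i.e. an a.e. limit of
simple functions, and it is essentially bounded. -/
def MemLInfTime (z₀ z₁ : ℝ) (p : ℝ≥0∞) (X : (Dom → F) → Prop) (T : ℝ) (f : ℝ → Dom → F) : Prop :=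
  (∀ᵐ t ∂(volume.restrict (Ioo 0 T)), X (f t)) ∧
  (∃ φ : ℕ → SimpleFunc ℝ (Dom → F), (∀ n t, MemLInf z₀ z₁ p (φ n t)) ∧
    ∀ᵐ t ∂(volume.restrict (Ioo 0 T)),
      Tendsto (fun n => mixedNorm z₀ z₁ p (φ n t - f t)) atTop (𝓝 0)) ∧
  ∃ M : ℝ, ∀ᵐ t ∂(volume.restrict (Ioo 0 T)), mixedNorm z₀ z₁ p (f t) ≤ ENNReal.ofReal M

/-- `f ∈ C(I; X)` for a space `X` of functions on the layer with the norm `‖·‖_{∞,p}`. -/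
def MemCTime (z₀ z₁ : ℝ) (p : ℝ≥0∞) (X : (Dom → F) → Prop) (I : Set ℝ) (f : ℝ → Dom → F) : Prop :=
  (∀ t ∈ I, X (f t)) ∧
  ∀ t ∈ I, Tendsto (fun s => mixedNorm z₀ z₁ p (f s - f t)) (𝓝[I] t) (𝓝 0)

end Spaces

/-- `g` is the weak derivative of `f` in direction `e` on the open set `U`. -/
def HasWeakDerivOn {E F : Type*} [NormedAddCommGroup E] [NormedSpace ℝ E] [MeasureSpace E]
    [NormedAddCommGroup F] [NormedSpace ℝ F] (U : Set E) (e : E) (f g : E → F) : Prop :=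
  LocallyIntegrableOn f U ∧ LocallyIntegrableOn g U ∧
  ∀ φ : E → ℝ, ContDiff ℝ ∞ φ → HasCompactSupport φ → tsupport φ ⊆ U →
    ∫ x in U, fderiv ℝ φ x e • f x = - ∫ x in U, φ x • g x

/-- The unit vectors of the plane. -/
def unit (i : Fin 2) : Plane := EuclideanSpace.single i (1 : ℝ)

/-- Classical partial derivative of a function on the plane. -/
def pd (i : Fin 2) (f : Plane → ℝ) (x : Plane) : ℝ := fderiv ℝ f x (unit i)

section Velocity

variable {𝕜 : Type*} [RCLike 𝕜]

/-- The vertical average of `f`. -/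
def mean (z₀ z₁ : ℝ) (f : Dom → Vec 𝕜) (x : Plane) : Vec 𝕜 :=
  (z₁ - z₀)⁻¹ • ∫ z in Ioo z₀ z₁, f (x, z)

/-- `div_H` of the vertical average vanishes: `∫ f̄ · ∇_H φ = 0` for all `φ ∈ L¹_loc(ℝ²)` with
`∇_H φ ∈ L¹(ℝ²)`. -/
def Solenoidal (z₀ z₁ : ℝ) (f : Dom → Vec 𝕜) : Prop :=
  ∀ (φ : Plane → ℝ) (dφ : Fin 2 → Plane → ℝ), LocallyIntegrable φ →
    (∀ i, Integrable (dφ i)) → (∀ i, HasWeakDerivOn univ (unit i) φ (dφ i)) →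
    ∫ x, ∑ i, dφ i x • mean z₀ z₁ f x i = 0

/-- `f ∈ L^∞_σ(ℝ²; L^p(z₀, z₁))`. -/
def MemLInfSigma (z₀ z₁ : ℝ) (p : ℝ≥0∞) (f : Dom → Vec 𝕜) : Prop :=
  MemLInf z₀ z₁ p f ∧ Solenoidal z₀ z₁ f

/-- `f ∈ BUC_σ(L^p) = BUC(ℝ²; L^p(z₀, z₁)) ∩ L^∞_σ(ℝ²; L^p(z₀, z₁))`. -/
def MemBUCSigma (z₀ z₁ : ℝ) (p : ℝ≥0∞) (f : Dom → Vec 𝕜) : Prop :=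
  MemBUC z₀ z₁ p f ∧ MemLInfSigma z₀ z₁ p f

/-- `f ∈ BUC_σ(BUC) = BUC(ℝ²; BUC(z₀, z₁)) ∩ L^∞_σ(ℝ²; L^∞(z₀, z₁))`. -/
def MemBUCBUCSigma (z₀ z₁ : ℝ) (f : Dom → Vec 𝕜) : Prop :=
  MemBUCBUC z₀ z₁ f ∧ MemLInfSigma z₀ z₁ ⊤ f

/-! ### The hydrostatic Stokes semigroup -/

/-- The Gauss kernel of the plane, the kernel of `e^{tΔ_H}`. -/
def gaussPlane (t : ℝ) (x : Plane) : ℝ := (4 * Real.pi * t)⁻¹ * Real.exp (-(‖x‖ ^ 2 / (4 * t)))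

/-- The Gauss kernel of the line. -/
def gaussLine (t : ℝ) (z : ℝ) : ℝ := (Real.sqrt (4 * Real.pi * t))⁻¹ * Real.exp (-(z ^ 2 / (4 * t)))

/-- The kernel of the Neumann heat semigroup `e^{tΔ_N}` on `(z₀, z₁)`: extend evenly across the
end points, with period `2 (z₁ - z₀)`, and apply the heat semigroup of the line. -/
def neumannKernel (z₀ z₁ t z ζ : ℝ) : ℝ :=
  ∑' k : ℤ, (gaussLine t (z - ζ + 2 * k * (z₁ - z₀))
    + gaussLine t (z + ζ - 2 * z₀ + 2 * k * (z₁ - z₀)))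

/-- The hydrostatic Stokes semigroup `S(t) = e^{tΔ_H} ⊗ e^{tΔ_N}`, `t > 0`. -/
def stokes (z₀ z₁ t : ℝ) (f : Dom → Vec 𝕜) (q : Dom) : Vec 𝕜 :=
  ∫ y : Plane, ∫ ζ in Ioo z₀ z₁,
    (gaussPlane t (q.1 - y) * neumannKernel z₀ z₁ t q.2 ζ) • f (y, ζ)

/-- The kernel of `∂_i ∂_j ∂_k (-Δ_H)^{-1} e^{tΔ_H}`, where `(-Δ_H)^{-1} = ∫_0^∞ e^{sΔ_H} ds`. -/
def rieszKernel (i j k : Fin 2) (t : ℝ) (x : Plane) : ℝ :=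
  ∫ s in Ioi t, pd i (pd j (pd k (gaussPlane s))) x

/-- `S(t) ℙ ∇·H` for the flux `H = (H₁, H₂, H_z)`, where the vector fields `H j` and `Hz` are
differentiated in the direction `x_j` and `z` respectively, so that
`∇·H = ∂₁ H₁ + ∂₂ H₂ + ∂_z H_z`, where `H_z = 0` at `z = z₀` and `z = z₁`, and where
`ℙ f = f + ∇_H (-Δ_H)^{-1} div_H f̄`. All derivatives are put on the kernels (with the sign of an
integration by parts for the derivative in the vertical source variable). The vertical average of
`∂_z H_z` vanishes, and `e^{tΔ_N}` is the identity on functions that do not depend on `z`, so that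
the component `k` of the contribution of `(-Δ_H)^{-1}` is
`∑_{i,j} ∂_k ∂_i ∂_j (-Δ_H)^{-1} e^{tΔ_H} (mean of the component i of H j)`. -/
def stokesProjDiv (z₀ z₁ t : ℝ) (H : Fin 2 → Dom → Vec 𝕜) (Hz : Dom → Vec 𝕜) (q : Dom) : Vec 𝕜 :=
  (∑ j, ∫ y : Plane, ∫ ζ in Ioo z₀ z₁,
      (pd j (gaussPlane t) (q.1 - y) * neumannKernel z₀ z₁ t q.2 ζ) • H j (y, ζ))
  - (∫ y : Plane, ∫ ζ in Ioo z₀ z₁,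
      (gaussPlane t (q.1 - y) * deriv (fun ξ => neumannKernel z₀ z₁ t q.2 ξ) ζ) • Hz (y, ζ))
  + WithLp.toLp 2 (fun k : Fin 2 =>
      ∑ i, ∑ j, ∫ y : Plane, rieszKernel k i j t (q.1 - y) • mean z₀ z₁ (H j) y i)

/-! ### Mild solutions -/

/-- The vertical velocity `w(x', z) = ∫_z^{z₁} div_H v`, from the horizontal derivatives
`DH i = ∂_i v`. -/
def vertVel (z₁ : ℝ) (DH : Fin 2 → Dom → Vec 𝕜) (q : Dom) : 𝕜 :=
  ∫ ζ in q.2..z₁, ∑ i, DH i (q.1, ζ) i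

/-- The function `S(t) ℙ ∇·(u ⊗ v)` with `u = (v, w)`. -/
def nonlin (z₀ z₁ t : ℝ) (v : Dom → Vec 𝕜) (DH : Fin 2 → Dom → Vec 𝕜) : Dom → Vec 𝕜 :=
  stokesProjDiv z₀ z₁ t (fun j q => v q j • v q) (fun q => vertVel z₁ DH q • v q)

/-- `DH` and `Dz` are the weak horizontal and vertical derivatives of `v` on the layer. -/
def IsWeakGrad (z₀ z₁ : ℝ) (v : Dom → Vec 𝕜) (DH : Fin 2 → Dom → Vec 𝕜) (Dz : Dom → Vec 𝕜) :
    Prop :=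
  (∀ i, HasWeakDerivOn (univ ×ˢ Ioo z₀ z₁ : Set Dom) ((unit i, 0) : Dom) v (DH i)) ∧
  HasWeakDerivOn (univ ×ˢ Ioo z₀ z₁ : Set Dom) ((0, 1) : Dom) v Dz

/-- The norm `‖∇v‖_{∞,p}`, as the sum of the norms of the partial derivatives. -/
def gradNorm (z₀ z₁ : ℝ) (p : ℝ≥0∞) (DH : Fin 2 → Dom → Vec 𝕜) (Dz : Dom → Vec 𝕜) : ℝ≥0∞ :=
  (∑ i, mixedNorm z₀ z₁ p (DH i)) + mixedNorm z₀ z₁ p Dz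

/-- `v`, with weak gradient `(DH, Dz)`, is a local mild solution on `(0, T)` of the primitive
equations with Neumann boundary conditions and with the initial value `a₁ + a₂`, in the class of
solutions with `v ∈ C((0, T); BUC_σ(L¹))`, with `v` and `t^{1/2} ∇v` bounded in `L^∞(L¹)`, and
with `limsup_{t → 0} t^{1/2} ‖∇v(t)‖_{∞,1} ≤ C ‖a₂‖_{∞,1}`. -/
structure IsLocalMildSolution (z₀ z₁ C T : ℝ) (a₁ a₂ : Dom → Vec 𝕜)
    (v : ℝ → Dom → Vec 𝕜) (DH : ℝ → Fin 2 → Dom → Vec 𝕜) (Dz : ℝ → Dom → Vec 𝕜) : Prop where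
  cont : MemCTime z₀ z₁ 1 (MemBUCSigma z₀ z₁ 1) (Ioo 0 T) v
  grad : ∀ t ∈ Ioo 0 T, IsWeakGrad z₀ z₁ (v t) (DH t) (Dz t) ∧
    (∀ i, MemLInf z₀ z₁ 1 (DH t i)) ∧ MemLInf z₀ z₁ 1 (Dz t)
  bdd : ∃ M : ℝ, ∀ t ∈ Ioo 0 T, mixedNorm z₀ z₁ 1 (v t) ≤ ENNReal.ofReal M ∧
    ENNReal.ofReal (Real.sqrt t) * gradNorm z₀ z₁ 1 (DH t) (Dz t) ≤ ENNReal.ofReal M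
  limsup_grad :
    limsup (fun t => ENNReal.ofReal (Real.sqrt t) * gradNorm z₀ z₁ 1 (DH t) (Dz t)) (𝓝[>] 0)
      ≤ ENNReal.ofReal C * mixedNorm z₀ z₁ 1 a₂
  mild : ∀ t ∈ Ioo 0 T, ∀ᵐ q ∂(layer z₀ z₁),
    IntegrableOn (fun s => nonlin z₀ z₁ (t - s) (v s) (DH s) q) (Ioo 0 t) ∧
    v t q = stokes z₀ z₁ t (a₁ + a₂) q
      - ∫ s in Ioo 0 t, nonlin z₀ z₁ (t - s) (v s) (DH s) q

end Velocity

end Primitive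

end

noncomputable section

namespace Primitive

/-! ### Self-similar kernels on the plane -/

/-! The class of solutions controls `v` and `t^{1/2}∇v` only in `L^∞(L¹)`. The vertical variable is
one-dimensional, so a vertical derivative in `L¹` bounds `v` pointwise
(`norm_le_of_weakDeriv_vertical`). Since `w` is a vertical integral of the divergence, the full
velocity `u = (v, w)` satisfies `|u(s)| ≤ U s^{-1/2}`. Hence one factor of the flux `u ⊗ v` can
always be taken in the supremum norm, and the integral equation becomes a linear one for the other
factor, with a coefficient of critical size.

The operator `S(τ)ℙ∇·` is a finite sum of integral operators with product kernels `k(x-y) m(z,ζ)`: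
`k` is self-similar, and `m` is a reflected periodized Gauss kernel, a derivative of it, or a
constant. A sum of order `n` maps `L^∞(L^p)` into bounded functions with norm `τ^{-n/2-1/(2p)}`
(`norm_Nop_le`) and into itself with norm `τ^{-n/2}` (`eLpNorm_Nop_le`). Using an `L^r` bound of the
flux for `s < t/2` and a supremum bound for `s > t/2` gives `|v(t)| ≲ t^{-1/2}`. Interpolating
between the orders one and two gives a Hölder constant of exponent `1/2` of size `t^{-3/4}`
(`MildEq.estimate`).

For the gradient the kernels have order two, and `(t-s)^{-1}` is not integrable. Here the structure
of the equations enters: `u` is divergence free and `w` vanishes at both ends of the interval, so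
the local part of `∇S(τ)∇·(u ⊗ c)` vanishes for constant `c`. The field `v(s)` may thus be replaced
by `v(s) - v(s, q)`, and Hölder continuity gains `τ^{1/4}`. In the part with `(-Δ_H)⁻¹` the field is
frozen in the horizontal variable only; the frozen term is integrated by parts, which produces the
divergence of `v` and a kernel of order one (`norm_Nop_freeze_le`). The result is `|∇v(t)| ≲
t^{-1}`. Cutting a short tail off the time integral gives uniform continuity of `v` and `∇v` on the
layer (`ucFamily_formula`), and the classical gradient is the weak one. Interpolating the supremum
bounds with the `L^∞(L¹)` bounds of the class yields exactly the weights of the statement, for every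
`p`.

It remains to see that the weighted functions vanish as `t → 0`. For `p > 1` the data are
subcritical: with `r = min p 2` they contribute `A t^θ` with `θ > 0`. The smallness of `a₂` makes
`U`, close to the initial time, smaller than a number `κ` depending only on the layer. Then the
inequalities `X ≤ c (A t^θ + U X)` for the `L^r` norm and `Y ≤ c (A t^θ + U X + U Y)` for the
supremum norm close by absorption, and `X`, `Y` and the constant of the gradient are arbitrarily
small on short intervals (`exists_smallness`). -/

/-- `k τ x = τ^{-1-a/2} κ(τ^{-1/2} x)` with a continuous profile `κ` of decay `|x|^{-d}`. -/
def HKernel (a : ℕ) (d : ℝ) (k : ℝ → Plane → ℝ) : Prop :=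
  ∃ κ : Plane → ℝ, Continuous κ ∧ (∃ c : ℝ, 0 ≤ c ∧ ∀ x, |κ x| ≤ c * (1 + ‖x‖) ^ (-d)) ∧
    ∀ τ : ℝ, 0 < τ → ∀ x, k τ x = (Real.sqrt τ ^ (a + 2))⁻¹ * κ ((Real.sqrt τ)⁻¹ • x)

theorem finrank_plane : Module.finrank ℝ Plane = 2 := by simp

theorem HKernel.mono {a : ℕ} {d d' : ℝ} {k : ℝ → Plane → ℝ} (h : HKernel a d k) (hd : d' ≤ d) :
    HKernel a d' k := by
  obtain ⟨κ, hc, ⟨c, hc0, hb⟩, hs⟩ := h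
  refine ⟨κ, hc, ⟨c, hc0, fun x => (hb x).trans ?_⟩, hs⟩
  gcongr
  linarith [norm_nonneg x]

theorem HKernel.continuousOn {a : ℕ} {d : ℝ} {k : ℝ → Plane → ℝ} (h : HKernel a d k) :
    ContinuousOn (fun p : ℝ × Plane => k p.1 p.2) (Ioi 0 ×ˢ univ) := by
  obtain ⟨κ, hc, -, hs⟩ := h
  have h1 : ContinuousOn (fun p : ℝ × Plane =>
      (Real.sqrt p.1 ^ (a + 2))⁻¹ * κ ((Real.sqrt p.1)⁻¹ • p.2)) (Ioi 0 ×ˢ univ) := by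
    have h2 : ContinuousOn (fun p : ℝ × Plane => Real.sqrt p.1) (Ioi 0 ×ˢ univ) := by fun_prop
    have h3 : ∀ p ∈ (Ioi 0 ×ˢ univ : Set (ℝ × Plane)), Real.sqrt p.1 ≠ 0 := fun p hp =>
      (Real.sqrt_pos.2 hp.1).ne'
    refine ContinuousOn.mul ((h2.pow _).inv₀ fun p hp => pow_ne_zero _ (h3 p hp)) ?_
    exact hc.comp_continuousOn ((h2.inv₀ h3).smul continuousOn_snd)
  exact h1.congr fun p hp => hs _ hp.1 _

theorem HKernel.continuous {a : ℕ} {d : ℝ} {k : ℝ → Plane → ℝ} (h : HKernel a d k) {τ : ℝ}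
    (hτ : 0 < τ) : Continuous (k τ) := by
  have := h.continuousOn.comp_continuous (f := fun x : Plane => ((τ, x) : ℝ × Plane))
    (by fun_prop) (fun x => ⟨hτ, mem_univ _⟩)
  exact this

theorem integrable_decay {d : ℝ} (hd : 2 < d) : Integrable (fun x : Plane => (1 + ‖x‖) ^ (-d)) :=
  integrable_one_add_norm (by rw [finrank_plane]; exact_mod_cast hd)

/-- Substituting `y = τ^{-1/2} x` leaves the factor `τ^{-a/2}`, and decay faster than `|x|^{-2}`
means integrability on the plane. -/
theorem HKernel.integral_le {a : ℕ} {d : ℝ} {k : ℝ → Plane → ℝ} (h : HKernel a d k) (hd : 2 < d) :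
    ∃ c : ℝ, 0 ≤ c ∧ ∀ τ : ℝ, 0 < τ →
      Integrable (k τ) ∧ ∫ x, |k τ x| ≤ c * (Real.sqrt τ ^ a)⁻¹ := by
  obtain ⟨κ, hc, ⟨c, hc0, hb⟩, hs⟩ := h
  have hi : Integrable κ := ((integrable_decay hd).const_mul c).mono' hc.aestronglyMeasurable
    (Eventually.of_forall fun x => by simpa using hb x)
  refine ⟨∫ x, |κ x|, integral_nonneg fun x => abs_nonneg _, fun τ hτ => ?_⟩
  have hsq := Real.sqrt_pos.2 hτ
  have e : k τ = fun x => (Real.sqrt τ ^ (a + 2))⁻¹ * κ ((Real.sqrt τ)⁻¹ • x) :=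
    funext fun x => hs τ hτ x
  constructor
  · rw [e]
    exact (hi.comp_smul (inv_ne_zero hsq.ne')).const_mul _
  · have e2 : (fun x => |k τ x|) = fun x => (Real.sqrt τ ^ (a + 2))⁻¹ *
        (fun y => |κ y|) ((Real.sqrt τ)⁻¹ • x) := by
      funext x
      rw [hs τ hτ, abs_mul, abs_of_nonneg (by positivity)]
    rw [e2, integral_const_mul, Measure.integral_comp_inv_smul volume (fun y => |κ y|),
      finrank_plane, smul_eq_mul, abs_of_nonneg (by positivity)]
    apply le_of_eq
    field_simp
    ring

/-- By scaling, the weight `√‖x‖` gains the factor `τ^{1/4}`, at the price of half a power of decay.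
For operators of order two this turns `τ^{-1}` into the integrable `τ^{-3/4}`. -/
theorem HKernel.weighted_integral_le {a : ℕ} {d : ℝ} {k : ℝ → Plane → ℝ} (h : HKernel a d k)
    (hd : 5 / 2 < d) :
    ∃ c : ℝ, 0 ≤ c ∧ ∀ τ : ℝ, 0 < τ → Integrable (fun x => k τ x * Real.sqrt ‖x‖) ∧
      ∫ x, |k τ x| * Real.sqrt ‖x‖ ≤ c * ((Real.sqrt τ ^ a)⁻¹ * Real.sqrt (Real.sqrt τ)) := by
  obtain ⟨κ, hc, ⟨c, hc0, hb⟩, hs⟩ := h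
  have hcw : Continuous fun x : Plane => κ x * Real.sqrt ‖x‖ := by fun_prop
  have hi : Integrable fun x => κ x * Real.sqrt ‖x‖ := by
    refine ((integrable_decay (d := d - 1/2) (by linarith)).const_mul c).mono'
      hcw.aestronglyMeasurable (Eventually.of_forall fun x => ?_)
    rw [norm_mul, Real.norm_eq_abs, Real.norm_of_nonneg (Real.sqrt_nonneg _)]
    have h1 : Real.sqrt ‖x‖ ≤ (1 + ‖x‖) ^ (1 / 2 : ℝ) := by
      rw [← Real.sqrt_eq_rpow]
      exact Real.sqrt_le_sqrt (by linarith)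
    calc |κ x| * Real.sqrt ‖x‖ ≤ (c * (1 + ‖x‖) ^ (-d)) * (1 + ‖x‖) ^ (1 / 2 : ℝ) :=
          mul_le_mul (hb x) h1 (Real.sqrt_nonneg _) ((abs_nonneg _).trans (hb x))
      _ = c * (1 + ‖x‖) ^ (-(d - 1 / 2)) := by
          rw [mul_assoc, ← Real.rpow_add (by positivity)]
          ring_nf
  refine ⟨∫ x, |κ x| * Real.sqrt ‖x‖, integral_nonneg fun x => by positivity, fun τ hτ => ?_⟩
  have hsq := Real.sqrt_pos.2 hτ
  have e1 : ∀ x : Plane, Real.sqrt ‖x‖ = Real.sqrt (Real.sqrt τ) *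
      Real.sqrt ‖(Real.sqrt τ)⁻¹ • x‖ := by
    intro x
    rw [← Real.sqrt_mul hsq.le, norm_smul, norm_inv, Real.norm_of_nonneg hsq.le,
      mul_inv_cancel_left₀ hsq.ne']
  constructor
  · have e : (fun x => k τ x * Real.sqrt ‖x‖) = fun x => ((Real.sqrt τ ^ (a + 2))⁻¹ *
        Real.sqrt (Real.sqrt τ)) * (fun y => κ y * Real.sqrt ‖y‖) ((Real.sqrt τ)⁻¹ • x) := by
      funext x
      rw [hs τ hτ, e1 x]
      ring
    rw [e]
    exact (hi.comp_smul (inv_ne_zero hsq.ne')).const_mul _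
  · have e2 : (fun x => |k τ x| * Real.sqrt ‖x‖) = fun x => ((Real.sqrt τ ^ (a + 2))⁻¹ *
        Real.sqrt (Real.sqrt τ)) * (fun y => |κ y| * Real.sqrt ‖y‖) ((Real.sqrt τ)⁻¹ • x) := by
      funext x
      rw [hs τ hτ, abs_mul, abs_of_nonneg (by positivity), e1 x]
      ring
    rw [e2, integral_const_mul,
      Measure.integral_comp_inv_smul volume (fun y => |κ y| * Real.sqrt ‖y‖), finrank_plane,
      smul_eq_mul, abs_of_nonneg (by positivity)]
    apply le_of_eq
    field_simp
    ring

/-- Domination of the kernel, locally uniformly in time and under small translations. -/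
theorem HKernel.dominated {a : ℕ} {d : ℝ} {k : ℝ → Plane → ℝ} (h : HKernel a d k) (hd : 2 < d)
    {δ T : ℝ} (hδ : 0 < δ) :
    ∃ C : ℝ, 0 ≤ C ∧ ∀ τ ∈ Icc δ T, ∀ y e : Plane, ‖e‖ ≤ 1 →
      |k τ (y + e)| ≤ C * (1 + ‖y‖) ^ (-d) := by
  obtain ⟨κ, hc, ⟨c, hc0, hb⟩, hs⟩ := h
  set S := max 1 (Real.sqrt T) with hS
  have hS1 : 1 ≤ S := le_max_left _ _
  -- The factor `2 * S` absorbs both the dilation by `√τ ≤ S` and a translation of length at most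
  -- one.
  refine ⟨(Real.sqrt δ ^ (a + 2))⁻¹ * (c * (2 * S) ^ d), by positivity, fun τ hτ y e he => ?_⟩
  have hτ0 : 0 < τ := hδ.trans_le hτ.1
  have hsq := Real.sqrt_pos.2 hτ0
  have hδs := Real.sqrt_pos.2 hδ
  rw [hs τ hτ0, abs_mul, abs_of_nonneg (by positivity), mul_assoc, mul_assoc]
  have h1 : (1 + ‖y‖) / (2 * S) ≤ 1 + ‖(Real.sqrt τ)⁻¹ • (y + e)‖ := by
    rw [norm_smul, norm_inv, Real.norm_of_nonneg hsq.le, div_le_iff₀ (by positivity)]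
    have h2 : ‖y‖ ≤ ‖y + e‖ + 1 := by
      have := norm_sub_le (y + e) e
      simp only [add_sub_cancel_right] at this
      linarith
    have h3 : Real.sqrt τ ≤ S := (Real.sqrt_le_sqrt hτ.2).trans (le_max_right _ _)
    have h4 : ‖y + e‖ ≤ (Real.sqrt τ)⁻¹ * ‖y + e‖ * S := by
      rw [mul_right_comm]
      have : 1 ≤ (Real.sqrt τ)⁻¹ * S := by
        rw [inv_mul_eq_div, one_le_div hsq]; exact h3
      exact le_mul_of_one_le_left (norm_nonneg _) this
    nlinarith [norm_nonneg (y + e)]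
  have h5 : (1 + ‖(Real.sqrt τ)⁻¹ • (y + e)‖) ^ (-d) ≤ ((1 + ‖y‖) / (2 * S)) ^ (-d) :=
    Real.rpow_le_rpow_of_nonpos (by positivity) h1 (by linarith)
  have h6 : ((1 + ‖y‖) / (2 * S)) ^ (-d) = (2 * S) ^ d * (1 + ‖y‖) ^ (-d) := by
    rw [Real.div_rpow (by positivity) (by positivity), Real.rpow_neg (by positivity : 0 ≤ 2 * S),
      div_inv_eq_mul, mul_comm]
  rw [← h6]
  refine mul_le_mul ?_ ((hb _).trans (mul_le_mul_of_nonneg_left h5 hc0)) (abs_nonneg _)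
    (by positivity)
  exact inv_anti₀ (by positivity) (pow_le_pow_left₀ hδs.le (Real.sqrt_le_sqrt hτ.1) _)

/-- Uniform continuity in `L¹` under translations and changes of time. -/
theorem HKernel.modulus {a : ℕ} {d : ℝ} {k : ℝ → Plane → ℝ} (h : HKernel a d k) (hd : 2 < d)
    {δ T ε : ℝ} (hδ : 0 < δ) (hε : 0 < ε) :
    ∃ η > 0, ∀ τ ∈ Icc δ T, ∀ τ' ∈ Icc δ T, ∀ e : Plane, |τ - τ'| < η → ‖e‖ < η →
      ∫ y, |k τ (y + e) - k τ' y| ≤ ε := by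
  obtain ⟨C, hC0, hC⟩ := h.dominated hd (T := T) hδ
  set K : Set (ℝ × ℝ × Plane) := Icc δ T ×ˢ Icc δ T ×ˢ Metric.closedBall 0 1 with hK
  have hKc : IsCompact K := isCompact_Icc.prod (isCompact_Icc.prod (isCompact_closedBall _ _))
  set Θ : ℝ × ℝ × Plane → ℝ := fun p => ∫ y, |k p.1 (y + p.2.2) - k p.2.1 y| with hΘ
  have hcont : ContinuousOn Θ K := by
    refine continuousOn_of_dominated (bound := fun y => 2 * (C * (1 + ‖y‖) ^ (-d))) ?_ ?_ ?_ ?_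
    · intro p hp
      have h1 := h.continuous (hδ.trans_le hp.1.1)
      have h2 := h.continuous (hδ.trans_le hp.2.1.1)
      have : Continuous fun y => |k p.1 (y + p.2.2) - k p.2.1 y| := by fun_prop
      exact this.aestronglyMeasurable
    · intro p hp
      refine Eventually.of_forall fun y => ?_
      rw [Real.norm_of_nonneg (abs_nonneg _)]
      have h1 := hC p.1 hp.1 y p.2.2 (by simpa using hp.2.2)
      have h2 := hC p.2.1 hp.2.1 y 0 (by simp)
      rw [add_zero] at h2
      exact (abs_sub _ _).trans (by linarith)
    · exact ((integrable_decay hd).const_mul _).const_mul _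
    · refine Eventually.of_forall fun y => ?_
      refine ContinuousOn.abs (ContinuousOn.sub ?_ ?_)
      · exact h.continuousOn.comp (f := fun p : ℝ × ℝ × Plane => (p.1, y + p.2.2))
          (by fun_prop) fun p hp => ⟨hδ.trans_le hp.1.1, mem_univ _⟩
      · exact h.continuousOn.comp (f := fun p : ℝ × ℝ × Plane => (p.2.1, y))
          (by fun_prop) fun p hp => ⟨hδ.trans_le hp.2.1.1, mem_univ _⟩
  have huc := hKc.uniformContinuousOn_of_continuous hcont
  rw [Metric.uniformContinuousOn_iff] at huc
  obtain ⟨η, hη, hu⟩ := huc ε hε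
  refine ⟨min η 1, lt_min hη one_pos, fun τ hτ τ' hτ' e h1 h2 => ?_⟩
  -- The comparison is with the point `(τ', τ', 0)`, at which `Θ` vanishes.
  have := hu (τ, τ', e) ⟨hτ, hτ', by simpa using h2.le.trans (min_le_right _ _)⟩ (τ', τ', 0)
    ⟨hτ', hτ', by simp⟩ ?_
  · have h0 : Θ (τ', τ', 0) = 0 := by simp [hΘ]
    rw [h0, Real.dist_eq, sub_zero] at this
    exact (le_abs_self _).trans this.le
  · rw [Prod.dist_eq, Prod.dist_eq]
    simp only [dist_self, dist_zero_right, Real.dist_eq]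
    exact max_lt (h1.trans_le (min_le_left _ _)) (max_lt hη (h2.trans_le (min_le_left _ _)))

/-- The time integral over `(τ, ∞)` of a self-similar kernel. -/
theorem HKernel.tailIntegral {a : ℕ} {d : ℝ} {k : ℝ → Plane → ℝ} (h : HKernel (a + 2) d k)
    (hd : 0 < d) (had : d < a + 2) :
    HKernel a d (fun τ x => ∫ s in Ioi τ, k s x) ∧
      ∀ τ : ℝ, 0 < τ → ∃ b : ℝ → ℝ, IntegrableOn b (Ioi τ) ∧ ∀ s > τ, ∀ x, |k s x| ≤ b s := by
  have hkc := h.continuousOn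
  obtain ⟨κ, hc, ⟨c, hc0, hb⟩, hs⟩ := h
  -- The kernel at time `s` has size `s^{-(a+4)/2}`, and writing its decay in terms of `x` instead
  -- of `x/√s` costs `s^{d/2}`. The condition `d < a + 2` says that the resulting power is
  -- integrable at infinity.
  set g : ℝ := -((a : ℝ) + 4) / 2 + d / 2 with hg
  have hg1 : g < -1 := by rw [hg]; linarith
  have key : ∀ s : ℝ, 1 < s → ∀ x, |k s x| ≤ c * (1 + ‖x‖) ^ (-d) * s ^ g := by
    intro s hs1 x
    have hs0 : 0 < s := by linarith
    have hsq := Real.sqrt_pos.2 hs0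
    have hsq1 : 1 ≤ Real.sqrt s := by rw [Real.one_le_sqrt]; exact hs1.le
    rw [hs s hs0, abs_mul, abs_of_nonneg (by positivity)]
    have h1 : (1 + ‖x‖) / Real.sqrt s ≤ 1 + ‖(Real.sqrt s)⁻¹ • x‖ := by
      rw [norm_smul, norm_inv, Real.norm_of_nonneg hsq.le, div_le_iff₀ hsq]
      have : (Real.sqrt s)⁻¹ * ‖x‖ * Real.sqrt s = ‖x‖ := by field_simp
      nlinarith
    have h5 : (1 + ‖(Real.sqrt s)⁻¹ • x‖) ^ (-d) ≤ ((1 + ‖x‖) / Real.sqrt s) ^ (-d) :=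
      Real.rpow_le_rpow_of_nonpos (by positivity) h1 (by linarith)
    have h6 : ((1 + ‖x‖) / Real.sqrt s) ^ (-d) = (1 + ‖x‖) ^ (-d) * s ^ (d / 2) := by
      rw [Real.div_rpow (by positivity) hsq.le, Real.rpow_neg hsq.le, div_inv_eq_mul,
        Real.sqrt_eq_rpow, ← Real.rpow_mul hs0.le]
      ring_nf
    have h7 : (Real.sqrt s ^ (a + 2 + 2))⁻¹ = s ^ (-((a : ℝ) + 4) / 2) := by
      rw [Real.sqrt_eq_rpow, ← Real.rpow_natCast, ← Real.rpow_mul hs0.le, ← Real.rpow_neg hs0.le]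
      congr 1
      push_cast
      ring
    calc (Real.sqrt s ^ (a + 2 + 2))⁻¹ * |κ ((Real.sqrt s)⁻¹ • x)|
        ≤ s ^ (-((a : ℝ) + 4) / 2) * (c * ((1 + ‖x‖) ^ (-d) * s ^ (d / 2))) := by
          rw [h7, ← h6]
          gcongr
          exact (hb _).trans (mul_le_mul_of_nonneg_left h5 hc0)
      _ = _ := by rw [hg, Real.rpow_add hs0]; ring
  have hgi : IntegrableOn (fun s : ℝ => s ^ g) (Ioi 1) := integrableOn_Ioi_rpow_of_lt hg1 one_pos
  refine ⟨⟨fun x => ∫ s in Ioi (1 : ℝ), k s x, ?_, ⟨c * ∫ s in Ioi (1 : ℝ), s ^ g, ?_, ?_⟩, ?_⟩, ?_⟩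
  · refine continuous_of_dominated (bound := fun s => c * s ^ g) ?_ ?_ (hgi.const_mul c) ?_
    · intro x
      refine ContinuousOn.aestronglyMeasurable ?_ measurableSet_Ioi
      exact hkc.comp (f := fun s : ℝ => ((s, x) : ℝ × Plane)) (by fun_prop)
        fun s (hs1 : 1 < s) => ⟨by simp; linarith, mem_univ _⟩
    · intro x
      filter_upwards [ae_restrict_mem measurableSet_Ioi] with s hs1
      refine (key s hs1 x).trans ?_
      have : (1 + ‖x‖) ^ (-d) ≤ 1 :=
        Real.rpow_le_one_of_one_le_of_nonpos (by linarith [norm_nonneg x]) (by linarith)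
      have hs0 : (0 : ℝ) < s := lt_trans one_pos hs1
      have := Real.rpow_nonneg hs0.le g
      gcongr
      exact mul_le_of_le_one_right hc0 ‹_›
    · filter_upwards [ae_restrict_mem measurableSet_Ioi] with s hs1
      have hs0 : (0 : ℝ) < s := lt_trans one_pos hs1
      exact hkc.comp_continuous (f := fun x : Plane => ((s, x) : ℝ × Plane)) (by fun_prop)
        fun x => ⟨hs0, mem_univ _⟩
  · exact mul_nonneg hc0 (setIntegral_nonneg measurableSet_Ioi fun s hs1 =>
      Real.rpow_nonneg (le_trans zero_le_one (le_of_lt hs1)) _)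
  · intro x
    simp only
    calc |∫ s in Ioi (1 : ℝ), k s x| ≤ ∫ s in Ioi (1 : ℝ), c * (1 + ‖x‖) ^ (-d) * s ^ g := by
          rw [← Real.norm_eq_abs]
          refine norm_integral_le_of_norm_le (hgi.const_mul _) ?_
          filter_upwards [ae_restrict_mem measurableSet_Ioi] with s hs1 using key s hs1 x
      _ = _ := by rw [integral_const_mul]; ring
  · intro τ hτ x
    have hsq := Real.sqrt_pos.2 hτ
    have e1 : ∀ s ∈ Ioi (1 : ℝ), k (τ * s) x =
        (Real.sqrt τ ^ (a + 2 + 2))⁻¹ * k s ((Real.sqrt τ)⁻¹ • x) := by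
      intro s hs1
      have hs0 : (0 : ℝ) < s := lt_trans one_pos hs1
      rw [hs _ (mul_pos hτ hs0), hs _ hs0, Real.sqrt_mul hτ.le, smul_smul, mul_inv, mul_pow,
        mul_inv, mul_comm (Real.sqrt τ)⁻¹]
      ring
    -- The dilation `s ↦ τ s` reduces to the interval `(1, ∞)`, on which the profile is defined.
    have e2 := integral_comp_mul_left_Ioi (fun s => k s x) 1 hτ
    rw [mul_one, setIntegral_congr_fun measurableSet_Ioi e1, integral_const_mul, smul_eq_mul] at e2
    have e3 : ∫ s in Ioi τ, k s x = τ * ((Real.sqrt τ ^ (a + 2 + 2))⁻¹ *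
        ∫ s in Ioi (1 : ℝ), k s ((Real.sqrt τ)⁻¹ • x)) := by
      rw [e2]; field_simp
    simp only
    rw [e3, ← mul_assoc]
    congr 1
    nth_rewrite 1 [← Real.sq_sqrt hτ.le]
    field_simp
    ring
  · intro τ hτ
    refine ⟨fun s => c * s ^ (-((a : ℝ) + 4) / 2),
      (integrableOn_Ioi_rpow_of_lt (by linarith) hτ).const_mul c, fun s hs1 x => ?_⟩
    have hs0 : 0 < s := hτ.trans hs1
    have hsq := Real.sqrt_pos.2 hs0
    rw [hs s hs0, abs_mul, abs_of_nonneg (by positivity)]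
    have h7 : (Real.sqrt s ^ (a + 2 + 2))⁻¹ = s ^ (-((a : ℝ) + 4) / 2) := by
      rw [Real.sqrt_eq_rpow, ← Real.rpow_natCast, ← Real.rpow_mul hs0.le, ← Real.rpow_neg hs0.le]
      congr 1
      push_cast
      ring
    rw [h7, mul_comm]
    simp only
    have h8 : (1 + ‖(Real.sqrt s)⁻¹ • x‖) ^ (-d) ≤ 1 :=
      Real.rpow_le_one_of_one_le_of_nonpos (by linarith [norm_nonneg ((Real.sqrt s)⁻¹ • x)])
        (by linarith)
    have := (hb ((Real.sqrt s)⁻¹ • x)).trans (mul_le_of_le_one_right hc0 h8)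
    exact mul_le_mul_of_nonneg_right this (Real.rpow_nonneg hs0.le _)

/-! ### The Gauss kernel of the plane, its derivatives, and the Riesz kernels -/

/-- Kronecker delta. -/
def kron (i j : Fin 2) : ℝ := if i = j then 1 else 0

theorem kron_comm (i j : Fin 2) : kron i j = kron j i := by simp [kron, eq_comm]

theorem unit_apply (l i : Fin 2) : unit l i = kron i l := by
  simp [unit, kron]

theorem norm_unit (l : Fin 2) : ‖unit l‖ = 1 := by simp [unit]

theorem abs_kron_le (i j : Fin 2) : |kron i j| ≤ 1 := by
  unfold kron; split_ifs <;> simp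

theorem abs_coord_le (x : Plane) (i : Fin 2) : |x i| ≤ ‖x‖ := by
  simpa using PiLp.norm_apply_le x i

/-- The derivatives are written out up to order four, because `rieszKernel` is a time integral of
third derivatives and is differentiated once more. -/
def gaussD1 (i : Fin 2) (s : ℝ) (x : Plane) : ℝ := -(x i / (2 * s)) * gaussPlane s x

def gaussD2 (i j : Fin 2) (s : ℝ) (x : Plane) : ℝ :=
  (x i * x j / (4 * s ^ 2) - kron i j / (2 * s)) * gaussPlane s x

def gaussD3 (i j k : Fin 2) (s : ℝ) (x : Plane) : ℝ :=
  (-(x i * x j * x k / (8 * s ^ 3))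
    + (kron i j * x k + kron i k * x j + kron j k * x i) / (4 * s ^ 2)) * gaussPlane s x

def gaussD4 (i j k l : Fin 2) (s : ℝ) (x : Plane) : ℝ :=
  (x i * x j * x k * x l / (16 * s ^ 4)
    - (kron i j * x k * x l + kron i k * x j * x l + kron i l * x j * x k
      + kron j k * x i * x l + kron j l * x i * x k + kron k l * x i * x j) / (8 * s ^ 3)
    + (kron i j * kron k l + kron i k * kron j l + kron i l * kron j k) / (4 * s ^ 2))
      * gaussPlane s x

theorem hasDerivAt_coord (x : Plane) (l i : Fin 2) :
    HasDerivAt (fun h : ℝ => (x + h • unit l) i) (kron i l) 0 := by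
  have : (fun h : ℝ => (x + h • unit l) i) = fun h => x i + h * kron i l := by
    funext h
    simp [unit_apply]
  rw [this]
  simpa using ((hasDerivAt_id (0 : ℝ)).mul_const (kron i l)).const_add (x i)

theorem norm_sq_line (x : Plane) (l : Fin 2) (h : ℝ) :
    ‖x + h • unit l‖ ^ 2 = ‖x‖ ^ 2 + 2 * h * x l + h ^ 2 := by
  rw [norm_add_sq_real, norm_smul, norm_unit, inner_smul_right]
  have : inner ℝ x (unit l) = x l := by
    simp [unit, EuclideanSpace.inner_single_right]
  rw [this, mul_one, Real.norm_eq_abs, sq_abs]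
  ring

theorem hasLineDerivAt_gaussPlane {s : ℝ} (x : Plane) (l : Fin 2) :
    HasLineDerivAt ℝ (gaussPlane s) (gaussD1 l s x) x (unit l) := by
  unfold HasLineDerivAt
  have e : (fun h : ℝ => gaussPlane s (x + h • unit l)) = fun h => (4 * Real.pi * s)⁻¹ *
      Real.exp (-((‖x‖ ^ 2 + 2 * h * x l + h ^ 2) / (4 * s))) := by
    funext h
    rw [gaussPlane, norm_sq_line]
  rw [e]
  have h1 : HasDerivAt (fun h : ℝ => ‖x‖ ^ 2 + 2 * h * x l + h ^ 2) (2 * x l) 0 := by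
    have := ((((hasDerivAt_id (0 : ℝ)).const_mul 2).mul_const (x l)).const_add (‖x‖ ^ 2)).add
      (hasDerivAt_pow 2 (0 : ℝ))
    refine this.congr_deriv ?_
    simp
  have h2 := (((h1.div_const (4 * s)).neg).exp).const_mul (4 * Real.pi * s)⁻¹
  refine h2.congr_deriv ?_
  simp only [gaussD1, gaussPlane, Pi.neg_apply]
  ring_nf

theorem hasLineDerivAt_gaussD1 {s : ℝ} (i l : Fin 2) (x : Plane) :
    HasLineDerivAt ℝ (gaussD1 i s) (gaussD2 i l s x) x (unit l) := by
  have h := (((hasDerivAt_coord x l i).div_const (2 * s)).neg).mul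
    (hasLineDerivAt_gaussPlane (s := s) x l)
  refine HasDerivAt.congr_deriv (f := fun h => gaussD1 i s (x + h • unit l)) h ?_
  simp only [gaussD2, gaussD1, Pi.neg_apply, zero_smul, add_zero]
  ring

theorem hasLineDerivAt_gaussD2 {s : ℝ} (i j l : Fin 2) (x : Plane) :
    HasLineDerivAt ℝ (gaussD2 i j s) (gaussD3 i j l s x) x (unit l) := by
  have h := ((((hasDerivAt_coord x l i).mul (hasDerivAt_coord x l j)).div_const
    (4 * s ^ 2)).sub_const (kron i j / (2 * s))).mul (hasLineDerivAt_gaussPlane (s := s) x l)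
  refine HasDerivAt.congr_deriv (f := fun h => gaussD2 i j s (x + h • unit l)) h ?_
  simp only [gaussD3, gaussD1, Pi.mul_apply, zero_smul, add_zero]
  ring

theorem hasLineDerivAt_gaussD3 {s : ℝ} (i j k l : Fin 2) (x : Plane) :
    HasLineDerivAt ℝ (gaussD3 i j k s) (gaussD4 i j k l s x) x (unit l) := by
  have hi := hasDerivAt_coord x l i
  have hj := hasDerivAt_coord x l j
  have hk := hasDerivAt_coord x l k
  have h := (((((hi.mul hj).mul hk).div_const (8 * s ^ 3)).neg).add
    ((((hk.const_mul (kron i j)).add (hj.const_mul (kron i k))).add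
      (hi.const_mul (kron j k))).div_const (4 * s ^ 2))).mul
    (hasLineDerivAt_gaussPlane (s := s) x l)
  refine HasDerivAt.congr_deriv (f := fun h => gaussD3 i j k s (x + h • unit l)) h ?_
  simp only [gaussD4, gaussD1, Pi.mul_apply, Pi.add_apply, Pi.neg_apply, zero_smul, add_zero]
  ring

theorem differentiable_gaussPlane (s : ℝ) : Differentiable ℝ (gaussPlane s) := by
  unfold gaussPlane
  have : Differentiable ℝ fun x : Plane => ‖x‖ ^ 2 := fun x =>
    (contDiff_norm_sq ℝ (n := 1)).differentiable (by norm_num) x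
  fun_prop

theorem pd_eq_of_hasLineDerivAt {f : Plane → ℝ} {x : Plane} {i : Fin 2} {d : ℝ}
    (hf : DifferentiableAt ℝ f x) (h : HasLineDerivAt ℝ f d x (unit i)) : pd i f x = d := by
  rw [pd, ← hf.lineDeriv_eq_fderiv, h.lineDeriv]

theorem pd_gaussPlane (s : ℝ) (i : Fin 2) : pd i (gaussPlane s) = gaussD1 i s :=
  funext fun x => pd_eq_of_hasLineDerivAt (differentiable_gaussPlane s x)
    (hasLineDerivAt_gaussPlane x i)

theorem pd_gaussD1 (s : ℝ) (i l : Fin 2) : pd l (gaussD1 i s) = gaussD2 i l s := by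
  refine funext fun x => pd_eq_of_hasLineDerivAt ?_ (hasLineDerivAt_gaussD1 i l x)
  have := differentiable_gaussPlane s
  have : Differentiable ℝ (gaussD1 i s) := by unfold gaussD1; fun_prop
  exact this x

theorem pd_gaussD2 (s : ℝ) (i j l : Fin 2) : pd l (gaussD2 i j s) = gaussD3 i j l s := by
  refine funext fun x => pd_eq_of_hasLineDerivAt ?_ (hasLineDerivAt_gaussD2 i j l x)
  have := differentiable_gaussPlane s
  have : Differentiable ℝ (gaussD2 i j s) := by unfold gaussD2; fun_prop
  exact this x

theorem rieszKernel_eq (i j k : Fin 2) (t : ℝ) (x : Plane) :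
    rieszKernel i j k t x = ∫ s in Ioi t, gaussD3 k j i s x := by
  simp only [rieszKernel, pd_gaussPlane, pd_gaussD1, pd_gaussD2]

/-- For the kernels `rieszD` this symmetry exchanges the derivative at the point of evaluation with
the one that falls on the flux. -/
theorem gaussD4_swap (i j k l : Fin 2) : gaussD4 i j k l = gaussD4 l j k i := by
  funext s x
  simp only [gaussD4, kron_comm i l, kron_comm i j, kron_comm i k, kron_comm j l, kron_comm k l]
  ring

/-- A kernel `τ^{-1-a/2} P(τ^{-1/2}x) e^{-|x|²/4τ}`, with `P` of at most quartic growth. -/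
theorem hKernel_of_gauss {a : ℕ} {k : ℝ → Plane → ℝ} (P : Plane → ℝ) (hP : Continuous P) {C : ℝ}
    (hC : ∀ x, |P x| ≤ C * (1 + ‖x‖) ^ 4)
    (hk : ∀ τ : ℝ, 0 < τ → ∀ x, k τ x =
      (Real.sqrt τ ^ (a + 2))⁻¹ * (P ((Real.sqrt τ)⁻¹ • x) *
        gaussPlane 1 ((Real.sqrt τ)⁻¹ • x))) :
    HKernel a 3 k := by
  have hC0 : 0 ≤ C := by simpa using (abs_nonneg _).trans (hC 0)
  refine ⟨fun x => P x * gaussPlane 1 x, hP.mul (differentiable_gaussPlane 1).continuous,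
    ⟨C * ((4 * Real.pi * 1)⁻¹ * Real.exp 49), by positivity, fun x => ?_⟩, hk⟩
  rw [abs_mul, gaussPlane, abs_mul, abs_of_nonneg (a := (4 * Real.pi * 1)⁻¹) (by positivity),
    Real.abs_exp]
  set r := ‖x‖ with hr
  have hr0 : 0 ≤ r := norm_nonneg x
  -- Seven powers: four for the growth of `P` and three for the decay to be shown. The bound `7 r -
  -- r²/4 ≤ 49` completes a square.
  have h1 : (1 + r) ^ 7 * Real.exp (-(r ^ 2 / (4 * 1))) ≤ Real.exp 49 := by
    have h2 : (1 + r) ^ 7 ≤ Real.exp (7 * r) := by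
      rw [mul_comm, Real.exp_mul]
      have h3 : 1 + r ≤ Real.exp r := by linarith [Real.add_one_le_exp r]
      calc (1 + r) ^ 7 ≤ (Real.exp r) ^ 7 := pow_le_pow_left₀ (by linarith) h3 7
        _ = Real.exp r ^ (7 : ℝ) := by norm_cast
    calc _ ≤ Real.exp (7 * r) * Real.exp (-(r ^ 2 / (4 * 1))) := by gcongr
      _ = Real.exp (7 * r + -(r ^ 2 / (4 * 1))) := (Real.exp_add _ _).symm
      _ ≤ _ := Real.exp_le_exp.2 (by nlinarith [sq_nonneg (r / 2 - 7)])
  have h4 : Real.exp (-(r ^ 2 / (4 * 1))) * (1 + r) ^ 4 ≤ Real.exp 49 * (1 + r) ^ (-3 : ℝ) := by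
    have e : (1 + r) ^ (-3 : ℝ) = ((1 + r) ^ 3)⁻¹ := by
      rw [Real.rpow_neg (by positivity)]; norm_cast
    rw [e, ← div_eq_mul_inv, le_div_iff₀ (by positivity)]
    calc _ = (1 + r) ^ 7 * Real.exp (-(r ^ 2 / (4 * 1))) := by ring
      _ ≤ _ := h1
  calc |P x| * ((4 * Real.pi * 1)⁻¹ * Real.exp (-(r ^ 2 / (4 * 1))))
      ≤ (C * (1 + r) ^ 4) * ((4 * Real.pi * 1)⁻¹ * Real.exp (-(r ^ 2 / (4 * 1)))) := by
        gcongr; exact hC x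
    _ = C * (4 * Real.pi * 1)⁻¹ * (Real.exp (-(r ^ 2 / (4 * 1))) * (1 + r) ^ 4) := by ring
    _ ≤ C * (4 * Real.pi * 1)⁻¹ * (Real.exp 49 * (1 + r) ^ (-3 : ℝ)) := by gcongr
    _ = _ := by ring

theorem gaussPlane_scale {τ : ℝ} (hτ : 0 < τ) (x : Plane) :
    gaussPlane τ x = (Real.sqrt τ ^ 2)⁻¹ * gaussPlane 1 ((Real.sqrt τ)⁻¹ • x) := by
  have hsq := Real.sqrt_pos.2 hτ
  rw [gaussPlane, gaussPlane, norm_smul, norm_inv, Real.norm_of_nonneg hsq.le, mul_pow, inv_pow,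
    Real.sq_sqrt hτ.le]
  have : τ⁻¹ * ‖x‖ ^ 2 / (4 * 1) = ‖x‖ ^ 2 / (4 * τ) := by field_simp
  rw [this]
  field_simp

theorem hKernel_gaussPlane : HKernel 0 3 gaussPlane := by
  refine hKernel_of_gauss (fun _ => 1) continuous_const (C := 1) (fun x => ?_) fun τ hτ x => ?_
  · rw [abs_one, one_mul]
    exact one_le_pow₀ (by linarith [norm_nonneg x])
  · rw [gaussPlane_scale hτ, one_mul]

theorem hKernel_gaussD1 (i : Fin 2) : HKernel 1 3 (gaussD1 i) := by
  refine hKernel_of_gauss (fun x => -(x i / 2)) (by fun_prop) (C := 1) (fun x => ?_)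
    fun τ hτ x => ?_
  · have := abs_coord_le x i
    have h0 := norm_nonneg x
    rw [abs_neg, abs_div, abs_two]
    have : 1 + ‖x‖ ≤ (1 + ‖x‖) ^ 4 := le_self_pow₀ (by linarith) (by norm_num)
    linarith
  · have hsq := Real.sqrt_pos.2 hτ
    rw [gaussD1, gaussPlane_scale hτ]
    nth_rewrite 1 [← Real.sq_sqrt hτ.le]
    simp only [PiLp.smul_apply, smul_eq_mul]
    field_simp
    ring

theorem hKernel_gaussD2 (i j : Fin 2) : HKernel 2 3 (gaussD2 i j) := by
  refine hKernel_of_gauss (fun x => x i * x j / 4 - kron i j / 2) (by fun_prop) (C := 1)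
    (fun x => ?_) fun τ hτ x => ?_
  · have hi := abs_coord_le x i
    have hj := abs_coord_le x j
    have h0 := norm_nonneg x
    have hk := abs_kron_le i j
    calc |x i * x j / 4 - kron i j / 2| ≤ |x i * x j / 4| + |kron i j / 2| := abs_sub _ _
      _ = |x i| * |x j| / 4 + |kron i j| / 2 := by
          rw [abs_div, abs_mul, abs_div]; norm_num
      _ ≤ ‖x‖ * ‖x‖ / 4 + 1 / 2 := by gcongr
      _ ≤ 1 * (1 + ‖x‖) ^ 4 := by nlinarith [sq_nonneg (‖x‖ ^ 2), pow_nonneg h0 3]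
  · have hsq := Real.sqrt_pos.2 hτ
    rw [gaussD2, gaussPlane_scale hτ]
    nth_rewrite 1 2 [← Real.sq_sqrt hτ.le]
    simp only [PiLp.smul_apply, smul_eq_mul]
    field_simp
    ring

theorem hKernel_gaussD3 (i j k : Fin 2) : HKernel 3 3 (gaussD3 i j k) := by
  refine hKernel_of_gauss (fun x => -(x i * x j * x k / 8)
    + (kron i j * x k + kron i k * x j + kron j k * x i) / 4) (by fun_prop) (C := 1)
    (fun x => ?_) fun τ hτ x => ?_
  · have hi := abs_coord_le x i
    have hj := abs_coord_le x j
    have hk := abs_coord_le x k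
    have h0 := norm_nonneg x
    have h1 := abs_kron_le i j
    have h2 := abs_kron_le i k
    have h3 := abs_kron_le j k
    calc |-(x i * x j * x k / 8) + (kron i j * x k + kron i k * x j + kron j k * x i) / 4|
        ≤ |-(x i * x j * x k / 8)| + (|kron i j * x k| + |kron i k * x j| + |kron j k * x i|) / 4 := by
          refine (abs_add_le _ _).trans ?_
          rw [abs_div (_ + _ : ℝ) 4, abs_of_pos (by norm_num : (0:ℝ) < 4)]
          gcongr
          exact abs_add_three _ _ _
      _ = |x i| * |x j| * |x k| / 8 + (|kron i j| * |x k| + |kron i k| * |x j|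
            + |kron j k| * |x i|) / 4 := by
          rw [abs_neg, abs_div]; simp only [abs_mul]; norm_num
      _ ≤ ‖x‖ * ‖x‖ * ‖x‖ / 8 + (1 * ‖x‖ + 1 * ‖x‖ + 1 * ‖x‖) / 4 := by gcongr
      _ ≤ 1 * (1 + ‖x‖) ^ 4 := by nlinarith [sq_nonneg (‖x‖ ^ 2), pow_nonneg h0 3]
  · have hsq := Real.sqrt_pos.2 hτ
    rw [gaussD3, gaussPlane_scale hτ]
    nth_rewrite 1 2 [← Real.sq_sqrt hτ.le]
    simp only [PiLp.smul_apply, smul_eq_mul]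
    field_simp
    ring

theorem hKernel_gaussD4 (i j k l : Fin 2) : HKernel 4 3 (gaussD4 i j k l) := by
  refine hKernel_of_gauss (fun x => x i * x j * x k * x l / 16
    - (kron i j * x k * x l + kron i k * x j * x l + kron i l * x j * x k
      + kron j k * x i * x l + kron j l * x i * x k + kron k l * x i * x j) / 8
    + (kron i j * kron k l + kron i k * kron j l + kron i l * kron j k) / 4) (by fun_prop) (C := 1)
    (fun x => ?_) fun τ hτ x => ?_
  · have h0 := norm_nonneg x
    have t : ∀ a b c : Fin 2, ∀ d : Fin 2, |kron a b * x c * x d| ≤ ‖x‖ ^ 2 := by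
      intro a b c d
      rw [abs_mul, abs_mul]
      calc _ ≤ 1 * ‖x‖ * ‖x‖ := by
            gcongr
            · exact abs_kron_le a b
            · exact abs_coord_le x c
            · exact abs_coord_le x d
        _ = _ := by ring
    have q : |x i * x j * x k * x l| ≤ ‖x‖ ^ 4 := by
      rw [abs_mul, abs_mul, abs_mul]
      calc _ ≤ ‖x‖ * ‖x‖ * ‖x‖ * ‖x‖ := by
            gcongr
            · exact abs_coord_le x i
            · exact abs_coord_le x j
            · exact abs_coord_le x k
            · exact abs_coord_le x l
        _ = _ := by ring
    have c : ∀ a b c d : Fin 2, |kron a b * kron c d| ≤ 1 := by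
      intro a b c d
      rw [abs_mul]
      exact mul_le_one₀ (abs_kron_le a b) (abs_nonneg _) (abs_kron_le c d)
    have h1 := abs_le.1 (t i j k l)
    have h2 := abs_le.1 (t i k j l)
    have h3 := abs_le.1 (t i l j k)
    have h4 := abs_le.1 (t j k i l)
    have h5 := abs_le.1 (t j l i k)
    have h6 := abs_le.1 (t k l i j)
    have c1 := abs_le.1 (c i j k l)
    have c2 := abs_le.1 (c i k j l)
    have c3 := abs_le.1 (c i l j k)
    have q1 := abs_le.1 q
    have e : 1 + ‖x‖ ^ 2 + ‖x‖ ^ 4 ≤ (1 + ‖x‖) ^ 4 := by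
      nlinarith [pow_nonneg h0 3, pow_nonneg h0 2]
    have := pow_nonneg h0 4
    have := pow_nonneg h0 2
    rw [abs_le]
    constructor <;> linarith
  · have hsq := Real.sqrt_pos.2 hτ
    rw [gaussD4, gaussPlane_scale hτ]
    nth_rewrite 1 2 3 [← Real.sq_sqrt hτ.le]
    simp only [PiLp.smul_apply, smul_eq_mul]
    field_simp
    ring

/-- `HKernel.tailIntegral` needs a decay below `a + 2 = 3`, so the decay of the third derivatives is
weakened to `11/4`. Anything above `2` suffices for integrability. -/
theorem hKernel_rieszKernel (i j k : Fin 2) : HKernel 1 (5 / 2 + 1 / 4) (rieszKernel i j k) := by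
  have h := ((hKernel_gaussD3 k j i).mono (d' := 5 / 2 + 1 / 4) (by norm_num)).tailIntegral
    (by norm_num) (by norm_num)
  have e : rieszKernel i j k = fun τ x => ∫ s in Ioi τ, gaussD3 k j i s x := by
    funext t x; exact rieszKernel_eq i j k t x
  rw [e]
  exact h.1

/-- `∂_l` of the kernel `rieszKernel i j k`. -/
def rieszD (i j k l : Fin 2) (t : ℝ) (x : Plane) : ℝ := ∫ s in Ioi t, gaussD4 k j i l s x

theorem rieszD_swap (i j k l : Fin 2) : rieszD i j k l = rieszD i j l k := by
  funext t x
  simp only [rieszD, gaussD4_swap k j i l]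

theorem hKernel_rieszD (i j k l : Fin 2) : HKernel 2 3 (rieszD i j k l) :=
  ((hKernel_gaussD4 k j i l).tailIntegral (by norm_num) (by norm_num)).1

theorem hasLineDerivAt_add {f f' : Plane → ℝ} {l : Fin 2}
    (h : ∀ x, HasLineDerivAt ℝ f (f' x) x (unit l)) (x : Plane) (r : ℝ) :
    HasDerivAt (fun h : ℝ => f (x + h • unit l)) (f' (x + r • unit l)) r := by
  have h1 := h (x + r • unit l)
  unfold HasLineDerivAt at h1
  rw [← sub_self r] at h1
  have h3 := h1.comp_sub_const r r
  refine h3.congr_of_eventuallyEq (Eventually.of_forall fun u => ?_)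
  simp only [add_assoc, ← add_smul, add_sub_cancel]

/-- The derivative passes under the time integral, because `HKernel.tailIntegral` bounds the fourth
derivatives by an integrable function of `s` alone. -/
theorem hasLineDerivAt_rieszKernel (i j k l : Fin 2) {t : ℝ} (ht : 0 < t) (x : Plane) :
    HasLineDerivAt ℝ (rieszKernel i j k t) (rieszD i j k l t x) x (unit l) := by
  unfold HasLineDerivAt
  have e : (fun h : ℝ => rieszKernel i j k t (x + h • unit l)) =
      fun h => ∫ s in Ioi t, gaussD3 k j i s (x + h • unit l) := by
    funext h; exact rieszKernel_eq _ _ _ _ _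
  have m3 : ∀ y, AEStronglyMeasurable (fun s => gaussD3 k j i s y) (volume.restrict (Ioi t)) := by
    intro y
    refine ContinuousOn.aestronglyMeasurable ?_ measurableSet_Ioi
    exact (hKernel_gaussD3 k j i).continuousOn.comp (f := fun s : ℝ => ((s, y) : ℝ × Plane))
      (by fun_prop) fun s (hs1 : t < s) => ⟨ht.trans hs1, mem_univ _⟩
  have m4 : ∀ y, AEStronglyMeasurable (fun s => gaussD4 k j i l s y)
      (volume.restrict (Ioi t)) := by
    intro y
    refine ContinuousOn.aestronglyMeasurable ?_ measurableSet_Ioi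
    exact (hKernel_gaussD4 k j i l).continuousOn.comp (f := fun s : ℝ => ((s, y) : ℝ × Plane))
      (by fun_prop) fun s (hs1 : t < s) => ⟨ht.trans hs1, mem_univ _⟩
  obtain ⟨b3, hb3, h3⟩ := (((hKernel_gaussD3 k j i).mono (d' := 5 / 2) (by norm_num)).tailIntegral
    (by norm_num) (by norm_num)).2 t ht
  obtain ⟨b4, hb4, h4⟩ := ((hKernel_gaussD4 k j i l).tailIntegral
    (by norm_num) (by norm_num)).2 t ht
  rw [e, rieszD]
  have := hasDerivAt_integral_of_dominated_loc_of_deriv_le (μ := volume.restrict (Ioi t))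
    (F := fun h s => gaussD3 k j i s (x + h • unit l))
    (F' := fun h s => gaussD4 k j i l s (x + h • unit l)) (x₀ := (0 : ℝ)) (s := univ)
    (bound := b4) univ_mem (Eventually.of_forall fun h => m3 _)
    (hb3.mono' (m3 _) ?_) (m4 _) ?_ hb4 ?_
  · simpa using this.2
  · filter_upwards [ae_restrict_mem measurableSet_Ioi] with s hs1 using h3 s hs1 _
  · filter_upwards [ae_restrict_mem measurableSet_Ioi] with s hs1 h _ using h4 s hs1 _
  · refine Eventually.of_forall fun s h _ => ?_
    exact hasLineDerivAt_add (fun y => hasLineDerivAt_gaussD3 k j i l y) x h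

/-! ### The Gauss kernel of the line and its periodization -/

/-- The polynomials in the derivatives of order at most two of the Gauss kernel. -/
def lineP : ℕ → ℝ → ℝ
  | 0, _ => 1
  | 1, u => -(u / 2)
  | _, u => u ^ 2 / 4 - 1 / 2

/-- The derivatives of order `n ≤ 2` of the Gauss kernel of the line. -/
def gaussLineD (n : ℕ) (t z : ℝ) : ℝ :=
  (Real.sqrt t ^ n)⁻¹ * lineP n (z / Real.sqrt t) * gaussLine t z

theorem gaussLineD_zero (t z : ℝ) : gaussLineD 0 t z = gaussLine t z := by
  simp [gaussLineD, lineP]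

theorem hasDerivAt_gaussLine (t z : ℝ) :
    HasDerivAt (gaussLine t) (-(z / (2 * t)) * gaussLine t z) z := by
  unfold gaussLine
  have h := ((((hasDerivAt_pow 2 z).div_const (4 * t)).neg).exp).const_mul
    (Real.sqrt (4 * Real.pi * t))⁻¹
  refine h.congr_deriv ?_
  simp only [Pi.neg_apply]
  ring_nf

theorem hasDerivAt_gaussLineD_zero {t : ℝ} (ht : 0 < t) (z : ℝ) :
    HasDerivAt (gaussLineD 0 t) (gaussLineD 1 t z) z := by
  have e : gaussLineD 0 t = gaussLine t := funext fun z => gaussLineD_zero t z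
  rw [e]
  refine (hasDerivAt_gaussLine t z).congr_deriv ?_
  have hsq := Real.sqrt_pos.2 ht
  simp only [gaussLineD, lineP]
  nth_rewrite 1 [← Real.sq_sqrt ht.le]
  field_simp

theorem hasDerivAt_gaussLineD_one {t : ℝ} (ht : 0 < t) (z : ℝ) :
    HasDerivAt (gaussLineD 1 t) (gaussLineD 2 t z) z := by
  have h := ((((hasDerivAt_id z).div_const (Real.sqrt t)).div_const 2).neg.const_mul
    (Real.sqrt t ^ 1)⁻¹).mul (hasDerivAt_gaussLine t z)
  refine HasDerivAt.congr_deriv (f := gaussLineD 1 t) h ?_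
  obtain ⟨r, hr, rfl⟩ : ∃ r : ℝ, 0 < r ∧ t = r ^ 2 :=
    ⟨Real.sqrt t, Real.sqrt_pos.2 ht, (Real.sq_sqrt ht.le).symm⟩
  simp only [gaussLineD, lineP, Pi.neg_apply, id, Real.sqrt_sq hr.le]
  field_simp
  ring

theorem hasDerivAt_gaussLineD {n : ℕ} (hn : n ≤ 1) {t : ℝ} (ht : 0 < t) (z : ℝ) :
    HasDerivAt (gaussLineD n t) (gaussLineD (n + 1) t z) z := by
  interval_cases n
  · exact hasDerivAt_gaussLineD_zero ht z
  · exact hasDerivAt_gaussLineD_one ht z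

theorem continuous_lineP (n : ℕ) : Continuous (lineP n) := by
  match n with
  | 0 => exact continuous_const
  | 1 => unfold lineP; fun_prop
  | (n + 2) => unfold lineP; fun_prop

theorem abs_lineP_le (n : ℕ) (u : ℝ) : |lineP n u| ≤ 2 * Real.exp (u ^ 2 / 8) := by
  have h := Real.add_one_le_exp (u ^ 2 / 8)
  have h2 := sq_nonneg u
  match n with
  | 0 => simp only [lineP, abs_one]; linarith
  | 1 =>
    simp only [lineP]
    rw [abs_le]
    constructor <;> nlinarith [sq_nonneg (u - 2), sq_nonneg (u + 2)]
  | (n + 2) =>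
    simp only [lineP]
    rw [abs_le]
    constructor <;> nlinarith

theorem gaussLine_eq {t : ℝ} (ht : 0 < t) (z : ℝ) :
    gaussLine t z = (Real.sqrt (4 * Real.pi))⁻¹ * (Real.sqrt t)⁻¹ *
      Real.exp (-((z / Real.sqrt t) ^ 2 / 4)) := by
  rw [gaussLine, Real.sqrt_mul (by positivity), mul_inv, div_pow, Real.sq_sqrt ht.le, div_div,
    mul_comm t 4]

theorem inv_sqrt_four_pi_le : (Real.sqrt (4 * Real.pi))⁻¹ ≤ 1 := by
  apply inv_le_one_of_one_le₀
  rw [Real.one_le_sqrt]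
  linarith [Real.pi_gt_three]

theorem abs_gaussLineD_le' (n : ℕ) {t : ℝ} (ht : 0 < t) (z : ℝ) :
    |gaussLineD n t z| ≤ 2 * (Real.sqrt t ^ (n + 1))⁻¹ * Real.exp (-(z ^ 2 / (8 * t))) := by
  have hsq := Real.sqrt_pos.2 ht
  set u := z / Real.sqrt t with hu
  have hu2 : z ^ 2 / (8 * t) = u ^ 2 / 8 := by
    rw [hu, div_pow, Real.sq_sqrt ht.le]; field_simp
  rw [gaussLineD, gaussLine_eq ht, ← hu, abs_mul, abs_mul, abs_mul, abs_mul, Real.abs_exp,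
    abs_of_nonneg (a := (Real.sqrt t ^ n)⁻¹) (by positivity),
    abs_of_nonneg (a := (Real.sqrt (4 * Real.pi))⁻¹) (by positivity),
    abs_of_nonneg (a := (Real.sqrt t)⁻¹) (by positivity), hu2]
  calc _ ≤ (Real.sqrt t ^ n)⁻¹ * (2 * Real.exp (u ^ 2 / 8)) *
        (1 * (Real.sqrt t)⁻¹ * Real.exp (-(u ^ 2 / 4))) := by
        gcongr
        · exact abs_lineP_le n u
        · exact inv_sqrt_four_pi_le
    _ = 2 * (Real.sqrt t ^ (n + 1))⁻¹ * (Real.exp (u ^ 2 / 8) * Real.exp (-(u ^ 2 / 4))) := by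
        rw [pow_succ (Real.sqrt t) n, mul_inv]; ring
    _ = _ := by rw [← Real.exp_add]; congr 2; ring

theorem abs_gaussLineD_le (n : ℕ) {t : ℝ} (ht : 0 < t) (z : ℝ) :
    |gaussLineD n t z| ≤ 6 * (Real.sqrt t ^ (n + 1))⁻¹ * Real.exp (-(z ^ 2 / (16 * t))) := by
  refine (abs_gaussLineD_le' n ht z).trans ?_
  gcongr
  · norm_num
  · norm_num

/-- Half of the Gaussian exponent pays for the weight. The right side is that of `abs_gaussLineD_le`
up to `√√t`, so one integral serves both bounds. -/
theorem abs_gaussLineD_mul_sqrt_le (n : ℕ) {t : ℝ} (ht : 0 < t) (z : ℝ) :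
    |gaussLineD n t z| * Real.sqrt |z| ≤
      Real.sqrt (Real.sqrt t) * (6 * (Real.sqrt t ^ (n + 1))⁻¹ * Real.exp (-(z ^ 2 / (16 * t)))) := by
  have hsq := Real.sqrt_pos.2 ht
  set u := z / Real.sqrt t with hu
  have hz : z = u * Real.sqrt t := by rw [hu]; field_simp
  have h8 : z ^ 2 / (8 * t) = u ^ 2 / 8 := by
    rw [hu, div_pow, Real.sq_sqrt ht.le]; field_simp
  have h16 : z ^ 2 / (16 * t) = u ^ 2 / 16 := by
    rw [hu, div_pow, Real.sq_sqrt ht.le]; field_simp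
  have hs : Real.sqrt |z| = Real.sqrt |u| * Real.sqrt (Real.sqrt t) := by
    rw [hz, abs_mul, abs_of_pos hsq, Real.sqrt_mul (abs_nonneg _)]
  have h1 : Real.sqrt |u| ≤ 3 * Real.exp (u ^ 2 / 16) := by
    have e := Real.add_one_le_exp (u ^ 2 / 16)
    have : Real.sqrt |u| ≤ (1 + |u|) / 2 := by
      have := sq_nonneg (Real.sqrt |u| - 1)
      nlinarith [Real.sq_sqrt (abs_nonneg u)]
    nlinarith [sq_nonneg (|u| - 4), sq_abs u]
  have h2 := abs_gaussLineD_le' n ht z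
  rw [h8] at h2
  rw [hs, h16]
  calc _ ≤ 2 * (Real.sqrt t ^ (n + 1))⁻¹ * Real.exp (-(u ^ 2 / 8)) *
        (3 * Real.exp (u ^ 2 / 16) * Real.sqrt (Real.sqrt t)) := by gcongr
    _ = Real.sqrt (Real.sqrt t) * (6 * (Real.sqrt t ^ (n + 1))⁻¹ *
        (Real.exp (-(u ^ 2 / 8)) * Real.exp (u ^ 2 / 16))) := by ring
    _ = _ := by rw [← Real.exp_add]; congr 3; ring

theorem lintegral_gauss_bound (n : ℕ) {t : ℝ} (ht : 0 < t) :
    ∫⁻ z : ℝ, ENNReal.ofReal (6 * (Real.sqrt t ^ (n + 1))⁻¹ * Real.exp (-(z ^ 2 / (16 * t)))) =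
      ENNReal.ofReal (24 * Real.sqrt Real.pi * (Real.sqrt t ^ n)⁻¹) := by
  have hsq := Real.sqrt_pos.2 ht
  have e : (fun z : ℝ => 6 * (Real.sqrt t ^ (n + 1))⁻¹ * Real.exp (-(z ^ 2 / (16 * t)))) =
      fun z => 6 * (Real.sqrt t ^ (n + 1))⁻¹ * Real.exp (-(1 / (16 * t)) * z ^ 2) := by
    funext z; congr 2; ring
  rw [← ofReal_integral_eq_lintegral_ofReal]
  · rw [e, integral_const_mul, integral_gaussian]
    have : Real.pi / (1 / (16 * t)) = (4 ^ 2 * Real.pi) * t := by field_simp; norm_num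
    rw [this, Real.sqrt_mul (by positivity), Real.sqrt_mul (by positivity),
      Real.sqrt_sq (by norm_num)]
    congr 1
    field_simp
    ring
  · rw [e]
    exact (integrable_exp_neg_mul_sq (by positivity)).const_mul _
  · exact Eventually.of_forall fun z => by positivity

/-- The periodization, with period `2 L`, of `gaussLineD`. -/
def theta (L : ℝ) (n : ℕ) (t y : ℝ) : ℝ := ∑' k : ℤ, gaussLineD n t (y + 2 * k * L)

/-- A summable majorant for the terms of `theta`. -/
def thetaBound (L Y T : ℝ) (k : ℤ) : ℝ :=
  Real.exp (Y ^ 2 / (16 * T)) * Real.exp (-(k ^ 2 * L ^ 2 / (8 * T)))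

theorem summable_thetaBound {L T : ℝ} (Y : ℝ) (hL : 0 < L) (hT : 0 < T) :
    Summable (thetaBound L Y T) := by
  have h := summable_pow_mul_jacobiTheta₂_term_bound 0 (T := L ^ 2 / (8 * T * Real.pi))
    (by positivity) 0
  refine (h.mul_left (Real.exp (Y ^ 2 / (16 * T)))).congr fun k => ?_
  rw [thetaBound]
  congr 1
  rw [pow_zero, one_mul]
  congr 1
  field_simp
  ring

/-- This is `(y + 2kL)² + y² ≥ 2k²L²`: the dependence on `y` goes into a constant, and a Gaussian in
`k` remains that is uniform in `t ≤ T`. -/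
theorem exp_le_thetaBound {L Y t T y : ℝ} (ht : 0 < t) (htT : t ≤ T) (hy : |y| ≤ Y) (k : ℤ) :
    Real.exp (-((y + 2 * k * L) ^ 2 / (16 * t))) ≤ thetaBound L Y T k := by
  have hT : 0 < T := ht.trans_le htT
  rw [thetaBound, ← Real.exp_add]
  refine Real.exp_le_exp.2 ?_
  have h1 : (y + 2 * k * L) ^ 2 / (16 * T) ≤ (y + 2 * k * L) ^ 2 / (16 * t) := by gcongr
  have h2 : y ^ 2 ≤ Y ^ 2 := sq_le_sq' (by linarith [neg_abs_le y]) ((le_abs_self y).trans hy)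
  have h3 : (2 * (k ^ 2 * L ^ 2) - Y ^ 2) / (16 * T) ≤ (y + 2 * k * L) ^ 2 / (16 * T) := by
    gcongr
    nlinarith [sq_nonneg (2 * y + 2 * k * L)]
  have h4 : (2 * (k ^ 2 * L ^ 2) - Y ^ 2) / (16 * T) =
      -(Y ^ 2 / (16 * T) + -(k ^ 2 * L ^ 2 / (8 * T))) := by field_simp; ring
  linarith

theorem gaussLineD_le_thetaBound {L Y δ t T y : ℝ} (n : ℕ) (hδ : 0 < δ) (hδt : δ ≤ t)
    (htT : t ≤ T) (hy : |y| ≤ Y) (k : ℤ) :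
    ‖gaussLineD n t (y + 2 * k * L)‖ ≤ 6 * (Real.sqrt δ ^ (n + 1))⁻¹ * thetaBound L Y T k := by
  have ht := hδ.trans_le hδt
  have := Real.sqrt_pos.2 hδ
  refine (abs_gaussLineD_le n ht _).trans ?_
  have := Real.sqrt_le_sqrt hδt
  gcongr
  exact exp_le_thetaBound ht htT hy k

theorem summable_theta {L t : ℝ} (hL : 0 < L) (n : ℕ) (ht : 0 < t) (y : ℝ) :
    Summable fun k : ℤ => gaussLineD n t (y + 2 * k * L) :=
  Summable.of_norm_bounded ((summable_thetaBound |y| hL ht).mul_left _)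
    fun k => gaussLineD_le_thetaBound n ht le_rfl le_rfl le_rfl k

theorem hasDerivAt_theta {L t : ℝ} (hL : 0 < L) {n : ℕ} (hn : n ≤ 1) (ht : 0 < t) (y : ℝ) :
    HasDerivAt (theta L n t) (theta L (n + 1) t y) y := by
  unfold theta
  have hs := summable_theta hL n ht y
  refine hasDerivAt_tsum_of_isPreconnected
    (g := fun (k : ℤ) (y : ℝ) => gaussLineD n t (y + 2 * k * L))
    (g' := fun (k : ℤ) (y : ℝ) => gaussLineD (n + 1) t (y + 2 * k * L))
    ((summable_thetaBound (L := L) (|y| + 1) hL ht).mul_left (6 * (Real.sqrt t ^ (n + 1 + 1))⁻¹))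
    (t := Metric.ball y 1) (y₀ := y) Metric.isOpen_ball (convex_ball y 1).isPreconnected
    (fun k x _ => ?_) (fun k x hx => ?_) (Metric.mem_ball_self one_pos) hs
    (Metric.mem_ball_self one_pos)
  · have h := hasDerivAt_gaussLineD hn ht (x + 2 * (k : ℝ) * L)
    exact HasDerivAt.comp_add_const x (2 * (k : ℝ) * L) h
  · refine gaussLineD_le_thetaBound (n + 1) ht le_rfl le_rfl ?_ k
    rw [Metric.mem_ball, Real.dist_eq] at hx
    have := abs_sub_abs_le_abs_sub x y
    linarith

theorem continuousOn_theta {L : ℝ} (hL : 0 < L) (n : ℕ) :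
    ContinuousOn (fun p : ℝ × ℝ => theta L n p.1 p.2) (Ioi 0 ×ˢ univ) := by
  intro p hp
  have hp1 : (0 : ℝ) < p.1 := hp.1
  set U : Set (ℝ × ℝ) := Ioo (p.1 / 2) (p.1 + 1) ×ˢ Ioo (-(|p.2| + 1)) (|p.2| + 1) with hU
  have hUo : IsOpen U := isOpen_Ioo.prod isOpen_Ioo
  have hpU : p ∈ U := ⟨⟨by linarith, by linarith⟩,
    by linarith [neg_abs_le p.2], by linarith [le_abs_self p.2]⟩
  have : ContinuousOn (fun q : ℝ × ℝ => theta L n q.1 q.2) U := by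
    refine continuousOn_tsum (u := fun k => 6 * (Real.sqrt (p.1 / 2) ^ (n + 1))⁻¹ *
      thetaBound L (|p.2| + 1) (p.1 + 1) k) (fun k => ?_)
      ((summable_thetaBound _ hL (by linarith)).mul_left _) fun k q hq => ?_
    · have hsq : ∀ q ∈ U, Real.sqrt q.1 ≠ 0 := fun q hq =>
        (Real.sqrt_pos.2 (by linarith [hq.1.1])).ne'
      have hsq4 : ∀ q ∈ U, Real.sqrt (4 * Real.pi * q.1) ≠ 0 := fun q hq =>
        (Real.sqrt_pos.2 (mul_pos (by positivity) (by linarith [hq.1.1]))).ne'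
      have hq1 : ∀ q ∈ U, 4 * q.1 ≠ 0 := fun q hq => by
        have : 0 < q.1 := by linarith [hq.1.1]
        positivity
      have hc : ContinuousOn (fun q : ℝ × ℝ => Real.sqrt q.1) U := by fun_prop
      have hc4 : ContinuousOn (fun q : ℝ × ℝ => Real.sqrt (4 * Real.pi * q.1)) U := by fun_prop
      have hz : ContinuousOn (fun q : ℝ × ℝ => q.2 + 2 * k * L) U := by fun_prop
      unfold gaussLineD gaussLine
      refine ((hc.pow n).inv₀ fun q hq => pow_ne_zero _ (hsq q hq)).mul
        ((continuous_lineP n).comp_continuousOn (hz.div hc hsq)) |>.mul ?_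
      refine (hc4.inv₀ hsq4).mul (Real.continuous_exp.comp_continuousOn ?_)
      exact ((hz.pow 2).div (by fun_prop) hq1).neg
    · exact gaussLineD_le_thetaBound n (by linarith) hq.1.1.le hq.1.2.le
        (abs_le.2 ⟨hq.2.1.le, hq.2.2.le⟩) k
  exact (this.continuousAt (hUo.mem_nhds hpU)).continuousWithinAt

theorem theta_periodic (L : ℝ) (n : ℕ) (t : ℝ) : Function.Periodic (theta L n t) (2 * L) := by
  intro y
  unfold theta
  rw [← (Equiv.addRight (1 : ℤ)).tsum_eq (fun k : ℤ => gaussLineD n t (y + 2 * k * L))]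
  refine tsum_congr fun k => ?_
  congr 1
  simp only [Equiv.coe_addRight, Int.cast_add, Int.cast_one]
  ring

/-- By periodicity `y` may be taken in `[0, 2L)`, and there a single summable majorant serves all
`y` and `t`. -/
theorem abs_theta_le {L T : ℝ} (hL : 0 < L) (hT : 0 < T) (n : ℕ) :
    ∃ c : ℝ, 0 ≤ c ∧ ∀ t ∈ Ioc 0 T, ∀ y, |theta L n t y| ≤ c * (Real.sqrt t ^ (n + 1))⁻¹ := by
  have hs := summable_thetaBound (L := L) (2 * L) hL hT
  refine ⟨6 * ∑' k, thetaBound L (2 * L) T k, mul_nonneg (by norm_num)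
    (tsum_nonneg fun k => by unfold thetaBound; positivity), fun t ht y => ?_⟩
  obtain ⟨y', hy', e⟩ := (theta_periodic L n t).exists_mem_Ico (by positivity) y 0
  rw [e, theta]
  have h1 : ∀ k : ℤ, ‖gaussLineD n t (y' + 2 * k * L)‖ ≤
      6 * (Real.sqrt t ^ (n + 1))⁻¹ * thetaBound L (2 * L) T k := by
    intro k
    have := Real.sqrt_pos.2 ht.1
    refine (abs_gaussLineD_le n ht.1 _).trans ?_
    gcongr
    refine exp_le_thetaBound ht.1 ht.2 ?_ k
    rw [abs_of_nonneg hy'.1]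
    linarith [hy'.2]
  have h2 := tsum_of_norm_bounded (hs.mul_left (6 * (Real.sqrt t ^ (n + 1))⁻¹)).hasSum h1
  rw [tsum_mul_left] at h2
  rw [← Real.norm_eq_abs]
  linarith

/-- A sum over the translates by multiples of `2 L`, on an interval of length `L`. -/
theorem lintegral_periodization_le {z₀ z₁ : ℝ} (hz : z₀ < z₁) (h : ℝ → ℝ≥0∞) (hm : Measurable h)
    (y : ℝ) (σ : ℝ) (hσ : σ = 1 ∨ σ = -1) :
    ∫⁻ ζ in Ioo z₀ z₁, ∑' k : ℤ, h (y + σ * ζ + 2 * k * (z₁ - z₀)) ≤ ∫⁻ w, h w := by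
  rw [lintegral_tsum (f := fun (k : ℤ) ζ => h (y + σ * ζ + 2 * k * (z₁ - z₀)))
    fun k => (hm.comp (by fun_prop)).aemeasurable]
  set L := z₁ - z₀ with hL
  have hL0 : 0 < L := by rw [hL]; linarith
  have hσ2 : σ * σ = 1 := by rcases hσ with rfl | rfl <;> norm_num
  set I : ℤ → Set ℝ := fun k => (fun w => σ * (w - y - 2 * k * L)) ⁻¹' Ioo z₀ z₁ with hI
  have hIm : ∀ k, MeasurableSet (I k) := fun k => measurableSet_Ioo.preimage (by fun_prop)
  have h1 : ∀ k : ℤ, ∫⁻ ζ in Ioo z₀ z₁, h (y + σ * ζ + 2 * k * L) = ∫⁻ w in I k, h w := by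
    intro k
    rw [← lintegral_indicator measurableSet_Ioo, ← lintegral_indicator (hIm k)]
    have e : ∀ ζ, (Ioo z₀ z₁).indicator (fun ζ => h (y + σ * ζ + 2 * k * L)) ζ =
        (I k).indicator h (σ * ζ + (y + 2 * k * L)) := by
      intro ζ
      have e1 : σ * (σ * ζ + (y + 2 * k * L) - y - 2 * k * L) = ζ := by
        linear_combination ζ * hσ2
      have e2 : y + σ * ζ + 2 * k * L = σ * ζ + (y + 2 * k * L) := by ring
      by_cases hζ : ζ ∈ Ioo z₀ z₁
      · rw [indicator_of_mem hζ, indicator_of_mem (by simpa only [hI, mem_preimage, e1] using hζ), e2]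
      · rw [indicator_of_notMem hζ,
          indicator_of_notMem (by simpa only [hI, mem_preimage, e1] using hζ)]
    simp_rw [e]
    have e3 := lintegral_add_right_eq_self (μ := (volume : Measure ℝ))
      (fun w => (I k).indicator h (σ * w)) (σ * (y + 2 * k * L))
    have e4 : ∀ ζ, σ * (ζ + σ * (y + 2 * k * L)) = σ * ζ + (y + 2 * k * L) := by
      intro ζ; linear_combination (y + 2 * k * L) * hσ2
    simp_rw [e4] at e3
    rw [e3]
    rcases hσ with rfl | rfl
    · simp
    · simp only [neg_mul, one_mul]
      exact lintegral_neg_eq_self _ (μ := (volume : Measure ℝ))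
  simp_rw [h1]
  rw [← lintegral_iUnion hIm]
  · exact setLIntegral_le_lintegral _ _
  -- The sets `I k` are intervals of length `L` whose positions differ by multiples of `2L`. They
  -- are disjoint, so the sum is at most one integral over the line.
  · intro k l hkl
    refine disjoint_left.2 fun w hk hl => hkl ?_
    simp only [hI, mem_preimage, mem_Ioo] at hk hl
    have hd : |((k - l : ℤ) : ℝ)| * (2 * L) < L := by
      rw [← abs_of_pos (by positivity : 0 < 2 * L), ← abs_mul]
      have e : ((k - l : ℤ) : ℝ) * (2 * L) = -σ * (σ * (w - y - 2 * k * L) - σ * (w - y - 2 * l * L)) := by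
        push_cast
        linear_combination (-(2 * L) * (k - l)) * hσ2
      rw [e, abs_mul]
      have : |-σ| = 1 := by rcases hσ with rfl | rfl <;> norm_num
      rw [this, one_mul, abs_lt]
      constructor <;> linarith [hk.1, hk.2, hl.1, hl.2]
    have h2 : |((k - l : ℤ) : ℝ)| < 1 := by nlinarith [abs_nonneg ((k - l : ℤ) : ℝ)]
    have h3 : |k - l| < 1 := by exact_mod_cast h2
    have := Int.abs_lt_one_iff.1 h3
    omega

/-! ### Vertical kernels -/

/-- A vertical kernel of order `b`, controlled for times up to `T`. -/
structure VKernel (z₀ z₁ T : ℝ) (b : ℕ) (m : ℝ → ℝ → ℝ → ℝ) : Prop where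
  cont : ContinuousOn (fun p : ℝ × ℝ × ℝ => m p.1 p.2.1 p.2.2) (Ioi 0 ×ˢ univ)
  sup : ∃ c : ℝ, 0 ≤ c ∧ ∀ τ ∈ Ioc 0 T, ∀ z ζ, |m τ z ζ| ≤ c * (Real.sqrt τ ^ (b + 1))⁻¹
  int_right : ∃ c : ℝ, 0 ≤ c ∧ ∀ τ ∈ Ioc 0 T, ∀ z,
    ∫⁻ ζ in Ioo z₀ z₁, ‖m τ z ζ‖ₑ ≤ ENNReal.ofReal (c * (Real.sqrt τ ^ b)⁻¹)
  int_left : ∃ c : ℝ, 0 ≤ c ∧ ∀ τ ∈ Ioc 0 T, ∀ ζ,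
    ∫⁻ z in Ioo z₀ z₁, ‖m τ z ζ‖ₑ ≤ ENNReal.ofReal (c * (Real.sqrt τ ^ b)⁻¹)

theorem VKernel.continuous {z₀ z₁ T : ℝ} {b : ℕ} {m : ℝ → ℝ → ℝ → ℝ} (h : VKernel z₀ z₁ T b m)
    {τ : ℝ} (hτ : 0 < τ) : Continuous (fun p : ℝ × ℝ => m τ p.1 p.2) :=
  h.cont.comp_continuous (f := fun p : ℝ × ℝ => ((τ, p) : ℝ × ℝ × ℝ)) (by fun_prop)
    fun p => ⟨hτ, mem_univ _⟩

theorem VKernel.continuous_right {z₀ z₁ T : ℝ} {b : ℕ} {m : ℝ → ℝ → ℝ → ℝ}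
    (h : VKernel z₀ z₁ T b m) {τ : ℝ} (hτ : 0 < τ) (z : ℝ) : Continuous (m τ z) :=
  (h.continuous hτ).comp (by fun_prop : Continuous fun ζ : ℝ => (z, ζ))

theorem VKernel.modulus {z₀ z₁ T : ℝ} {b : ℕ} {m : ℝ → ℝ → ℝ → ℝ} (h : VKernel z₀ z₁ T b m)
    {δ T' ε : ℝ} (hδ : 0 < δ) (hε : 0 < ε) :
    ∃ η > 0, ∀ τ ∈ Icc δ T', ∀ τ' ∈ Icc δ T', ∀ z ∈ Ioo z₀ z₁, ∀ z' ∈ Ioo z₀ z₁,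
      ∀ ζ ∈ Ioo z₀ z₁, |τ - τ'| < η → |z - z'| < η → |m τ z ζ - m τ' z' ζ| ≤ ε := by
  set K : Set (ℝ × ℝ × ℝ) := Icc δ T' ×ˢ Icc z₀ z₁ ×ˢ Icc z₀ z₁
  have hK : IsCompact K := isCompact_Icc.prod (isCompact_Icc.prod isCompact_Icc)
  have huc := hK.uniformContinuousOn_of_continuous (h.cont.mono fun p hp =>
    ⟨hδ.trans_le hp.1.1, mem_univ _⟩)
  rw [Metric.uniformContinuousOn_iff] at huc
  obtain ⟨η, hη, hu⟩ := huc ε hε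
  refine ⟨η, hη, fun τ hτ τ' hτ' z hz z' hz' ζ hζ h1 h2 => ?_⟩
  refine (hu (τ, z, ζ) ⟨hτ, Ioo_subset_Icc_self hz, Ioo_subset_Icc_self hζ⟩ (τ', z', ζ)
    ⟨hτ', Ioo_subset_Icc_self hz', Ioo_subset_Icc_self hζ⟩ ?_).le
  rw [Prod.dist_eq, Prod.dist_eq]
  simp only [dist_self, Real.dist_eq]
  exact max_lt h1 (max_lt h2 hη)

theorem vKernel_zero (z₀ z₁ T : ℝ) (b : ℕ) : VKernel z₀ z₁ T b (fun _ _ _ => 0) where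
  cont := continuousOn_const
  sup := ⟨0, le_rfl, fun τ _ z ζ => by simp⟩
  int_right := ⟨0, le_rfl, fun τ _ z => by simp⟩
  int_left := ⟨0, le_rfl, fun τ _ z => by simp⟩

/-- A constant does not decay in time; a bound by `τ^{-1/2}` is true only up to a time horizon,
which accounts for the factor `√T`. -/
theorem vKernel_const {z₀ z₁ T : ℝ} (hz : z₀ < z₁) :
    VKernel z₀ z₁ T 0 (fun _ _ _ => (z₁ - z₀)⁻¹) := by
  have hL : 0 < z₁ - z₀ := by linarith
  have hi : ∫⁻ ζ in Ioo z₀ z₁, ‖(z₁ - z₀)⁻¹‖ₑ ≤ ENNReal.ofReal 1 := by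
    rw [lintegral_const, Measure.restrict_apply_univ, Real.volume_Ioo,
      Real.enorm_eq_ofReal (by positivity), ← ENNReal.ofReal_mul (by positivity)]
    rw [inv_mul_cancel₀ hL.ne']
  refine ⟨continuousOn_const, ⟨Real.sqrt T * (z₁ - z₀)⁻¹, by positivity, fun τ hτ z ζ => ?_⟩,
    ⟨1, zero_le_one, fun τ hτ z => ?_⟩, ⟨1, zero_le_one, fun τ hτ z => ?_⟩⟩
  · have hsq := Real.sqrt_pos.2 hτ.1
    have := Real.sqrt_le_sqrt hτ.2
    rw [abs_of_nonneg (by positivity), zero_add, pow_one, mul_right_comm]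
    refine le_mul_of_one_le_left (by positivity) ?_
    rw [← div_eq_mul_inv, one_le_div hsq]
    exact this
  · simpa using hi
  · simpa using hi

/-- The periodization reflected at the end points of the interval. -/
def reflKernel (z₀ z₁ : ℝ) (n : ℕ) (c₁ c₂ τ z ζ : ℝ) : ℝ :=
  c₁ * theta (z₁ - z₀) n τ (z - ζ) + c₂ * theta (z₁ - z₀) n τ (z + ζ - 2 * z₀)

theorem enorm_theta_le (L : ℝ) (n : ℕ) (t y : ℝ) :
    ‖theta L n t y‖ₑ ≤ ∑' k : ℤ, ‖gaussLineD n t (y + 2 * k * L)‖ₑ :=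
  enorm_tsum_le_tsum_enorm

theorem measurable_gaussLineD (n : ℕ) (t : ℝ) : Measurable (gaussLineD n t) := by
  have := (continuous_lineP n).measurable
  unfold gaussLineD gaussLine
  fun_prop

theorem lintegral_gaussLineD_le (n : ℕ) {t : ℝ} (ht : 0 < t) :
    ∫⁻ w, ‖gaussLineD n t w‖ₑ ≤ ENNReal.ofReal (24 * Real.sqrt Real.pi * (Real.sqrt t ^ n)⁻¹) := by
  rw [← lintegral_gauss_bound n ht]
  refine lintegral_mono fun w => ?_
  rw [Real.enorm_eq_ofReal_abs]
  exact ENNReal.ofReal_le_ofReal (abs_gaussLineD_le n ht w)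

theorem lintegral_theta_le {z₀ z₁ : ℝ} (hz : z₀ < z₁) (n : ℕ) {t : ℝ} (ht : 0 < t) (y σ : ℝ)
    (hσ : σ = 1 ∨ σ = -1) :
    ∫⁻ ζ in Ioo z₀ z₁, ‖theta (z₁ - z₀) n t (y + σ * ζ)‖ₑ ≤
      ENNReal.ofReal (24 * Real.sqrt Real.pi * (Real.sqrt t ^ n)⁻¹) :=
  (lintegral_mono fun ζ => enorm_theta_le _ n t (y + σ * ζ)).trans
    ((lintegral_periodization_le hz (fun w => ‖gaussLineD n t w‖ₑ)
      (measurable_gaussLineD n t).enorm y σ hσ).trans (lintegral_gaussLineD_le n ht))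

theorem continuous_theta (L : ℝ) (n : ℕ) {t : ℝ} (hL : 0 < L) (ht : 0 < t) :
    Continuous (theta L n t) :=
  (continuousOn_theta hL n).comp_continuous (f := fun y : ℝ => ((t, y) : ℝ × ℝ)) (by fun_prop)
    fun y => ⟨ht, mem_univ _⟩

/-- Both variables enter the argument of `theta` with coefficient `±1`. Rows and columns are
therefore alike integrals of a periodization over half a period. -/
theorem vKernel_reflKernel {z₀ z₁ T : ℝ} (hz : z₀ < z₁) (hT : 0 < T) (n : ℕ) {c₁ c₂ : ℝ}
    (h₁ : |c₁| = 1) (h₂ : |c₂| = 1) : VKernel z₀ z₁ T n (reflKernel z₀ z₁ n c₁ c₂) := by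
  have hL : 0 < z₁ - z₀ := by linarith
  have e₁ : ‖c₁‖ₑ = 1 := by rw [Real.enorm_eq_ofReal_abs, h₁, ENNReal.ofReal_one]
  have e₂ : ‖c₂‖ₑ = 1 := by rw [Real.enorm_eq_ofReal_abs, h₂, ENNReal.ofReal_one]
  have hb : ∀ τ z ζ, ‖reflKernel z₀ z₁ n c₁ c₂ τ z ζ‖ₑ ≤
      ‖theta (z₁ - z₀) n τ (z - ζ)‖ₑ + ‖theta (z₁ - z₀) n τ (z + ζ - 2 * z₀)‖ₑ := by
    intro τ z ζ
    refine (enorm_add_le _ _).trans ?_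
    rw [enorm_mul, enorm_mul, e₁, e₂, one_mul, one_mul]
  refine ⟨?_, ?_, ⟨48 * Real.sqrt Real.pi, by positivity, fun τ hτ z => ?_⟩,
    ⟨48 * Real.sqrt Real.pi, by positivity, fun τ hτ ζ => ?_⟩⟩
  · unfold reflKernel
    refine (continuousOn_const.mul ?_).add (continuousOn_const.mul ?_)
    · exact (continuousOn_theta hL n).comp (f := fun p : ℝ × ℝ × ℝ => (p.1, p.2.1 - p.2.2))
        (by fun_prop) fun p hp => ⟨hp.1, mem_univ _⟩
    · exact (continuousOn_theta hL n).comp (f := fun p : ℝ × ℝ × ℝ =>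
        (p.1, p.2.1 + p.2.2 - 2 * z₀)) (by fun_prop) fun p hp => ⟨hp.1, mem_univ _⟩
  · obtain ⟨c, hc0, hc⟩ := abs_theta_le hL hT n
    refine ⟨2 * c, by positivity, fun τ hτ z ζ => ?_⟩
    refine (abs_add_le _ _).trans ?_
    rw [abs_mul, abs_mul, h₁, h₂, one_mul, one_mul]
    linarith [hc τ hτ (z - ζ), hc τ hτ (z + ζ - 2 * z₀)]
  · have a1 := lintegral_theta_le hz n hτ.1 z (-1) (Or.inr rfl)
    have a2 := lintegral_theta_le hz n hτ.1 (z - 2 * z₀) 1 (Or.inl rfl)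
    refine (lintegral_mono fun ζ => hb τ z ζ).trans ?_
    have hc : Continuous fun ζ : ℝ => theta (z₁ - z₀) n τ (z - ζ) :=
      (continuous_theta _ n hL hτ.1).comp (by fun_prop)
    rw [lintegral_add_left hc.measurable.enorm]
    have q1 : ∀ ζ : ℝ, z + -1 * ζ = z - ζ := fun ζ => by ring
    have q2 : ∀ ζ : ℝ, z - 2 * z₀ + 1 * ζ = z + ζ - 2 * z₀ := fun ζ => by ring
    simp only [q1] at a1
    simp only [q2] at a2
    refine (add_le_add a1 a2).trans ?_
    have := Real.sqrt_pos.2 hτ.1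
    rw [← ENNReal.ofReal_add (by positivity) (by positivity)]
    exact ENNReal.ofReal_le_ofReal (by linarith)
  · have a1 := lintegral_theta_le hz n hτ.1 (-ζ) 1 (Or.inl rfl)
    have a2 := lintegral_theta_le hz n hτ.1 (ζ - 2 * z₀) 1 (Or.inl rfl)
    refine (lintegral_mono fun z => hb τ z ζ).trans ?_
    have hc : Continuous fun z : ℝ => theta (z₁ - z₀) n τ (z - ζ) :=
      (continuous_theta _ n hL hτ.1).comp (by fun_prop)
    rw [lintegral_add_left hc.measurable.enorm]
    have q1 : ∀ z : ℝ, -ζ + 1 * z = z - ζ := fun z => by ring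
    have q2 : ∀ z : ℝ, ζ - 2 * z₀ + 1 * z = z + ζ - 2 * z₀ := fun z => by ring
    simp only [q1] at a1
    simp only [q2] at a2
    refine (add_le_add a1 a2).trans ?_
    have := Real.sqrt_pos.2 hτ.1
    rw [← ENNReal.ofReal_add (by positivity) (by positivity)]
    exact ENNReal.ofReal_le_ofReal (by linarith)

/-- The distance of the vertical points is at most that of all reflected and translated points. -/
theorem abs_sub_le_abs_reflected {z₀ z₁ z ζ : ℝ} (hz : z ∈ Ioo z₀ z₁) (hζ : ζ ∈ Ioo z₀ z₁) (k : ℤ) :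
    |z - ζ| ≤ |z - ζ + 2 * k * (z₁ - z₀)| ∧ |z - ζ| ≤ |z + ζ - 2 * z₀ + 2 * k * (z₁ - z₀)| := by
  have hL : 0 < z₁ - z₀ := by linarith [hz.1, hz.2]
  obtain ⟨h1, h2⟩ := hz
  obtain ⟨h3, h4⟩ := hζ
  rcases lt_trichotomy k 0 with hk | rfl | hk
  · have hk' : (k : ℝ) ≤ -1 := by exact_mod_cast Int.le_sub_one_of_lt hk
    have h5 : (k : ℝ) * (z₁ - z₀) ≤ -1 * (z₁ - z₀) := by gcongr
    constructor
    · rw [abs_le]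
      constructor <;> nlinarith [neg_abs_le (z - ζ + 2 * k * (z₁ - z₀)),
        le_abs_self (z - ζ + 2 * k * (z₁ - z₀)), neg_le_abs (z - ζ + 2 * k * (z₁ - z₀))]
    · rw [abs_le]
      constructor <;> nlinarith [neg_le_abs (z + ζ - 2 * z₀ + 2 * k * (z₁ - z₀))]
  · simp only [Int.cast_zero, mul_zero, zero_mul, add_zero, le_refl, true_and]
    rw [abs_le]
    constructor <;> linarith [le_abs_self (z + ζ - 2 * z₀)]
  · have hk' : (1 : ℝ) ≤ k := by exact_mod_cast hk
    have h5 : 1 * (z₁ - z₀) ≤ (k : ℝ) * (z₁ - z₀) := by gcongr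
    constructor
    · rw [abs_le]
      constructor <;> nlinarith [le_abs_self (z - ζ + 2 * k * (z₁ - z₀))]
    · rw [abs_le]
      constructor <;> nlinarith [le_abs_self (z + ζ - 2 * z₀ + 2 * k * (z₁ - z₀))]

/-- By hypothesis `|z - ζ|` is at most the argument of each term of the periodization, so the weight
can be moved inside the sum onto the Gauss kernel of the line. -/
theorem lintegral_theta_weighted_le {z₀ z₁ : ℝ} (hz : z₀ < z₁) (n : ℕ) {t : ℝ} (ht : 0 < t)
    (y σ : ℝ) (hσ : σ = 1 ∨ σ = -1) {z : ℝ}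
    (hd : ∀ ζ ∈ Ioo z₀ z₁, ∀ k : ℤ, |z - ζ| ≤ |y + σ * ζ + 2 * k * (z₁ - z₀)|) :
    ∫⁻ ζ in Ioo z₀ z₁, ‖theta (z₁ - z₀) n t (y + σ * ζ)‖ₑ * ENNReal.ofReal (Real.sqrt |z - ζ|) ≤
      ENNReal.ofReal (24 * Real.sqrt Real.pi * ((Real.sqrt t ^ n)⁻¹ * Real.sqrt (Real.sqrt t))) := by
  set h : ℝ → ℝ≥0∞ := fun w => ENNReal.ofReal (|gaussLineD n t w| * Real.sqrt |w|) with hh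
  have hm : Measurable h := by
    have := measurable_gaussLineD n t
    exact ENNReal.measurable_ofReal.comp (by
      have h1 : Measurable fun w => |gaussLineD n t w| := this.norm
      have h2 : Measurable fun w : ℝ => Real.sqrt |w| := by fun_prop
      exact h1.mul h2)
  have h1 : ∫⁻ ζ in Ioo z₀ z₁, ‖theta (z₁ - z₀) n t (y + σ * ζ)‖ₑ *
      ENNReal.ofReal (Real.sqrt |z - ζ|) ≤
      ∫⁻ ζ in Ioo z₀ z₁, ∑' k : ℤ, h (y + σ * ζ + 2 * k * (z₁ - z₀)) := by
    refine setLIntegral_mono' measurableSet_Ioo fun ζ hζ => ?_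
    refine (mul_le_mul_left (enorm_theta_le _ n t (y + σ * ζ)) _).trans ?_
    rw [← ENNReal.tsum_mul_right]
    refine ENNReal.tsum_le_tsum fun k => ?_
    rw [Real.enorm_eq_ofReal_abs, ← ENNReal.ofReal_mul (abs_nonneg _)]
    refine ENNReal.ofReal_le_ofReal ?_
    have := Real.sqrt_le_sqrt (hd ζ hζ k)
    gcongr
  refine h1.trans ((lintegral_periodization_le hz h hm y σ hσ).trans ?_)
  calc ∫⁻ w, h w ≤ ∫⁻ w, ENNReal.ofReal (Real.sqrt (Real.sqrt t)) *
        ENNReal.ofReal (6 * (Real.sqrt t ^ (n + 1))⁻¹ * Real.exp (-(w ^ 2 / (16 * t)))) := by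
        refine lintegral_mono fun w => ?_
        rw [← ENNReal.ofReal_mul (Real.sqrt_nonneg _)]
        exact ENNReal.ofReal_le_ofReal (abs_gaussLineD_mul_sqrt_le n ht w)
    _ = _ := by
        rw [lintegral_const_mul' _ _ ENNReal.ofReal_ne_top, lintegral_gauss_bound n ht,
          ← ENNReal.ofReal_mul (Real.sqrt_nonneg _)]
        congr 1
        ring

theorem reflKernel_weighted_le {z₀ z₁ : ℝ} (n : ℕ) {c₁ c₂ : ℝ} (h₁ : |c₁| = 1) (h₂ : |c₂| = 1)
    {τ z : ℝ} (hτ : 0 < τ) (hz : z ∈ Ioo z₀ z₁) :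
    ∫⁻ ζ in Ioo z₀ z₁, ‖reflKernel z₀ z₁ n c₁ c₂ τ z ζ‖ₑ * ENNReal.ofReal (Real.sqrt |z - ζ|) ≤
      ENNReal.ofReal (48 * Real.sqrt Real.pi *
        ((Real.sqrt τ ^ n)⁻¹ * Real.sqrt (Real.sqrt τ))) := by
  have hz' : z₀ < z₁ := hz.1.trans hz.2
  have hL : 0 < z₁ - z₀ := by linarith
  have e₁ : ‖c₁‖ₑ = 1 := by rw [Real.enorm_eq_ofReal_abs, h₁, ENNReal.ofReal_one]
  have e₂ : ‖c₂‖ₑ = 1 := by rw [Real.enorm_eq_ofReal_abs, h₂, ENNReal.ofReal_one]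
  have q1 : ∀ ζ : ℝ, z + -1 * ζ = z - ζ := fun ζ => by ring
  have q2 : ∀ ζ : ℝ, z - 2 * z₀ + 1 * ζ = z + ζ - 2 * z₀ := fun ζ => by ring
  have a1 := lintegral_theta_weighted_le hz' n hτ z (-1) (Or.inr rfl) (z := z) (fun ζ hζ k => by
    rw [q1]; exact (abs_sub_le_abs_reflected hz hζ k).1)
  have a2 := lintegral_theta_weighted_le hz' n hτ (z - 2 * z₀) 1 (Or.inl rfl) (z := z)
    (fun ζ hζ k => by rw [q2]; exact (abs_sub_le_abs_reflected hz hζ k).2)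
  simp only [q1] at a1
  simp only [q2] at a2
  have hb : ∀ ζ, ‖reflKernel z₀ z₁ n c₁ c₂ τ z ζ‖ₑ * ENNReal.ofReal (Real.sqrt |z - ζ|) ≤
      ‖theta (z₁ - z₀) n τ (z - ζ)‖ₑ * ENNReal.ofReal (Real.sqrt |z - ζ|) +
      ‖theta (z₁ - z₀) n τ (z + ζ - 2 * z₀)‖ₑ * ENNReal.ofReal (Real.sqrt |z - ζ|) := by
    intro ζ
    rw [← add_mul]
    gcongr
    refine (enorm_add_le _ _).trans ?_
    rw [enorm_mul, enorm_mul, e₁, e₂, one_mul, one_mul]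
  refine (lintegral_mono hb).trans ?_
  rw [lintegral_add_left]
  · refine (add_le_add a1 a2).trans ?_
    rw [← ENNReal.ofReal_add (by positivity) (by positivity)]
    exact ENNReal.ofReal_le_ofReal (by ring_nf; rfl)
  · have h3 : Continuous fun ζ : ℝ => theta (z₁ - z₀) n τ (z - ζ) :=
      (continuous_theta _ n hL hτ).comp (by fun_prop)
    exact h3.measurable.enorm.mul (by fun_prop)

theorem neumannKernel_eq {z₀ z₁ t : ℝ} (hz : z₀ < z₁) (ht : 0 < t) (z ζ : ℝ) :
    neumannKernel z₀ z₁ t z ζ = reflKernel z₀ z₁ 0 1 1 t z ζ := by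
  have hL : 0 < z₁ - z₀ := by linarith
  have h := (summable_theta hL 0 ht (z - ζ)).tsum_add (summable_theta hL 0 ht (z + ζ - 2 * z₀))
  simp only [gaussLineD_zero] at h
  simp only [neumannKernel, reflKernel, theta, gaussLineD_zero, one_mul, h]

theorem hasDerivAt_reflKernel_left {z₀ z₁ t : ℝ} (hz : z₀ < z₁) {n : ℕ} (hn : n ≤ 1) (ht : 0 < t)
    (c₁ c₂ z ζ : ℝ) : HasDerivAt (fun z => reflKernel z₀ z₁ n c₁ c₂ t z ζ)
      (reflKernel z₀ z₁ (n + 1) c₁ c₂ t z ζ) z := by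
  have hL : 0 < z₁ - z₀ := by linarith
  have h1 : HasDerivAt (fun z => theta (z₁ - z₀) n t (z - ζ))
      (theta (z₁ - z₀) (n + 1) t (z - ζ)) z :=
    (hasDerivAt_theta hL hn ht (z - ζ)).comp_sub_const z ζ
  have h2 : HasDerivAt (fun z => theta (z₁ - z₀) n t (z + (ζ - 2 * z₀)))
      (theta (z₁ - z₀) (n + 1) t (z + (ζ - 2 * z₀))) z :=
    (hasDerivAt_theta hL hn ht (z + (ζ - 2 * z₀))).comp_add_const z (ζ - 2 * z₀)
  simp only [← add_sub_assoc] at h2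
  exact (h1.const_mul c₁).add (h2.const_mul c₂)

/-- The direct part depends on `z - ζ`, the reflected part on `z + ζ`. A derivative in `ζ` thus
differs from one in `z` by the sign of the first coefficient, which is why the signs are parameters
of `reflKernel`. -/
theorem hasDerivAt_reflKernel_right {z₀ z₁ t : ℝ} (hz : z₀ < z₁) {n : ℕ} (hn : n ≤ 1) (ht : 0 < t)
    (c₁ c₂ z ζ : ℝ) : HasDerivAt (fun ζ => reflKernel z₀ z₁ n c₁ c₂ t z ζ)
      (reflKernel z₀ z₁ (n + 1) (-c₁) c₂ t z ζ) ζ := by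
  have hL : 0 < z₁ - z₀ := by linarith
  have h1 : HasDerivAt (fun ζ => theta (z₁ - z₀) n t (z - ζ))
      (-theta (z₁ - z₀) (n + 1) t (z - ζ)) ζ :=
    (hasDerivAt_theta hL hn ht (z - ζ)).comp_const_sub z ζ
  have h2 : HasDerivAt (fun ζ => theta (z₁ - z₀) n t (ζ + (z - 2 * z₀)))
      (theta (z₁ - z₀) (n + 1) t (ζ + (z - 2 * z₀))) ζ :=
    (hasDerivAt_theta hL hn ht (ζ + (z - 2 * z₀))).comp_add_const ζ (z - 2 * z₀)
  have e : ∀ ζ, ζ + (z - 2 * z₀) = z + ζ - 2 * z₀ := fun ζ => by ring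
  simp only [e] at h2
  refine ((h1.const_mul c₁).add (h2.const_mul c₂)).congr_deriv ?_
  simp only [reflKernel]
  ring

theorem deriv_neumannKernel {z₀ z₁ t : ℝ} (hz : z₀ < z₁) (ht : 0 < t) (z ζ : ℝ) :
    deriv (fun ξ => neumannKernel z₀ z₁ t z ξ) ζ = reflKernel z₀ z₁ 1 (-1) 1 t z ζ := by
  have e : (fun ξ => neumannKernel z₀ z₁ t z ξ) = fun ξ => reflKernel z₀ z₁ 0 1 1 t z ξ :=
    funext fun ξ => neumannKernel_eq hz ht z ξ
  rw [e]
  exact (hasDerivAt_reflKernel_right hz (by norm_num) ht 1 1 z ζ).deriv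

/-! ### Integral operators with product kernels -/

section Operators

variable {E : Type*} [NormedAddCommGroup E]

theorem mixedNorm_le_iff {z₀ z₁ : ℝ} {p : ℝ≥0∞} {f : Dom → E} {C : ℝ≥0∞} :
    mixedNorm z₀ z₁ p f ≤ C ↔
      ∀ᵐ x : Plane, eLpNorm (fun z : ℝ => f (x, z)) p (volume.restrict (Ioo z₀ z₁)) ≤ C :=
  ⟨fun h => (ae_le_essSup).mono fun _ hx => hx.trans h, fun h => essSup_le_of_ae_le _ h⟩

theorem mixedNorm_congr {z₀ z₁ : ℝ} {p : ℝ≥0∞} {f g : Dom → E} (h : f =ᵐ[layer z₀ z₁] g) :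
    mixedNorm z₀ z₁ p f = mixedNorm z₀ z₁ p g :=
  essSup_congr_ae ((Measure.ae_ae_of_ae_prod h).mono fun _ hx => eLpNorm_congr_ae hx)

instance sFinite_layer (z₀ z₁ : ℝ) : SFinite (layer z₀ z₁) := by unfold layer; infer_instance

theorem inv_sqrt_pow {τ : ℝ} (hτ : 0 < τ) (a : ℕ) :
    (Real.sqrt τ ^ a)⁻¹ = τ ^ (-(a : ℝ) / 2) := by
  rw [Real.sqrt_eq_rpow, ← Real.rpow_natCast, ← Real.rpow_mul hτ.le, ← Real.rpow_neg hτ.le]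
  congr 1
  ring

/-- Tonelli, in the form in which all operators are estimated: an `L¹` bound horizontally, a uniform
bound of the vertical integrals. -/
theorem lintegral_layer_le {z₀ z₁ : ℝ} {h : Plane → ℝ≥0∞} (hh : Measurable h) {G : Dom → ℝ≥0∞}
    (hG : AEMeasurable G (layer z₀ z₁)) {C : ℝ≥0∞}
    (hC : ∀ᵐ y : Plane, ∫⁻ ζ in Ioo z₀ z₁, G (y, ζ) ≤ C) :
    ∫⁻ p, h p.1 * G p ∂(layer z₀ z₁) ≤ (∫⁻ y, h y) * C := by
  have hm : AEMeasurable (fun p : Dom => h p.1 * G p) (layer z₀ z₁) :=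
    (hh.comp measurable_fst).aemeasurable.mul hG
  unfold layer at hm ⊢
  rw [lintegral_prod _ hm, ← lintegral_mul_const _ hh]
  refine lintegral_mono_ae ?_
  have h2 : ∀ᵐ y : Plane, AEMeasurable (fun ζ => G (y, ζ)) (volume.restrict (Ioo z₀ z₁)) :=
    (hG.aestronglyMeasurable.prodMk_left).mono fun _ h => h.aemeasurable
  filter_upwards [hC, h2] with y hy hy2
  rw [lintegral_const_mul'' _ hy2]
  gcongr

/-- Hölder's inequality for the measure `w μ`, whose mass is at most `W₁` and whose density is at
most `W`. With `w` a vertical kernel it yields the smoothing from `L^p` to bounded functions for all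
`p` at once, `p = ∞` included. -/
theorem lintegral_weight_le {α : Type*} [MeasurableSpace α] {μ : Measure α} {w : α → ℝ≥0∞}
    (hw : AEMeasurable w μ) {φ : α → E} (hφ : AEStronglyMeasurable φ μ) {p : ℝ≥0∞} (hp : 1 ≤ p)
    {W₁ W : ℝ≥0∞} (hW₁ : ∫⁻ x, w x ∂μ ≤ W₁) (hW : ∀ᵐ x ∂μ, w x ≤ W) (hW0 : W ≠ 0) :
    ∫⁻ x, w x * ‖φ x‖ₑ ∂μ ≤
      W₁ ^ (1 - p⁻¹.toReal) * (W ^ p⁻¹.toReal * eLpNorm φ p μ) := by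
  have hac := withDensity_absolutelyContinuous μ w
  have e1 : ∫⁻ x, w x * ‖φ x‖ₑ ∂μ = eLpNorm φ 1 (μ.withDensity w) := by
    rw [eLpNorm_one_eq_lintegral_enorm, lintegral_withDensity_eq_lintegral_mul₀ hw hφ.enorm]
    rfl
  have hp1 : p⁻¹.toReal ≤ 1 :=
    ENNReal.toReal_le_of_le_ofReal zero_le_one (by simpa using ENNReal.inv_le_inv.2 hp)
  have e2 : (μ.withDensity w) univ ≤ W₁ := by
    rw [withDensity_apply _ MeasurableSet.univ, Measure.restrict_univ]
    exact hW₁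
  have e3 : eLpNorm φ p (μ.withDensity w) ≤ W ^ p⁻¹.toReal * eLpNorm φ p μ := by
    refine (eLpNorm_mono_measure φ (withDensity_mono hW)).trans ?_
    rw [withDensity_const, eLpNorm_smul_measure_of_ne_zero hW0, one_div, smul_eq_mul]
  rw [e1]
  refine (eLpNorm_le_eLpNorm_mul_rpow_measure_univ hp (hφ.mono_ac hac)).trans ?_
  rw [mul_comm]
  refine mul_le_mul' ?_ e3
  rw [ENNReal.toReal_one, div_one, one_div, ← ENNReal.toReal_inv]
  exact ENNReal.rpow_le_rpow e2 (by linarith)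

/-- Jensen's inequality for `w μ`, without normalizing the mass. It carries both the Schur test in
`eLpNorm_op_le` and Minkowski's inequality in `eLpNorm_integral_le`. -/
theorem jensen_weight {α : Type*} [MeasurableSpace α] {μ : Measure α} {w : α → ℝ≥0∞}
    (hw : AEMeasurable w μ) {φ : α → ℝ≥0∞} (hφ : AEMeasurable φ μ) {r : ℝ} (hr : 1 ≤ r) :
    (∫⁻ x, w x * φ x ∂μ) ^ r ≤ (∫⁻ x, w x ∂μ) ^ (r - 1) * ∫⁻ x, w x * φ x ^ r ∂μ := by
  have hac := withDensity_absolutelyContinuous μ w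
  have h := eLpNorm'_le_eLpNorm'_mul_rpow_measure_univ (μ := μ.withDensity w) one_pos hr
    (hφ.mono_ac hac).aestronglyMeasurable
  have hr0 : 0 < r := by linarith
  have e1 : eLpNorm' φ 1 (μ.withDensity w) = ∫⁻ x, w x * φ x ∂μ := by
    rw [eLpNorm'_eq_lintegral_enorm]
    simp only [enorm_eq_self, ENNReal.rpow_one, div_one]
    rw [lintegral_withDensity_eq_lintegral_mul₀ hw hφ]
    rfl
  have e2 : eLpNorm' φ r (μ.withDensity w) = (∫⁻ x, w x * φ x ^ r ∂μ) ^ (1 / r) := by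
    rw [eLpNorm'_eq_lintegral_enorm]
    simp only [enorm_eq_self]
    rw [lintegral_withDensity_eq_lintegral_mul₀ hw (hφ.pow_const r)]
    rfl
  have e3 : (μ.withDensity w) univ = ∫⁻ x, w x ∂μ := by
    rw [withDensity_apply _ MeasurableSet.univ, Measure.restrict_univ]
  rw [e1, e2, e3] at h
  calc _ ≤ ((∫⁻ x, w x * φ x ^ r ∂μ) ^ (1 / r) * (∫⁻ x, w x ∂μ) ^ (1 / 1 - 1 / r)) ^ r :=
        ENNReal.rpow_le_rpow h hr0.le
    _ = _ := by
        rw [ENNReal.mul_rpow_of_nonneg _ _ hr0.le, ← ENNReal.rpow_mul, ← ENNReal.rpow_mul,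
          one_div_mul_cancel hr0.ne', ENNReal.rpow_one, mul_comm]
        congr 2
        field_simp

theorem inv_toReal_mem {p : ℝ≥0∞} (hp : 1 ≤ p) : 0 ≤ p⁻¹.toReal ∧ p⁻¹.toReal ≤ 1 :=
  ⟨ENNReal.toReal_nonneg,
    ENNReal.toReal_le_of_le_ofReal zero_le_one (by simpa using ENNReal.inv_le_inv.2 hp)⟩

variable [NormedSpace ℝ E]

/-- The integral operator on the layer with kernel `k(x - y) m(z, ζ)`. -/
def Op (z₀ z₁ : ℝ) (k : Plane → ℝ) (m : ℝ → ℝ → ℝ) (f : Dom → E) (q : Dom) : E :=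
  ∫ p, (k (q.1 - p.1) * m q.2 p.2) • f p ∂(layer z₀ z₁)

theorem Op_congr {z₀ z₁ : ℝ} {k : Plane → ℝ} {m : ℝ → ℝ → ℝ} {f g : Dom → E}
    (h : f =ᵐ[layer z₀ z₁] g) : Op z₀ z₁ k m f = Op z₀ z₁ k m g := by
  funext q
  exact integral_congr_ae (h.mono fun p hp => by simp only [hp])

theorem enorm_op_le {z₀ z₁ : ℝ} {k : Plane → ℝ} (hk : Measurable k) {m : ℝ → ℝ → ℝ} {f : Dom → E}
    {q : Dom} (hm : Measurable (m q.2)) (hf : AEStronglyMeasurable f (layer z₀ z₁)) {C : ℝ≥0∞}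
    (hC : ∀ᵐ y : Plane, ∫⁻ ζ in Ioo z₀ z₁, ‖m q.2 ζ‖ₑ * ‖f (y, ζ)‖ₑ ≤ C) :
    ‖Op z₀ z₁ k m f q‖ₑ ≤ (∫⁻ y, ‖k y‖ₑ) * C := by
  refine (enorm_integral_le_lintegral_enorm _).trans ?_
  have e : ∀ p : Dom, ‖(k (q.1 - p.1) * m q.2 p.2) • f p‖ₑ =
      ‖k (q.1 - p.1)‖ₑ * (‖m q.2 p.2‖ₑ * ‖f p‖ₑ) := fun p => by
    rw [enorm_smul, enorm_mul, mul_assoc]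
  simp_rw [e]
  have h := lintegral_layer_le (z₀ := z₀) (z₁ := z₁) (h := fun y => ‖k (q.1 - y)‖ₑ)
    (hk.comp (by fun_prop)).enorm (G := fun p => ‖m q.2 p.2‖ₑ * ‖f p‖ₑ)
    ((hm.comp measurable_snd).enorm.aemeasurable.mul hf.enorm) hC
  rwa [lintegral_sub_left_eq_self (fun y => ‖k y‖ₑ) q.1] at h

theorem integrable_mul_of_memLInf {z₀ z₁ : ℝ} {h : Plane → ℝ} (hh : Integrable h) {f : Dom → E}
    (hf : MemLInf z₀ z₁ 1 f) : Integrable (fun p : Dom => h p.1 • f p) (layer z₀ z₁) := by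
  obtain ⟨h', hm', he⟩ := hh.aestronglyMeasurable
  have hqm : Measure.QuasiMeasurePreserving (Prod.fst : Dom → Plane) (layer z₀ z₁) volume :=
    Measure.quasiMeasurePreserving_fst
  have he2 : (fun p : Dom => h p.1 • f p) =ᵐ[layer z₀ z₁] fun p => h' p.1 • f p := by
    filter_upwards [hqm.ae_eq_comp he] with p hp
    simp only [Function.comp_apply] at hp
    rw [hp]
  refine Integrable.congr ⟨?_, ?_⟩ he2.symm
  · exact (hm'.comp_measurable measurable_fst).aestronglyMeasurable.smul hf.1
  · have h1 := lintegral_layer_le (z₀ := z₀) (z₁ := z₁) (h := fun y => ‖h' y‖ₑ)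
      hm'.measurable.enorm (G := fun p => ‖f p‖ₑ) hf.1.enorm (C := mixedNorm z₀ z₁ 1 f) (by
        have := mixedNorm_le_iff.1 (le_refl (mixedNorm z₀ z₁ 1 f))
        simpa only [eLpNorm_one_eq_lintegral_enorm] using this)
    rw [hasFiniteIntegral_iff_enorm]
    simp_rw [enorm_smul]
    refine h1.trans_lt (ENNReal.mul_lt_top ?_ hf.2)
    have := (hh.congr he).2
    rwa [hasFiniteIntegral_iff_enorm] at this

/-- The kernel, applied to functions with values in `L¹`, is integrable. -/
theorem integrable_op {z₀ z₁ : ℝ} {k : Plane → ℝ} (hk : Integrable k) {w : ℝ → ℝ}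
    (hw : Measurable w) {c : ℝ} (hc : ∀ ζ, |w ζ| ≤ c) {f : Dom → E} (hf : MemLInf z₀ z₁ 1 f)
    (x : Plane) : Integrable (fun p : Dom => (k (x - p.1) * w p.2) • f p) (layer z₀ z₁) := by
  have h1 : Integrable (fun y => k (x - y)) := hk.comp_sub_left x
  have h2 := integrable_mul_of_memLInf h1 hf
  have e : (fun p : Dom => (k (x - p.1) * w p.2) • f p) = fun p => w p.2 • (k (x - p.1) • f p) := by
    funext p; rw [smul_smul, mul_comm]
  rw [e]
  exact h2.bdd_smul c (hw.comp measurable_snd).aestronglyMeasurable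
    (Eventually.of_forall fun p => hc p.2)

/-- The operator of order `a + b` maps `L^∞(L^p)` to bounded functions. -/
theorem norm_op_le {z₀ z₁ T : ℝ} {a b : ℕ} {d : ℝ} {k : ℝ → Plane → ℝ} {m : ℝ → ℝ → ℝ → ℝ}
    (hk : HKernel a d k) (hd : 2 < d) (hm : VKernel z₀ z₁ T b m) :
    ∃ c : ℝ, 0 ≤ c ∧ ∀ τ ∈ Ioc 0 T, ∀ p : ℝ≥0∞, 1 ≤ p → ∀ (f : Dom → E) (A : ℝ), 0 ≤ A →
      AEStronglyMeasurable f (layer z₀ z₁) → mixedNorm z₀ z₁ p f ≤ ENNReal.ofReal A → ∀ q,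
      ‖Op z₀ z₁ (k τ) (m τ) f q‖ ≤ c * τ ^ (-((a + b : ℕ) : ℝ) / 2 - p⁻¹.toReal / 2) * A := by
  obtain ⟨ck, hck0, hck⟩ := hk.integral_le hd
  obtain ⟨cs, hcs0, hcs⟩ := hm.sup
  obtain ⟨cr, hcr0, hcr⟩ := hm.int_right
  refine ⟨ck * ((cr + 1) * (cs + 1)), by positivity, fun τ hτ p hp f A hA hf hfA q => ?_⟩
  have hsq := Real.sqrt_pos.2 hτ.1
  obtain ⟨he0, he1⟩ := inv_toReal_mem hp
  set e := p⁻¹.toReal with he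
  -- The constants are raised by one to make `W₁` and `W` positive, and so that powers of the
  -- constants with exponents in `[0, 1]` do not exceed the constants.
  set W₁ : ℝ := (cr + 1) * τ ^ (-(b : ℝ) / 2) with hW₁
  set W : ℝ := (cs + 1) * τ ^ (-((b + 1 : ℕ) : ℝ) / 2) with hW
  have hτp : ∀ s : ℝ, 0 < τ ^ s := fun s => Real.rpow_pos_of_pos hτ.1 s
  have hW₁0 : 0 < W₁ := mul_pos (by linarith) (hτp _)
  have hW0 : 0 < W := mul_pos (by linarith) (hτp _)
  have hmc : Measurable (m τ q.2) := (hm.continuous_right hτ.1 q.2).measurable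
  have hinner : ∀ᵐ y : Plane, ∫⁻ ζ in Ioo z₀ z₁, ‖m τ q.2 ζ‖ₑ * ‖f (y, ζ)‖ₑ ≤
      ENNReal.ofReal (W₁ ^ (1 - e) * (W ^ e * A)) := by
    filter_upwards [mixedNorm_le_iff.1 hfA, hf.prodMk_left] with y hy hfm
    have := lintegral_weight_le (μ := volume.restrict (Ioo z₀ z₁)) (w := fun ζ => ‖m τ q.2 ζ‖ₑ)
      hmc.enorm.aemeasurable hfm hp (W₁ := ENNReal.ofReal W₁) (W := ENNReal.ofReal W)
      ((hcr τ hτ q.2).trans (ENNReal.ofReal_le_ofReal (by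
        rw [inv_sqrt_pow hτ.1, hW₁]
        have := hτp (-(b : ℝ) / 2)
        gcongr
        linarith)))
      (Eventually.of_forall fun ζ => by
        rw [Real.enorm_eq_ofReal_abs]
        refine ENNReal.ofReal_le_ofReal ((hcs τ hτ q.2 ζ).trans ?_)
        rw [inv_sqrt_pow hτ.1, hW]
        have := hτp (-((b + 1 : ℕ) : ℝ) / 2)
        gcongr
        linarith)
      (by simpa using hW0)
    refine this.trans ?_
    rw [ENNReal.ofReal_rpow_of_pos hW₁0, ENNReal.ofReal_rpow_of_pos hW0,
      ENNReal.ofReal_mul (by positivity), ENNReal.ofReal_mul (by positivity)]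
    gcongr
  have hop := enorm_op_le (hk.continuous hτ.1).measurable hmc hf hinner
  have hki : ∫⁻ y, ‖k τ y‖ₑ ≤ ENNReal.ofReal (ck * τ ^ (-(a : ℝ) / 2)) := by
    rw [← ofReal_integral_norm_eq_lintegral_enorm (hck τ hτ.1).1, ← inv_sqrt_pow hτ.1]
    exact ENNReal.ofReal_le_ofReal (hck τ hτ.1).2
  have h2 := hop.trans (mul_le_mul_left hki _)
  have := hτp (-(a : ℝ) / 2)
  rw [← ENNReal.ofReal_mul (by positivity), ← ofReal_norm,
    ENNReal.ofReal_le_ofReal_iff (by positivity)] at h2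
  refine h2.trans ?_
  have h3 : W₁ ^ (1 - e) ≤ (cr + 1) * τ ^ (-(b : ℝ) / 2 * (1 - e)) := by
    rw [hW₁, Real.mul_rpow (by positivity) (hτp _).le, ← Real.rpow_mul hτ.1.le]
    refine mul_le_mul_of_nonneg_right ?_ (hτp _).le
    calc (cr + 1) ^ (1 - e) ≤ (cr + 1) ^ (1 : ℝ) :=
          Real.rpow_le_rpow_of_exponent_le (by linarith) (by linarith)
      _ = _ := Real.rpow_one _
  have h4 : W ^ e ≤ (cs + 1) * τ ^ (-((b + 1 : ℕ) : ℝ) / 2 * e) := by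
    rw [hW, Real.mul_rpow (by positivity) (hτp _).le, ← Real.rpow_mul hτ.1.le]
    refine mul_le_mul_of_nonneg_right ?_ (hτp _).le
    calc (cs + 1) ^ e ≤ (cs + 1) ^ (1 : ℝ) :=
          Real.rpow_le_rpow_of_exponent_le (by linarith) (by linarith)
      _ = _ := Real.rpow_one _
  have h5 := hτp (-(b : ℝ) / 2 * (1 - e))
  have h6 := hτp (-((b + 1 : ℕ) : ℝ) / 2 * e)
  calc ck * τ ^ (-(a : ℝ) / 2) * (W₁ ^ (1 - e) * (W ^ e * A))
      ≤ ck * τ ^ (-(a : ℝ) / 2) * (((cr + 1) * τ ^ (-(b : ℝ) / 2 * (1 - e))) *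
        (((cs + 1) * τ ^ (-((b + 1 : ℕ) : ℝ) / 2 * e)) * A)) := by gcongr
    _ = ck * ((cr + 1) * (cs + 1)) * (τ ^ (-(a : ℝ) / 2) * τ ^ (-(b : ℝ) / 2 * (1 - e)) *
        τ ^ (-((b + 1 : ℕ) : ℝ) / 2 * e)) * A := by ring
    _ = _ := by
        rw [← Real.rpow_add hτ.1, ← Real.rpow_add hτ.1]
        congr 3
        push_cast
        ring

/-- The operator of order `a + b` is bounded in `L^∞(L^p)`, `p < ∞`. -/
theorem eLpNorm_op_le {z₀ z₁ T : ℝ} {a b : ℕ} {d : ℝ} {k : ℝ → Plane → ℝ} {m : ℝ → ℝ → ℝ → ℝ}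
    (hk : HKernel a d k) (hd : 2 < d) (hm : VKernel z₀ z₁ T b m) :
    ∃ c : ℝ, 0 ≤ c ∧ ∀ τ ∈ Ioc 0 T, ∀ p : ℝ≥0∞, 1 ≤ p → p ≠ ⊤ → ∀ (f : Dom → E) (A : ℝ), 0 ≤ A →
      AEStronglyMeasurable f (layer z₀ z₁) → mixedNorm z₀ z₁ p f ≤ ENNReal.ofReal A → ∀ x,
      eLpNorm (fun z => Op z₀ z₁ (k τ) (m τ) f (x, z)) p (volume.restrict (Ioo z₀ z₁)) ≤
        ENNReal.ofReal (c * τ ^ (-((a + b : ℕ) : ℝ) / 2) * A) := by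
  obtain ⟨ck, hck0, hck⟩ := hk.integral_le hd
  obtain ⟨cl, hcl0, hcl⟩ := hm.int_left
  obtain ⟨cr, hcr0, hcr⟩ := hm.int_right
  set cv := max cl cr with hcv
  refine ⟨ck * cv, by positivity, fun τ hτ p hp hpt f A hA hf hfA x => ?_⟩
  have hp0 : p ≠ 0 := (zero_lt_one.trans_le hp).ne'
  set r := p.toReal with hr
  have hr1 : 1 ≤ r := by
    rw [hr, ← ENNReal.toReal_one]; exact ENNReal.toReal_mono hpt hp
  have hr0 : 0 < r := by linarith
  have hsq := Real.sqrt_pos.2 hτ.1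
  have hkm := (hk.continuous hτ.1).measurable
  have hmm := (hm.continuous hτ.1).measurable
  set Kc : ℝ≥0∞ := ENNReal.ofReal (ck * (Real.sqrt τ ^ a)⁻¹) with hKc
  set Vc : ℝ≥0∞ := ENNReal.ofReal (cv * (Real.sqrt τ ^ b)⁻¹) with hVc
  have hki : ∫⁻ y, ‖k τ y‖ₑ ≤ Kc := by
    rw [← ofReal_integral_norm_eq_lintegral_enorm (hck τ hτ.1).1]
    exact ENNReal.ofReal_le_ofReal (hck τ hτ.1).2
  have hvl : ∀ ζ, ∫⁻ z in Ioo z₀ z₁, ‖m τ z ζ‖ₑ ≤ Vc := fun ζ =>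
    (hcl τ hτ ζ).trans (ENNReal.ofReal_le_ofReal (by gcongr; exact le_max_left _ _))
  have hvr : ∀ z, ∫⁻ ζ in Ioo z₀ z₁, ‖m τ z ζ‖ₑ ≤ Vc := fun z =>
    (hcr τ hτ z).trans (ENNReal.ofReal_le_ofReal (by gcongr; exact le_max_right _ _))
  have hB : ∀ᵐ y : Plane, ∫⁻ ζ in Ioo z₀ z₁, ‖f (y, ζ)‖ₑ ^ r ≤ ENNReal.ofReal A ^ r := by
    filter_upwards [mixedNorm_le_iff.1 hfA] with y hy
    rw [eLpNorm_eq_lintegral_rpow_enorm_toReal hp0 hpt, ← hr] at hy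
    have := ENNReal.rpow_le_rpow hy hr0.le
    rwa [← ENNReal.rpow_mul, one_div_mul_cancel hr0.ne', ENNReal.rpow_one] at this
  -- pointwise estimate
  have hpt1 : ∀ z, ‖Op z₀ z₁ (k τ) (m τ) f (x, z)‖ₑ ^ r ≤ (Kc * Vc) ^ (r - 1) *
      ∫⁻ p, (‖k τ (x - p.1)‖ₑ * ‖m τ z p.2‖ₑ) * ‖f p‖ₑ ^ r ∂(layer z₀ z₁) := by
    intro z
    have hmz : Measurable (m τ z) := (hm.continuous_right hτ.1 z).measurable
    have hw : Measurable fun p : Dom => ‖k τ (x - p.1)‖ₑ * ‖m τ z p.2‖ₑ :=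
      (hkm.comp (by fun_prop)).enorm.mul (hmz.comp measurable_snd).enorm
    have hJ := jensen_weight hw.aemeasurable hf.enorm hr1
    have hW : ∫⁻ p, ‖k τ (x - p.1)‖ₑ * ‖m τ z p.2‖ₑ ∂(layer z₀ z₁) ≤ Kc * Vc := by
      have := lintegral_layer_le (z₀ := z₀) (z₁ := z₁) (h := fun y => ‖k τ (x - y)‖ₑ)
        (hkm.comp (by fun_prop)).enorm (G := fun p => ‖m τ z p.2‖ₑ)
        (hmz.comp measurable_snd).enorm.aemeasurable (Eventually.of_forall fun y => hvr z)
      rw [lintegral_sub_left_eq_self (fun y => ‖k τ y‖ₑ) x] at this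
      exact this.trans (mul_le_mul_left hki _)
    refine (ENNReal.rpow_le_rpow ?_ hr0.le).trans (hJ.trans (mul_le_mul_left
      (ENNReal.rpow_le_rpow hW (by linarith)) _))
    refine (enorm_integral_le_lintegral_enorm _).trans (le_of_eq ?_)
    simp_rw [enorm_smul, enorm_mul]
  -- integration in `z`
  have hint : ∫⁻ z in Ioo z₀ z₁, ‖Op z₀ z₁ (k τ) (m τ) f (x, z)‖ₑ ^ r ≤
      (Kc * Vc * ENNReal.ofReal A) ^ r := by
    have hmeas : AEMeasurable (Function.uncurry fun (z : ℝ) (p : Dom) =>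
        (‖k τ (x - p.1)‖ₑ * ‖m τ z p.2‖ₑ) * ‖f p‖ₑ ^ r)
        ((volume.restrict (Ioo z₀ z₁)).prod (layer z₀ z₁)) := by
      have h1 : Measurable fun P : ℝ × Dom => ‖k τ (x - P.2.1)‖ₑ * ‖m τ P.1 P.2.2‖ₑ :=
        (hkm.comp (by fun_prop)).enorm.mul (hmm.comp
          (by fun_prop : Measurable fun P : ℝ × Dom => (P.1, P.2.2))).enorm
      exact h1.aemeasurable.mul ((hf.enorm.pow_const r).comp_snd)
    calc _ ≤ ∫⁻ z in Ioo z₀ z₁, ((Kc * Vc) ^ (r - 1) *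
          ∫⁻ P, (‖k τ (x - P.1)‖ₑ * ‖m τ z P.2‖ₑ) * ‖f P‖ₑ ^ r ∂(layer z₀ z₁)) :=
          lintegral_mono fun z => hpt1 z
      _ = (Kc * Vc) ^ (r - 1) * ∫⁻ P, (∫⁻ z in Ioo z₀ z₁,
          (‖k τ (x - P.1)‖ₑ * ‖m τ z P.2‖ₑ) * ‖f P‖ₑ ^ r) ∂(layer z₀ z₁) := by
          rw [lintegral_const_mul' _ _ (ENNReal.rpow_ne_top_of_nonneg (by linarith)
            (ENNReal.mul_ne_top ENNReal.ofReal_ne_top ENNReal.ofReal_ne_top)),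
            lintegral_lintegral_swap hmeas]
      _ ≤ (Kc * Vc) ^ (r - 1) * ∫⁻ P, ‖k τ (x - P.1)‖ₑ * (Vc * ‖f P‖ₑ ^ r) ∂(layer z₀ z₁) := by
          refine mul_le_mul_right (lintegral_mono fun P => ?_) _
          have e : ∀ z, (‖k τ (x - P.1)‖ₑ * ‖m τ z P.2‖ₑ) * ‖f P‖ₑ ^ r =
              (‖k τ (x - P.1)‖ₑ * ‖f P‖ₑ ^ r) * ‖m τ z P.2‖ₑ := fun z => by ring
          simp_rw [e]
          have hmz : Measurable fun z => ‖m τ z P.2‖ₑ :=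
            (hmm.comp (by fun_prop : Measurable fun z : ℝ => (z, P.2))).enorm
          rw [lintegral_const_mul _ hmz]
          calc _ ≤ (‖k τ (x - P.1)‖ₑ * ‖f P‖ₑ ^ r) * Vc := by gcongr; exact hvl _
            _ = _ := by ring
      _ ≤ (Kc * Vc) ^ (r - 1) * (Kc * (Vc * ENNReal.ofReal A ^ r)) := by
          refine mul_le_mul_right ?_ _
          have := lintegral_layer_le (z₀ := z₀) (z₁ := z₁) (h := fun y => ‖k τ (x - y)‖ₑ)
            (hkm.comp (by fun_prop)).enorm (G := fun P => Vc * ‖f P‖ₑ ^ r)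
            ((hf.enorm.pow_const r).const_mul _) (C := Vc * ENNReal.ofReal A ^ r) (by
              filter_upwards [hB] with y hy
              rw [lintegral_const_mul' _ _ ENNReal.ofReal_ne_top]
              gcongr)
          rw [lintegral_sub_left_eq_self (fun y => ‖k τ y‖ₑ) x] at this
          exact this.trans (mul_le_mul_left hki _)
      _ = _ := by
          rw [ENNReal.mul_rpow_of_nonneg _ _ hr0.le]
          have h1 : (Kc * Vc) ^ r = (Kc * Vc) ^ (r - 1) * (Kc * Vc) := by
            conv_lhs => rw [show r = (r - 1) + 1 by ring]
            rw [ENNReal.rpow_add_of_nonneg _ _ (by linarith) zero_le_one, ENNReal.rpow_one]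
          rw [h1]
          ring
  rw [eLpNorm_eq_lintegral_rpow_enorm_toReal hp0 hpt, ← hr]
  refine (ENNReal.rpow_le_rpow hint (by positivity)).trans (le_of_eq ?_)
  rw [← ENNReal.rpow_mul, mul_one_div_cancel hr0.ne', ENNReal.rpow_one, hKc, hVc,
    ← ENNReal.ofReal_mul (by positivity), ← ENNReal.ofReal_mul (by positivity),
    inv_sqrt_pow hτ.1, inv_sqrt_pow hτ.1]
  congr 1
  have : -((a + b : ℕ) : ℝ) / 2 = -(a : ℝ) / 2 + -(b : ℝ) / 2 := by push_cast; ring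
  rw [this, Real.rpow_add hτ.1]
  ring

end Operators

/-! ### Derivatives and moduli of continuity of the product operators -/

section Operators

variable {E : Type*} [NormedAddCommGroup E]

theorem eLpNorm_weight_le {z₀ z₁ : ℝ} {w : ℝ → ℝ} {W : ℝ} (hW : ∀ ζ ∈ Ioo z₀ z₁, |w ζ| ≤ W)
    (φ : ℝ → E) :
    ∫⁻ ζ in Ioo z₀ z₁, ‖w ζ‖ₑ * ‖φ ζ‖ₑ ≤
      ENNReal.ofReal W * eLpNorm φ 1 (volume.restrict (Ioo z₀ z₁)) := by
  rw [eLpNorm_one_eq_lintegral_enorm, ← lintegral_const_mul' _ _ ENNReal.ofReal_ne_top]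
  refine setLIntegral_mono' measurableSet_Ioo fun ζ hζ => ?_
  rw [Real.enorm_eq_ofReal_abs]
  gcongr
  exact hW ζ hζ

variable [NormedSpace ℝ E]

/-- Differentiation under the integral: `HKernel.dominated` majorizes the differentiated kernel
under all translations of length at most one. -/
theorem hasLineDerivAt_op_horizontal {z₀ z₁ T : ℝ} {a a' b : ℕ} {d d' : ℝ}
    {k k' : ℝ → Plane → ℝ} {m : ℝ → ℝ → ℝ → ℝ} (hk : HKernel a d k) (hd : 2 < d)
    (hk' : HKernel a' d' k') (hd' : 2 < d') (hm : VKernel z₀ z₁ T b m) {l : Fin 2} {τ : ℝ}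
    (hτ : τ ∈ Ioc 0 T) (hkk : ∀ x, HasLineDerivAt ℝ (k τ) (k' τ x) x (unit l)) {f : Dom → E}
    (hf : MemLInf z₀ z₁ 1 f) (q : Dom) :
    HasLineDerivAt ℝ (Op z₀ z₁ (k τ) (m τ) f) (Op z₀ z₁ (k' τ) (m τ) f q) q
      ((unit l, 0) : Dom) := by
  obtain ⟨cs, hcs0, hcs⟩ := hm.sup
  obtain ⟨C, hC0, hC⟩ := hk'.dominated hd' (δ := τ) (T := τ) hτ.1
  set cm := cs * (Real.sqrt τ ^ (b + 1))⁻¹ with hcm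
  have hmm : ∀ z, Measurable (m τ z) := fun z => (hm.continuous_right hτ.1 z).measurable
  have hki := (hk.integral_le hd).choose_spec.2 τ hτ.1 |>.1
  have hki' := (hk'.integral_le hd').choose_spec.2 τ hτ.1 |>.1
  have hi : ∀ x z, Integrable (fun p : Dom => (k τ (x - p.1) * m τ z p.2) • f p) (layer z₀ z₁) :=
    fun x z => integrable_op hki (hmm z) (fun ζ => hcs τ hτ z ζ) hf x
  have hi' : ∀ x z, Integrable (fun p : Dom => (k' τ (x - p.1) * m τ z p.2) • f p) (layer z₀ z₁) :=
    fun x z => integrable_op hki' (hmm z) (fun ζ => hcs τ hτ z ζ) hf x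
  have hb : Integrable (fun p : Dom => ‖(C * (1 + ‖q.1 - p.1‖) ^ (-d') * cm) • f p‖)
      (layer z₀ z₁) :=
    (integrable_mul_of_memLInf ((((integrable_decay hd').comp_sub_left q.1).const_mul
      C).mul_const cm) hf).norm
  unfold HasLineDerivAt
  have := hasDerivAt_integral_of_dominated_loc_of_deriv_le (μ := layer z₀ z₁)
    (F := fun (h : ℝ) p => (k τ (q.1 + h • unit l - p.1) * m τ q.2 p.2) • f p)
    (F' := fun (h : ℝ) p => (k' τ (q.1 + h • unit l - p.1) * m τ q.2 p.2) • f p)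
    (x₀ := (0 : ℝ)) (s := Metric.ball 0 1) (Metric.ball_mem_nhds _ one_pos)
    (Eventually.of_forall fun h => (hi _ _).1) (hi _ _) (hi' _ _).1
    (bound := fun p => ‖(C * (1 + ‖q.1 - p.1‖) ^ (-d') * cm) • f p‖) ?_ hb ?_
  · simpa [Op] using this.2
  · refine Eventually.of_forall fun p h hh => ?_
    rw [norm_smul, norm_smul, norm_mul]
    refine mul_le_mul_of_nonneg_right ?_ (norm_nonneg _)
    refine le_trans ?_ (le_abs_self _)
    have h1 := hC τ ⟨le_rfl, le_rfl⟩ (q.1 - p.1) (h • unit l) (by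
      rw [norm_smul, norm_unit, mul_one]
      rw [Metric.mem_ball, dist_zero_right] at hh
      exact hh.le)
    have h2 : q.1 + h • unit l - p.1 = q.1 - p.1 + h • unit l := by abel
    rw [h2]
    exact mul_le_mul h1 (hcs τ hτ q.2 p.2) (norm_nonneg _) ((abs_nonneg _).trans h1)
  · refine Eventually.of_forall fun p h _ => ?_
    have h1 := hasLineDerivAt_add hkk (q.1 - p.1) h
    have h2 : ∀ h : ℝ, q.1 + h • unit l - p.1 = q.1 - p.1 + h • unit l := fun h => by abel
    simp only [h2]
    exact (h1.mul_const _).smul_const _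

theorem hasLineDerivAt_op_vertical {z₀ z₁ T : ℝ} {a b b' : ℕ} {d : ℝ}
    {k : ℝ → Plane → ℝ} {m m' : ℝ → ℝ → ℝ → ℝ} (hk : HKernel a d k) (hd : 2 < d)
    (hm : VKernel z₀ z₁ T b m) (hm' : VKernel z₀ z₁ T b' m') {τ : ℝ} (hτ : τ ∈ Ioc 0 T)
    (hmm' : ∀ z ζ, HasDerivAt (fun z => m τ z ζ) (m' τ z ζ) z) {f : Dom → E}
    (hf : MemLInf z₀ z₁ 1 f) (q : Dom) :
    HasLineDerivAt ℝ (Op z₀ z₁ (k τ) (m τ) f) (Op z₀ z₁ (k τ) (m' τ) f q) q ((0, 1) : Dom) := by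
  obtain ⟨cs, hcs0, hcs⟩ := hm.sup
  obtain ⟨cs', hcs0', hcs'⟩ := hm'.sup
  have hmm : ∀ z, Measurable (m τ z) := fun z => (hm.continuous_right hτ.1 z).measurable
  have hmm2 : ∀ z, Measurable (m' τ z) := fun z => (hm'.continuous_right hτ.1 z).measurable
  have hki := (hk.integral_le hd).choose_spec.2 τ hτ.1 |>.1
  have hi : ∀ x z, Integrable (fun p : Dom => (k τ (x - p.1) * m τ z p.2) • f p) (layer z₀ z₁) :=
    fun x z => integrable_op hki (hmm z) (fun ζ => hcs τ hτ z ζ) hf x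
  have hi' : ∀ x z, Integrable (fun p : Dom => (k τ (x - p.1) * m' τ z p.2) • f p) (layer z₀ z₁) :=
    fun x z => integrable_op hki (hmm2 z) (fun ζ => hcs' τ hτ z ζ) hf x
  set cm := cs' * (Real.sqrt τ ^ (b' + 1))⁻¹ with hcm
  have hb : Integrable (fun p : Dom => ‖(k τ (q.1 - p.1) * cm) • f p‖) (layer z₀ z₁) :=
    (integrable_mul_of_memLInf ((hki.comp_sub_left q.1).mul_const cm) hf).norm
  unfold HasLineDerivAt
  have := hasDerivAt_integral_of_dominated_loc_of_deriv_le (μ := layer z₀ z₁)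
    (F := fun (h : ℝ) p => (k τ (q.1 - p.1) * m τ (q.2 + h) p.2) • f p)
    (F' := fun (h : ℝ) p => (k τ (q.1 - p.1) * m' τ (q.2 + h) p.2) • f p)
    (x₀ := (0 : ℝ)) (s := univ) univ_mem
    (Eventually.of_forall fun h => (hi _ _).1) (hi _ _) (hi' _ _).1
    (bound := fun p => ‖(k τ (q.1 - p.1) * cm) • f p‖) ?_ hb ?_
  · simpa [Op] using this.2
  · refine Eventually.of_forall fun p h _ => ?_
    rw [norm_smul, norm_smul, norm_mul, norm_mul]
    gcongr
    exact (hcs' τ hτ _ p.2).trans (le_abs_self _)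
  · refine Eventually.of_forall fun p h _ => ?_
    have h1 : HasDerivAt (fun h => m τ (q.2 + h) p.2) (m' τ (q.2 + h) p.2) h :=
      (hmm' (q.2 + h) p.2).comp_const_add q.2 h
    exact (h1.const_mul _).smul_const _

/-- The operators depend uniformly continuously on the time and on the point of evaluation. -/
theorem op_modulus {z₀ z₁ T : ℝ} {a b : ℕ} {d : ℝ} {k : ℝ → Plane → ℝ} {m : ℝ → ℝ → ℝ → ℝ}
    (hk : HKernel a d k) (hd : 2 < d) (hm : VKernel z₀ z₁ T b m) {δ ε : ℝ} (hδ : 0 < δ)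
    (hε : 0 < ε) :
    ∃ η > 0, ∀ τ ∈ Icc δ T, ∀ τ' ∈ Icc δ T, ∀ q q' : Dom, q.2 ∈ Ioo z₀ z₁ → q'.2 ∈ Ioo z₀ z₁ →
      |τ - τ'| < η → dist q q' < η → ∀ (f : Dom → E) (A : ℝ),
      0 ≤ A → AEStronglyMeasurable f (layer z₀ z₁) →
      mixedNorm z₀ z₁ 1 f ≤ ENNReal.ofReal A →
      ‖Op z₀ z₁ (k τ) (m τ) f q - Op z₀ z₁ (k τ') (m τ') f q'‖ ≤ ε * A := by
  obtain ⟨cs, hcs0, hcs⟩ := hm.sup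
  obtain ⟨ck, hck0, hck⟩ := hk.integral_le hd
  set M := cs * (Real.sqrt δ ^ (b + 1))⁻¹ with hM
  set N := ck * (Real.sqrt δ ^ a)⁻¹ with hN
  have hsδ := Real.sqrt_pos.2 hδ
  obtain ⟨η₁, hη₁, h₁⟩ := hk.modulus hd (T := T) hδ (ε := ε / (2 * (M + 1))) (by positivity)
  obtain ⟨η₂, hη₂, h₂⟩ := hm.modulus (T' := T) hδ (ε := ε / (2 * (N + 1))) (by positivity)
  refine ⟨min η₁ η₂, lt_min hη₁ hη₂, fun τ hτ τ' hτ' q q' hq hq' hττ hqq f A hA hfm hfA => ?_⟩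
  have hτ0 := hδ.trans_le hτ.1
  have hτ0' := hδ.trans_le hτ'.1
  have hf : MemLInf z₀ z₁ 1 f := ⟨hfm, hfA.trans_lt ENNReal.ofReal_lt_top⟩
  have hd1 : ‖q.1 - q'.1‖ < η₁ := by
    rw [← dist_eq_norm]
    exact (le_max_left _ _).trans_lt (hqq.trans_le (min_le_left _ _))
  have hd2 : |q.2 - q'.2| < η₂ := by
    rw [← Real.dist_eq]
    exact (le_max_right _ _).trans_lt (hqq.trans_le (min_le_right _ _))
  have hmc : ∀ τ, 0 < τ → ∀ z, Continuous (m τ z) := fun τ h z => hm.continuous_right h z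
  have hkc := hk.continuous hτ0
  have hkc' := hk.continuous hτ0'
  set K₁ : Plane → ℝ := fun y => k τ (y + (q.1 - q'.1)) - k τ' y with hK₁
  set m₁ : ℝ → ℝ → ℝ := fun z ζ => m τ z ζ - m τ' q'.2 ζ with hm₁
  have hK₁c : Continuous K₁ := by fun_prop
  have i1 : Integrable (fun p : Dom => (k τ (q.1 - p.1) * m τ q.2 p.2) • f p) (layer z₀ z₁) :=
    integrable_op (hck τ hτ0).1 (hmc τ hτ0 _).measurable
      (fun ζ => hcs τ ⟨hτ0, hτ.2⟩ q.2 ζ) hf q.1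
  have i2 : Integrable (fun p : Dom => (k τ' (q'.1 - p.1) * m τ q.2 p.2) • f p) (layer z₀ z₁) :=
    integrable_op (hck τ' hτ0').1 (hmc τ hτ0 _).measurable
      (fun ζ => hcs τ ⟨hτ0, hτ.2⟩ q.2 ζ) hf q'.1
  have i3 : Integrable (fun p : Dom => (k τ' (q'.1 - p.1) * m τ' q'.2 p.2) • f p) (layer z₀ z₁) :=
    integrable_op (hck τ' hτ0').1 (hmc τ' hτ0' _).measurable
      (fun ζ => hcs τ' ⟨hτ0', hτ'.2⟩ q'.2 ζ) hf q'.1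
  -- The horizontal kernel is changed first; the change is small in `L¹` and the vertical kernel is
  -- bounded. Then the vertical kernel is changed, with a small supremum. Only the `L^∞(L¹)` norm of
  -- `f` is used, which makes the modulus uniform in `f`.
  have e : Op z₀ z₁ (k τ) (m τ) f q - Op z₀ z₁ (k τ') (m τ') f q' =
      Op z₀ z₁ K₁ (m τ) f (q'.1, q.2) + Op z₀ z₁ (k τ') m₁ f (q'.1, q.2) := by
    unfold Op
    have e1 : ∀ p : Dom, (K₁ (q'.1 - p.1) * m τ q.2 p.2) • f p =
        (k τ (q.1 - p.1) * m τ q.2 p.2) • f p - (k τ' (q'.1 - p.1) * m τ q.2 p.2) • f p := by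
      intro p
      have : q'.1 - p.1 + (q.1 - q'.1) = q.1 - p.1 := by abel
      rw [hK₁]
      simp only [this]
      rw [← sub_smul]
      ring_nf
    have e2 : ∀ p : Dom, (k τ' (q'.1 - p.1) * m₁ q.2 p.2) • f p =
        (k τ' (q'.1 - p.1) * m τ q.2 p.2) • f p - (k τ' (q'.1 - p.1) * m τ' q'.2 p.2) • f p := by
      intro p
      rw [hm₁, ← sub_smul]
      ring_nf
    simp only [e1, e2]
    rw [integral_sub i1 i2, integral_sub i2 i3]
    abel
  rw [e]
  have hfA' := mixedNorm_le_iff.1 hfA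
  have hsup : ∀ ζ, |m τ q.2 ζ| ≤ M := fun ζ => (hcs τ ⟨hτ0, hτ.2⟩ q.2 ζ).trans (by
    rw [hM]
    have := Real.sqrt_le_sqrt hτ.1
    gcongr)
  have b1 : ‖Op z₀ z₁ K₁ (m τ) f (q'.1, q.2)‖ ≤ ε / (2 * (M + 1)) * (M * A) := by
    have := enorm_op_le (q := (q'.1, q.2)) hK₁c.measurable (hmc τ hτ0 q.2).measurable hfm
      (C := ENNReal.ofReal (M * A)) (by
        filter_upwards [hfA'] with y hy
        refine (eLpNorm_weight_le (fun ζ _ => hsup ζ) _).trans ?_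
        rw [ENNReal.ofReal_mul (p := M) (by positivity)]
        exact mul_le_mul' le_rfl hy)
    have hK₁i : Integrable K₁ := ((hck τ hτ0).1.comp_add_right _).sub (hck τ' hτ0').1
    have hKi : ∫⁻ y, ‖K₁ y‖ₑ ≤ ENNReal.ofReal (ε / (2 * (M + 1))) := by
      rw [← ofReal_integral_norm_eq_lintegral_enorm hK₁i]
      exact ENNReal.ofReal_le_ofReal (h₁ τ hτ τ' hτ' _ (hττ.trans_le (min_le_left _ _)) hd1)
    have h3 := this.trans (mul_le_mul_left hKi _)
    rwa [← ENNReal.ofReal_mul (by positivity), ← ofReal_norm,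
      ENNReal.ofReal_le_ofReal_iff (by positivity)] at h3
  have b2 : ‖Op z₀ z₁ (k τ') m₁ f (q'.1, q.2)‖ ≤ N * (ε / (2 * (N + 1)) * A) := by
    have := enorm_op_le (k := k τ') (m := m₁) (q := (q'.1, q.2)) hkc'.measurable
      (((hmc τ hτ0 q.2).sub (hmc τ' hτ0' q'.2)).measurable) hfm
      (C := ENNReal.ofReal (ε / (2 * (N + 1)) * A)) (by
        filter_upwards [hfA'] with y hy
        refine (eLpNorm_weight_le (W := ε / (2 * (N + 1))) (fun ζ hζ => h₂ τ hτ τ' hτ' q.2 hq q'.2 hq' ζ hζ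
          (hττ.trans_le (min_le_right _ _)) hd2) _).trans ?_
        rw [ENNReal.ofReal_mul (by positivity)]
        gcongr)
    have hKi : ∫⁻ y, ‖k τ' y‖ₑ ≤ ENNReal.ofReal N := by
      rw [← ofReal_integral_norm_eq_lintegral_enorm (hck τ' hτ0').1]
      refine ENNReal.ofReal_le_ofReal ((hck τ' hτ0').2.trans ?_)
      rw [hN]
      have := Real.sqrt_le_sqrt hτ'.1
      gcongr
    have h3 := this.trans (mul_le_mul_left hKi _)
    rwa [← ENNReal.ofReal_mul (by positivity), ← ofReal_norm,
      ENNReal.ofReal_le_ofReal_iff (by positivity)] at h3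
  have c1 : ε / (2 * (M + 1)) * (M * A) ≤ ε / 2 * A := by
    have hM0 : 0 ≤ M := by positivity
    rw [← mul_assoc]
    refine mul_le_mul_of_nonneg_right ?_ hA
    rw [div_mul_eq_mul_div, div_le_div_iff₀ (by positivity) (by positivity)]
    nlinarith
  have c2 : N * (ε / (2 * (N + 1)) * A) ≤ ε / 2 * A := by
    have hN0 : 0 ≤ N := by positivity
    rw [← mul_assoc]
    refine mul_le_mul_of_nonneg_right ?_ hA
    rw [mul_div_assoc', div_le_div_iff₀ (by positivity) (by positivity)]
    nlinarith
  linarith [norm_add_le (Op z₀ z₁ K₁ (m τ) f (q'.1, q.2)) (Op z₀ z₁ (k τ') m₁ f (q'.1, q.2))]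

theorem continuous_op {z₀ z₁ T : ℝ} {a b : ℕ} {d : ℝ} {k : ℝ → Plane → ℝ} {m : ℝ → ℝ → ℝ → ℝ}
    (hk : HKernel a d k) (hd : 2 < d) (hm : VKernel z₀ z₁ T b m) {τ : ℝ} (hτ : τ ∈ Ioc 0 T)
    {f : Dom → E} (hf : MemLInf z₀ z₁ 1 f) : Continuous (Op z₀ z₁ (k τ) (m τ) f) := by
  obtain ⟨cs, hcs0, hcs⟩ := hm.sup
  obtain ⟨C, hC0, hC⟩ := hk.dominated hd (δ := τ) (T := τ) hτ.1
  set cm := cs * (Real.sqrt τ ^ (b + 1))⁻¹ with hcm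
  have hki := (hk.integral_le hd).choose_spec.2 τ hτ.1 |>.1
  rw [continuous_iff_continuousAt]
  intro q
  refine continuousAt_of_dominated
    (bound := fun p => ‖(C * (1 + ‖q.1 - p.1‖) ^ (-d) * cm) • f p‖) ?_ ?_ ?_ ?_
  · exact Eventually.of_forall fun q' => (integrable_op hki
      (hm.continuous_right hτ.1 q'.2).measurable (fun ζ => hcs τ hτ q'.2 ζ) hf q'.1).1
  · filter_upwards [Metric.ball_mem_nhds q one_pos] with q' hq'
    refine Eventually.of_forall fun p => ?_
    rw [norm_smul, norm_smul, norm_mul]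
    refine mul_le_mul_of_nonneg_right ?_ (norm_nonneg _)
    refine le_trans ?_ (le_abs_self _)
    have h1 := hC τ ⟨le_rfl, le_rfl⟩ (q.1 - p.1) (q'.1 - q.1) (by
      rw [← dist_eq_norm]
      exact (le_max_left _ _).trans (Metric.mem_ball.1 hq').le)
    have h2 : q.1 - p.1 + (q'.1 - q.1) = q'.1 - p.1 := by abel
    rw [h2] at h1
    exact mul_le_mul h1 (hcs τ hτ q'.2 p.2) (norm_nonneg _) ((abs_nonneg _).trans h1)
  · exact (integrable_mul_of_memLInf ((((integrable_decay hd).comp_sub_left q.1).const_mul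
      C).mul_const cm) hf).norm
  · refine Eventually.of_forall fun p => ?_
    have h1 := hk.continuous hτ.1
    have h2 := hm.continuous hτ.1
    have h3 : Continuous fun q' : Dom => (k τ (q'.1 - p.1) * m τ q'.2 p.2) • f p :=
      ((h1.comp (by fun_prop)).mul
        (h2.comp (by fun_prop : Continuous fun q' : Dom => (q'.2, p.2)))).smul continuous_const
    exact h3.continuousAt

end Operators

/-! ### The nonlinearity as a finite sum of integral operators -/

/-- The terms of `S(τ)ℙ∇·`: horizontal fluxes, the vertical flux, and the contributions of
`(-Δ_H)⁻¹`. -/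
abbrev Idx : Type := Fin 2 ⊕ Unit ⊕ (Fin 2 × Fin 2 × Fin 2)

/-- The letter N stands for the operator itself, H for its derivative in the horizontal direction
`l`, Z for its vertical derivative. The latter annihilates the terms with `(-Δ_H)⁻¹`, which do not
depend on `z`. -/
def kN : Idx → ℝ → Plane → ℝ
  | .inl j => gaussD1 j
  | .inr (.inl _) => gaussPlane
  | .inr (.inr (k, i, j)) => rieszKernel k i j

def kH (l : Fin 2) : Idx → ℝ → Plane → ℝ
  | .inl j => gaussD2 j l
  | .inr (.inl _) => gaussD1 l
  | .inr (.inr (k, i, j)) => rieszD k i j l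

def mN (z₀ z₁ : ℝ) : Idx → ℝ → ℝ → ℝ → ℝ
  | .inl _ => reflKernel z₀ z₁ 0 1 1
  | .inr (.inl _) => reflKernel z₀ z₁ 1 (-1) 1
  | .inr (.inr _) => fun _ _ _ => (z₁ - z₀)⁻¹

def mZ (z₀ z₁ : ℝ) : Idx → ℝ → ℝ → ℝ → ℝ
  | .inl _ => reflKernel z₀ z₁ 1 1 1
  | .inr (.inl _) => reflKernel z₀ z₁ 2 (-1) 1
  | .inr (.inr _) => fun _ _ _ => 0

def comp : Idx → Fin 3
  | .inl j => j.castSucc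
  | .inr (.inl _) => Fin.last 2
  | .inr (.inr (_, _, j)) => j.castSucc

section System

variable {𝕜 : Type*} [RCLike 𝕜]

/-- The sign in the vertical term comes from the integration by parts in `ζ`. In the terms with
`(-Δ_H)⁻¹`, the coordinate `i` of the flux feeds the component `k` of the result. -/
def lin : Idx → Vec 𝕜 → Vec 𝕜
  | .inl _ => fun u => u
  | .inr (.inl _) => fun u => -u
  | .inr (.inr (k, i, _)) => fun u => EuclideanSpace.single k (u i)

def singleIsometry (k : Fin 2) : 𝕜 →ₗᵢ[ℝ] Vec 𝕜 where
  toFun := EuclideanSpace.single k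
  map_add' a b := by ext i; by_cases h : i = k <;> simp [h]
  map_smul' a b := by ext i; by_cases h : i = k <;> simp [h]
  norm_map' a := by simp

theorem norm_coord_le (u : Vec 𝕜) (i : Fin 2) : ‖u i‖ ≤ ‖u‖ := PiLp.norm_apply_le u i

theorem norm_lin_le (ι : Idx) (u : Vec 𝕜) : ‖lin ι u‖ ≤ ‖u‖ := by
  rcases ι with j | _ | ⟨k, i, j⟩
  · exact le_rfl
  · simp [lin]
  · simpa [lin] using norm_coord_le u i

theorem lin_add (ι : Idx) (u v : Vec 𝕜) : lin ι (u + v) = lin ι u + lin ι v := by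
  rcases ι with j | _ | ⟨k, i, j⟩
  · rfl
  · simp [lin, add_comm]
  · exact (singleIsometry k).map_add _ _

theorem lin_neg (ι : Idx) (u : Vec 𝕜) : lin ι (-u) = -lin ι u := by
  rcases ι with j | _ | ⟨k, i, j⟩
  · rfl
  · simp [lin]
  · exact (singleIsometry k).map_neg _

theorem lin_sub (ι : Idx) (u v : Vec 𝕜) : lin ι (u - v) = lin ι u - lin ι v := by
  rw [sub_eq_add_neg, lin_add, lin_neg, ← sub_eq_add_neg]

theorem continuous_lin (ι : Idx) : Continuous (lin ι : Vec 𝕜 → Vec 𝕜) := by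
  rw [Metric.continuous_iff]
  intro b ε hε
  refine ⟨ε, hε, fun a ha => ?_⟩
  rw [dist_eq_norm, ← lin_sub]
  exact (norm_lin_le _ _).trans_lt (by rwa [dist_eq_norm] at ha)

theorem mixedNorm_mono {E E' : Type*} [NormedAddCommGroup E] [NormedAddCommGroup E'] {z₀ z₁ : ℝ}
    {p : ℝ≥0∞} {f : Dom → E} {g : Dom → E'} (h : ∀ᵐ q ∂(layer z₀ z₁), ‖f q‖ ≤ ‖g q‖) :
    mixedNorm z₀ z₁ p f ≤ mixedNorm z₀ z₁ p g := by
  rw [mixedNorm_le_iff]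
  filter_upwards [mixedNorm_le_iff.1 (le_refl (mixedNorm z₀ z₁ p g)), Measure.ae_ae_of_ae_prod h]
    with x hx hm
  exact (eLpNorm_mono_ae hm).trans hx

theorem aestronglyMeasurable_lin {z₀ z₁ : ℝ} (ι : Idx) {f : Dom → Vec 𝕜}
    (hf : AEStronglyMeasurable f (layer z₀ z₁)) :
    AEStronglyMeasurable (fun p => lin ι (f p)) (layer z₀ z₁) :=
  (continuous_lin ι).comp_aestronglyMeasurable hf

theorem mixedNorm_lin_le {z₀ z₁ : ℝ} {p : ℝ≥0∞} (ι : Idx) (f : Dom → Vec 𝕜) :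
    mixedNorm z₀ z₁ p (fun q => lin ι (f q)) ≤ mixedNorm z₀ z₁ p f :=
  mixedNorm_mono (Eventually.of_forall fun _ => norm_lin_le _ _)

theorem MemLInf.lin {z₀ z₁ : ℝ} {p : ℝ≥0∞} (ι : Idx) {f : Dom → Vec 𝕜}
    (hf : MemLInf z₀ z₁ p f) : MemLInf z₀ z₁ p (fun q => Primitive.lin ι (f q)) :=
  ⟨aestronglyMeasurable_lin ι hf.1, (mixedNorm_lin_le ι f).trans_lt hf.2⟩

/-- The sum of the integral operators with the kernels `k ι`, `m ι`, applied to the components of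
a flux. -/
def Nop (z₀ z₁ : ℝ) (k : Idx → ℝ → Plane → ℝ) (m : Idx → ℝ → ℝ → ℝ → ℝ) (τ : ℝ)
    (F : Fin 3 → Dom → Vec 𝕜) (q : Dom) : Vec 𝕜 :=
  ∑ ι, Op z₀ z₁ (k ι τ) (m ι τ) (fun p => lin ι (F (comp ι) p)) q

/-- A system of kernels of order `n`. -/
def IsSystem (z₀ z₁ T : ℝ) (n : ℕ) (k : Idx → ℝ → Plane → ℝ) (m : Idx → ℝ → ℝ → ℝ → ℝ) : Prop :=
  ∀ ι, ∃ (a b : ℕ) (d : ℝ), a + b = n ∧ 2 < d ∧ HKernel a d (k ι) ∧ VKernel z₀ z₁ T b (m ι)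

theorem isSystem_N {z₀ z₁ T : ℝ} (hz : z₀ < z₁) (hT : 0 < T) :
    IsSystem z₀ z₁ T 1 kN (mN z₀ z₁) := by
  rintro (j | _ | ⟨k, i, j⟩)
  · exact ⟨1, 0, 3, rfl, by norm_num, hKernel_gaussD1 j,
      vKernel_reflKernel hz hT 0 (by simp) (by simp)⟩
  · exact ⟨0, 1, 3, rfl, by norm_num, hKernel_gaussPlane,
      vKernel_reflKernel hz hT 1 (by simp) (by simp)⟩
  · exact ⟨1, 0, _, rfl, by norm_num, hKernel_rieszKernel k i j, vKernel_const hz⟩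

theorem isSystem_H {z₀ z₁ T : ℝ} (hz : z₀ < z₁) (hT : 0 < T) (l : Fin 2) :
    IsSystem z₀ z₁ T 2 (kH l) (mN z₀ z₁) := by
  rintro (j | _ | ⟨k, i, j⟩)
  · exact ⟨2, 0, 3, rfl, by norm_num, hKernel_gaussD2 j l,
      vKernel_reflKernel hz hT 0 (by simp) (by simp)⟩
  · exact ⟨1, 1, 3, rfl, by norm_num, hKernel_gaussD1 l,
      vKernel_reflKernel hz hT 1 (by simp) (by simp)⟩
  · exact ⟨2, 0, _, rfl, by norm_num, hKernel_rieszD k i j l, vKernel_const hz⟩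

theorem isSystem_Z {z₀ z₁ T : ℝ} (hz : z₀ < z₁) (hT : 0 < T) :
    IsSystem z₀ z₁ T 2 kN (mZ z₀ z₁) := by
  rintro (j | _ | ⟨k, i, j⟩)
  · exact ⟨1, 1, 3, rfl, by norm_num, hKernel_gaussD1 j,
      vKernel_reflKernel hz hT 1 (by simp) (by simp)⟩
  · exact ⟨0, 2, 3, rfl, by norm_num, hKernel_gaussPlane,
      vKernel_reflKernel hz hT 2 (by simp) (by simp)⟩
  -- The zero kernel has every order; order one makes the total order two.
  · exact ⟨1, 1, _, rfl, by norm_num, hKernel_rieszKernel k i j, vKernel_zero z₀ z₁ T 1⟩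

/-! ### Bounds and moduli of continuity for systems of kernels -/

section Bounds

variable {z₀ z₁ T : ℝ} {n : ℕ} {k : Idx → ℝ → Plane → ℝ} {m : Idx → ℝ → ℝ → ℝ → ℝ}

theorem Nop_congr {F G : Fin 3 → Dom → Vec 𝕜} {τ : ℝ} (h : ∀ i, F i =ᵐ[layer z₀ z₁] G i) :
    Nop z₀ z₁ k m τ F = Nop z₀ z₁ k m τ G := by
  funext q
  refine Finset.sum_congr rfl fun ι _ => ?_
  rw [Op_congr]
  exact (h (comp ι)).mono fun p hp => by simp only [hp]

theorem norm_Nop_le (hs : IsSystem z₀ z₁ T n k m) :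
    ∃ c : ℝ, 0 ≤ c ∧ ∀ τ ∈ Ioc 0 T, ∀ p : ℝ≥0∞, 1 ≤ p → ∀ (F : Fin 3 → Dom → Vec 𝕜) (A : ℝ),
      0 ≤ A → (∀ i, AEStronglyMeasurable (F i) (layer z₀ z₁)) →
      (∀ i, mixedNorm z₀ z₁ p (F i) ≤ ENNReal.ofReal A) → ∀ q,
      ‖Nop z₀ z₁ k m τ F q‖ ≤ c * τ ^ (-(n : ℝ) / 2 - p⁻¹.toReal / 2) * A := by
  have : ∀ ι, ∃ c : ℝ, 0 ≤ c ∧ ∀ τ ∈ Ioc 0 T, ∀ p : ℝ≥0∞, 1 ≤ p → ∀ (f : Dom → Vec 𝕜) (A : ℝ),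
      0 ≤ A → AEStronglyMeasurable f (layer z₀ z₁) → mixedNorm z₀ z₁ p f ≤ ENNReal.ofReal A → ∀ q,
      ‖Op z₀ z₁ (k ι τ) (m ι τ) f q‖ ≤ c * τ ^ (-(n : ℝ) / 2 - p⁻¹.toReal / 2) * A := by
    intro ι
    obtain ⟨a, b, d, rfl, hd, hk, hm⟩ := hs ι
    exact norm_op_le hk hd hm
  choose c hc0 hc using this
  refine ⟨∑ ι, c ι, Finset.sum_nonneg fun ι _ => hc0 ι, fun τ hτ p hp F A hA hF hFA q => ?_⟩
  rw [Finset.sum_mul, Finset.sum_mul]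
  exact (norm_sum_le _ _).trans (Finset.sum_le_sum fun ι _ => hc ι τ hτ p hp _ A hA
    (aestronglyMeasurable_lin ι (hF _)) ((mixedNorm_lin_le ι _).trans (hFA _)) q)

theorem continuous_Nop (hs : IsSystem z₀ z₁ T n k m) {τ : ℝ} (hτ : τ ∈ Ioc 0 T)
    {F : Fin 3 → Dom → Vec 𝕜} (hF : ∀ i, MemLInf z₀ z₁ 1 (F i)) :
    Continuous (Nop z₀ z₁ k m τ F) := by
  refine continuous_finsetSum _ fun ι _ => ?_
  obtain ⟨a, b, d, rfl, hd, hk, hm⟩ := hs ι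
  exact continuous_op hk hd hm hτ ((hF _).lin ι)

theorem eLpNorm_Nop_le (hs : IsSystem z₀ z₁ T n k m) :
    ∃ c : ℝ, 0 ≤ c ∧ ∀ τ ∈ Ioc 0 T, ∀ p : ℝ≥0∞, 1 ≤ p → p ≠ ⊤ → ∀ (F : Fin 3 → Dom → Vec 𝕜)
      (A : ℝ), 0 ≤ A → (∀ i, MemLInf z₀ z₁ 1 (F i)) →
      (∀ i, mixedNorm z₀ z₁ p (F i) ≤ ENNReal.ofReal A) → ∀ x,
      eLpNorm (fun z => Nop z₀ z₁ k m τ F (x, z)) p (volume.restrict (Ioo z₀ z₁)) ≤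
        ENNReal.ofReal (c * τ ^ (-(n : ℝ) / 2) * A) := by
  have : ∀ ι, ∃ c : ℝ, 0 ≤ c ∧ ∀ τ ∈ Ioc 0 T, ∀ p : ℝ≥0∞, 1 ≤ p → p ≠ ⊤ →
      ∀ (f : Dom → Vec 𝕜) (A : ℝ),
      0 ≤ A → AEStronglyMeasurable f (layer z₀ z₁) → mixedNorm z₀ z₁ p f ≤ ENNReal.ofReal A → ∀ x,
      eLpNorm (fun z => Op z₀ z₁ (k ι τ) (m ι τ) f (x, z)) p (volume.restrict (Ioo z₀ z₁)) ≤
        ENNReal.ofReal (c * τ ^ (-(n : ℝ) / 2) * A) := by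
    intro ι
    obtain ⟨a, b, d, rfl, hd, hk, hm⟩ := hs ι
    exact eLpNorm_op_le hk hd hm
  choose c hc0 hc using this
  refine ⟨∑ ι, c ι, Finset.sum_nonneg fun ι _ => hc0 ι, fun τ hτ p hp hpt F A hA hF hFA x => ?_⟩
  have hτp : ∀ s : ℝ, 0 < τ ^ s := fun s => Real.rpow_pos_of_pos hτ.1 s
  rw [Finset.sum_mul, Finset.sum_mul, ENNReal.ofReal_sum_of_nonneg fun ι _ =>
    mul_nonneg (mul_nonneg (hc0 ι) (hτp _).le) hA]
  have e : (fun z => Nop z₀ z₁ k m τ F (x, z)) =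
      ∑ ι, fun z => Op z₀ z₁ (k ι τ) (m ι τ) (fun p => lin ι (F (comp ι) p)) (x, z) := by
    funext z; simp [Nop]
  rw [e]
  refine (eLpNorm_sum_le (fun ι _ => ?_) hp).trans (Finset.sum_le_sum fun ι _ => ?_)
  · obtain ⟨a, b, d, hn, hd, hk, hm⟩ := hs ι
    have := continuous_op hk hd hm hτ ((hF (comp ι)).lin ι)
    exact (this.comp (by fun_prop : Continuous fun z : ℝ => (x, z))).aestronglyMeasurable
  · exact hc ι τ hτ p hp hpt _ A hA (aestronglyMeasurable_lin ι (hF _).1)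
      ((mixedNorm_lin_le ι _).trans (hFA _)) x

theorem Nop_modulus (hs : IsSystem z₀ z₁ T n k m) {δ ε : ℝ} (hδ : 0 < δ) (hε : 0 < ε) :
    ∃ η > 0, ∀ τ ∈ Icc δ T, ∀ τ' ∈ Icc δ T, ∀ q q' : Dom, q.2 ∈ Ioo z₀ z₁ → q'.2 ∈ Ioo z₀ z₁ →
      |τ - τ'| < η → dist q q' < η → ∀ (F : Fin 3 → Dom → Vec 𝕜) (A : ℝ), 0 ≤ A →
      (∀ i, AEStronglyMeasurable (F i) (layer z₀ z₁)) →
      (∀ i, mixedNorm z₀ z₁ 1 (F i) ≤ ENNReal.ofReal A) →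
      ‖Nop z₀ z₁ k m τ F q - Nop z₀ z₁ k m τ' F q'‖ ≤ ε * A := by
  have hcard : (0 : ℝ) < Fintype.card Idx := by
    exact_mod_cast Fintype.card_pos
  have : ∀ ι, ∃ η > 0, ∀ τ ∈ Icc δ T, ∀ τ' ∈ Icc δ T, ∀ q q' : Dom, q.2 ∈ Ioo z₀ z₁ →
      q'.2 ∈ Ioo z₀ z₁ → |τ - τ'| < η → dist q q' < η → ∀ (f : Dom → Vec 𝕜) (A : ℝ),
      0 ≤ A → AEStronglyMeasurable f (layer z₀ z₁) →
      mixedNorm z₀ z₁ 1 f ≤ ENNReal.ofReal A →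
      ‖Op z₀ z₁ (k ι τ) (m ι τ) f q - Op z₀ z₁ (k ι τ') (m ι τ') f q'‖ ≤
        ε / Fintype.card Idx * A := by
    intro ι
    obtain ⟨a, b, d, hn, hd, hk, hm⟩ := hs ι
    exact op_modulus hk hd hm hδ (div_pos hε hcard)
  choose η hη0 hη using this
  obtain ⟨η₀, hη₀, hle⟩ : ∃ η₀ > 0, ∀ ι, η₀ ≤ η ι := by
    refine ⟨Finset.univ.inf' Finset.univ_nonempty η, ?_, fun ι => Finset.inf'_le _ (by simp)⟩
    simpa [Finset.lt_inf'_iff] using hη0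
  refine ⟨η₀, hη₀, fun τ hτ τ' hτ' q q' hq hq' h1 h2 F A hA hF hFA => ?_⟩
  rw [Nop, Nop, ← Finset.sum_sub_distrib]
  refine (norm_sum_le _ _).trans ((Finset.sum_le_sum fun ι _ => hη ι τ hτ τ' hτ' q q' hq hq'
    (h1.trans_le (hle ι)) (h2.trans_le (hle ι)) _ A hA (aestronglyMeasurable_lin ι (hF _))
    ((mixedNorm_lin_le ι _).trans (hFA _))).trans (le_of_eq ?_))
  rw [Finset.sum_const, nsmul_eq_mul, Finset.card_univ]
  field_simp

end Bounds

/-! ### Derivatives of the nonlinear operator -/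

section Derivatives

variable {z₀ z₁ T : ℝ}

theorem HasLineDerivAt.finset_sum {E F ι : Type*} [NormedAddCommGroup E] [NormedSpace ℝ E]
    [NormedAddCommGroup F] [NormedSpace ℝ F] {s : Finset ι} {f : ι → E → F} {f' : ι → F} {x v : E}
    (h : ∀ i ∈ s, HasLineDerivAt ℝ (f i) (f' i) x v) :
    HasLineDerivAt ℝ (fun y => ∑ i ∈ s, f i y) (∑ i ∈ s, f' i) x v :=
  HasDerivAt.fun_sum h

theorem gaussD2_swap (i j : Fin 2) : gaussD2 i j = gaussD2 j i := by
  funext s x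
  simp only [gaussD2, kron_comm i j]
  ring

theorem hasLineDerivAt_Nop_horizontal (hz : z₀ < z₁) {τ : ℝ} (hτ : τ ∈ Ioc 0 T)
    {F : Fin 3 → Dom → Vec 𝕜} (hF : ∀ i, MemLInf z₀ z₁ 1 (F i)) (l : Fin 2) (q : Dom) :
    HasLineDerivAt ℝ (Nop z₀ z₁ kN (mN z₀ z₁) τ F) (Nop z₀ z₁ (kH l) (mN z₀ z₁) τ F q) q
      ((unit l, 0) : Dom) := by
  refine HasLineDerivAt.finset_sum fun ι _ => ?_
  have hT := hτ.1.trans_le hτ.2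
  obtain ⟨a, b, d, hn, hd, hk, hm⟩ := isSystem_N hz hT ι
  obtain ⟨a', b', d', hn', hd', hk', hm'⟩ := isSystem_H hz hT l ι
  refine hasLineDerivAt_op_horizontal hk hd hk' hd' hm hτ (fun x => ?_) ((hF _).lin ι) q
  rcases ι with j | _ | ⟨k, i, j⟩
  · exact hasLineDerivAt_gaussD1 j l x
  · exact hasLineDerivAt_gaussPlane x l
  · exact hasLineDerivAt_rieszKernel k i j l hτ.1 x

theorem hasLineDerivAt_Nop_vertical (hz : z₀ < z₁) {τ : ℝ} (hτ : τ ∈ Ioc 0 T)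
    {F : Fin 3 → Dom → Vec 𝕜} (hF : ∀ i, MemLInf z₀ z₁ 1 (F i)) (q : Dom) :
    HasLineDerivAt ℝ (Nop z₀ z₁ kN (mN z₀ z₁) τ F) (Nop z₀ z₁ kN (mZ z₀ z₁) τ F q) q
      ((0, 1) : Dom) := by
  refine HasLineDerivAt.finset_sum fun ι _ => ?_
  have hT := hτ.1.trans_le hτ.2
  obtain ⟨a, b, d, hn, hd, hk, hm⟩ := isSystem_N hz hT ι
  obtain ⟨a', b', d', hn', hd', hk', hm'⟩ := isSystem_Z hz hT ι
  refine hasLineDerivAt_op_vertical hk hd hm hm' hτ (fun z ζ => ?_) ((hF _).lin ι) q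
  rcases ι with j | _ | ⟨k, i, j⟩
  · exact hasDerivAt_reflKernel_left hz (by norm_num) hτ.1 1 1 z ζ
  · exact hasDerivAt_reflKernel_left hz le_rfl hτ.1 (-1) 1 z ζ
  · exact hasDerivAt_const z _

end Derivatives

/-! ### The flux, and the nonlinearity as a sum of product operators -/

/-- The velocity `(v, w)`. -/
def vel (z₁ : ℝ) (v : Dom → Vec 𝕜) (DH : Fin 2 → Dom → Vec 𝕜) : Fin 3 → Dom → 𝕜 :=
  Fin.snoc (α := fun _ => Dom → 𝕜) (fun j q => v q j) (vertVel z₁ DH)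

/-- The flux `u ⊗ v`. -/
def flux (u : Fin 3 → Dom → 𝕜) (v : Dom → Vec 𝕜) (i : Fin 3) (q : Dom) : Vec 𝕜 := u i q • v q

theorem vel_castSucc (z₁ : ℝ) (v : Dom → Vec 𝕜) (DH : Fin 2 → Dom → Vec 𝕜) (j : Fin 2) :
    vel z₁ v DH j.castSucc = fun q => v q j := by
  simp [vel]

theorem vel_last (z₁ : ℝ) (v : Dom → Vec 𝕜) (DH : Fin 2 → Dom → Vec 𝕜) :
    vel z₁ v DH (Fin.last 2) = vertVel z₁ DH :=
  Fin.snoc_last (α := fun _ => Dom → 𝕜) _ _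

theorem Op_eq_iterated {E : Type*} [NormedAddCommGroup E] [NormedSpace ℝ E] {z₀ z₁ T : ℝ}
    {a b : ℕ} {d : ℝ}
    {k : ℝ → Plane → ℝ} {m : ℝ → ℝ → ℝ → ℝ} (hk : HKernel a d k) (hd : 2 < d)
    (hm : VKernel z₀ z₁ T b m) {τ : ℝ} (hτ : τ ∈ Ioc 0 T)
    {f : Dom → E} (hf : MemLInf z₀ z₁ 1 f) (q : Dom) :
    Op z₀ z₁ (k τ) (m τ) f q =
      ∫ y : Plane, ∫ ζ in Ioo z₀ z₁, (k τ (q.1 - y) * m τ q.2 ζ) • f (y, ζ) := by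
  obtain ⟨cs, hcs0, hcs⟩ := hm.sup
  have hki := (hk.integral_le hd).choose_spec.2 τ hτ.1 |>.1
  have := integrable_op hki (hm.continuous_right hτ.1 q.2).measurable
    (fun ζ => hcs τ hτ q.2 ζ) hf q.1
  unfold Op layer at *
  rw [integral_prod _ this]

theorem stokes_eq_Op {z₀ z₁ : ℝ} (hz : z₀ < z₁) {t : ℝ} (ht : 0 < t) {f : Dom → Vec 𝕜}
    (hf : MemLInf z₀ z₁ 1 f) :
    stokes z₀ z₁ t f = Op z₀ z₁ (gaussPlane t) (reflKernel z₀ z₁ 0 1 1 t) f := by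
  funext q
  rw [Op_eq_iterated hKernel_gaussPlane (by norm_num)
    (vKernel_reflKernel hz ht 0 (by simp) (by simp)) ⟨ht, le_rfl⟩ hf]
  simp only [stokes, neumannKernel_eq hz ht]

/-- Integrability of the fluxes turns the iterated integrals into integrals over the layer, and the
vertical mean becomes integration against the constant kernel `(z₁ - z₀)⁻¹`. -/
theorem nonlin_eq_Nop {z₀ z₁ : ℝ} (hz : z₀ < z₁) {t : ℝ} (ht : 0 < t) {v : Dom → Vec 𝕜}
    {DH : Fin 2 → Dom → Vec 𝕜} (hF : ∀ i, MemLInf z₀ z₁ 1 (flux (vel z₁ v DH) v i)) :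
    nonlin z₀ z₁ t v DH = Nop z₀ z₁ kN (mN z₀ z₁) t (flux (vel z₁ v DH) v) := by
  funext q
  have hm0 : VKernel z₀ z₁ t 0 (reflKernel z₀ z₁ 0 1 1) :=
    vKernel_reflKernel hz ht 0 (by simp) (by simp)
  have hm1 : VKernel z₀ z₁ t 1 (reflKernel z₀ z₁ 1 (-1) 1) :=
    vKernel_reflKernel hz ht 1 (by simp) (by simp)
  have hmc : VKernel z₀ z₁ t 0 (fun _ _ _ => (z₁ - z₀)⁻¹) := vKernel_const hz
  have htt : t ∈ Ioc 0 t := ⟨ht, le_rfl⟩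
  have hj : ∀ j : Fin 2, flux (vel z₁ v DH) v j.castSucc = fun q => v q j • v q := fun j => by
    funext p; simp [flux, vel_castSucc]
  have hl : flux (vel z₁ v DH) v (Fin.last 2) = fun q => vertVel z₁ DH q • v q := by
    funext p; rw [flux, vel_last]
  rw [nonlin, stokesProjDiv, Nop, Fintype.sum_sum_type, Fintype.sum_sum_type, ← add_assoc,
    sub_eq_add_neg]
  congr 1
  · congr 1
    · refine Finset.sum_congr rfl fun j _ => ?_
      simp only [kN, mN, lin, comp]
      rw [Op_eq_iterated (hKernel_gaussD1 j) (by norm_num) hm0 htt (hF _), hj]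
      simp only [pd_gaussPlane, neumannKernel_eq hz ht]
    · simp only [kN, mN, lin, comp, Finset.univ_unique, Finset.sum_singleton]
      have h1 := Op_eq_iterated hKernel_gaussPlane (by norm_num) hm1 htt (hF (Fin.last 2)) q
      have h2 : Op z₀ z₁ (gaussPlane t) (reflKernel z₀ z₁ 1 (-1) 1 t)
          (fun p => -flux (vel z₁ v DH) v (Fin.last 2) p) q =
          - Op z₀ z₁ (gaussPlane t) (reflKernel z₀ z₁ 1 (-1) 1 t)
          (flux (vel z₁ v DH) v (Fin.last 2)) q := by
        simp only [Op, smul_neg, integral_neg]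
      rw [h2, h1, hl]
      simp only [deriv_neumannKernel hz ht]
  · have key : ∀ k i j : Fin 2, Op z₀ z₁ (rieszKernel k i j t) (fun _ _ => (z₁ - z₀)⁻¹)
        (fun p => EuclideanSpace.single k (flux (vel z₁ v DH) v j.castSucc p i)) q =
        EuclideanSpace.single k (∫ y : Plane, rieszKernel k i j t (q.1 - y) •
          mean z₀ z₁ (fun q => v q j • v q) y i) := by
      intro k i j
      have h1 := Op_eq_iterated (hKernel_rieszKernel k i j) (by norm_num) hmc htt
        ((hF j.castSucc).lin (.inr (.inr (k, i, j)))) q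
      simp only [lin] at h1
      rw [h1, hj]
      change _ = singleIsometry k _
      rw [← LinearIsometry.integral_comp_comm]
      have hint : ∀ᵐ y : Plane, Integrable (fun ζ => v (y, ζ) j • v (y, ζ))
          (volume.restrict (Ioo z₀ z₁)) := by
        have h2 := hF j.castSucc
        rw [hj] at h2
        filter_upwards [h2.1.prodMk_left, mixedNorm_le_iff.1 (le_refl (mixedNorm z₀ z₁ 1
          (fun q : Dom => v q j • v q)))] with y hy1 hy2
        exact memLp_one_iff_integrable.1 ⟨hy1, hy2.trans_lt h2.2⟩
      refine integral_congr_ae ?_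
      filter_upwards [hint] with y hy
      have h3 : mean z₀ z₁ (fun q => v q j • v q) y i =
          (z₁ - z₀)⁻¹ • ∫ ζ in Ioo z₀ z₁, (v (y, ζ) j • v (y, ζ)) i := by
        rw [mean, PiLp.smul_apply]
        congr 1
        exact ((EuclideanSpace.proj (𝕜 := 𝕜) i).integral_comp_comm hy).symm
      rw [h3, smul_smul, ← integral_smul, ← LinearIsometry.integral_comp_comm]
      simp only [map_smul]
      rfl
    simp only [Fintype.sum_prod_type, kN, mN, lin, comp, key]
    ext k'
    fin_cases k' <;> simp

end System

/-! ### Weak derivatives and mollification -/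

theorem HasWeakDerivOn.congr {E F : Type*} [NormedAddCommGroup E] [NormedSpace ℝ E]
    [MeasureSpace E] [NormedAddCommGroup F] [NormedSpace ℝ F] {U : Set E} {e : E} {f g f' g' : E → F}
    (h : HasWeakDerivOn U e f g) (hf : f =ᵐ[volume.restrict U] f')
    (hg : g =ᵐ[volume.restrict U] g') (hf' : LocallyIntegrableOn f' U)
    (hg' : LocallyIntegrableOn g' U) : HasWeakDerivOn U e f' g' := by
  refine ⟨hf', hg', fun φ h1 h2 h3 => ?_⟩
  have e1 : ∫ x in U, fderiv ℝ φ x e • f' x = ∫ x in U, fderiv ℝ φ x e • f x :=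
    integral_congr_ae (hf.mono fun x hx => by simp only [hx])
  have e2 : ∫ x in U, φ x • g' x = ∫ x in U, φ x • g x :=
    integral_congr_ae (hg.mono fun x hx => by simp only [hx])
  rw [e1, e2]
  exact h.2.2 φ h1 h2 h3

open scoped Convolution in
/-- The mollification of a function with a weak derivative has a classical derivative. -/
theorem HasWeakDerivOn.hasLineDerivAt_convolution {E F : Type*} [NormedAddCommGroup E]
    [NormedSpace ℝ E] [FiniteDimensional ℝ E] [MeasureSpace E] [BorelSpace E]
    [(volume : Measure E).IsAddHaarMeasure] [NormedAddCommGroup F] [NormedSpace ℝ F]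
    [CompleteSpace F]
    {U : Set E} (hU : MeasurableSet U) {e : E} {f g : E → F} (h : HasWeakDerivOn U e f g)
    (hf : LocallyIntegrable (U.indicator f)) (φ : ContDiffBump (0 : E)) {q : E}
    (hq : Metric.closedBall q φ.rOut ⊆ U) :
    HasLineDerivAt ℝ (φ.normed volume ⋆[ContinuousLinearMap.lsmul ℝ ℝ, volume] U.indicator f)
      ((φ.normed volume ⋆[ContinuousLinearMap.lsmul ℝ ℝ, volume] U.indicator g) q) q e := by
  set η : E → ℝ := φ.normed volume with hη
  have hηc : ContDiff ℝ ∞ η := φ.contDiff_normed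
  have hηs : HasCompactSupport η := φ.hasCompactSupport_normed
  have hηt : tsupport η = Metric.closedBall 0 φ.rOut := φ.tsupport_normed_eq
  have h1 := (hηs.hasFDerivAt_convolution_left (ContinuousLinearMap.lsmul ℝ ℝ)
    (hηc.of_le (by exact_mod_cast le_top)) hf q).hasLineDerivAt e
  convert h1 using 1
  have hex : ConvolutionExistsAt (fderiv ℝ η) (U.indicator f) q
      ((ContinuousLinearMap.lsmul ℝ ℝ : ℝ →L[ℝ] F →L[ℝ] F).precompL E) volume :=
    (hηs.fderiv ℝ).convolutionExists_left _ (hηc.continuous_fderiv (by simp)) hf q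
  have h2 : ((fderiv ℝ η ⋆[(ContinuousLinearMap.lsmul ℝ ℝ : ℝ →L[ℝ] F →L[ℝ] F).precompL E, volume]
      U.indicator f) q) e = ∫ t, fderiv ℝ η t e • U.indicator f (q - t) := by
    unfold convolution
    rw [ContinuousLinearMap.integral_apply hex]
    simp [ContinuousLinearMap.precompL_apply]
  have h3 : ∫ t, fderiv ℝ η t e • U.indicator f (q - t) =
      ∫ p, fderiv ℝ η (q - p) e • U.indicator f p := by
    rw [← integral_sub_left_eq_self (fun t => fderiv ℝ η t e • U.indicator f (q - t)) volume q]
    simp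
  rw [h2, h3, convolution_lsmul_swap]
  -- The reflected and translated mollifier is an admissible test function, because the closed ball
  -- around `q` lies in `U`.
  set ψ : E → ℝ := fun p => η (q - p) with hψ
  have hψd : ∀ p, fderiv ℝ ψ p e = -fderiv ℝ η (q - p) e := by
    intro p
    have : HasFDerivAt ψ ((fderiv ℝ η (q - p)).comp (-(ContinuousLinearMap.id ℝ E))) p :=
      ((hηc.differentiable (by simp)) (q - p)).hasFDerivAt.comp p
        ((hasFDerivAt_id p).const_sub q)
    rw [this.fderiv]
    simp
  have hψt : tsupport ψ ⊆ U := by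
    refine Subset.trans (closure_minimal ?_ Metric.isClosed_closedBall) hq
    intro p hp
    have h4 : q - p ∈ tsupport η := subset_tsupport _ hp
    rw [hηt, mem_closedBall_zero_iff] at h4
    rw [Metric.mem_closedBall, dist_comm, dist_eq_norm]
    exact h4
  have hψc : HasCompactSupport ψ :=
    HasCompactSupport.of_support_subset_isCompact (isCompact_closedBall q φ.rOut) (by
      intro p hp
      have h4 : q - p ∈ tsupport η := subset_tsupport _ hp
      rw [hηt, mem_closedBall_zero_iff] at h4
      rw [Metric.mem_closedBall, dist_comm, dist_eq_norm]
      exact h4)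
  have h5 := h.2.2 ψ (hηc.comp (contDiff_const.sub contDiff_id)) hψc hψt
  simp only [hψd, neg_smul, integral_neg, neg_inj] at h5
  have ind : ∀ (a : E → ℝ) (b : E → F), ∫ p, a p • U.indicator b p = ∫ p in U, a p • b p := by
    intro a b
    rw [← integral_indicator hU]
    congr 1
    funext p
    by_cases hp : p ∈ U <;> simp [hp]
  rw [ind, ind]
  exact h5.symm

instance isAddHaarMeasure_dom : (volume : Measure Dom).IsAddHaarMeasure :=
  Measure.prod.instIsAddHaarMeasure (volume : Measure Plane) (volume : Measure ℝ)

theorem layer_eq (z₀ z₁ : ℝ) : layer z₀ z₁ = volume.restrict (univ ×ˢ Ioo z₀ z₁ : Set Dom) := by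
  rw [layer, ← Measure.restrict_univ (μ := (volume : Measure Plane)), Measure.prod_restrict]
  rfl

theorem measurableSet_dom (z₀ z₁ : ℝ) : MeasurableSet (univ ×ˢ Ioo z₀ z₁ : Set Dom) :=
  MeasurableSet.univ.prod measurableSet_Ioo

theorem isOpen_dom (z₀ z₁ : ℝ) : IsOpen (univ ×ˢ Ioo z₀ z₁ : Set Dom) := isOpen_univ.prod isOpen_Ioo

theorem MemLInf.locallyIntegrable {F : Type*} [NormedAddCommGroup F] [NormedSpace ℝ F] {z₀ z₁ : ℝ}
    {f : Dom → F} (hf : MemLInf z₀ z₁ 1 f) :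
    LocallyIntegrable ((univ ×ˢ Ioo z₀ z₁ : Set Dom).indicator f) := by
  rw [locallyIntegrable_iff]
  intro K hK
  obtain ⟨B, hB⟩ := (hK.image continuous_fst).isBounded.subset_closedBall (0 : Plane)
  have h1 := integrable_mul_of_memLInf (h := (Metric.closedBall (0 : Plane) B).indicator 1)
    ((integrable_indicator_iff Metric.isClosed_closedBall.measurableSet).2
      ((integrableOn_const_iff (C := (1 : ℝ))).2 (Or.inr (by
        exact (isCompact_closedBall _ _).measure_lt_top)))) hf
  rw [layer_eq] at h1
  change IntegrableOn _ _ _ at h1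
  rw [← integrable_indicator_iff (measurableSet_dom z₀ z₁)] at h1
  rw [IntegrableOn]
  refine (h1.integrableOn (s := K)).congr ?_
  filter_upwards [ae_restrict_mem hK.measurableSet] with p hp
  have : p.1 ∈ Metric.closedBall (0 : Plane) B := hB ⟨p, hp, rfl⟩
  by_cases h : p ∈ (univ ×ˢ Ioo z₀ z₁ : Set Dom) <;> simp only [indicator, h, this, if_true,
    if_false, Pi.one_apply, one_smul]

theorem MemLInf.locallyIntegrableOn {F : Type*} [NormedAddCommGroup F] [NormedSpace ℝ F]
    {z₀ z₁ : ℝ} {f : Dom → F} (hf : MemLInf z₀ z₁ 1 f) :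
    LocallyIntegrableOn f (univ ×ˢ Ioo z₀ z₁ : Set Dom) := by
  refine (locallyIntegrableOn_iff (isOpen_dom z₀ z₁).isLocallyClosed).2 fun K hKs hK => ?_
  refine ((hf.locallyIntegrable.integrableOn_isCompact hK)).congr_fun (fun p hp => ?_)
    hK.measurableSet
  exact indicator_of_mem (hKs hp) _

open scoped Convolution in
-- For fixed `x` the vertical integral of the mollification is at most an average of vertical
-- integrals of `‖f‖` at neighbouring horizontal points. The essential bound thereby becomes a bound
-- at every `x`.
theorem lintegral_convolution_le {F : Type*} [NormedAddCommGroup F] [NormedSpace ℝ F] {z₀ z₁ : ℝ}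
    {f : Dom → F} (hf : MemLInf z₀ z₁ 1 f) (φ : ContDiffBump (0 : Dom)) (x : Plane) (s : Set ℝ) :
    ∫⁻ z in s, ‖(φ.normed volume ⋆[ContinuousLinearMap.lsmul ℝ ℝ, volume]
      (univ ×ˢ Ioo z₀ z₁ : Set Dom).indicator f) (x, z)‖ₑ ≤ mixedNorm z₀ z₁ 1 f := by
  set η : Dom → ℝ := φ.normed volume with hη
  have hηc : Continuous η := φ.continuous_normed
  have h0 : ∀ z, ‖(η ⋆[ContinuousLinearMap.lsmul ℝ ℝ, volume]
      (univ ×ˢ Ioo z₀ z₁ : Set Dom).indicator f) (x, z)‖ₑ ≤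
      ∫⁻ p, ‖η ((x, z) - p)‖ₑ * ‖f p‖ₑ ∂(layer z₀ z₁) := by
    intro z
    rw [convolution_lsmul_swap]
    refine (enorm_integral_le_lintegral_enorm _).trans (le_of_eq ?_)
    rw [layer_eq, ← lintegral_indicator (measurableSet_dom z₀ z₁)]
    congr 1
    funext p
    by_cases h : p ∈ (univ ×ˢ Ioo z₀ z₁ : Set Dom) <;> simp [h, enorm_smul]
  refine (setLIntegral_le_lintegral _ _).trans ((lintegral_mono h0).trans ?_)
  have hmeas : AEMeasurable (Function.uncurry fun (z : ℝ) (p : Dom) =>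
      ‖η ((x, z) - p)‖ₑ * ‖f p‖ₑ) (volume.prod (layer z₀ z₁)) := by
    have h1 : Measurable fun P : ℝ × Dom => ‖η ((x, P.1) - P.2)‖ₑ :=
      (hηc.comp (by fun_prop)).measurable.enorm
    exact h1.aemeasurable.mul hf.1.enorm.comp_snd
  rw [lintegral_lintegral_swap hmeas]
  set h : Plane → ℝ≥0∞ := fun y => ∫⁻ z : ℝ, ‖η (y, z)‖ₑ with hh
  have hhm : Measurable h := by
    have : Measurable fun P : Plane × ℝ => ‖η P‖ₑ := hηc.measurable.enorm
    exact this.lintegral_prod_right'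
  have hin : ∀ p : Dom, ∫⁻ z : ℝ, ‖η ((x, z) - p)‖ₑ * ‖f p‖ₑ = h (x - p.1) * ‖f p‖ₑ := by
    intro p
    have hm : Measurable fun z : ℝ => ‖η ((x, z) - p)‖ₑ :=
      (hηc.comp (by fun_prop)).measurable.enorm
    rw [lintegral_mul_const _ hm]
    congr 1
    exact lintegral_sub_right_eq_self (fun z => ‖η (x - p.1, z)‖ₑ) p.2
  simp_rw [hin]
  have h2 := lintegral_layer_le (z₀ := z₀) (z₁ := z₁) (h := fun y => h (x - y))
    (hhm.comp (by fun_prop)) (G := fun p => ‖f p‖ₑ) hf.1.enorm (C := mixedNorm z₀ z₁ 1 f) (by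
      have := mixedNorm_le_iff.1 (le_refl (mixedNorm z₀ z₁ 1 f))
      simpa only [eLpNorm_one_eq_lintegral_enorm] using this)
  rw [lintegral_sub_left_eq_self h x] at h2
  have h3 : ∫⁻ y, h y = 1 := by
    have h4 : ∫⁻ p : Dom, ‖η p‖ₑ = 1 := by
      rw [← ofReal_integral_norm_eq_lintegral_enorm φ.integrable_normed]
      simp only [Real.norm_eq_abs, abs_of_nonneg (φ.nonneg_normed _)]
      rw [φ.integral_normed, ENNReal.ofReal_one]
    rw [← h4]
    exact (lintegral_prod (μ := (volume : Measure Plane)) (ν := (volume : Measure ℝ)) _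
      hηc.measurable.enorm.aemeasurable).symm
  rwa [h3, one_mul] at h2

/-- A function with one derivative in `L^∞(L¹)` in the vertical direction is bounded. -/
theorem norm_le_of_weakDeriv_vertical {F : Type*} [NormedAddCommGroup F] [NormedSpace ℝ F]
    [CompleteSpace F] {z₀ z₁ : ℝ} (hz : z₀ < z₁) {f g : Dom → F} (hf : MemLInf z₀ z₁ 1 f)
    (hg : MemLInf z₀ z₁ 1 g)
    (h : HasWeakDerivOn (univ ×ˢ Ioo z₀ z₁ : Set Dom) ((0, 1) : Dom) f g) :
    ∀ᵐ q ∂(layer z₀ z₁), ‖f q‖ ≤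
      (z₁ - z₀)⁻¹ * (mixedNorm z₀ z₁ 1 f).toReal + (mixedNorm z₀ z₁ 1 g).toReal := by
  set A := (mixedNorm z₀ z₁ 1 f).toReal with hA
  set B := (mixedNorm z₀ z₁ 1 g).toReal with hB
  set Ω : Set Dom := univ ×ˢ Ioo z₀ z₁ with hΩ
  set φ : ℕ → ContDiffBump (0 : Dom) := fun n =>
    ⟨(1 / 2) * (1 / ((n : ℝ) + 1)), 1 / ((n : ℝ) + 1), by positivity,
      by have : (0 : ℝ) < 1 / ((n : ℝ) + 1) := by positivity
         linarith⟩ with hφ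
  have hr : Tendsto (fun n => (φ n).rOut) atTop (𝓝 0) := tendsto_one_div_add_atTop_nhds_zero_nat
  have hconv := ContDiffBump.ae_convolution_tendsto_right_of_locallyIntegrable (φ := φ)
    (l := atTop) (K := 2) (μ := volume) hr (Eventually.of_forall fun n => by
      simp only [hφ]; linarith) hf.locallyIntegrable
  rw [layer_eq]
  filter_upwards [ae_restrict_of_ae hconv, ae_restrict_mem (measurableSet_dom z₀ z₁)] with q hq hqΩ
  obtain ⟨x, z⟩ := q
  have hzI : z ∈ Ioo z₀ z₁ := hqΩ.2
  rw [indicator_of_mem hqΩ] at hq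
  -- On the interval shortened by `δ` the mollifications are differentiable, and `|fn z| ≤ |fn ζ| +
  -- ∫ |gn|` is averaged over `ζ`. The limits `n → ∞` and `δ → 0` follow.
  have key : ∀ δ : ℝ, 0 < δ → z₀ + δ < z → z < z₁ - δ →
      (z₁ - z₀ - 2 * δ) * ‖f (x, z)‖ ≤ A + (z₁ - z₀ - 2 * δ) * B := by
    intro δ hδ h1 h2
    refine le_of_tendsto (hq.norm.const_mul _) ?_
    filter_upwards [hr.eventually_lt_const hδ] with n hn
    set a := z₀ + δ with ha
    set b := z₁ - δ with hb
    set fn : ℝ → F := fun ζ => (convolution ((φ n).normed volume) (Ω.indicator f)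
      (ContinuousLinearMap.lsmul ℝ ℝ) volume) (x, ζ) with hfn
    set gn : ℝ → F := fun ζ => (convolution ((φ n).normed volume) (Ω.indicator g)
      (ContinuousLinearMap.lsmul ℝ ℝ) volume) (x, ζ) with hgn
    have hcf : Continuous fn := ((φ n).hasCompactSupport_normed.continuous_convolution_left _
      (φ n).continuous_normed hf.locallyIntegrable).comp (by fun_prop)
    have hcg : Continuous gn := ((φ n).hasCompactSupport_normed.continuous_convolution_left _
      (φ n).continuous_normed hg.locallyIntegrable).comp (by fun_prop)
    have hd : ∀ ζ ∈ Icc a b, HasDerivAt fn (gn ζ) ζ := by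
      intro ζ hζ
      have h3 := h.hasLineDerivAt_convolution (measurableSet_dom z₀ z₁) hf.locallyIntegrable (φ n)
        (q := (x, ζ)) (by
          intro p hp
          rw [Metric.mem_closedBall, Prod.dist_eq] at hp
          have h4 := (le_max_right _ _).trans hp
          rw [Real.dist_eq] at h4
          have h5 := abs_le.1 (h4.trans hn.le)
          have h6 := abs_lt.1 (h4.trans_lt hn)
          exact ⟨mem_univ _, by linarith [hζ.1], by linarith [hζ.2]⟩)
      unfold HasLineDerivAt at h3
      have h5 : HasDerivAt (fun s : ℝ => fn (ζ + s)) (gn ζ) (ζ - ζ) := by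
        rw [sub_self]
        simpa [hfn, hgn] using h3
      have h6 := h5.comp_sub_const ζ ζ
      simpa using h6
    have hA' : ∫ ζ in a..b, ‖fn ζ‖ ≤ A := by
      rw [intervalIntegral.integral_of_le (by linarith), hA,
        integral_norm_eq_lintegral_enorm hcf.aestronglyMeasurable]
      exact ENNReal.toReal_mono hf.2.ne (lintegral_convolution_le hf (φ n) x _)
    have hB' : ∫ ζ in a..b, ‖gn ζ‖ ≤ B := by
      rw [intervalIntegral.integral_of_le (by linarith), hB,
        integral_norm_eq_lintegral_enorm hcg.aestronglyMeasurable]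
      exact ENNReal.toReal_mono hg.2.ne (lintegral_convolution_le hg (φ n) x _)
    have hpt : ∀ ζ ∈ Icc a b, ‖fn z‖ ≤ ‖fn ζ‖ + B := by
      intro ζ hζ
      have hsub : uIcc ζ z ⊆ Icc a b := uIcc_subset_Icc hζ ⟨h1.le, h2.le⟩
      have h3 := intervalIntegral.integral_eq_sub_of_hasDerivAt (fun s hs => hd s (hsub hs))
        (hcg.intervalIntegrable _ _)
      have h4 : ‖∫ s in ζ..z, gn s‖ ≤ ∫ s in a..b, ‖gn s‖ := by
        rw [intervalIntegral.norm_intervalIntegral_eq, intervalIntegral.integral_of_le (by linarith)]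
        refine (norm_integral_le_integral_norm _).trans
          (setIntegral_mono_set (hcg.norm.integrableOn_Icc.mono_set Ioc_subset_Icc_self)
            (Eventually.of_forall fun _ => norm_nonneg _) ?_)
        refine (Ioc_subset_Ioc ?_ ?_).eventuallyLE
        · exact le_min hζ.1 h1.le
        · exact max_le hζ.2 h2.le
      have h5 : fn z = fn ζ + ∫ s in ζ..z, gn s := by rw [h3]; abel
      rw [h5]
      exact (norm_add_le _ _).trans (by linarith)
    have h3 : ∫ ζ in a..b, ‖fn z‖ ≤ ∫ ζ in a..b, (‖fn ζ‖ + B) :=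
      intervalIntegral.integral_mono_on (by linarith) (by simp)
        ((hcf.norm.add continuous_const).intervalIntegrable _ _) hpt
    rw [intervalIntegral.integral_add (hcf.norm.intervalIntegrable _ _) (by simp)] at h3
    simp only [intervalIntegral.integral_const, smul_eq_mul] at h3
    have h4 : b - a = z₁ - z₀ - 2 * δ := by rw [ha, hb]; ring
    rw [h4] at h3
    linarith
  have hlim : Tendsto (fun δ : ℝ => (z₁ - z₀ - 2 * δ) * ‖f (x, z)‖) (𝓝[>] 0)
      (𝓝 ((z₁ - z₀ - 2 * 0) * ‖f (x, z)‖)) :=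
    ((by fun_prop : Continuous fun δ : ℝ => (z₁ - z₀ - 2 * δ) * ‖f (x, z)‖).tendsto 0).mono_left
      nhdsWithin_le_nhds
  have hlim2 : Tendsto (fun δ : ℝ => A + (z₁ - z₀ - 2 * δ) * B) (𝓝[>] 0)
      (𝓝 (A + (z₁ - z₀ - 2 * 0) * B)) :=
    ((by fun_prop : Continuous fun δ : ℝ => A + (z₁ - z₀ - 2 * δ) * B).tendsto 0).mono_left
      nhdsWithin_le_nhds
  have hfin := le_of_tendsto_of_tendsto hlim hlim2 (by
    have hm : 0 < min (z - z₀) (z₁ - z) := lt_min (by linarith [hzI.1]) (by linarith [hzI.2])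
    filter_upwards [Ioo_mem_nhdsGT hm] with δ hδ
    have h1 := hδ.2.trans_le (min_le_left _ _)
    have h2 := hδ.2.trans_le (min_le_right _ _)
    exact key δ hδ.1 (by linarith) (by linarith))
  have hL : 0 < z₁ - z₀ := by linarith
  rw [mul_zero, sub_zero] at hfin
  rw [← sub_nonneg] at hfin ⊢
  have : (z₁ - z₀)⁻¹ * A + B - ‖f (x, z)‖ =
      (z₁ - z₀)⁻¹ * (A + (z₁ - z₀) * B - (z₁ - z₀) * ‖f (x, z)‖) := by field_simp
  rw [this]
  positivity

/-! ### Integration by parts against kernels -/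

section

variable {F : Type*} [NormedAddCommGroup F]

theorem norm_vertical_integral_le {z₀ z₁ : ℝ} {f : Dom → F} (hf : MemLInf z₀ z₁ 1 f) :
    ∀ᵐ y : Plane, Integrable (fun ζ => f (y, ζ)) (volume.restrict (Ioo z₀ z₁)) ∧
      ∫ ζ in Ioo z₀ z₁, ‖f (y, ζ)‖ ≤ (mixedNorm z₀ z₁ 1 f).toReal := by
  filter_upwards [hf.1.prodMk_left, mixedNorm_le_iff.1 (le_refl (mixedNorm z₀ z₁ 1 f))]
    with y h1 h2
  refine ⟨memLp_one_iff_integrable.1 ⟨h1, h2.trans_lt hf.2⟩, ?_⟩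
  rw [integral_norm_eq_lintegral_enorm h1, ← eLpNorm_one_eq_lintegral_enorm]
  exact ENNReal.toReal_mono hf.2.ne h2

variable [NormedSpace ℝ F]

theorem integral_layer_eq {z₀ z₁ : ℝ} {f : Dom → F} (hf : MemLInf z₀ z₁ 1 f) {a : Plane → ℝ}
    (ha : Integrable a) :
    ∫ p, a p.1 • f p ∂(layer z₀ z₁) = ∫ y, a y • ∫ ζ in Ioo z₀ z₁, f (y, ζ) := by
  have h := integrable_mul_of_memLInf ha hf
  unfold layer at h ⊢
  rw [integral_prod _ h]
  simp only [integral_smul]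

theorem hasLineDerivAt_of_fderiv {E : Type*} [NormedAddCommGroup E] [NormedSpace ℝ E] {φ : E → ℝ}
    (hφ : ContDiff ℝ ∞ φ) (e x : E) : HasLineDerivAt ℝ φ (fderiv ℝ φ x e) x e :=
  (hφ.differentiable (by simp) x).hasFDerivAt.hasLineDerivAt e

theorem continuous_fderiv_apply {E : Type*} [NormedAddCommGroup E] [NormedSpace ℝ E] {φ : E → ℝ}
    (hφ : ContDiff ℝ ∞ φ) (e : E) : Continuous fun x => fderiv ℝ φ x e :=
  (hφ.continuous_fderiv (by simp)).clm_apply continuous_const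

theorem hasCompactSupport_fderiv_apply {E : Type*} [NormedAddCommGroup E] [NormedSpace ℝ E]
    {φ : E → ℝ} (hs : HasCompactSupport φ) (e : E) :
    HasCompactSupport fun x => fderiv ℝ φ x e :=
  (hs.fderiv ℝ).comp_left (g := fun L : E →L[ℝ] ℝ => L e) (by simp)

theorem locallyIntegrable_vertical_integral {z₀ z₁ : ℝ} {f : Dom → F} (hf : MemLInf z₀ z₁ 1 f) :
    LocallyIntegrable fun y : Plane => ∫ ζ in Ioo z₀ z₁, f (y, ζ) := by
  have hm : AEStronglyMeasurable (fun y : Plane => ∫ ζ in Ioo z₀ z₁, f (y, ζ)) volume :=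
    hf.1.integral_prod_right'
  refine LocallyIntegrable.mono (locallyIntegrable_const (mixedNorm z₀ z₁ 1 f).toReal) hm ?_
  filter_upwards [norm_vertical_integral_le hf] with y hy
  exact (norm_integral_le_integral_norm _).trans (hy.2.trans (le_abs_self _))

variable [CompleteSpace F]

/-- Integration by parts of bounded functions with a bounded weak derivative on the plane. -/
theorem HasWeakDerivOn.integral_smul_eq {i : Fin 2} {f g : Plane → F} {B : ℝ}
    (h : HasWeakDerivOn univ (unit i) f g) (hf : ∀ᵐ x, ‖f x‖ ≤ B) (hg : ∀ᵐ x, ‖g x‖ ≤ B)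
    {ψ ψ' : Plane → ℝ} (hψ : Integrable ψ) (hψ' : Integrable ψ')
    (hd : ∀ x, HasLineDerivAt ℝ ψ (ψ' x) x (unit i)) :
    ∫ x, ψ' x • f x = - ∫ x, ψ x • g x := by
  have hfl : LocallyIntegrable f := locallyIntegrableOn_univ.1 h.1
  have hgl : LocallyIntegrable g := locallyIntegrableOn_univ.1 h.2.1
  set φ : ℕ → ContDiffBump (0 : Plane) := fun n =>
    ⟨(1 / 2) * (1 / ((n : ℝ) + 1)), 1 / ((n : ℝ) + 1), by positivity,
      by have : (0 : ℝ) < 1 / ((n : ℝ) + 1) := by positivity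
         linarith⟩ with hφ
  have hr : Tendsto (fun n => (φ n).rOut) atTop (𝓝 0) := tendsto_one_div_add_atTop_nhds_zero_nat
  have hK : ∀ᶠ n in atTop, (φ n).rOut ≤ 2 * (φ n).rIn :=
    Eventually.of_forall fun n => by simp only [hφ]; linarith
  have cf := ContDiffBump.ae_convolution_tendsto_right_of_locallyIntegrable (φ := φ)
    (l := atTop) (K := 2) (μ := volume) hr hK hfl
  have cg := ContDiffBump.ae_convolution_tendsto_right_of_locallyIntegrable (φ := φ)
    (l := atTop) (K := 2) (μ := volume) hr hK hgl
  set m : ℕ → (Plane → F) → Plane → F := fun n u => convolution ((φ n).normed volume) u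
      (ContinuousLinearMap.lsmul ℝ ℝ) volume with hm
  have hbd : ∀ n (u : Plane → F), (∀ᵐ x, ‖u x‖ ≤ B) → ∀ x, ‖m n u x‖ ≤ B := by
    intro n u hu x
    have h1 : Integrable fun t => (φ n).normed volume (x - t) * B :=
      ((φ n).integrable_normed.comp_sub_left x).mul_const B
    have h2 : ∫ t, (φ n).normed volume (x - t) * B = B := by
      rw [integral_mul_const, integral_sub_left_eq_self (fun t => (φ n).normed volume t),
        (φ n).integral_normed, one_mul]
    rw [hm]
    simp only
    rw [convolution_lsmul_swap, ← h2]
    refine norm_integral_le_of_norm_le h1 (hu.mono fun t ht => ?_)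
    rw [norm_smul, Real.norm_of_nonneg ((φ n).nonneg_normed _)]
    exact mul_le_mul_of_nonneg_left ht ((φ n).nonneg_normed _)
  have hcont : ∀ n (u : Plane → F), LocallyIntegrable u → Continuous (m n u) := fun n u hu =>
    (φ n).hasCompactSupport_normed.continuous_convolution_left _ (φ n).continuous_normed hu
  have hi : ∀ n {u : Plane → F}, LocallyIntegrable u → (∀ᵐ x, ‖u x‖ ≤ B) → ∀ {a : Plane → ℝ},
      Integrable a → Integrable fun x => a x • m n u x := fun n u hu hub a ha =>
    ha.smul_bdd B (hcont n u hu).aestronglyMeasurable (Eventually.of_forall (hbd n u hub))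
  have hlim : ∀ {u : Plane → F}, LocallyIntegrable u → (∀ᵐ x, ‖u x‖ ≤ B) →
      (∀ᵐ x, Tendsto (fun n => m n u x) atTop (𝓝 (u x))) → ∀ {a : Plane → ℝ}, Integrable a →
      Tendsto (fun n => ∫ x, a x • m n u x) atTop (𝓝 (∫ x, a x • u x)) := by
    intro u hu hub hc a ha
    refine tendsto_integral_of_dominated_convergence (fun x => ‖a x‖ * B)
      (fun n => (hi n hu hub ha).1) (ha.norm.mul_const B) (fun n => Eventually.of_forall fun x => ?_)
      (hc.mono fun x hx => hx.const_smul _)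
    rw [norm_smul]
    exact mul_le_mul_of_nonneg_left (hbd n u hub x) (norm_nonneg _)
  -- The mollifications are bounded and have bounded classical derivatives, so here integrability of
  -- `ψ` and `ψ'` replaces compact support.
  have e : ∀ n, ∫ x, ψ' x • m n f x = - ∫ x, ψ x • m n g x := by
    intro n
    have h1 := integral_bilinear_hasLineDerivAt_right_eq_neg_left_of_integrable
      (μ := (volume : Measure Plane)) (B := (ContinuousLinearMap.lsmul ℝ ℝ : ℝ →L[ℝ] F →L[ℝ] F))
      (f := ψ) (f' := ψ') (g := m n f) (g' := m n g) (v := unit i)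
      (hi n hfl hf hψ') (hi n hgl hg hψ) (hi n hfl hf hψ) (fun x _ => hd x) (fun x _ => by
        have := h.hasLineDerivAt_convolution MeasurableSet.univ (by simpa using hfl) (φ n) (q := x)
          (subset_univ _)
        simpa only [indicator_univ] using this)
    simp only [ContinuousLinearMap.lsmul_apply] at h1
    rw [h1, neg_neg]
  have l1 := hlim hfl hf cf hψ'
  have l2 := (hlim hgl hg cg hψ).neg
  simp only [e] at l1
  exact tendsto_nhds_unique l1 l2

end

/-! ### Weak horizontal derivatives and the horizontal divergence -/

section Horizontal

variable {𝕜 : Type*} [RCLike 𝕜] {z₀ z₁ : ℝ}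

theorem MemLInf.bdd_mul {f : Dom → 𝕜} (hf : MemLInf z₀ z₁ 1 f) {c : ℝ → 𝕜}
    (hc : AEStronglyMeasurable c (volume.restrict (Ioo z₀ z₁))) {B : ℝ}
    (hB : ∀ ζ ∈ Ioo z₀ z₁, ‖c ζ‖ ≤ B) :
    MemLInf z₀ z₁ 1 (fun p => c p.2 * f p) := by
  refine ⟨(hc.comp_snd (μ := (volume : Measure Plane))).mul hf.1, ?_⟩
  have : mixedNorm z₀ z₁ 1 (fun p => c p.2 * f p) ≤ ENNReal.ofReal B * mixedNorm z₀ z₁ 1 f := by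
    rw [mixedNorm_le_iff]
    filter_upwards [mixedNorm_le_iff.1 (le_refl (mixedNorm z₀ z₁ 1 f))] with x hx
    refine le_trans ?_ (mul_le_mul' le_rfl hx)
    rw [eLpNorm_one_eq_lintegral_enorm, eLpNorm_one_eq_lintegral_enorm,
      ← lintegral_const_mul' _ _ ENNReal.ofReal_ne_top]
    refine setLIntegral_mono' measurableSet_Ioo fun ζ hζ => ?_
    rw [enorm_mul]
    refine mul_le_mul' ?_ le_rfl
    rw [← ofReal_norm]
    exact ENNReal.ofReal_le_ofReal (hB ζ hζ)
  exact this.trans_lt (ENNReal.mul_lt_top ENNReal.ofReal_lt_top hf.2)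

/-- A weak horizontal derivative may be tested with functions that are only bounded in the
vertical direction. -/
theorem HasWeakDerivOn.vertical_integral {i : Fin 2} {f g : Dom → 𝕜}
    (h : HasWeakDerivOn (univ ×ˢ Ioo z₀ z₁ : Set Dom) ((unit i, 0) : Dom) f g)
    (hf : MemLInf z₀ z₁ 1 f) (hg : MemLInf z₀ z₁ 1 g) {c : ℝ → 𝕜}
    (hc : AEStronglyMeasurable c (volume.restrict (Ioo z₀ z₁))) {B : ℝ}
    (hB : ∀ ζ ∈ Ioo z₀ z₁, ‖c ζ‖ ≤ B) :
    HasWeakDerivOn univ (unit i) (fun y : Plane => ∫ ζ in Ioo z₀ z₁, c ζ * f (y, ζ))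
      (fun y => ∫ ζ in Ioo z₀ z₁, c ζ * g (y, ζ)) := by
  refine ⟨locallyIntegrableOn_univ.2 (locallyIntegrable_vertical_integral (hf.bdd_mul hc hB)),
    locallyIntegrableOn_univ.2 (locallyIntegrable_vertical_integral (hg.bdd_mul hc hB)),
    fun φ hφ hs _ => ?_⟩
  rw [setIntegral_univ, setIntegral_univ]
  have hφ'i : Integrable fun x => fderiv ℝ φ x (unit i) :=
    (continuous_fderiv_apply hφ _).integrable_of_hasCompactSupport
      (hasCompactSupport_fderiv_apply hs _)
  have hφi : Integrable φ := hφ.continuous.integrable_of_hasCompactSupport hs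
  set Φ : Dom → 𝕜 := fun p => fderiv ℝ φ p.1 (unit i) • f p + φ p.1 • g p with hΦ
  have i1 := integrable_mul_of_memLInf hφ'i hf
  have i2 := integrable_mul_of_memLInf hφi hg
  have hΦi : Integrable Φ (layer z₀ z₁) := i1.add i2
  -- Testing with products `φ(y) χ(ζ)` shows that `H` vanishes almost everywhere. After that, a
  -- factor `c(ζ)` need only be bounded and measurable; later it is a vertical slice of the
  -- solution.
  set H : ℝ → 𝕜 := fun ζ => ∫ y : Plane, Φ (y, ζ) with hH
  have hHi : Integrable H (volume.restrict (Ioo z₀ z₁)) := hΦi.integral_prod_right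
  have hH0 : ∀ᵐ ζ ∂(volume.restrict (Ioo z₀ z₁)), ζ ∈ Ioo z₀ z₁ → H ζ = 0 := by
    refine isOpen_Ioo.ae_eq_zero_of_integral_contDiff_smul_eq_zero
      (hHi.locallyIntegrable.locallyIntegrableOn _) fun χ hχ hχs hχt => ?_
    have hbχ : ∃ C, ∀ z, ‖χ z‖ ≤ C := hχ.continuous.bounded_above_of_compact_support hχs
    obtain ⟨Cχ, hCχ⟩ := hbχ
    have h1 := h.2.2 (fun p : Dom => φ p.1 * χ p.2) ((hφ.comp contDiff_fst).mul
      (hχ.comp contDiff_snd)) (by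
        refine HasCompactSupport.of_support_subset_isCompact
          ((show IsCompact (tsupport φ) from hs).prod (show IsCompact (tsupport χ) from hχs)) ?_
        intro p hp
        rw [Function.mem_support, mul_ne_zero_iff] at hp
        exact ⟨subset_tsupport _ hp.1, subset_tsupport _ hp.2⟩) (by
        refine Subset.trans (closure_minimal (t := univ ×ˢ tsupport χ) ?_
          (isClosed_univ.prod (isClosed_tsupport _))) (prod_mono Subset.rfl hχt)
        intro p hp
        rw [Function.mem_support, mul_ne_zero_iff] at hp
        exact ⟨mem_univ _, subset_tsupport _ hp.2⟩)
    have hd : ∀ p : Dom, fderiv ℝ (fun p : Dom => φ p.1 * χ p.2) p ((unit i, 0) : Dom) =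
        χ p.2 * fderiv ℝ φ p.1 (unit i) := by
      intro p
      have a1 : HasFDerivAt (fun p : Dom => φ p.1) ((fderiv ℝ φ p.1).comp
          (ContinuousLinearMap.fst ℝ Plane ℝ)) p :=
        (hφ.differentiable (by simp) p.1).hasFDerivAt.comp p hasFDerivAt_fst
      have a2 : HasFDerivAt (fun p : Dom => χ p.2) ((fderiv ℝ χ p.2).comp
          (ContinuousLinearMap.snd ℝ Plane ℝ)) p :=
        (hχ.differentiable (by simp) p.2).hasFDerivAt.comp p hasFDerivAt_snd
      rw [(a1.fun_mul a2).fderiv]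
      simp
    simp only [hd] at h1
    rw [← layer_eq] at h1
    have j1 : Integrable (fun p : Dom => χ p.2 • (fderiv ℝ φ p.1 (unit i) • f p)) (layer z₀ z₁) :=
      i1.bdd_smul Cχ (hχ.continuous.comp continuous_snd).aestronglyMeasurable
        (Eventually.of_forall fun p => hCχ p.2)
    have j2 : Integrable (fun p : Dom => χ p.2 • (φ p.1 • g p)) (layer z₀ z₁) :=
      i2.bdd_smul Cχ (hχ.continuous.comp continuous_snd).aestronglyMeasurable
        (Eventually.of_forall fun p => hCχ p.2)
    have h2 : ∫ p, χ p.2 • Φ p ∂(layer z₀ z₁) = 0 := by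
      simp only [hΦ, smul_add]
      rw [integral_add j1 j2, ← eq_neg_iff_add_eq_zero]
      simp only [smul_smul]
      rw [h1]
      simp only [mul_comm]
    have h3 : Integrable (fun p : Dom => χ p.2 • Φ p) (layer z₀ z₁) := by
      simp only [hΦ, smul_add]
      exact j1.add j2
    unfold layer at h2 h3
    rw [integral_prod_symm _ h3] at h2
    simpa only [integral_smul] using h2
  have hH0' : ∀ᵐ ζ ∂(volume.restrict (Ioo z₀ z₁)), H ζ = 0 := by
    filter_upwards [hH0, ae_restrict_mem measurableSet_Ioo] with ζ h1 h2 using h1 h2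
  have k1 : Integrable (fun p : Dom => c p.2 * Φ p) (layer z₀ z₁) := by
    have := hΦi.bdd_mul (c := B) (f := fun p : Dom => c p.2) (hc.comp_snd) (by
      have : ∀ᵐ p : Dom ∂(layer z₀ z₁), p ∈ (univ ×ˢ Ioo z₀ z₁ : Set Dom) := by
        rw [layer_eq]; exact ae_restrict_mem (measurableSet_dom z₀ z₁)
      exact this.mono fun p hp => hB p.2 hp.2)
    exact this
  have k2 : ∫ p, c p.2 * Φ p ∂(layer z₀ z₁) = 0 := by
    unfold layer at k1 ⊢
    rw [integral_prod_symm _ k1]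
    rw [integral_eq_zero_of_ae]
    filter_upwards [hH0'] with ζ hζ
    rw [integral_const_mul]
    change c ζ * H ζ = 0
    rw [hζ, mul_zero]
  have e : ∀ p : Dom, c p.2 * Φ p = fderiv ℝ φ p.1 (unit i) • (c p.2 * f p) +
      φ p.1 • (c p.2 * g p) := by
    intro p
    simp only [hΦ, mul_add, mul_smul_comm]
  simp only [e] at k2
  rw [integral_add (integrable_mul_of_memLInf hφ'i (hf.bdd_mul hc hB))
    (integrable_mul_of_memLInf hφi (hg.bdd_mul hc hB)), integral_layer_eq (hf.bdd_mul hc hB) hφ'i,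
    integral_layer_eq (hg.bdd_mul hc hB) hφi] at k2
  exact eq_neg_of_add_eq_zero_left k2

/-- Integration by parts against a product kernel. -/
theorem HasWeakDerivOn.integral_kernel_eq {i : Fin 2} {f g : Dom → 𝕜}
    (h : HasWeakDerivOn (univ ×ˢ Ioo z₀ z₁ : Set Dom) ((unit i, 0) : Dom) f g)
    (hf : MemLInf z₀ z₁ 1 f) (hg : MemLInf z₀ z₁ 1 g) {c : ℝ → 𝕜}
    (hc : AEStronglyMeasurable c (volume.restrict (Ioo z₀ z₁))) {B : ℝ}
    (hB : ∀ ζ ∈ Ioo z₀ z₁, ‖c ζ‖ ≤ B) {ψ ψ' : Plane → ℝ} (hψ : Integrable ψ)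
    (hψ' : Integrable ψ') (hd : ∀ x, HasLineDerivAt ℝ ψ (ψ' x) x (unit i)) (x : Plane) :
    ∫ p, ψ' (x - p.1) • (c p.2 * f p) ∂(layer z₀ z₁) =
      ∫ p, ψ (x - p.1) • (c p.2 * g p) ∂(layer z₀ z₁) := by
  have hf' := hf.bdd_mul hc hB
  have hg' := hg.bdd_mul hc hB
  set M := max (mixedNorm z₀ z₁ 1 (fun p => c p.2 * f p)).toReal
    (mixedNorm z₀ z₁ 1 (fun p => c p.2 * g p)).toReal with hM
  have h1 := (h.vertical_integral hf hg hc hB).integral_smul_eq (B := M)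
    ((norm_vertical_integral_le hf').mono fun y hy =>
      (norm_integral_le_integral_norm _).trans (hy.2.trans (le_max_left _ _)))
    ((norm_vertical_integral_le hg').mono fun y hy =>
      (norm_integral_le_integral_norm _).trans (hy.2.trans (le_max_right _ _)))
    (ψ := fun y => ψ (x - y)) (ψ' := fun y => -ψ' (x - y)) (hψ.comp_sub_left x)
    (hψ'.comp_sub_left x).neg (fun y => by
      have h2 := hasLineDerivAt_add (l := i) hd (x - y) 0
      rw [zero_smul, add_zero] at h2
      have h4 : HasDerivAt (fun s : ℝ => ψ (x - y + s • unit i)) (ψ' (x - y)) (-0) := by simpa using h2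
      have h5 := (h4.scomp (0 : ℝ) (hasDerivAt_neg (0 : ℝ)))
      unfold HasLineDerivAt
      simp only [Function.comp_def, neg_smul, one_smul] at h5
      convert h5 using 2
      rename_i s
      change ψ (x - (y + s • unit i)) = _
      congr 1
      abel)
  rw [integral_layer_eq hf' (hψ'.comp_sub_left x), integral_layer_eq hg' (hψ.comp_sub_left x)]
  simp only [neg_smul, integral_neg, neg_inj] at h1
  exact h1

theorem HasWeakDerivOn.coord {E : Type*} [NormedAddCommGroup E] [NormedSpace ℝ E]
    [MeasureSpace E] {U : Set E} {e : E} {f g : E → Vec 𝕜} (h : HasWeakDerivOn U e f g)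
    [OpensMeasurableSpace E]
    (i : Fin 2) :
    HasWeakDerivOn U e (fun x => f x i) (fun x => g x i) := by
  have L : ∀ u : E → Vec 𝕜, LocallyIntegrableOn u U → LocallyIntegrableOn (fun x => u x i) U := by
    intro u hu x hx
    obtain ⟨s, hs, hi⟩ := hu x hx
    exact ⟨s, hs, (EuclideanSpace.proj (𝕜 := 𝕜) i).integrable_comp hi⟩
  refine ⟨L _ h.1, L _ h.2.1, fun φ h1 h2 h3 => ?_⟩
  have I : ∀ (a : E → ℝ) (u : E → Vec 𝕜), Continuous a → HasCompactSupport a → tsupport a ⊆ U →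
      LocallyIntegrableOn u U → ∫ x in U, a x • u x i = (∫ x in U, a x • u x) i := by
    intro a u ha hs ht hu
    have hi : Integrable (fun x => a x • u x) (volume.restrict U) := by
      have hu' : IntegrableOn u (tsupport a) := hu.integrableOn_compact_subset ht hs
      have h4 : IntegrableOn (fun x => a x • u x) (tsupport a) := by
        obtain ⟨C, hC⟩ := ha.bounded_above_of_compact_support hs
        exact hu'.bdd_smul C ha.aestronglyMeasurable (Eventually.of_forall hC)
      exact ((integrableOn_iff_integrable_of_support_subset (fun x hx => subset_tsupport _ (by
        rw [Function.mem_support] at hx ⊢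
        exact fun h0 => hx (by simp [h0])))).1 h4).restrict
    exact (EuclideanSpace.proj (𝕜 := 𝕜) i).integral_comp_comm hi
  have ht : tsupport (fun x => fderiv ℝ φ x e) ⊆ U :=
    (closure_minimal (fun x hx => by
      by_contra hn
      have : fderiv ℝ φ x = 0 := by
        by_contra h5
        exact hn (support_fderiv_subset ℝ h5)
      exact hx (by simp [this])) (isClosed_tsupport _)).trans h3
  rw [I _ _ (continuous_fderiv_apply h1 e) (hasCompactSupport_fderiv_apply h2 e) ht h.1,
    I _ _ h1.continuous h2 h3 h.2.1, h.2.2 φ h1 h2 h3]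
  simp

theorem MemLInf.coord {p : ℝ≥0∞} {f : Dom → Vec 𝕜} (hf : MemLInf z₀ z₁ p f) (i : Fin 2) :
    MemLInf z₀ z₁ p (fun q => f q i) :=
  ⟨(EuclideanSpace.proj (𝕜 := 𝕜) i).continuous.comp_aestronglyMeasurable hf.1,
    (mixedNorm_mono (Eventually.of_forall fun q => norm_coord_le (f q) i)).trans_lt hf.2⟩

/-- The horizontal divergence. -/
def hdiv (DH : Fin 2 → Dom → Vec 𝕜) (q : Dom) : 𝕜 := ∑ i, DH i q i

theorem memLInf_hdiv {DH : Fin 2 → Dom → Vec 𝕜} (h : ∀ i, MemLInf z₀ z₁ 1 (DH i)) :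
    MemLInf z₀ z₁ 1 (hdiv DH) ∧
      mixedNorm z₀ z₁ 1 (hdiv DH) ≤ ∑ i, mixedNorm z₀ z₁ 1 (DH i) := by
  have hm : ∀ i, AEStronglyMeasurable (fun q => DH i q i) (layer z₀ z₁) := fun i => ((h i).coord i).1
  have hle : mixedNorm z₀ z₁ 1 (hdiv DH) ≤ ∑ i, mixedNorm z₀ z₁ 1 (DH i) := by
    rw [mixedNorm_le_iff]
    have h1 : ∀ᵐ x : Plane, ∀ i, eLpNorm (fun z => DH i (x, z)) 1 (volume.restrict (Ioo z₀ z₁)) ≤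
        mixedNorm z₀ z₁ 1 (DH i) := ae_all_iff.2 fun i => mixedNorm_le_iff.1 le_rfl
    have h2 : ∀ᵐ x : Plane, ∀ i, AEStronglyMeasurable (fun z => DH i (x, z) i)
        (volume.restrict (Ioo z₀ z₁)) := ae_all_iff.2 fun i => (hm i).prodMk_left
    filter_upwards [h1, h2] with x hx hx2
    have e : (fun z => hdiv DH (x, z)) = ∑ i, fun z => DH i (x, z) i := by
      funext z; simp [hdiv]
    rw [e]
    refine (eLpNorm_sum_le (fun i _ => hx2 i) le_rfl).trans (Finset.sum_le_sum fun i _ => ?_)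
    exact (eLpNorm_mono fun z => norm_coord_le _ i).trans (hx i)
  refine ⟨⟨?_, hle.trans_lt (ENNReal.sum_lt_top.2 fun i _ => (h i).2)⟩, hle⟩
  have : hdiv DH = ∑ i, fun q => DH i q i := by funext q; simp [hdiv]
  rw [this]
  exact Finset.aestronglyMeasurable_sum _ fun i _ => hm i

/-- The vertical average of a solenoidal field is divergence free. -/
theorem integral_hdiv_eq_zero (hz : z₀ < z₁) {v : Dom → Vec 𝕜} {DH : Fin 2 → Dom → Vec 𝕜}
    (hv : MemLInf z₀ z₁ 1 v) (hD : ∀ i, MemLInf z₀ z₁ 1 (DH i)) (hs : Solenoidal z₀ z₁ v)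
    (h : ∀ i, HasWeakDerivOn (univ ×ˢ Ioo z₀ z₁ : Set Dom) ((unit i, 0) : Dom) v (DH i)) :
    ∀ᵐ x : Plane, ∫ ζ in Ioo z₀ z₁, hdiv DH (x, ζ) = 0 := by
  refine ae_eq_zero_of_integral_contDiff_smul_eq_zero
    (locallyIntegrable_vertical_integral (memLInf_hdiv hD).1) fun φ hφ hφs => ?_
  have hφ'i : ∀ i, Integrable fun x => fderiv ℝ φ x (unit i) := fun i =>
    (continuous_fderiv_apply hφ _).integrable_of_hasCompactSupport
      (hasCompactSupport_fderiv_apply hφs _)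
  have hφi : Integrable φ := hφ.continuous.integrable_of_hasCompactSupport hφs
  -- Solenoidality is tested with weak gradients, so the classical gradient of `φ` has to be
  -- recognized as a weak one.
  have hsol := hs φ (fun i x => fderiv ℝ φ x (unit i)) hφi.locallyIntegrable hφ'i (fun i => by
    refine ⟨hφi.locallyIntegrable.locallyIntegrableOn _,
      (hφ'i i).locallyIntegrable.locallyIntegrableOn _, fun ψ hψ hψs _ => ?_⟩
    rw [setIntegral_univ, setIntegral_univ]
    simp only [smul_eq_mul]
    have hm : ∀ {a b : Plane → ℝ}, Continuous a → Continuous b → HasCompactSupport a →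
        Integrable fun x => a x * b x := fun ha hb hs =>
      (ha.mul hb).integrable_of_hasCompactSupport (hs.mul_right)
    have h1 := integral_bilinear_hasLineDerivAt_right_eq_neg_left_of_integrable
      (μ := (volume : Measure Plane)) (B := ContinuousLinearMap.mul ℝ ℝ)
      (f := ψ) (f' := fun x => fderiv ℝ ψ x (unit i)) (g := φ)
      (g' := fun x => fderiv ℝ φ x (unit i)) (v := unit i)
      (hm (continuous_fderiv_apply hψ _) hφ.continuous (hasCompactSupport_fderiv_apply hψs _))
      (hm hψ.continuous (continuous_fderiv_apply hφ _) hψs)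
      (hm hψ.continuous hφ.continuous hψs) (fun x _ => hasLineDerivAt_of_fderiv hψ _ x)
      (fun x _ => hasLineDerivAt_of_fderiv hφ _ x)
    simp only [ContinuousLinearMap.mul_apply'] at h1
    rw [h1, neg_neg])
  have key : ∀ i, ∫ y, fderiv ℝ φ y (unit i) • ∫ ζ in Ioo z₀ z₁, v (y, ζ) i =
      - ∫ y, φ y • ∫ ζ in Ioo z₀ z₁, DH i (y, ζ) i := by
    intro i
    have h1 := (((h i).coord i).vertical_integral (hv.coord i)
      ((hD i).coord i) (c := fun _ => 1) aestronglyMeasurable_const (B := 1) (by simp)).2.2 φ hφ hφs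
      (subset_univ _)
    simpa using h1
  have bnd : ∀ {f : Dom → 𝕜}, MemLInf z₀ z₁ 1 f → ∀ {a : Plane → ℝ}, Integrable a →
      Integrable fun y => a y • ∫ ζ in Ioo z₀ z₁, f (y, ζ) := by
    intro f hf a ha
    have hm : AEStronglyMeasurable (fun y : Plane => ∫ ζ in Ioo z₀ z₁, f (y, ζ)) volume :=
      hf.1.integral_prod_right'
    exact ha.smul_bdd _ hm ((norm_vertical_integral_le hf).mono fun y hy =>
      (norm_integral_le_integral_norm _).trans hy.2)
  have e1 : ∀ᵐ x : Plane, ∑ i, fderiv ℝ φ x (unit i) • mean z₀ z₁ v x i =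
      (z₁ - z₀)⁻¹ • ∑ i, fderiv ℝ φ x (unit i) • ∫ ζ in Ioo z₀ z₁, v (x, ζ) i := by
    filter_upwards [norm_vertical_integral_le hv] with x hx
    rw [Finset.smul_sum]
    refine Finset.sum_congr rfl fun i _ => ?_
    rw [mean, PiLp.smul_apply, smul_comm]
    congr 2
    exact ((EuclideanSpace.proj (𝕜 := 𝕜) i).integral_comp_comm hx.1).symm
  rw [integral_congr_ae e1, integral_smul, smul_eq_zero_iff_right (by
    exact inv_ne_zero (by linarith)), integral_finsetSum _ fun i _ => bnd (hv.coord i) (hφ'i i)]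
    at hsol
  simp only [key] at hsol
  rw [Finset.sum_neg_distrib, neg_eq_zero,
    ← integral_finsetSum _ fun i _ => bnd ((hD i).coord i) hφi] at hsol
  rw [← hsol]
  refine integral_congr_ae ?_
  have h2 : ∀ᵐ x : Plane, ∀ i, Integrable (fun ζ => DH i (x, ζ) i) (volume.restrict (Ioo z₀ z₁)) :=
    ae_all_iff.2 fun i => (norm_vertical_integral_le ((hD i).coord i)).mono fun _ hy => hy.1
  filter_upwards [h2] with x hx
  rw [← Finset.smul_sum, ← integral_finsetSum _ fun i _ => hx i]
  rfl

end Horizontal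

/-! ### The vertical velocity -/

section Vertical

variable {𝕜 : Type*} [RCLike 𝕜] {z₀ z₁ : ℝ}

/-- With an indicator the domain of integration no longer depends on `z`, as Fubini and the
measurability of `w` require. -/
theorem vertVel_eq_integral_indicator {DH : Fin 2 → Dom → Vec 𝕜} {x : Plane} {z : ℝ}
    (hz : z ∈ Ioo z₀ z₁) :
    vertVel z₁ DH (x, z) = ∫ ζ in Ioo z₀ z₁, (Ioi z).indicator (fun ζ => hdiv DH (x, ζ)) ζ := by
  rw [integral_indicator measurableSet_Ioi, Measure.restrict_restrict measurableSet_Ioi]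
  have : Ioi z ∩ Ioo z₀ z₁ = Ioo z z₁ := by
    ext ζ
    simp only [mem_inter_iff, mem_Ioi, mem_Ioo]
    exact ⟨fun h => ⟨h.1, h.2.2⟩, fun h => ⟨h.1, hz.1.trans h.1, h.2⟩⟩
  rw [this, ← integral_Ioc_eq_integral_Ioo, vertVel, intervalIntegral.integral_of_le hz.2.le]
  rfl

theorem ae_layer_mem : ∀ᵐ p ∂(layer z₀ z₁), p.2 ∈ Ioo z₀ z₁ := by
  rw [layer_eq]
  exact (ae_restrict_mem (measurableSet_dom z₀ z₁)).mono fun p hp => hp.2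

theorem ae_layer_of_ae_plane {P : Plane → Prop} (h : ∀ᵐ x, P x) : ∀ᵐ p ∂(layer z₀ z₁), P p.1 :=
  Measure.quasiMeasurePreserving_fst.ae h

theorem norm_vertVel_le {DH : Fin 2 → Dom → Vec 𝕜} (hD : ∀ i, MemLInf z₀ z₁ 1 (DH i)) :
    ∀ᵐ x : Plane, ∀ z ∈ Ioo z₀ z₁,
      ‖vertVel z₁ DH (x, z)‖ ≤ (mixedNorm z₀ z₁ 1 (hdiv DH)).toReal := by
  filter_upwards [norm_vertical_integral_le (memLInf_hdiv hD).1] with x hx z hz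
  rw [vertVel_eq_integral_indicator hz]
  refine (norm_integral_le_integral_norm _).trans (le_trans ?_ hx.2)
  refine integral_mono_of_nonneg (Eventually.of_forall fun _ => norm_nonneg _) hx.1.norm
    (Eventually.of_forall fun ζ => ?_)
  exact norm_indicator_le_norm_self _ _

theorem aestronglyMeasurable_vertVel {DH : Fin 2 → Dom → Vec 𝕜}
    (hD : ∀ i, MemLInf z₀ z₁ 1 (DH i)) :
    AEStronglyMeasurable (vertVel z₁ DH) (layer z₀ z₁) := by
  obtain ⟨d, hdm, hde⟩ := (memLInf_hdiv hD).1.1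
  have hm : StronglyMeasurable fun q : Dom => ∫ ζ in Ioo z₀ z₁,
      (Ioi q.2).indicator (fun ζ => d (q.1, ζ)) ζ := by
    have h1 : StronglyMeasurable fun P : Dom × ℝ =>
        {P : Dom × ℝ | P.1.2 < P.2}.indicator (fun P => d (P.1.1, P.2)) P :=
      (hdm.comp_measurable (by fun_prop)).indicator
        (measurableSet_lt (by fun_prop) (by fun_prop))
    exact h1.integral_prod_right
  refine ⟨_, hm, ?_⟩
  filter_upwards [ae_layer_mem, ae_layer_of_ae_plane (Measure.ae_ae_of_ae_prod hde)] with q hq h2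
  rw [show q = (q.1, q.2) from rfl, vertVel_eq_integral_indicator hq]
  refine integral_congr_ae (h2.mono fun ζ hζ => ?_)
  by_cases h : ζ ∈ Ioi q.2 <;> simp [h, hζ]

/-- Integration by parts for a divergence that is only integrable, by Fubini on the triangle `ζ <
ξ`. The vertical velocity vanishes at `z₁` by definition, and at `z₀` because the divergence has
zero vertical integral; the latter removes the term with `μ z₀`. -/
theorem integral_deriv_smul_vertVel {DH : Fin 2 → Dom → Vec 𝕜} {x : Plane}
    (hi : Integrable (fun ζ => hdiv DH (x, ζ)) (volume.restrict (Ioo z₀ z₁)))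
    (h0 : ∫ ζ in Ioo z₀ z₁, hdiv DH (x, ζ) = 0) {μ μ' : ℝ → ℝ}
    (hμ : ∀ ζ, HasDerivAt μ (μ' ζ) ζ) (hc : Continuous μ') :
    ∫ ζ in Ioo z₀ z₁, μ' ζ • vertVel z₁ DH (x, ζ) = ∫ ζ in Ioo z₀ z₁, μ ζ • hdiv DH (x, ζ) := by
  set ν := volume.restrict (Ioo z₀ z₁) with hν
  have hμc : Continuous μ := continuous_iff_continuousAt.2 fun ζ => (hμ ζ).continuousAt
  have bd : ∀ {a : ℝ → ℝ}, Continuous a → ∃ B, ∀ᵐ ζ ∂ν, ‖a ζ‖ ≤ B := fun {a} ha => by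
    obtain ⟨B, hB⟩ := isCompact_Icc.exists_bound_of_continuousOn (s := Icc z₀ z₁) ha.continuousOn
    exact ⟨B, (ae_restrict_mem measurableSet_Ioo).mono fun ζ hζ => hB ζ (Ioo_subset_Icc_self hζ)⟩
  obtain ⟨B, hB⟩ := bd hc
  obtain ⟨B', hB'⟩ := bd hμc
  have hm' : Integrable μ' ν := (hc.integrableOn_Icc).mono_set Ioo_subset_Icc_self
  have e1 : ∫ ζ, μ' ζ • vertVel z₁ DH (x, ζ) ∂ν =
      ∫ ζ, ∫ ξ, {P : ℝ × ℝ | P.1 < P.2}.indicator (fun P => μ' P.1 • hdiv DH (x, P.2)) (ζ, ξ) ∂ν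
        ∂ν := by
    refine integral_congr_ae ((ae_restrict_mem measurableSet_Ioo).mono fun ζ hζ => ?_)
    simp only
    rw [vertVel_eq_integral_indicator hζ, ← integral_smul]
    refine integral_congr_ae (Eventually.of_forall fun ξ => ?_)
    by_cases h : ζ < ξ <;> simp [h]
  have hint : Integrable (Function.uncurry fun ζ ξ => {P : ℝ × ℝ | P.1 < P.2}.indicator
      (fun P => μ' P.1 • hdiv DH (x, P.2)) (ζ, ξ)) (ν.prod ν) := by
    have h1 : Integrable (fun P : ℝ × ℝ => μ' P.1 • hdiv DH (x, P.2)) (ν.prod ν) := hm'.smul_prod hi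
    exact h1.indicator (measurableSet_lt measurable_fst measurable_snd)
  rw [e1, integral_integral_swap hint]
  have e2 : ∀ ξ ∈ Ioo z₀ z₁, ∫ ζ, {P : ℝ × ℝ | P.1 < P.2}.indicator
      (fun P => μ' P.1 • hdiv DH (x, P.2)) (ζ, ξ) ∂ν = (μ ξ - μ z₀) • hdiv DH (x, ξ) := by
    intro ξ hξ
    have h1 : ∀ ζ, {P : ℝ × ℝ | P.1 < P.2}.indicator
      (fun P => μ' P.1 • hdiv DH (x, P.2)) (ζ, ξ) = (Iio ξ).indicator μ' ζ • hdiv DH (x, ξ) := by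
      intro ζ
      by_cases h : ζ < ξ <;> simp [h]
    simp only [h1]
    rw [integral_smul_const, integral_indicator measurableSet_Iio, hν,
      Measure.restrict_restrict measurableSet_Iio]
    have h2 : Iio ξ ∩ Ioo z₀ z₁ = Ioo z₀ ξ := by
      ext ζ
      simp only [mem_inter_iff, mem_Iio, mem_Ioo]
      exact ⟨fun h => ⟨h.2.1, h.1⟩, fun h => ⟨h.2, h.1, h.2.trans hξ.2⟩⟩
    rw [h2, ← integral_Ioc_eq_integral_Ioo, ← intervalIntegral.integral_of_le hξ.1.le,
      intervalIntegral.integral_eq_sub_of_hasDerivAt (fun s _ => hμ s) (hc.intervalIntegrable _ _)]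
  rw [hν, setIntegral_congr_fun measurableSet_Ioo e2, ← hν]
  simp only [sub_smul]
  have i1 : Integrable (fun ξ => μ ξ • hdiv DH (x, ξ)) ν :=
    hi.bdd_smul B' hμc.aestronglyMeasurable hB'
  have i2 : Integrable (fun ξ => μ z₀ • hdiv DH (x, ξ)) ν :=
    (hi.smul (μ z₀)).congr (Eventually.of_forall fun _ => rfl)
  rw [integral_sub i1 i2, integral_smul, h0, smul_zero, sub_zero]

/-- A solenoidal velocity field with weak horizontal derivatives, with a bound for `(v, w)`. -/
structure IsSlice (z₀ z₁ : ℝ) (v : Dom → Vec 𝕜) (DH : Fin 2 → Dom → Vec 𝕜) (U : ℝ) : Prop where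
  memv : MemLInf z₀ z₁ 1 v
  memD : ∀ i, MemLInf z₀ z₁ 1 (DH i)
  sol : Solenoidal z₀ z₁ v
  weak : ∀ i, HasWeakDerivOn (univ ×ˢ Ioo z₀ z₁ : Set Dom) ((unit i, 0) : Dom) v (DH i)
  nonneg : 0 ≤ U
  bound : ∀ᵐ p ∂(layer z₀ z₁), ‖v p‖ ≤ U
  div_le : mixedNorm z₀ z₁ 1 (hdiv DH) ≤ ENNReal.ofReal U

theorem IsSlice.vel_le {v : Dom → Vec 𝕜} {DH : Fin 2 → Dom → Vec 𝕜} {U : ℝ}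
    (h : IsSlice z₀ z₁ v DH U) (i : Fin 3) : ∀ᵐ p ∂(layer z₀ z₁), ‖vel z₁ v DH i p‖ ≤ U := by
  induction i using Fin.lastCases with
  | last =>
    rw [vel_last]
    filter_upwards [ae_layer_mem, ae_layer_of_ae_plane (norm_vertVel_le h.memD)] with p hp h2
    exact (h2 p.2 hp).trans (ENNReal.toReal_le_of_le_ofReal h.nonneg h.div_le)
  | cast j =>
    rw [vel_castSucc]
    exact h.bound.mono fun p hp => (norm_coord_le _ _).trans hp

theorem IsSlice.vel_measurable {v : Dom → Vec 𝕜} {DH : Fin 2 → Dom → Vec 𝕜} {U : ℝ}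
    (h : IsSlice z₀ z₁ v DH U) (i : Fin 3) : AEStronglyMeasurable (vel z₁ v DH i) (layer z₀ z₁) := by
  induction i using Fin.lastCases with
  | last => rw [vel_last]; exact aestronglyMeasurable_vertVel h.memD
  | cast j => rw [vel_castSucc]; exact (h.memv.coord j).1

theorem IsSlice.flux_measurable {v c : Dom → Vec 𝕜} {DH : Fin 2 → Dom → Vec 𝕜} {U : ℝ}
    (h : IsSlice z₀ z₁ v DH U) (hc : AEStronglyMeasurable c (layer z₀ z₁)) (i : Fin 3) :
    AEStronglyMeasurable (flux (vel z₁ v DH) c i) (layer z₀ z₁) :=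
  (h.vel_measurable i).smul hc

theorem mixedNorm_le_of_norm_le {E E' : Type*} [NormedAddCommGroup E] [NormedAddCommGroup E']
    {p : ℝ≥0∞} {B : ℝ} {f : Dom → E} {g : Dom → E'}
    (h : ∀ᵐ q ∂(layer z₀ z₁), ‖f q‖ ≤ B * ‖g q‖) :
    mixedNorm z₀ z₁ p f ≤ ENNReal.ofReal B * mixedNorm z₀ z₁ p g := by
  rw [mixedNorm_le_iff]
  filter_upwards [mixedNorm_le_iff.1 (le_refl (mixedNorm z₀ z₁ p g)), Measure.ae_ae_of_ae_prod h]
    with x hx hm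
  refine (eLpNorm_le_mul_eLpNorm_of_ae_le_mul hm p).trans ?_
  gcongr

theorem IsSlice.mixedNorm_flux_le {v c : Dom → Vec 𝕜} {DH : Fin 2 → Dom → Vec 𝕜} {U : ℝ}
    (h : IsSlice z₀ z₁ v DH U) {p : ℝ≥0∞} (i : Fin 3) :
    mixedNorm z₀ z₁ p (flux (vel z₁ v DH) c i) ≤ ENNReal.ofReal U * mixedNorm z₀ z₁ p c :=
  mixedNorm_le_of_norm_le ((h.vel_le i).mono fun q hq => by
    rw [flux, norm_smul]
    exact mul_le_mul_of_nonneg_right hq (norm_nonneg _))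

theorem IsSlice.memLInf_flux {v c : Dom → Vec 𝕜} {DH : Fin 2 → Dom → Vec 𝕜} {U : ℝ}
    (h : IsSlice z₀ z₁ v DH U) {p : ℝ≥0∞} (hc : MemLInf z₀ z₁ p c) (i : Fin 3) :
    MemLInf z₀ z₁ p (flux (vel z₁ v DH) c i) :=
  ⟨h.flux_measurable hc.1 i,
    (h.mixedNorm_flux_le i).trans_lt (ENNReal.mul_lt_top ENNReal.ofReal_lt_top hc.2)⟩

/-- The transport operator annihilates constants: `S(τ)∇·(u ⊗ c) = 0`. -/
theorem IsSlice.local_cancel (hz : z₀ < z₁) {v : Dom → Vec 𝕜} {DH : Fin 2 → Dom → Vec 𝕜} {U : ℝ}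
    (h : IsSlice z₀ z₁ v DH U) {ψ : Plane → ℝ} {ψ' : Fin 2 → Plane → ℝ} (hψ : Integrable ψ)
    (hψ' : ∀ j, Integrable (ψ' j)) (hd : ∀ j x, HasLineDerivAt ℝ ψ (ψ' j x) x (unit j))
    {μ μ' : ℝ → ℝ} (hμ : ∀ ζ, HasDerivAt μ (μ' ζ) ζ) (hc : Continuous μ') (x : Plane) :
    ∑ j, ∫ p, (ψ' j (x - p.1) * μ p.2) • vel z₁ v DH j.castSucc p ∂(layer z₀ z₁) =
      ∫ p, (ψ (x - p.1) * μ' p.2) • vel z₁ v DH (Fin.last 2) p ∂(layer z₀ z₁) := by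
  have hμc : Continuous μ := continuous_iff_continuousAt.2 fun ζ => (hμ ζ).continuousAt
  have bd : ∀ {a : ℝ → ℝ}, Continuous a → ∃ B, ∀ ζ ∈ Ioo z₀ z₁, ‖(a ζ : 𝕜)‖ ≤ B := fun {a} ha => by
    obtain ⟨B, hB⟩ := isCompact_Icc.exists_bound_of_continuousOn (s := Icc z₀ z₁) ha.continuousOn
    exact ⟨B, fun ζ hζ => by simpa using hB ζ (Ioo_subset_Icc_self hζ)⟩
  have cm : ∀ {a : ℝ → ℝ}, Continuous a →
      AEStronglyMeasurable (fun ζ => (a ζ : 𝕜)) (volume.restrict (Ioo z₀ z₁)) := fun {a} ha =>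
    (RCLike.continuous_ofReal.comp ha).aestronglyMeasurable
  obtain ⟨B, hB⟩ := bd hμc
  obtain ⟨B', hB'⟩ := bd hc
  -- The horizontal derivatives pass from the kernel to `v`, so that the sum over `j` produces the
  -- divergence.
  have e1 : ∀ j : Fin 2, ∫ p, (ψ' j (x - p.1) * μ p.2) • vel z₁ v DH j.castSucc p ∂(layer z₀ z₁) =
      ∫ p, ψ (x - p.1) • ((μ p.2 : 𝕜) * DH j p j) ∂(layer z₀ z₁) := by
    intro j
    rw [← ((h.weak j).coord j).integral_kernel_eq (h.memv.coord j) ((h.memD j).coord j) (cm hμc) hB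
      hψ (hψ' j) (hd j) x, vel_castSucc]
    refine integral_congr_ae (Eventually.of_forall fun p => ?_)
    simp only [mul_smul, RCLike.real_smul_eq_coe_mul]
  have hI : ∀ j, Integrable (fun p => ψ (x - p.1) • ((μ p.2 : 𝕜) * DH j p j)) (layer z₀ z₁) :=
    fun j => integrable_mul_of_memLInf (hψ.comp_sub_left x)
      (((h.memD j).coord j).bdd_mul (cm hμc) hB)
  simp only [e1]
  rw [← integral_finsetSum _ fun j _ => hI j]
  have e2 : ∀ p : Dom, ∑ j, ψ (x - p.1) • ((μ p.2 : 𝕜) * DH j p j) =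
      ψ (x - p.1) • ((μ p.2 : 𝕜) * hdiv DH p) := fun p => by
    rw [hdiv, Finset.mul_sum, Finset.smul_sum]
  simp only [e2]
  have hdm := (memLInf_hdiv h.memD).1
  have hwm : MemLInf z₀ z₁ 1 (vertVel z₁ DH) := by
    refine ⟨aestronglyMeasurable_vertVel h.memD, ?_⟩
    have h1 := mixedNorm_le_of_norm_le (p := 1) (g := fun _ : Dom => (1 : ℝ))
      ((h.vel_le (Fin.last 2)).mono fun p hp => by simpa using hp)
    rw [← vel_last z₁ v DH]
    refine h1.trans_lt (ENNReal.mul_lt_top ENNReal.ofReal_lt_top ?_)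
    refine lt_of_le_of_lt (b := ENNReal.ofReal (z₁ - z₀)) (mixedNorm_le_iff.2
      (Eventually.of_forall fun x => ?_)) ENNReal.ofReal_lt_top
    simp [eLpNorm_one_eq_lintegral_enorm]
  rw [integral_layer_eq (hdm.bdd_mul (cm hμc) hB) (hψ.comp_sub_left x), vel_last]
  have e3 : ∀ p : Dom, (ψ (x - p.1) * μ' p.2) • vertVel z₁ DH p =
      ψ (x - p.1) • ((μ' p.2 : 𝕜) * vertVel z₁ DH p) := fun p => by
    rw [mul_smul, RCLike.real_smul_eq_coe_mul (μ' p.2)]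
  simp only [e3]
  rw [integral_layer_eq (hwm.bdd_mul (cm hc) hB') (hψ.comp_sub_left x)]
  refine integral_congr_ae ?_
  -- What remains is `∂_z w = -div_H v`, tested with `μ` on almost every vertical line.
  filter_upwards [integral_hdiv_eq_zero hz h.memv h.memD h.sol h.weak,
    norm_vertical_integral_le hdm] with y h1 h2
  have h3 := integral_deriv_smul_vertVel h2.1 h1 hμ hc
  simp only [RCLike.real_smul_eq_coe_mul] at h3
  rw [h3]

end Vertical

/-! ### Operators of order two applied to Hölder continuous functions -/

section Weighted

variable {E : Type*} [NormedAddCommGroup E] [NormedSpace ℝ E] {z₀ z₁ : ℝ}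

/-- The horizontal part of the Hölder weight is charged to `k`, the vertical part to `m`; in each
term the other kernel is only integrated. -/
theorem norm_op_weighted_le {k : Plane → ℝ} (hk : Measurable k) {m : ℝ → ℝ → ℝ} {q : Dom}
    (hm : Measurable (m q.2)) {K Kw M Mw : ℝ} (hK0 : 0 ≤ K) (hKw0 : 0 ≤ Kw)
    (hM0 : 0 ≤ M) (hMw0 : 0 ≤ Mw) (hK : ∫⁻ y, ‖k y‖ₑ ≤ ENNReal.ofReal K)
    (hKw : ∫⁻ y, ‖k y‖ₑ * ENNReal.ofReal (Real.sqrt ‖y‖) ≤ ENNReal.ofReal Kw)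
    (hM : ∫⁻ ζ in Ioo z₀ z₁, ‖m q.2 ζ‖ₑ ≤ ENNReal.ofReal M)
    (hMw : ∫⁻ ζ in Ioo z₀ z₁, ‖m q.2 ζ‖ₑ * ENNReal.ofReal (Real.sqrt |q.2 - ζ|) ≤
      ENNReal.ofReal Mw) {f : Dom → E} {B B' : ℝ} (hB : 0 ≤ B) (hB' : 0 ≤ B')
    (hf : ∀ᵐ p ∂(layer z₀ z₁),
      ‖f p‖ ≤ B * Real.sqrt ‖q.1 - p.1‖ + B' * Real.sqrt |q.2 - p.2|) :
    ‖Op z₀ z₁ k m f q‖ ≤ Kw * (M * B) + K * (Mw * B') := by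
  have h1 := lintegral_layer_le (z₀ := z₀) (z₁ := z₁)
    (h := fun y => ‖k (q.1 - y)‖ₑ * ENNReal.ofReal (Real.sqrt ‖q.1 - y‖))
    ((hk.comp (by fun_prop)).enorm.mul (by fun_prop))
    (G := fun p => ‖m q.2 p.2‖ₑ * ENNReal.ofReal B)
    ((hm.comp measurable_snd).enorm.mul_const _).aemeasurable
    (C := ENNReal.ofReal M * ENNReal.ofReal B) (Eventually.of_forall fun y => by
      rw [lintegral_mul_const' _ _ ENNReal.ofReal_ne_top]
      exact mul_le_mul' hM le_rfl)
  have h2 := lintegral_layer_le (z₀ := z₀) (z₁ := z₁) (h := fun y => ‖k (q.1 - y)‖ₑ)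
    (hk.comp (by fun_prop)).enorm
    (G := fun p => (‖m q.2 p.2‖ₑ * ENNReal.ofReal (Real.sqrt |q.2 - p.2|)) * ENNReal.ofReal B')
    (((hm.comp measurable_snd).enorm.mul (by fun_prop)).mul_const _).aemeasurable
    (C := ENNReal.ofReal Mw * ENNReal.ofReal B') (Eventually.of_forall fun y => by
      rw [lintegral_mul_const' _ _ ENNReal.ofReal_ne_top]
      exact mul_le_mul' hMw le_rfl)
  rw [lintegral_sub_left_eq_self (fun y => ‖k y‖ₑ * ENNReal.ofReal (Real.sqrt ‖y‖)) q.1] at h1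
  rw [lintegral_sub_left_eq_self (fun y => ‖k y‖ₑ) q.1] at h2
  have h3 : ‖Op z₀ z₁ k m f q‖ₑ ≤ ENNReal.ofReal Kw * (ENNReal.ofReal M * ENNReal.ofReal B) +
      ENNReal.ofReal K * (ENNReal.ofReal Mw * ENNReal.ofReal B') := by
    refine le_trans ?_ (add_le_add (h1.trans (mul_le_mul' hKw le_rfl))
      (h2.trans (mul_le_mul' hK le_rfl)))
    rw [← lintegral_add_left' (by
      exact (((hk.comp (by fun_prop)).enorm.mul (by fun_prop)).mul
        ((hm.comp measurable_snd).enorm.mul_const _)).aemeasurable)]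
    refine (enorm_integral_le_lintegral_enorm _).trans (lintegral_mono_ae (hf.mono fun p hp => ?_))
    rw [enorm_smul, enorm_mul, ← ofReal_norm (f p)]
    refine (mul_le_mul' le_rfl (ENNReal.ofReal_le_ofReal hp)).trans (le_of_eq ?_)
    rw [ENNReal.ofReal_add (by positivity) (by positivity), ENNReal.ofReal_mul hB,
      ENNReal.ofReal_mul hB']
    ring
  rwa [← ENNReal.ofReal_mul hM0, ← ENNReal.ofReal_mul hKw0, ← ENNReal.ofReal_mul hMw0,
    ← ENNReal.ofReal_mul hK0, ← ENNReal.ofReal_add (by positivity) (by positivity), ← ofReal_norm,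
    ENNReal.ofReal_le_ofReal_iff (by positivity)] at h3

theorem sqrt_sqrt_eq {τ : ℝ} (hτ : 0 < τ) : Real.sqrt (Real.sqrt τ) = τ ^ (1 / 4 : ℝ) := by
  rw [Real.sqrt_eq_rpow, Real.sqrt_eq_rpow, ← Real.rpow_mul hτ.le]
  norm_num

/-- However the order two is distributed between the two kernels, the gain of `τ^{1/4}` leaves the
integrable power `-3/4`. -/
theorem weight_exponent {τ : ℝ} (hτ : 0 < τ) {a b : ℕ} (hab : a + b = 2) :
    (Real.sqrt τ ^ a)⁻¹ * Real.sqrt (Real.sqrt τ) * (Real.sqrt τ ^ b)⁻¹ = τ ^ (-3 / 4 : ℝ) := by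
  rw [inv_sqrt_pow hτ, inv_sqrt_pow hτ, sqrt_sqrt_eq hτ, ← Real.rpow_add hτ, ← Real.rpow_add hτ]
  congr 1
  have : (a : ℝ) + b = 2 := by exact_mod_cast hab
  linarith

theorem HKernel.integrable {a : ℕ} {d : ℝ} {k : ℝ → Plane → ℝ} (h : HKernel a d k) (hd : 2 < d)
    {τ : ℝ} (hτ : 0 < τ) : Integrable (k τ) :=
  let ⟨_, _, hc⟩ := h.integral_le hd
  (hc τ hτ).1

theorem HKernel.lintegral_weighted_le {a : ℕ} {d : ℝ} {k : ℝ → Plane → ℝ} (h : HKernel a d k)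
    (hd : 5 / 2 < d) :
    ∃ c : ℝ, 0 ≤ c ∧ ∀ τ : ℝ, 0 < τ →
      ∫⁻ y, ‖k τ y‖ₑ ≤ ENNReal.ofReal (c * (Real.sqrt τ ^ a)⁻¹) ∧
      ∫⁻ y, ‖k τ y‖ₑ * ENNReal.ofReal (Real.sqrt ‖y‖) ≤
        ENNReal.ofReal (c * ((Real.sqrt τ ^ a)⁻¹ * Real.sqrt (Real.sqrt τ))) := by
  obtain ⟨c, hc0, hc⟩ := h.integral_le (by linarith)
  obtain ⟨c', hc0', hc'⟩ := h.weighted_integral_le hd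
  refine ⟨max c c', le_max_of_le_left hc0, fun τ hτ => ⟨?_, ?_⟩⟩
  · rw [← ofReal_integral_norm_eq_lintegral_enorm (hc τ hτ).1]
    refine ENNReal.ofReal_le_ofReal ((hc τ hτ).2.trans ?_)
    gcongr
    exact le_max_left _ _
  · have e : ∀ y, ‖k τ y‖ₑ * ENNReal.ofReal (Real.sqrt ‖y‖) = ‖k τ y * Real.sqrt ‖y‖‖ₑ := fun y => by
      rw [enorm_mul, ← ofReal_norm (Real.sqrt _), Real.norm_of_nonneg (Real.sqrt_nonneg _)]
    simp_rw [e]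
    rw [← ofReal_integral_norm_eq_lintegral_enorm (hc' τ hτ).1]
    refine ENNReal.ofReal_le_ofReal (le_trans (le_of_eq ?_) ((hc' τ hτ).2.trans ?_))
    · refine integral_congr_ae (Eventually.of_forall fun y => ?_)
      simp [abs_of_nonneg (Real.sqrt_nonneg _)]
    · gcongr
      exact le_max_right _ _

theorem norm_op_refl_weighted_le (hz : z₀ < z₁) {T : ℝ} (hT : 0 < T) {a b : ℕ} (hab : a + b = 2)
    {d : ℝ} {k : ℝ → Plane → ℝ} (hk : HKernel a d k) (hd : 5 / 2 < d)
    {c₁ c₂ : ℝ} (h₁ : |c₁| = 1) (h₂ : |c₂| = 1) :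
    ∃ c : ℝ, 0 ≤ c ∧ ∀ τ ∈ Ioc 0 T, ∀ (f : Dom → E) (B : ℝ) (q : Dom), 0 ≤ B → q.2 ∈ Ioo z₀ z₁ →
      (∀ᵐ p ∂(layer z₀ z₁),
        ‖f p‖ ≤ B * Real.sqrt ‖q.1 - p.1‖ + B * Real.sqrt |q.2 - p.2|) →
      ‖Op z₀ z₁ (k τ) (reflKernel z₀ z₁ b c₁ c₂ τ) f q‖ ≤ c * τ ^ (-3 / 4 : ℝ) * B := by
  obtain ⟨c, hc0, hc⟩ := hk.lintegral_weighted_le hd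
  have hm := vKernel_reflKernel hz hT b h₁ h₂
  obtain ⟨cr, hcr0, hcr⟩ := hm.int_right
  refine ⟨c * cr + c * (48 * Real.sqrt Real.pi), by positivity, fun τ hτ f B q hB hq hf => ?_⟩
  have := norm_op_weighted_le (hk.continuous hτ.1).measurable
    (hm.continuous_right hτ.1 q.2).measurable (by positivity) (by positivity) (by positivity)
    (by positivity) (hc τ hτ.1).1 (hc τ hτ.1).2 (hcr τ hτ q.2)
    (reflKernel_weighted_le b h₁ h₂ hτ.1 hq) hB hB hf
  refine this.trans (le_of_eq ?_)
  rw [← weight_exponent hτ.1 hab]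
  ring

/-- The constant vertical kernel is not concentrated near `z`, so a vertical distance would gain
nothing. The bound of `f` therefore involves the horizontal distance only. -/
theorem norm_op_const_weighted_le (hz : z₀ < z₁) {d : ℝ} {k : ℝ → Plane → ℝ}
    (hk : HKernel 2 d k) (hd : 5 / 2 < d) :
    ∃ c : ℝ, 0 ≤ c ∧ ∀ τ, 0 < τ → ∀ (f : Dom → E) (B : ℝ) (q : Dom), 0 ≤ B → q.2 ∈ Ioo z₀ z₁ →
      (∀ᵐ p ∂(layer z₀ z₁), ‖f p‖ ≤ B * Real.sqrt ‖q.1 - p.1‖) →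
      ‖Op z₀ z₁ (k τ) (fun _ _ => (z₁ - z₀)⁻¹) f q‖ ≤ c * τ ^ (-3 / 4 : ℝ) * B := by
  obtain ⟨c, hc0, hc⟩ := hk.lintegral_weighted_le hd
  have hL : 0 < z₁ - z₀ := by linarith
  refine ⟨c, by positivity, fun τ hτ f B q hB hq hf => ?_⟩
  have e1 : ∫⁻ _ in Ioo z₀ z₁, ‖(z₁ - z₀)⁻¹‖ₑ ≤ ENNReal.ofReal 1 := by
    rw [setLIntegral_const, Real.volume_Ioo, Real.enorm_eq_ofReal (by positivity),
      ← ENNReal.ofReal_mul (by positivity), inv_mul_cancel₀ hL.ne']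
  -- Any finite `Mw` will do, because the vertical weight enters with coefficient zero.
  have := norm_op_weighted_le (z₀ := z₀) (z₁ := z₁) (m := fun _ _ => (z₁ - z₀)⁻¹) (q := q)
    (Mw := Real.sqrt (z₁ - z₀)) (hk.continuous hτ).measurable
    measurable_const (by positivity) (by positivity) zero_le_one
    (by positivity) (hc τ hτ).1 (hc τ hτ).2 e1 (by
      calc _ ≤ ∫⁻ _ in Ioo z₀ z₁, ‖(z₁ - z₀)⁻¹‖ₑ * ENNReal.ofReal (Real.sqrt (z₁ - z₀)) := by
            refine setLIntegral_mono' measurableSet_Ioo fun ζ hζ => ?_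
            gcongr
            rw [abs_le]
            constructor <;> linarith [hζ.1, hζ.2, hq.1, hq.2]
        _ ≤ _ := by
            rw [lintegral_mul_const' _ _ ENNReal.ofReal_ne_top]
            refine (mul_le_mul' e1 le_rfl).trans (by simp)) hB le_rfl (f := f)
    (by simpa using hf)
  refine this.trans (le_of_eq ?_)
  rw [← weight_exponent hτ (show 2 + 0 = 2 from rfl)]
  simp

end Weighted

/-! ### Cancellation by freezing the transported field -/

section Freeze

variable {𝕜 : Type*} [RCLike 𝕜] {z₀ z₁ : ℝ}

theorem Op_add {E : Type*} [NormedAddCommGroup E] [NormedSpace ℝ E] {k : Plane → ℝ}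
    {m : ℝ → ℝ → ℝ} {f g : Dom → E} {q : Dom}
    (hf : Integrable (fun p : Dom => (k (q.1 - p.1) * m q.2 p.2) • f p) (layer z₀ z₁))
    (hg : Integrable (fun p : Dom => (k (q.1 - p.1) * m q.2 p.2) • g p) (layer z₀ z₁)) :
    Op z₀ z₁ k m (fun p => f p + g p) q = Op z₀ z₁ k m f q + Op z₀ z₁ k m g q := by
  simp only [Op, smul_add]
  exact integral_add hf hg

theorem Op_smul_const {k : Plane → ℝ} {m : ℝ → ℝ → ℝ} (f : Dom → 𝕜) (c : Vec 𝕜) (q : Dom) :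
    Op z₀ z₁ k m (fun p => f p • c) q = Op z₀ z₁ k m f q • c := by
  simp only [Op, ← smul_assoc]
  exact integral_smul_const _ _

theorem memLInf_of_bdd {E : Type*} [NormedAddCommGroup E] {f : Dom → E}
    (hf : AEStronglyMeasurable f (layer z₀ z₁)) {B : ℝ} (hB : ∀ᵐ p ∂(layer z₀ z₁), ‖f p‖ ≤ B) :
    MemLInf z₀ z₁ 1 f := by
  refine ⟨hf, ?_⟩
  have h1 := mixedNorm_le_of_norm_le (p := 1) (g := fun _ : Dom => (1 : ℝ)) (B := B)
    (hB.mono fun p hp => by simpa using hp)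
  refine h1.trans_lt (ENNReal.mul_lt_top ENNReal.ofReal_lt_top ?_)
  refine lt_of_le_of_lt (b := ENNReal.ofReal (z₁ - z₀)) (mixedNorm_le_iff.2
    (Eventually.of_forall fun x => ?_)) ENNReal.ofReal_lt_top
  simp [eLpNorm_one_eq_lintegral_enorm]

/-- Hölder continuity of order `1/2` on the layer. -/
def HolderHalf (z₀ z₁ : ℝ) (v : Dom → Vec 𝕜) (H : ℝ) : Prop :=
  ∀ p q : Dom, p.2 ∈ Ioo z₀ z₁ → q.2 ∈ Ioo z₀ z₁ →
    ‖v p - v q‖ ≤ H * Real.sqrt ‖q.1 - p.1‖ + H * Real.sqrt |q.2 - p.2|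

/-- The local part of the derivative of the nonlinearity. -/
theorem norm_local_le (hz : z₀ < z₁) {T : ℝ} (hT : 0 < T) {a n : ℕ} (han : a + n = 1)
    {k0 : ℝ → Plane → ℝ} {k1 : Fin 2 → ℝ → Plane → ℝ} (hk0 : HKernel a 3 k0)
    (hk1 : ∀ j, HKernel (a + 1) 3 (k1 j))
    (hkk : ∀ j τ x, 0 < τ → HasLineDerivAt ℝ (k0 τ) (k1 j τ x) x (unit j))
    {c₁ c₂ : ℝ} (h₁ : |c₁| = 1) (h₂ : |c₂| = 1) :
    ∃ c : ℝ, 0 ≤ c ∧ ∀ τ ∈ Ioc 0 T, ∀ (v : Dom → Vec 𝕜) (DH : Fin 2 → Dom → Vec 𝕜) (U H : ℝ),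
      IsSlice z₀ z₁ v DH U → 0 ≤ H → HolderHalf z₀ z₁ v H → ∀ q : Dom, q.2 ∈ Ioo z₀ z₁ →
      ‖∑ j, Op z₀ z₁ (k1 j τ) (reflKernel z₀ z₁ n c₁ c₂ τ) (flux (vel z₁ v DH) v j.castSucc) q +
        Op z₀ z₁ (k0 τ) (reflKernel z₀ z₁ (n + 1) (-c₁) c₂ τ)
          (fun p => -flux (vel z₁ v DH) v (Fin.last 2) p) q‖ ≤ c * τ ^ (-3 / 4 : ℝ) * (U * H) := by
  have h₁' : |(-c₁)| = 1 := by rwa [abs_neg]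
  have w1 : ∀ j, _ := fun j => norm_op_refl_weighted_le (E := Vec 𝕜) hz hT
    (show a + 1 + n = 2 by omega) (hk1 j) (by norm_num) h₁ h₂
  obtain w0 := norm_op_refl_weighted_le (E := Vec 𝕜) hz hT
    (show a + (n + 1) = 2 by omega) hk0 (by norm_num) h₁' h₂
  choose cj hcj0 hcj using w1
  obtain ⟨cl, hcl0, hcl⟩ := w0
  have hm1 := vKernel_reflKernel hz hT n h₁ h₂
  have hm0 := vKernel_reflKernel hz hT (n + 1) h₁' h₂
  obtain ⟨s1, -, hs1⟩ := hm1.sup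
  obtain ⟨s0, -, hs0⟩ := hm0.sup
  refine ⟨∑ j, cj j + cl, add_nonneg (Finset.sum_nonneg fun j _ => hcj0 j) hcl0,
    fun τ hτ v DH U H hs hH hv q hq => ?_⟩
  have i1 : ∀ j {f : Dom → Vec 𝕜}, MemLInf z₀ z₁ 1 f → Integrable (fun p : Dom =>
      (k1 j τ (q.1 - p.1) * reflKernel z₀ z₁ n c₁ c₂ τ q.2 p.2) • f p) (layer z₀ z₁) :=
    fun j f hf => integrable_op ((hk1 j).integrable (by norm_num) hτ.1)
      (hm1.continuous_right hτ.1 q.2).measurable (fun ζ => hs1 τ hτ q.2 ζ) hf q.1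
  have i0 : ∀ {f : Dom → Vec 𝕜}, MemLInf z₀ z₁ 1 f → Integrable (fun p : Dom =>
      (k0 τ (q.1 - p.1) * reflKernel z₀ z₁ (n + 1) (-c₁) c₂ τ q.2 p.2) • f p) (layer z₀ z₁) :=
    fun {f} hf => integrable_op (hk0.integrable (by norm_num) hτ.1)
      (hm0.continuous_right hτ.1 q.2).measurable (fun ζ => hs0 τ hτ q.2 ζ) hf q.1
  set u := vel z₁ v DH with hu
  -- The value of `v` at the point of evaluation is subtracted. The difference carries the Hölder
  -- weight; the constant is removed by `IsSlice.local_cancel`.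
  set w : Dom → Vec 𝕜 := fun p => v p - v q with hw
  have mconst : ∀ i, MemLInf z₀ z₁ 1 (fun p => u i p • v q) := fun i =>
    memLInf_of_bdd ((hs.vel_measurable i).smul_const _) (B := U * ‖v q‖)
      ((hs.vel_le i).mono fun p hp => by rw [norm_smul]; gcongr)
  have mv : ∀ i, MemLInf z₀ z₁ 1 (flux u v i) := fun i => hs.memLInf_flux hs.memv i
  have mw : ∀ i, MemLInf z₀ z₁ 1 (flux u w i) := fun i => by
    have h1 : MemLInf z₀ z₁ 1 (fun _ : Dom => v q) :=
      memLInf_of_bdd aestronglyMeasurable_const (B := ‖v q‖) (by simp)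
    have h2 : MemLInf z₀ z₁ 1 w := by
      refine memLInf_of_bdd (hs.memv.1.sub aestronglyMeasurable_const) (B := U + ‖v q‖) ?_
      exact hs.bound.mono fun p hp => (norm_sub_le _ _).trans (by gcongr)
    exact hs.memLInf_flux h2 i
  have e : ∀ i, flux u v i = fun p => flux u w i p + u i p • v q := fun i => by
    funext p; simp [flux, hw, smul_sub]
  have fw : ∀ i, ∀ᵐ p ∂(layer z₀ z₁), ‖flux u w i p‖ ≤
      U * H * Real.sqrt ‖q.1 - p.1‖ + U * H * Real.sqrt |q.2 - p.2| := fun i => by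
    filter_upwards [hs.vel_le i, ae_layer_mem] with p h1 h2
    rw [flux, norm_smul, mul_assoc, mul_assoc, ← mul_add]
    exact mul_le_mul h1 (hv p q h2 hq) (norm_nonneg _) hs.nonneg
  -- Here `μ` is the vertical kernel as a function of `ζ`; its derivative has the opposite first
  -- sign `-c₁`, as in the vertical flux term.
  have hcancel := hs.local_cancel hz (hk0.integrable (by norm_num) hτ.1)
    (fun j => (hk1 j).integrable (by norm_num) hτ.1)
    (fun j x => hkk j τ x hτ.1)
    (fun ζ => hasDerivAt_reflKernel_right hz (by omega) hτ.1 c₁ c₂ q.2 ζ)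
    (hm0.continuous_right hτ.1 q.2) q.1
  have key : ∑ j, Op z₀ z₁ (k1 j τ) (reflKernel z₀ z₁ n c₁ c₂ τ) (flux u v j.castSucc) q +
        Op z₀ z₁ (k0 τ) (reflKernel z₀ z₁ (n + 1) (-c₁) c₂ τ)
          (fun p => -flux u v (Fin.last 2) p) q =
      ∑ j, Op z₀ z₁ (k1 j τ) (reflKernel z₀ z₁ n c₁ c₂ τ) (flux u w j.castSucc) q +
        Op z₀ z₁ (k0 τ) (reflKernel z₀ z₁ (n + 1) (-c₁) c₂ τ)
          (fun p => -flux u w (Fin.last 2) p) q := by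
    have n1 : ∀ f : Dom → Vec 𝕜, Op z₀ z₁ (k0 τ) (reflKernel z₀ z₁ (n + 1) (-c₁) c₂ τ)
          (fun p => -f p) q = -Op z₀ z₁ (k0 τ) (reflKernel z₀ z₁ (n + 1) (-c₁) c₂ τ) f q :=
      fun f => by simp only [Op, smul_neg, integral_neg]
    rw [n1, n1]
    simp only [e]
    rw [Op_add (i0 (mw _)) (i0 (mconst _)), Op_smul_const]
    have e1 : ∀ j : Fin 2, Op z₀ z₁ (k1 j τ) (reflKernel z₀ z₁ n c₁ c₂ τ)
        (fun p => flux u w j.castSucc p + u j.castSucc p • v q) q =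
        Op z₀ z₁ (k1 j τ) (reflKernel z₀ z₁ n c₁ c₂ τ) (flux u w j.castSucc) q +
        Op z₀ z₁ (k1 j τ) (reflKernel z₀ z₁ n c₁ c₂ τ) (u j.castSucc) q • v q := fun j => by
      rw [Op_add (i1 j (mw _)) (i1 j (mconst _)), Op_smul_const]
    simp only [e1]
    rw [Finset.sum_add_distrib, ← Finset.sum_smul]
    have h3 : ∑ j, Op z₀ z₁ (k1 j τ) (reflKernel z₀ z₁ n c₁ c₂ τ) (u j.castSucc) q =
        Op z₀ z₁ (k0 τ) (reflKernel z₀ z₁ (n + 1) (-c₁) c₂ τ) (u (Fin.last 2)) q := hcancel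
    rw [h3]
    abel
  rw [key, add_mul, add_mul, Finset.sum_mul, Finset.sum_mul]
  have hUH : 0 ≤ U * H := mul_nonneg hs.nonneg hH
  refine (norm_add_le _ _).trans (add_le_add ((norm_sum_le _ _).trans
    (Finset.sum_le_sum fun j _ => ?_)) ?_)
  · exact hcj j τ hτ _ _ q hUH hq (fw _)
  · exact hcl τ hτ _ _ q hUH hq ((fw _).mono fun p hp => by rwa [norm_neg])

/-- The part of the derivative of the nonlinearity that contains `(-Δ_H)⁻¹`. -/
theorem norm_riesz_le (hz : z₀ < z₁) (T : ℝ) (k i l : Fin 2) :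
    ∃ c : ℝ, 0 ≤ c ∧ ∀ τ ∈ Ioc 0 T, ∀ (v : Dom → Vec 𝕜) (DH : Fin 2 → Dom → Vec 𝕜) (U H Y : ℝ),
      IsSlice z₀ z₁ v DH U → 0 ≤ H → HolderHalf z₀ z₁ v H → 0 ≤ Y →
      ContinuousOn v (univ ×ˢ Ioo z₀ z₁) →
      (∀ q : Dom, q.2 ∈ Ioo z₀ z₁ → ‖v q‖ ≤ Y) → ∀ q : Dom, q.2 ∈ Ioo z₀ z₁ →
      ‖∑ j, Op z₀ z₁ (rieszD k i j l τ) (fun _ _ => (z₁ - z₀)⁻¹)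
        (fun p => flux (vel z₁ v DH) v j.castSucc p i) q‖ ≤
        c * (τ ^ (-3 / 4 : ℝ) * (U * H) + τ ^ (-1 / 2 : ℝ) * (U * Y)) := by
  have w1 : ∀ j, _ := fun j => norm_op_const_weighted_le (E := 𝕜) hz (hKernel_rieszD k i j l)
    (by norm_num)
  choose cj hcj0 hcj using w1
  have hL : 0 < z₁ - z₀ := by linarith
  obtain ⟨cR, hcR0, hcR⟩ := (hKernel_rieszKernel k i l).integral_le (by norm_num)
  refine ⟨∑ j, cj j + cR * (z₁ - z₀)⁻¹, by
    have := Finset.sum_nonneg fun j (_ : j ∈ Finset.univ) => hcj0 j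
    positivity, fun τ hτ v DH U H Y hs hH hv hY hvc hvY q hq => ?_⟩
  have hK1 : ∀ j, Integrable (rieszD k i j l τ) := fun j =>
    (hKernel_rieszD k i j l).integrable (by norm_num) hτ.1
  set u := vel z₁ v DH with hu
  -- The nonlocal kernel is constant in the vertical variable, so `v` is frozen in the horizontal
  -- variable only and the frozen field still depends on `ζ`.
  set c : ℝ → 𝕜 := fun ζ => v (q.1, ζ) i with hc
  have hcm : AEStronglyMeasurable c (volume.restrict (Ioo z₀ z₁)) := by
    have h1 : ContinuousOn c (Ioo z₀ z₁) :=
      (EuclideanSpace.proj (𝕜 := 𝕜) i).continuous.comp_continuousOn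
        (hvc.comp (by fun_prop : ContinuousOn (fun ζ : ℝ => (q.1, ζ)) (Ioo z₀ z₁))
          fun ζ hζ => ⟨mem_univ _, hζ⟩)
    exact h1.aestronglyMeasurable measurableSet_Ioo
  have hcB : ∀ ζ ∈ Ioo z₀ z₁, ‖c ζ‖ ≤ Y := fun ζ hζ => (norm_coord_le _ _).trans (hvY _ hζ)
  have hcl : AEStronglyMeasurable (fun p : Dom => c p.2) (layer z₀ z₁) := hcm.comp_snd
  have hcb : ∀ᵐ p ∂(layer z₀ z₁), ‖c p.2‖ ≤ Y := ae_layer_mem.mono fun p hp => hcB _ hp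
  set w : Dom → 𝕜 := fun p => v p i - c p.2 with hw
  have i1 : ∀ j {f : Dom → 𝕜}, MemLInf z₀ z₁ 1 f → Integrable (fun p : Dom =>
      (rieszD k i j l τ (q.1 - p.1) * (z₁ - z₀)⁻¹) • f p) (layer z₀ z₁) :=
    fun j f hf => integrable_op (hK1 j) measurable_const (c := (z₁ - z₀)⁻¹)
      (fun ζ => by rw [abs_of_pos (by positivity)]) hf q.1
  have mw : ∀ j : Fin 2, MemLInf z₀ z₁ 1 (fun p => u j.castSucc p * w p) := fun j => by
    refine memLInf_of_bdd ((hs.vel_measurable _).mul ((hs.memv.coord i).1.sub hcl))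
      (B := U * (U + Y)) ?_
    filter_upwards [hs.vel_le j.castSucc, hs.bound, hcb] with p h1 h2 h3
    rw [norm_mul]
    exact mul_le_mul h1 ((norm_sub_le _ _).trans (add_le_add ((norm_coord_le _ _).trans h2) h3))
      (norm_nonneg _) hs.nonneg
  have mc : ∀ j : Fin 2, MemLInf z₀ z₁ 1 (fun p => u j.castSucc p * c p.2) := fun j => by
    refine memLInf_of_bdd ((hs.vel_measurable _).mul hcl) (B := U * Y) ?_
    filter_upwards [hs.vel_le j.castSucc, hcb] with p h1 h3
    rw [norm_mul]
    exact mul_le_mul h1 h3 (norm_nonneg _) hs.nonneg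
  have e1 : ∀ j : Fin 2, Op z₀ z₁ (rieszD k i j l τ) (fun _ _ => (z₁ - z₀)⁻¹)
        (fun p => flux u v j.castSucc p i) q =
      Op z₀ z₁ (rieszD k i j l τ) (fun _ _ => (z₁ - z₀)⁻¹) (fun p => u j.castSucc p * w p) q +
      Op z₀ z₁ (rieszD k i j l τ) (fun _ _ => (z₁ - z₀)⁻¹) (fun p => u j.castSucc p * c p.2) q := by
    intro j
    rw [← Op_add (i1 j (mw j)) (i1 j (mc j))]
    congr 1
    funext p
    simp only [flux, hw, PiLp.smul_apply, smul_eq_mul]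
    ring
  -- After exchanging the derivatives `l` and `j`, the derivative `j` passes from the kernel to the
  -- velocity. Summed over `j` it gives the divergence, against a kernel of order one.
  have e2 : ∀ j : Fin 2, Op z₀ z₁ (rieszD k i j l τ) (fun _ _ => (z₁ - z₀)⁻¹)
        (fun p => u j.castSucc p * c p.2) q =
      ∫ p, rieszKernel k i l τ (q.1 - p.1) • (((z₁ - z₀)⁻¹ : ℝ) • c p.2 * DH j p j)
        ∂(layer z₀ z₁) := by
    intro j
    have h1 := ((hs.weak j).coord j).integral_kernel_eq (hs.memv.coord j) ((hs.memD j).coord j)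
      (c := fun ζ => ((z₁ - z₀)⁻¹ : ℝ) • c ζ) (hcm.const_smul _) (B := (z₁ - z₀)⁻¹ * Y)
      (fun ζ hζ => by
        rw [norm_smul, Real.norm_of_nonneg (by positivity)]
        exact mul_le_mul_of_nonneg_left (hcB ζ hζ) (by positivity))
      (hcR τ hτ.1).1 (hK1 j) (fun x => by
        rw [rieszD_swap]
        exact hasLineDerivAt_rieszKernel k i l j hτ.1 x) q.1
    rw [← h1, Op]
    refine integral_congr_ae (Eventually.of_forall fun p => ?_)
    simp only [hu, vel_castSucc, mul_smul, smul_mul_assoc, mul_comm (v p j)]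
  have mdj : ∀ j, Integrable (fun p : Dom => rieszKernel k i l τ (q.1 - p.1) •
      (((z₁ - z₀)⁻¹ : ℝ) • c p.2 * DH j p j)) (layer z₀ z₁) := fun j =>
    integrable_mul_of_memLInf ((hcR τ hτ.1).1.comp_sub_left q.1)
      (((hs.memD j).coord j).bdd_mul (c := fun ζ => ((z₁ - z₀)⁻¹ : ℝ) • c ζ) (hcm.const_smul _)
        (B := (z₁ - z₀)⁻¹ * Y) (fun ζ hζ => by
          rw [norm_smul, Real.norm_of_nonneg (by positivity)]
          exact mul_le_mul_of_nonneg_left (hcB ζ hζ) (by positivity)))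
  simp only [e1]
  rw [Finset.sum_add_distrib]
  have b1 : ‖∑ j, Op z₀ z₁ (rieszD k i j l τ) (fun _ _ => (z₁ - z₀)⁻¹)
      (fun p => u (Fin.castSucc j) p * w p) q‖ ≤ (∑ j, cj j) * τ ^ (-3 / 4 : ℝ) * (U * H) := by
    rw [Finset.sum_mul, Finset.sum_mul]
    refine (norm_sum_le _ _).trans (Finset.sum_le_sum fun j _ =>
      hcj j τ hτ.1 _ _ q (mul_nonneg hs.nonneg hH) hq ?_)
    filter_upwards [hs.vel_le j.castSucc, ae_layer_mem] with p h1 h2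
    rw [norm_mul, mul_assoc]
    refine mul_le_mul h1 ?_ (norm_nonneg _) hs.nonneg
    have h3 := hv p (q.1, p.2) h2 h2
    simp only [sub_self, abs_zero, Real.sqrt_zero, mul_zero, add_zero] at h3
    refine le_trans ?_ h3
    exact norm_coord_le (v p - v (q.1, p.2)) i
  have b2 : ‖∑ j, Op z₀ z₁ (rieszD k i j l τ) (fun _ _ => (z₁ - z₀)⁻¹)
      (fun p => u (Fin.castSucc j) p * c p.2) q‖ ≤
      cR * (z₁ - z₀)⁻¹ * τ ^ (-1 / 2 : ℝ) * (U * Y) := by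
    simp only [e2]
    rw [← integral_finsetSum _ fun j _ => mdj j]
    have e3 : ∀ p : Dom, ∑ j, rieszKernel k i l τ (q.1 - p.1) •
        (((z₁ - z₀)⁻¹ : ℝ) • c p.2 * DH j p j) =
        (rieszKernel k i l τ (q.1 - p.1) * (z₁ - z₀)⁻¹) • (c p.2 * hdiv DH p) := fun p => by
      rw [hdiv, Finset.mul_sum, Finset.smul_sum]
      refine Finset.sum_congr rfl fun j _ => ?_
      rw [smul_mul_assoc, smul_smul]
    simp only [e3]
    have h1 := enorm_op_le (z₀ := z₀) (z₁ := z₁) (k := rieszKernel k i l τ)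
      ((hKernel_rieszKernel k i l).continuous hτ.1).measurable (m := fun _ _ => (z₁ - z₀)⁻¹)
      (q := q) measurable_const
      (((memLInf_hdiv hs.memD).1.bdd_mul hcm hcB)).1 (C := ENNReal.ofReal ((z₁ - z₀)⁻¹ * (Y * U))) (by
        filter_upwards [mixedNorm_le_iff.1 hs.div_le] with y hy
        rw [eLpNorm_one_eq_lintegral_enorm] at hy
        calc _ ≤ ∫⁻ ζ in Ioo z₀ z₁, ENNReal.ofReal ((z₁ - z₀)⁻¹ * Y) * ‖hdiv DH (y, ζ)‖ₑ := by
              refine setLIntegral_mono' measurableSet_Ioo fun ζ hζ => ?_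
              rw [enorm_mul, ← mul_assoc, ENNReal.ofReal_mul (by positivity),
                Real.enorm_eq_ofReal (by positivity)]
              refine mul_le_mul' (mul_le_mul' le_rfl ?_) le_rfl
              rw [← ofReal_norm]
              exact ENNReal.ofReal_le_ofReal (hcB ζ hζ)
          _ ≤ _ := by
              rw [lintegral_const_mul' _ _ ENNReal.ofReal_ne_top, ← mul_assoc,
                ENNReal.ofReal_mul (p := (z₁ - z₀)⁻¹ * Y) (by positivity)]
              exact mul_le_mul' le_rfl hy)
    have hki : ∫⁻ y, ‖rieszKernel k i l τ y‖ₑ ≤ ENNReal.ofReal (cR * τ ^ (-1 / 2 : ℝ)) := by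
      rw [← ofReal_integral_norm_eq_lintegral_enorm (hcR τ hτ.1).1]
      refine ENNReal.ofReal_le_ofReal ((hcR τ hτ.1).2.trans (le_of_eq ?_))
      rw [inv_sqrt_pow hτ.1]
      norm_num
    have h2 := h1.trans (mul_le_mul' hki le_rfl)
    have hτp := Real.rpow_pos_of_pos hτ.1 (-1 / 2 : ℝ)
    have hU := hs.nonneg
    rw [← ENNReal.ofReal_mul (by positivity), ← ofReal_norm,
      ENNReal.ofReal_le_ofReal_iff (by positivity)] at h2
    refine h2.trans (le_of_eq (by ring))
  refine (norm_add_le _ _).trans ((add_le_add b1 b2).trans ?_)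
  have hτp := Real.rpow_pos_of_pos hτ.1 (-1 / 2 : ℝ)
  have hτp' := Real.rpow_pos_of_pos hτ.1 (-3 / 4 : ℝ)
  have hU := hs.nonneg
  have hS := Finset.sum_nonneg fun j (_ : j ∈ Finset.univ) => hcj0 j
  have h5 : 0 ≤ cR * (z₁ - z₀)⁻¹ := by positivity
  have h6 : 0 ≤ τ ^ (-3 / 4 : ℝ) * (U * H) := by positivity
  have h7 : 0 ≤ τ ^ (-1 / 2 : ℝ) * (U * Y) := by positivity
  nlinarith [mul_nonneg h5 h6, mul_nonneg hS h7]

end Freeze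

/-! ### Directional derivatives of the operators -/

/-- The coordinate directions; `none` is the vertical one. -/
def dir : Option (Fin 2) → Dom
  | some l => (unit l, 0)
  | none => (0, 1)

/-- The letter D marks a first derivative of the nonlinearity in a coordinate direction, the letter
S below a first derivative of the linear part `S(t)a`. -/
def kD : Option (Fin 2) → Idx → ℝ → Plane → ℝ
  | some l => kH l
  | none => kN

def mD (z₀ z₁ : ℝ) : Option (Fin 2) → Idx → ℝ → ℝ → ℝ → ℝ
  | some _ => mN z₀ z₁
  | none => mZ z₀ z₁

def kS : Option (Fin 2) → ℝ → Plane → ℝ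
  | some l => gaussD1 l
  | none => gaussPlane

def mS (z₀ z₁ : ℝ) : Option (Fin 2) → ℝ → ℝ → ℝ → ℝ
  | some _ => reflKernel z₀ z₁ 0 1 1
  | none => reflKernel z₀ z₁ 1 1 1

section Freeze

variable {𝕜 : Type*} [RCLike 𝕜] {z₀ z₁ : ℝ}

theorem isSystem_D (hz : z₀ < z₁) {T : ℝ} (hT : 0 < T) (d : Option (Fin 2)) :
    IsSystem z₀ z₁ T 2 (kD d) (mD z₀ z₁ d) := by
  cases d with
  | none => exact isSystem_Z hz hT
  | some l => exact isSystem_H hz hT l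

theorem hasLineDerivAt_Nop (hz : z₀ < z₁) {T τ : ℝ} (hτ : τ ∈ Ioc 0 T)
    {F : Fin 3 → Dom → Vec 𝕜} (hF : ∀ i, MemLInf z₀ z₁ 1 (F i)) (d : Option (Fin 2)) (q : Dom) :
    HasLineDerivAt ℝ (Nop z₀ z₁ kN (mN z₀ z₁) τ F) (Nop z₀ z₁ (kD d) (mD z₀ z₁ d) τ F q) q
      (dir d) := by
  cases d with
  | none => exact hasLineDerivAt_Nop_vertical hz hτ hF q
  | some l => exact hasLineDerivAt_Nop_horizontal hz hτ hF l q

theorem kernel_S (hz : z₀ < z₁) {T : ℝ} (hT : 0 < T) (d : Option (Fin 2)) :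
    ∃ a b : ℕ, a + b = 1 ∧ HKernel a 3 (kS d) ∧ VKernel z₀ z₁ T b (mS z₀ z₁ d) := by
  cases d with
  | none => exact ⟨0, 1, rfl, hKernel_gaussPlane, vKernel_reflKernel hz hT 1 (by simp) (by simp)⟩
  | some l => exact ⟨1, 0, rfl, hKernel_gaussD1 l, vKernel_reflKernel hz hT 0 (by simp) (by simp)⟩

theorem hasLineDerivAt_heat {E : Type*} [NormedAddCommGroup E] [NormedSpace ℝ E] (hz : z₀ < z₁)
    {τ : ℝ} (hτ : 0 < τ) {f : Dom → E} (hf : MemLInf z₀ z₁ 1 f) (d : Option (Fin 2)) (q : Dom) :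
    HasLineDerivAt ℝ (Op z₀ z₁ (gaussPlane τ) (reflKernel z₀ z₁ 0 1 1 τ) f)
      (Op z₀ z₁ (kS d τ) (mS z₀ z₁ d τ) f q) q (dir d) := by
  have hm0 : VKernel z₀ z₁ τ 0 (reflKernel z₀ z₁ 0 1 1) :=
    vKernel_reflKernel hz hτ 0 (by simp) (by simp)
  cases d with
  | none =>
    exact hasLineDerivAt_op_vertical hKernel_gaussPlane (by norm_num) hm0
      (vKernel_reflKernel hz hτ 1 (by simp) (by simp)) ⟨hτ, le_rfl⟩
      (fun z ζ => hasDerivAt_reflKernel_left hz (by norm_num) hτ 1 1 z ζ) hf q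
  | some l =>
    exact hasLineDerivAt_op_horizontal hKernel_gaussPlane (by norm_num) (hKernel_gaussD1 l)
      (by norm_num) hm0 ⟨hτ, le_rfl⟩ (fun x => hasLineDerivAt_gaussPlane x l) hf q

theorem Op_single {k : Plane → ℝ} {m : ℝ → ℝ → ℝ} (i : Fin 2) (f : Dom → 𝕜) (q : Dom) :
    Op z₀ z₁ k m (fun p => EuclideanSpace.single i (f p)) q =
      EuclideanSpace.single i (Op z₀ z₁ k m f q) := by
  change _ = singleIsometry i _
  rw [Op, Op, ← LinearIsometry.integral_comp_comm]
  simp only [map_smul]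
  rfl

variable (𝕜) in
/-- The derivatives of the nonlinearity on Hölder continuous fields: the singularity is
integrable. -/
theorem norm_Nop_freeze_le (hz : z₀ < z₁) {T : ℝ} (hT : 0 < T) (d : Option (Fin 2)) :
    ∃ c : ℝ, 0 ≤ c ∧ ∀ τ ∈ Ioc 0 T, ∀ (v : Dom → Vec 𝕜) (DH : Fin 2 → Dom → Vec 𝕜) (U H Y : ℝ),
      IsSlice z₀ z₁ v DH U → 0 ≤ H → HolderHalf z₀ z₁ v H → 0 ≤ Y →
      ContinuousOn v (univ ×ˢ Ioo z₀ z₁) →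
      (∀ q : Dom, q.2 ∈ Ioo z₀ z₁ → ‖v q‖ ≤ Y) → ∀ q : Dom, q.2 ∈ Ioo z₀ z₁ →
      ‖Nop z₀ z₁ (kD d) (mD z₀ z₁ d) τ (flux (vel z₁ v DH) v) q‖ ≤
        c * (τ ^ (-3 / 4 : ℝ) * (U * H) + τ ^ (-1 / 2 : ℝ) * (U * Y)) := by
  cases d with
  | none =>
    -- For the vertical derivative only local terms survive: `k0` is the Gauss kernel, and the
    -- vertical kernel has one derivative already.
    obtain ⟨c, hc0, hc⟩ := norm_local_le (𝕜 := 𝕜) hz hT (show 0 + 1 = 1 from rfl)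
      hKernel_gaussPlane hKernel_gaussD1 (fun j τ x _ => hasLineDerivAt_gaussPlane x j)
      (c₁ := 1) (c₂ := 1) (by simp) (by simp)
    refine ⟨c, hc0, fun τ hτ v DH U H Y hs hH hv hY hvc hvY q hq => ?_⟩
    have h1 := hc τ hτ v DH U H hs hH hv q hq
    rw [Nop, Fintype.sum_sum_type, Fintype.sum_sum_type, ← add_assoc]
    have e : ∀ f : Dom → Vec 𝕜, ∀ k : Plane → ℝ, Op z₀ z₁ k (fun _ _ => (0 : ℝ)) f q = 0 :=
      fun f k => by simp [Op]
    simp only [kD, mD, kN, mZ, comp, lin, Finset.univ_unique, Finset.sum_singleton, e,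
      Finset.sum_const_zero, add_zero]
    refine h1.trans ?_
    have h2 : 0 ≤ τ ^ (-1 / 2 : ℝ) * (U * Y) :=
      mul_nonneg (Real.rpow_nonneg hτ.1.le _) (mul_nonneg hs.nonneg hY)
    rw [mul_assoc]
    gcongr
    linarith
  | some l =>
    -- For a horizontal derivative `k0` is itself `∂_l` of the Gauss kernel, and the terms with
    -- `(-Δ_H)⁻¹` are added.
    obtain ⟨c, hc0, hc⟩ := norm_local_le (𝕜 := 𝕜) hz hT (show 1 + 0 = 1 from rfl)
      (hKernel_gaussD1 l) (k1 := fun j => gaussD2 j l) (fun j => hKernel_gaussD2 j l)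
      (fun j τ x _ => by rw [gaussD2_swap]; exact hasLineDerivAt_gaussD1 l j x)
      (c₁ := 1) (c₂ := 1) (by simp) (by simp)
    have hR := fun k i => norm_riesz_le (𝕜 := 𝕜) hz T k i l
    choose cR hcR0 hcR using hR
    refine ⟨c + ∑ k, ∑ i, cR k i, add_nonneg hc0 (Finset.sum_nonneg fun k _ =>
      Finset.sum_nonneg fun i _ => hcR0 k i), fun τ hτ v DH U H Y hs hH hv hY hvc hvY q hq => ?_⟩
    have h1 := hc τ hτ v DH U H hs hH hv q hq
    have h2 : 0 ≤ τ ^ (-1 / 2 : ℝ) * (U * Y) :=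
      mul_nonneg (Real.rpow_nonneg hτ.1.le _) (mul_nonneg hs.nonneg hY)
    rw [Nop, Fintype.sum_sum_type, Fintype.sum_sum_type, ← add_assoc]
    simp only [kD, mD, kH, mN, comp, lin, Finset.univ_unique, Finset.sum_singleton,
      Fintype.sum_prod_type, Op_single]
    rw [add_mul]
    refine (norm_add_le _ _).trans (add_le_add (h1.trans ?_) ?_)
    · rw [mul_assoc]
      gcongr
      linarith
    · have e : ∀ k i : Fin 2, ∑ j, (EuclideanSpace.single k (Op z₀ z₁ (rieszD k i j l τ)
          (fun _ _ => (z₁ - z₀)⁻¹) (fun p => flux (vel z₁ v DH) v j.castSucc p i) q) : Vec 𝕜) =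
          singleIsometry k (∑ j, Op z₀ z₁ (rieszD k i j l τ)
          (fun _ _ => (z₁ - z₀)⁻¹) (fun p => flux (vel z₁ v DH) v j.castSucc p i) q) := fun k i => by
        rw [map_sum]; rfl
      simp only [e]
      rw [Finset.sum_mul]
      refine (norm_sum_le _ _).trans (Finset.sum_le_sum fun k _ => ?_)
      rw [Finset.sum_mul]
      refine (norm_sum_le _ _).trans (Finset.sum_le_sum fun i _ => ?_)
      rw [LinearIsometry.norm_map]
      exact hcR k i τ hτ v DH U H Y hs hH hv hY hvc hvY q hq

end Freeze

/-! ### Hölder estimates by interpolation -/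

section Holder

variable {E : Type*} [NormedAddCommGroup E] [NormedSpace ℝ E]

/-- Along each coordinate direction `min (2a₀) (a₁|h|) ≤ √(2a₀a₁|h|)`. The constant `3` accounts for
the two horizontal steps, with `√2 ≤ 3/2`. -/
theorem holder_of_lineDeriv {f : Dom → E} {f' : Option (Fin 2) → Dom → E} {a₀ a₁ : ℝ}
    (h0 : ∀ q, ‖f q‖ ≤ a₀) (h1 : ∀ d q, HasLineDerivAt ℝ f (f' d q) q (dir d))
    (h2 : ∀ d q, ‖f' d q‖ ≤ a₁) (p q : Dom) :
    ‖f p - f q‖ ≤ 3 * Real.sqrt (a₀ * a₁) *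
      (Real.sqrt ‖q.1 - p.1‖ + Real.sqrt |q.2 - p.2|) := by
  have ha0 : 0 ≤ a₀ := (norm_nonneg _).trans (h0 q)
  have ha1 : 0 ≤ a₁ := (norm_nonneg _).trans (h2 none q)
  have move : ∀ (q : Dom) d (h : ℝ), ‖f (q + h • dir d) - f q‖ ≤
      Real.sqrt (2 * (a₀ * a₁)) * Real.sqrt |h| := by
    intro q d h
    have hd : ∀ s : ℝ, HasDerivAt (fun s : ℝ => f (q + s • dir d)) (f' d (q + s • dir d)) s := by
      intro s
      have h3 := h1 d (q + s • dir d)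
      unfold HasLineDerivAt at h3
      have h4 : HasDerivAt (fun t : ℝ => f (q + (s + t) • dir d)) (f' d (q + s • dir d)) (s - s) := by
        rw [sub_self]
        simpa only [add_smul, add_assoc] using h3
      have h5 := h4.comp_sub_const s s
      simpa using h5
    have h3 : ‖f (q + h • dir d) - f q‖ ≤ a₁ * |h| := by
      have := convex_univ.norm_image_sub_le_of_norm_hasDerivWithin_le
        (fun s _ => (hd s).hasDerivWithinAt) (fun s _ => h2 d (q + s • dir d)) (mem_univ (0 : ℝ))
        (mem_univ h)
      simpa using this
    have h4 : ‖f (q + h • dir d) - f q‖ ≤ 2 * a₀ :=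
      (norm_sub_le _ _).trans (by linarith [h0 (q + h • dir d), h0 q])
    rw [← Real.sqrt_mul (by positivity)]
    refine Real.le_sqrt_of_sq_le ?_
    rw [sq]
    calc _ ≤ (2 * a₀) * (a₁ * |h|) := mul_le_mul h4 h3 (norm_nonneg _) (by positivity)
      _ = _ := by ring
  set h : Fin 2 → ℝ := fun i => (p.1 - q.1) i with hh
  have hp : p = q + h 0 • dir (some 0) + h 1 • dir (some 1) + (p.2 - q.2) • dir none := by
    refine Prod.ext ?_ ?_
    · ext i
      fin_cases i <;> simp [dir, hh, unit]
    · simp [dir]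
  have hc : ∀ i, Real.sqrt |h i| ≤ Real.sqrt ‖q.1 - p.1‖ := fun i =>
    Real.sqrt_le_sqrt (by rw [← norm_neg, neg_sub]; exact abs_coord_le (p.1 - q.1) i)
  have e : f p - f q = (f (q + h 0 • dir (some 0) + h 1 • dir (some 1) + (p.2 - q.2) • dir none) -
      f (q + h 0 • dir (some 0) + h 1 • dir (some 1))) +
      (f (q + h 0 • dir (some 0) + h 1 • dir (some 1)) - f (q + h 0 • dir (some 0))) +
      (f (q + h 0 • dir (some 0)) - f q) := by
    rw [← hp]; abel
  rw [e]
  have m1 := move (q + h 0 • dir (some 0) + h 1 • dir (some 1)) none (p.2 - q.2)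
  have m2 := move (q + h 0 • dir (some 0)) (some 1) (h 1)
  have m3 := move q (some 0) (h 0)
  have hs : Real.sqrt (2 * (a₀ * a₁)) ≤ 3 / 2 * Real.sqrt (a₀ * a₁) := by
    rw [Real.sqrt_mul (by norm_num)]
    refine mul_le_mul_of_nonneg_right ?_ (Real.sqrt_nonneg _)
    rw [Real.sqrt_le_left (by norm_num)]
    norm_num
  rw [abs_sub_comm] at m1
  have hS := Real.sqrt_nonneg (a₀ * a₁)
  have hS2 := Real.sqrt_nonneg (2 * (a₀ * a₁))
  have hX := Real.sqrt_nonneg ‖q.1 - p.1‖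
  have hZ := Real.sqrt_nonneg |q.2 - p.2|
  have n1 := mul_le_mul hs le_rfl hZ (by positivity)
  have n2 := mul_le_mul hs (hc 1) (Real.sqrt_nonneg _) (by positivity)
  have n3 := mul_le_mul hs (hc 0) (Real.sqrt_nonneg _) (by positivity)
  have n4 := mul_nonneg hS hZ
  refine (norm_add₃_le).trans ?_
  nlinarith

theorem sqrt_interp {τ c₀ c₁ A x y : ℝ} (hτ : 0 < τ) (hA : 0 ≤ A) :
    Real.sqrt (c₀ * τ ^ x * A * (c₁ * τ ^ y * A)) = Real.sqrt (c₀ * c₁) * τ ^ ((x + y) / 2) * A := by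
  have e : c₀ * τ ^ x * A * (c₁ * τ ^ y * A) = c₀ * c₁ * (τ ^ ((x + y) / 2) * A) ^ 2 := by
    have : τ ^ x * τ ^ y = τ ^ ((x + y) / 2) * τ ^ ((x + y) / 2) := by
      rw [← Real.rpow_add hτ, ← Real.rpow_add hτ]; ring_nf
    linear_combination c₀ * c₁ * A ^ 2 * this
  rw [e, Real.sqrt_mul' _ (sq_nonneg _),
    Real.sqrt_sq (mul_nonneg (Real.rpow_nonneg hτ.le _) hA), mul_assoc]

end Holder

section HolderOps

variable (𝕜 : Type*) [RCLike 𝕜] {z₀ z₁ : ℝ}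

/-- The exponent `3/4` is the mean of the exponents `1/2` and `1` of the operator and of its
derivatives. -/
theorem holder_Nop_le (hz : z₀ < z₁) {T : ℝ} (hT : 0 < T) :
    ∃ c : ℝ, 0 ≤ c ∧ ∀ τ ∈ Ioc 0 T, ∀ p : ℝ≥0∞, 1 ≤ p → ∀ (F : Fin 3 → Dom → Vec 𝕜) (A : ℝ),
      0 ≤ A → (∀ i, MemLInf z₀ z₁ 1 (F i)) →
      (∀ i, mixedNorm z₀ z₁ p (F i) ≤ ENNReal.ofReal A) → ∀ q q',
      ‖Nop z₀ z₁ kN (mN z₀ z₁) τ F q - Nop z₀ z₁ kN (mN z₀ z₁) τ F q'‖ ≤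
        c * τ ^ (-3 / 4 - p⁻¹.toReal / 2) * A *
          (Real.sqrt ‖q'.1 - q.1‖ + Real.sqrt |q'.2 - q.2|) := by
  obtain ⟨c₀, hc00, hc0⟩ := norm_Nop_le (𝕜 := 𝕜) (isSystem_N hz hT)
  have h1 := fun d => norm_Nop_le (𝕜 := 𝕜) (isSystem_D hz hT d)
  choose c₁ hc10 hc1 using h1
  set C := ∑ d, c₁ d with hC
  have hC0 : 0 ≤ C := Finset.sum_nonneg fun d _ => hc10 d
  refine ⟨3 * Real.sqrt (c₀ * C), by positivity, fun τ hτ p hp F A hA hF hFA q q' => ?_⟩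
  have := holder_of_lineDeriv (hc0 τ hτ p hp F A hA (fun i => (hF i).1) hFA)
    (hasLineDerivAt_Nop hz hτ hF)
    (a₁ := C * τ ^ (-((2 : ℕ) : ℝ) / 2 - p⁻¹.toReal / 2) * A) (fun d q => by
      refine (hc1 d τ hτ p hp F A hA (fun i => (hF i).1) hFA q).trans ?_
      have := Real.rpow_nonneg hτ.1.le (-((2 : ℕ) : ℝ) / 2 - p⁻¹.toReal / 2)
      gcongr
      exact Finset.single_le_sum (fun d _ => hc10 d) (Finset.mem_univ d)) q q'
  rw [sqrt_interp hτ.1 hA] at this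
  refine this.trans (le_of_eq ?_)
  have e : (-((1 : ℕ) : ℝ) / 2 - p⁻¹.toReal / 2 + (-((2 : ℕ) : ℝ) / 2 - p⁻¹.toReal / 2)) / 2 =
      -3 / 4 - p⁻¹.toReal / 2 := by push_cast; ring
  rw [e]
  ring

theorem norm_heat_le (hz : z₀ < z₁) {T : ℝ} (hT : 0 < T) :
    ∃ c : ℝ, 0 ≤ c ∧ ∀ τ ∈ Ioc 0 T, ∀ p : ℝ≥0∞, 1 ≤ p → ∀ (f : Dom → Vec 𝕜) (A : ℝ),
      0 ≤ A → MemLInf z₀ z₁ 1 f → mixedNorm z₀ z₁ p f ≤ ENNReal.ofReal A →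
      (∀ q, ‖Op z₀ z₁ (gaussPlane τ) (reflKernel z₀ z₁ 0 1 1 τ) f q‖ ≤
        c * τ ^ (-(p⁻¹.toReal / 2)) * A) ∧
      (∀ q q', ‖Op z₀ z₁ (gaussPlane τ) (reflKernel z₀ z₁ 0 1 1 τ) f q -
        Op z₀ z₁ (gaussPlane τ) (reflKernel z₀ z₁ 0 1 1 τ) f q'‖ ≤
        c * τ ^ (-1 / 4 - p⁻¹.toReal / 2) * A *
          (Real.sqrt ‖q'.1 - q.1‖ + Real.sqrt |q'.2 - q.2|)) ∧
      ∀ d q, ‖Op z₀ z₁ (kS d τ) (mS z₀ z₁ d τ) f q‖ ≤ c * τ ^ (-1 / 2 - p⁻¹.toReal / 2) * A := by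
  obtain ⟨c₀, hc00, hc0⟩ := norm_op_le (E := Vec 𝕜) hKernel_gaussPlane (by norm_num)
    (vKernel_reflKernel hz hT 0 (c₁ := 1) (c₂ := 1) (by simp) (by simp))
  have h1 : ∀ d, ∃ c : ℝ, 0 ≤ c ∧ ∀ τ ∈ Ioc 0 T, ∀ p : ℝ≥0∞, 1 ≤ p → ∀ (f : Dom → Vec 𝕜) (A : ℝ),
      0 ≤ A → AEStronglyMeasurable f (layer z₀ z₁) → mixedNorm z₀ z₁ p f ≤ ENNReal.ofReal A → ∀ q,
      ‖Op z₀ z₁ (kS d τ) (mS z₀ z₁ d τ) f q‖ ≤ c * τ ^ (-((1 : ℕ) : ℝ) / 2 - p⁻¹.toReal / 2) * A := by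
    intro d
    obtain ⟨a, b, hab, hk, hm⟩ := kernel_S hz hT d
    have := norm_op_le (E := Vec 𝕜) hk (by norm_num) hm
    rwa [hab] at this
  choose c₁ hc10 hc1 using h1
  set C := ∑ d, c₁ d with hC
  have hC0 : 0 ≤ C := Finset.sum_nonneg fun d _ => hc10 d
  refine ⟨c₀ + C + 3 * Real.sqrt (c₀ * C), by positivity, fun τ hτ p hp f A hA hf hfA => ?_⟩
  have hrp : ∀ x : ℝ, 0 ≤ τ ^ x := fun x => Real.rpow_nonneg hτ.1.le x
  have b0 := hc0 τ hτ p hp f A hA hf.1 hfA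
  have b1 : ∀ d q, ‖Op z₀ z₁ (kS d τ) (mS z₀ z₁ d τ) f q‖ ≤
      C * τ ^ (-((1 : ℕ) : ℝ) / 2 - p⁻¹.toReal / 2) * A := fun d q => by
    refine (hc1 d τ hτ p hp f A hA hf.1 hfA q).trans ?_
    have := hrp (-((1 : ℕ) : ℝ) / 2 - p⁻¹.toReal / 2)
    gcongr
    exact Finset.single_le_sum (fun d _ => hc10 d) (Finset.mem_univ d)
  have hsq := Real.sqrt_nonneg (c₀ * C)
  refine ⟨fun q => (b0 q).trans ?_, fun q q' => ?_, fun d q => (b1 d q).trans ?_⟩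
  · have e : -((0 + 0 : ℕ) : ℝ) / 2 - p⁻¹.toReal / 2 = -(p⁻¹.toReal / 2) := by push_cast; ring
    rw [e]
    have := hrp (-(p⁻¹.toReal / 2))
    gcongr
    linarith
  · have := holder_of_lineDeriv b0 (hasLineDerivAt_heat hz hτ.1 hf) b1 q q'
    rw [sqrt_interp hτ.1 hA] at this
    refine this.trans ?_
    have e : (-((0 + 0 : ℕ) : ℝ) / 2 - p⁻¹.toReal / 2 + (-((1 : ℕ) : ℝ) / 2 - p⁻¹.toReal / 2)) / 2 =
      -1 / 4 - p⁻¹.toReal / 2 := by push_cast; ring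
    rw [e]
    have := hrp (-1 / 4 - p⁻¹.toReal / 2)
    have hn : 0 ≤ Real.sqrt ‖q'.1 - q.1‖ + Real.sqrt |q'.2 - q.2| := by positivity
    refine mul_le_mul_of_nonneg_right ?_ hn
    rw [← mul_assoc, ← mul_assoc]
    gcongr
    linarith
  · have e : -((1 : ℕ) : ℝ) / 2 - p⁻¹.toReal / 2 = -1 / 2 - p⁻¹.toReal / 2 := by push_cast; ring
    rw [e]
    have := hrp (-1 / 2 - p⁻¹.toReal / 2)
    gcongr
    linarith

end HolderOps

/-! ### Weakly singular integrals -/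

section Singular

/-- All singular exponents that occur are at most `3/4`, so `1/(1 - a) ≤ 4` serves as a common
constant. -/
theorem integral_singular {t P Q a b : ℝ} (ht : 0 < t) (hP : 0 ≤ P) (hQ : 0 ≤ Q) (ha : a ≤ 3 / 4)
    (hb : b ≤ 3 / 4) :
    IntegrableOn (fun s => P * s ^ (-b) + Q * (t - s) ^ (-a)) (Ioo 0 t) ∧
      ∫ s in Ioo 0 t, (P * s ^ (-b) + Q * (t - s) ^ (-a)) ≤
        4 * P * t ^ (1 - b) + 4 * Q * t ^ (1 - a) := by
  have h1 : IntervalIntegrable (fun s : ℝ => s ^ (-b)) volume 0 t :=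
    intervalIntegral.intervalIntegrable_rpow' (by linarith)
  have h2 : IntervalIntegrable (fun s : ℝ => (t - s) ^ (-a)) volume 0 t := by
    have h3 : IntervalIntegrable (fun s : ℝ => s ^ (-a)) volume (t - 0) (t - t) := by
      rw [sub_zero, sub_self]
      exact (intervalIntegral.intervalIntegrable_rpow' (by linarith)).symm
    simpa using h3.comp_sub_left t
  have h4 := (h1.const_mul P).add (h2.const_mul Q)
  have key : ∀ x : ℝ, x ≤ 3 / 4 → ∫ s in (0 : ℝ)..t, s ^ (-x) ≤ 4 * t ^ (1 - x) := by
    intro x hx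
    rw [integral_rpow (Or.inl (by linarith)), Real.zero_rpow (by linarith), sub_zero,
      show -x + 1 = 1 - x by ring, div_le_iff₀ (by linarith)]
    have := Real.rpow_nonneg ht.le (1 - x)
    nlinarith
  constructor
  · rw [← intervalIntegrable_iff_integrableOn_Ioo_of_le ht.le]
    exact h4
  · rw [← integral_Ioc_eq_integral_Ioo, ← intervalIntegral.integral_of_le ht.le,
      intervalIntegral.integral_add (h1.const_mul P) (h2.const_mul Q),
      intervalIntegral.integral_const_mul, intervalIntegral.integral_const_mul,
      intervalIntegral.integral_comp_sub_left (fun s => s ^ (-a)) t, sub_self, sub_zero]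
    have k1 := mul_le_mul_of_nonneg_left (key b hb) hP
    have k2 := mul_le_mul_of_nonneg_left (key a ha) hQ
    linarith

theorem norm_integral_singular_le {E : Type*} [NormedAddCommGroup E] [NormedSpace ℝ E] {f : ℝ → E}
    {t P Q a b : ℝ} (ht : 0 < t) (hP : 0 ≤ P) (hQ : 0 ≤ Q) (ha : a ≤ 3 / 4) (hb : b ≤ 3 / 4)
    (hf : ∀ s ∈ Ioo 0 t, ‖f s‖ ≤ P * s ^ (-b) + Q * (t - s) ^ (-a)) :
    ‖∫ s in Ioo 0 t, f s‖ ≤ 4 * P * t ^ (1 - b) + 4 * Q * t ^ (1 - a) := by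
  obtain ⟨h1, h2⟩ := integral_singular ht hP hQ ha hb
  exact (norm_integral_le_of_norm_le h1 ((ae_restrict_mem measurableSet_Ioo).mono hf)).trans h2

theorem rpow_half_le {t s e : ℝ} (ht : 0 < t) (hs : t / 2 ≤ s) (he0 : 0 ≤ e) (he : e ≤ 2) :
    s ^ (-e) ≤ 4 * t ^ (-e) := by
  have h1 : s ^ (-e) ≤ (t / 2) ^ (-e) :=
    Real.rpow_le_rpow_of_nonpos (by linarith) hs (by linarith)
  have h2 : (t / 2) ^ (-e) = 2 ^ e * t ^ (-e) := by
    rw [div_eq_mul_inv, Real.mul_rpow ht.le (by norm_num), Real.inv_rpow (by norm_num),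
      Real.rpow_neg (by norm_num : (0 : ℝ) ≤ 2), inv_inv, mul_comm]
  have h3 : (2 : ℝ) ^ e ≤ 4 := by
    calc (2 : ℝ) ^ e ≤ 2 ^ (2 : ℝ) := Real.rpow_le_rpow_of_exponent_le (by norm_num) he
      _ = 4 := by norm_num
  rw [h2] at h1
  exact h1.trans (mul_le_mul_of_nonneg_right h3 (Real.rpow_nonneg ht.le _))

/-- Two bounds for the same quantity: the first may fail to be integrable at `s = t`, the second at
`s = 0`. Each is used on the half where its bad factor is comparable to a power of `t`; since the
results are added, the integral itself need not be split. The factor `4` is `2^2`, from exponents at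
most `2`. -/
theorem half_split {t s F P Q a b e g : ℝ} (hs : s ∈ Ioo 0 t) (hP : 0 ≤ P) (hQ : 0 ≤ Q)
    (he0 : 0 ≤ e) (he : e ≤ 2) (hg0 : 0 ≤ g) (hg : g ≤ 2)
    (h1 : F ≤ P * ((t - s) ^ (-e) * s ^ (-b))) (h2 : F ≤ Q * ((t - s) ^ (-a) * s ^ (-g))) :
    F ≤ 4 * P * t ^ (-e) * s ^ (-b) + 4 * Q * t ^ (-g) * (t - s) ^ (-a) := by
  have ht : 0 < t := hs.1.trans hs.2
  have p1 := Real.rpow_nonneg hs.1.le (-b)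
  have p2 := Real.rpow_nonneg (sub_pos.2 hs.2).le (-a)
  have p3 := Real.rpow_nonneg ht.le (-e)
  have p4 := Real.rpow_nonneg ht.le (-g)
  rcases le_total s (t / 2) with h | h
  · have h3 := rpow_half_le ht (show t / 2 ≤ t - s by linarith) he0 he
    have h4 : P * ((t - s) ^ (-e) * s ^ (-b)) ≤ P * (4 * t ^ (-e) * s ^ (-b)) := by gcongr
    have : 0 ≤ 4 * Q * t ^ (-g) * (t - s) ^ (-a) := by positivity
    nlinarith
  · have h3 := rpow_half_le ht h hg0 hg
    have h4 : Q * ((t - s) ^ (-a) * s ^ (-g)) ≤ Q * ((t - s) ^ (-a) * (4 * t ^ (-g))) := by gcongr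
    have : 0 ≤ 4 * P * t ^ (-e) * s ^ (-b) := by positivity
    nlinarith

end Singular

/-! ### Measurability of families of continuous functions -/

section Measurability

variable {F : Type*} [NormedAddCommGroup F]

/-- The projection onto the closed layer. -/
def clamp (z₀ z₁ : ℝ) (q : Dom) : Dom := (q.1, max z₀ (min z₁ q.2))

theorem clamp_of_mem {z₀ z₁ : ℝ} {q : Dom} (hq : q.2 ∈ Icc z₀ z₁) : clamp z₀ z₁ q = q := by
  simp [clamp, hq.1, hq.2]

theorem continuous_clamp {z₀ z₁ : ℝ} : Continuous (clamp z₀ z₁) := by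
  unfold clamp; fun_prop

theorem clamp_mem_closure {z₀ z₁ : ℝ} (hz : z₀ < z₁) (q : Dom) :
    clamp z₀ z₁ q ∈ closure (univ ×ˢ Ioo z₀ z₁ : Set Dom) := by
  rw [closure_prod_eq, closure_univ, closure_Ioo hz.ne]
  refine ⟨mem_univ _, le_max_left _ _, max_le hz.le (min_le_left _ _)⟩

/-- A family of continuous functions that is measurable in the parameter at almost every point is
jointly measurable. -/
theorem exists_jointly_measurable {z₀ z₁ : ℝ} (hz : z₀ < z₁) {S : Set ℝ} (hS : MeasurableSet S)
    {f : ℝ → Dom → F} (hc : ∀ s ∈ S, Continuous (f s))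
    (hm : ∀ᵐ q ∂(layer z₀ z₁), AEStronglyMeasurable (fun s => f s q) (volume.restrict S)) :
    ∃ g : ℝ → Dom → F, StronglyMeasurable (Function.uncurry g) ∧
      ∀ᵐ s ∂(volume.restrict S), ∀ q : Dom, q.2 ∈ Icc z₀ z₁ → f s q = g s q := by
  -- The points at which measurability in the parameter is known have full measure in the layer.
  -- They are therefore dense, and by continuity a countable dense subset of them determines each `f
  -- s`.
  set G : Set Dom := {q | q ∈ (univ ×ˢ Ioo z₀ z₁ : Set Dom) ∧
    AEStronglyMeasurable (fun s => f s q) (volume.restrict S)} with hG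
  have hGd : closure (univ ×ˢ Ioo z₀ z₁ : Set Dom) ⊆ closure G := by
    refine closure_minimal (fun q hq => ?_) isClosed_closure
    rw [mem_closure_iff]
    intro o ho hqo
    by_contra hne
    have h1 : volume (o ∩ (univ ×ˢ Ioo z₀ z₁ : Set Dom)) = 0 := by
      rw [layer_eq, ae_restrict_iff' (measurableSet_dom z₀ z₁)] at hm
      refine measure_mono_null (fun p hp => ?_) (ae_iff.1 hm)
      simp only [mem_ofPred_eq, Classical.not_imp]
      exact ⟨hp.2, fun h => hne ⟨p, hp.1, hp.2, h⟩⟩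
    exact (IsOpen.measure_pos volume (ho.inter (isOpen_dom z₀ z₁)) ⟨q, hqo, hq⟩).ne' h1
  obtain ⟨D', hD'c, hD'd⟩ := TopologicalSpace.exists_countable_dense G
  set D : Set Dom := Subtype.val '' D' with hD
  have hDc : D.Countable := hD'c.image _
  have hDd : closure (univ ×ˢ Ioo z₀ z₁ : Set Dom) ⊆ closure D := by
    refine hGd.trans (closure_minimal (fun q hq => ?_) isClosed_closure)
    have h1 : (⟨q, hq⟩ : G) ∈ closure D' := hD'd _
    exact image_closure_subset_closure_image continuous_subtype_val ⟨_, h1, rfl⟩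
  have hDG : ∀ q ∈ D, AEStronglyMeasurable (fun s => f s q) (volume.restrict S) := by
    rintro q ⟨q', _, rfl⟩
    exact q'.2.2
  have hbad : ∀ᵐ s ∂(volume.restrict S), ∀ q : D, f s q = (hDG q q.2).mk _ s := by
    have := hDc.to_subtype
    exact ae_all_iff.2 fun q => (hDG q q.2).ae_eq_mk
  rw [ae_restrict_iff' hS, ae_iff] at hbad
  -- A measurable null set contains all parameters at which some chosen representative differs from
  -- the family.
  set N := toMeasurable volume {s | ¬(s ∈ S → ∀ q : D, f s q = (hDG q q.2).mk _ s)} with hN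
  have hN0 : volume N = 0 := by rw [hN, measure_toMeasurable]; exact hbad
  have hNm : MeasurableSet N := measurableSet_toMeasurable _ _
  have hok : ∀ s ∈ S \ N, ∀ q : D, f s q = (hDG q q.2).mk _ s := by
    intro s hs
    by_contra h
    exact hs.2 (subset_toMeasurable _ _ (by simp only [mem_ofPred_eq, Classical.not_imp]; exact ⟨hs.1, h⟩))
  -- Set to zero outside `S \ N` and composed with `clamp`, the family is continuous in `q` for
  -- every `s` and measurable in `s` for every `q`, which gives joint measurability.
  set g : ℝ → Dom → F := fun s q => (S \ N).indicator (fun s => f s (clamp z₀ z₁ q)) s with hg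
  have hgc : ∀ s, Continuous (g s) := by
    intro s
    by_cases h : s ∈ S \ N
    · have : g s = fun q => f s (clamp z₀ z₁ q) := by funext q; simp [hg, h]
      rw [this]
      exact (hc s h.1).comp continuous_clamp
    · have : g s = fun _ => 0 := by funext q; simp [hg, h]
      rw [this]
      exact continuous_const
  have hSN : MeasurableSet (S \ N) := hS.diff hNm
  have hgm : ∀ q, StronglyMeasurable fun s => g s q := by
    intro q
    obtain ⟨u, huD, hul⟩ := mem_closure_iff_seq_limit.1 (hDd (clamp_mem_closure hz q))
    refine stronglyMeasurable_of_tendsto (f := fun n s => (S \ N).indicator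
      ((hDG (u n) (huD n)).mk _) s) atTop (fun n => (hDG (u n) (huD n)).stronglyMeasurable_mk.indicator hSN) ?_
    rw [tendsto_pi_nhds]
    intro s
    by_cases h : s ∈ S \ N
    · simp only [hg, indicator_of_mem h]
      have h1 := ((hc s h.1).tendsto (clamp z₀ z₁ q)).comp hul
      refine h1.congr fun n => ?_
      exact hok s h ⟨u n, huD n⟩
    · simp only [hg, indicator_of_notMem h]
      exact tendsto_const_nhds
  refine ⟨g, ?_, ?_⟩
  · have h1 := stronglyMeasurable_uncurry_of_continuous_of_stronglyMeasurable
      (u := fun (q : Dom) (s : ℝ) => g s q) hgc hgm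
    exact h1.comp_measurable measurable_swap
  · rw [ae_restrict_iff' hS]
    have : ∀ᵐ s, s ∉ N := measure_eq_zero_iff_ae_notMem.1 hN0
    filter_upwards [this] with s hs hsS q hq
    simp only [hg, indicator_of_mem (show s ∈ S \ N from ⟨hsS, hs⟩), clamp_of_mem hq]

end Measurability

/-! ### Estimates of the integral equation -/

section Estimates

variable {𝕜 : Type*} [RCLike 𝕜] {z₀ z₁ : ℝ}

/-- The flux `u ⊗ v` at time `s`. -/
def fl (z₁ : ℝ) (v : ℝ → Dom → Vec 𝕜) (DH : ℝ → Fin 2 → Dom → Vec 𝕜) (s : ℝ) :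
    Fin 3 → Dom → Vec 𝕜 :=
  flux (vel z₁ (v s) (DH s)) (v s)

/-- Bounds, on `(0, t)`, of a solution in the scaling invariant norms. -/
structure SolOn (z₀ z₁ : ℝ) (r : ℝ≥0∞) (t U X Y : ℝ) (v : ℝ → Dom → Vec 𝕜)
    (DH : ℝ → Fin 2 → Dom → Vec 𝕜) : Prop where
  hU : 0 ≤ U
  hX : 0 ≤ X
  hY : 0 ≤ Y
  slice : ∀ s ∈ Ioo 0 t, IsSlice z₀ z₁ (v s) (DH s) (U * s ^ (-1 / 2 : ℝ))
  lr : ∀ s ∈ Ioo 0 t,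
    mixedNorm z₀ z₁ r (v s) ≤ ENNReal.ofReal (X * s ^ (-(1 / 2 - r⁻¹.toReal / 2)))
  sup : ∀ s ∈ Ioo 0 t, ∀ᵐ p ∂(layer z₀ z₁), ‖v s p‖ ≤ Y * s ^ (-1 / 2 : ℝ)

theorem SolOn.mono {r : ℝ≥0∞} {t t' U X Y : ℝ} {v : ℝ → Dom → Vec 𝕜}
    {DH : ℝ → Fin 2 → Dom → Vec 𝕜} (h : SolOn z₀ z₁ r t U X Y v DH) (ht : t' ≤ t) :
    SolOn z₀ z₁ r t' U X Y v DH :=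
  ⟨h.hU, h.hX, h.hY, fun s hs => h.slice s ⟨hs.1, hs.2.trans_le ht⟩,
    fun s hs => h.lr s ⟨hs.1, hs.2.trans_le ht⟩, fun s hs => h.sup s ⟨hs.1, hs.2.trans_le ht⟩⟩

theorem mixedNorm_top_le {E : Type*} [NormedAddCommGroup E] {f : Dom → E} {B : ℝ}
    (h : ∀ᵐ p ∂(layer z₀ z₁), ‖f p‖ ≤ B) : mixedNorm z₀ z₁ ⊤ f ≤ ENNReal.ofReal B := by
  rw [mixedNorm_le_iff]
  filter_upwards [Measure.ae_ae_of_ae_prod h] with x hx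
  rw [eLpNorm_exponent_top]
  refine essSup_le_of_ae_le _ (hx.mono fun ζ hζ => ?_)
  change ‖f (x, ζ)‖ₑ ≤ ENNReal.ofReal B
  rw [← ofReal_norm]
  exact ENNReal.ofReal_le_ofReal hζ

section

variable {r : ℝ≥0∞} {t U X Y : ℝ} {v : ℝ → Dom → Vec 𝕜} {DH : ℝ → Fin 2 → Dom → Vec 𝕜}

theorem SolOn.memLInf_fl (h : SolOn z₀ z₁ r t U X Y v DH) {s : ℝ} (hs : s ∈ Ioo 0 t) (i : Fin 3) :
    MemLInf z₀ z₁ 1 (fl z₁ v DH s i) :=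
  (h.slice s hs).memLInf_flux (h.slice s hs).memv i

theorem SolOn.lr_fl (h : SolOn z₀ z₁ r t U X Y v DH) {s : ℝ} (hs : s ∈ Ioo 0 t) (i : Fin 3) :
    mixedNorm z₀ z₁ r (fl z₁ v DH s i) ≤
      ENNReal.ofReal (U * X * s ^ (-(1 - r⁻¹.toReal / 2))) := by
  have hp := Real.rpow_nonneg hs.1.le (-1 / 2 : ℝ)
  refine ((h.slice s hs).mixedNorm_flux_le i).trans ((mul_le_mul' le_rfl (h.lr s hs)).trans ?_)
  rw [← ENNReal.ofReal_mul (mul_nonneg h.hU hp)]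
  refine le_of_eq (congrArg _ ?_)
  rw [show -(1 - r⁻¹.toReal / 2) = -1 / 2 + -(1 / 2 - r⁻¹.toReal / 2) by ring, Real.rpow_add hs.1]
  ring

theorem SolOn.top_fl (h : SolOn z₀ z₁ r t U X Y v DH) {s : ℝ} (hs : s ∈ Ioo 0 t) (i : Fin 3) :
    mixedNorm z₀ z₁ ⊤ (fl z₁ v DH s i) ≤ ENNReal.ofReal (U * Y * s ^ (-1 : ℝ)) := by
  have hp := Real.rpow_nonneg hs.1.le (-1 / 2 : ℝ)
  refine mixedNorm_top_le ?_
  filter_upwards [(h.slice s hs).vel_le i, h.sup s hs] with p h1 h2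
  rw [fl, flux, norm_smul]
  refine (mul_le_mul h1 h2 (norm_nonneg _) (mul_nonneg h.hU hp)).trans (le_of_eq ?_)
  rw [show (-1 : ℝ) = -1 / 2 + -1 / 2 by norm_num, Real.rpow_add hs.1]
  ring_nf

end

theorem inv_top_toReal : ((⊤ : ℝ≥0∞)⁻¹).toReal = 0 := by simp

/-- The velocity `u` is taken in the supremum norm in both estimates. The transported field is taken
in `L^∞(L^r)` in the first, which is mild at `s = 0`, and in the supremum norm in the second, which
is mild at `s = t`. -/
theorem Nop_integrand_le {T : ℝ} {n : ℕ} {k : Idx → ℝ → Plane → ℝ} {m : Idx → ℝ → ℝ → ℝ → ℝ}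
    (hs : IsSystem z₀ z₁ T n k m) :
    ∃ c : ℝ, 0 ≤ c ∧ ∀ (r : ℝ≥0∞) (t U X Y : ℝ) (v : ℝ → Dom → Vec 𝕜)
      (DH : ℝ → Fin 2 → Dom → Vec 𝕜), 1 ≤ r → t ≤ T → SolOn z₀ z₁ r t U X Y v DH →
      ∀ s ∈ Ioo 0 t, ∀ q,
      ‖Nop z₀ z₁ k m (t - s) (fl z₁ v DH s) q‖ ≤
        c * (U * X) * ((t - s) ^ (-((n : ℝ) / 2 + r⁻¹.toReal / 2)) *
          s ^ (-(1 - r⁻¹.toReal / 2))) ∧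
      ‖Nop z₀ z₁ k m (t - s) (fl z₁ v DH s) q‖ ≤
        c * (U * Y) * ((t - s) ^ (-((n : ℝ) / 2)) * s ^ (-(1 : ℝ))) := by
  obtain ⟨c, hc0, hc⟩ := norm_Nop_le (𝕜 := 𝕜) hs
  refine ⟨c, hc0, fun r t U X Y v DH hr ht h s hs q => ?_⟩
  have hts : t - s ∈ Ioc 0 T := ⟨sub_pos.2 hs.2, by linarith [hs.1]⟩
  have hU := h.hU
  have hX := h.hX
  have hY := h.hY
  have p1 := Real.rpow_nonneg hs.1.le (-(1 - r⁻¹.toReal / 2))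
  have p2 := Real.rpow_nonneg hs.1.le (-1 : ℝ)
  constructor
  · refine (hc _ hts r hr _ _ (by positivity) (fun i => (h.memLInf_fl hs i).1)
      (h.lr_fl hs) q).trans (le_of_eq ?_)
    rw [show -(n : ℝ) / 2 - r⁻¹.toReal / 2 = -((n : ℝ) / 2 + r⁻¹.toReal / 2) by ring]
    ring
  · refine (hc _ hts ⊤ le_top _ _ (by positivity) (fun i => (h.memLInf_fl hs i).1)
      (h.top_fl hs) q).trans (le_of_eq ?_)
    rw [inv_top_toReal, show -(n : ℝ) / 2 - 0 / 2 = -((n : ℝ) / 2) by ring]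
    ring

/-- The exponents `1 ≤ r ≤ 2`. -/
def GoodExp (r : ℝ≥0∞) : Prop := 1 ≤ r ∧ r ≠ ⊤ ∧ 1 / 2 ≤ r⁻¹.toReal

theorem GoodExp.mem {r : ℝ≥0∞} (h : GoodExp r) :
    1 / 4 ≤ r⁻¹.toReal / 2 ∧ r⁻¹.toReal / 2 ≤ 1 / 2 :=
  ⟨by linarith [h.2.2], by linarith [(inv_toReal_mem h.1).2]⟩

variable (𝕜) in
-- The `L^r` bound serves for `s < t/2`, the supremum bound for `s > t/2`. For `1 ≤ r ≤ 2` the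
-- exponent `1 - 1/(2r)` at `s = 0` stays at most `3/4`.
theorem integrand_V_le (hz : z₀ < z₁) {T : ℝ} (hT : 0 < T) :
    ∃ c : ℝ, 0 ≤ c ∧ ∀ (r : ℝ≥0∞) (t U X Y : ℝ) (v : ℝ → Dom → Vec 𝕜)
      (DH : ℝ → Fin 2 → Dom → Vec 𝕜), GoodExp r → t ≤ T → SolOn z₀ z₁ r t U X Y v DH →
      ∀ s ∈ Ioo 0 t,
      (∀ q, ‖Nop z₀ z₁ kN (mN z₀ z₁) (t - s) (fl z₁ v DH s) q‖ ≤
        c * (U * X) * t ^ (-(1 / 2 + r⁻¹.toReal / 2)) * s ^ (-(1 - r⁻¹.toReal / 2)) +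
        c * (U * Y) * t ^ (-(1 : ℝ)) * (t - s) ^ (-(1 / 2 : ℝ))) ∧
      ∀ q q', ‖Nop z₀ z₁ kN (mN z₀ z₁) (t - s) (fl z₁ v DH s) q -
          Nop z₀ z₁ kN (mN z₀ z₁) (t - s) (fl z₁ v DH s) q'‖ ≤
        c * (U * X) * (Real.sqrt ‖q'.1 - q.1‖ + Real.sqrt |q'.2 - q.2|) *
          t ^ (-(3 / 4 + r⁻¹.toReal / 2)) * s ^ (-(1 - r⁻¹.toReal / 2)) +
        c * (U * Y) * (Real.sqrt ‖q'.1 - q.1‖ + Real.sqrt |q'.2 - q.2|) *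
          t ^ (-(1 : ℝ)) * (t - s) ^ (-(3 / 4 : ℝ)) := by
  obtain ⟨c, hc0, hc⟩ := Nop_integrand_le (𝕜 := 𝕜) (isSystem_N hz hT)
  obtain ⟨c', hc0', hc'⟩ := holder_Nop_le 𝕜 hz hT
  refine ⟨4 * (c + c'), by positivity, fun r t U X Y v DH hr ht h s hs => ?_⟩
  have hU := h.hU
  have hX := h.hX
  have hY := h.hY
  have hr2 := hr.mem
  have ht0 : 0 < t := hs.1.trans hs.2
  have hts : t - s ∈ Ioc 0 T := ⟨sub_pos.2 hs.2, by linarith [hs.1]⟩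
  have q1 := fun x => Real.rpow_nonneg hs.1.le x
  have q2 := fun x => Real.rpow_nonneg hts.1.le x
  have q3 := fun x => Real.rpow_nonneg ht0.le x
  constructor
  · intro q
    obtain ⟨h1, h2⟩ := hc r t U X Y v DH hr.1 ht h s hs q
    simp only [Nat.cast_one] at h1 h2
    refine (half_split hs (by positivity) (by positivity) (by linarith) (by linarith) zero_le_one
      (by norm_num) h1 h2).trans ?_
    have := q1 (-(1 - r⁻¹.toReal / 2))
    have := q2 (-(1 / 2 : ℝ))
    have := q3 (-(1 / 2 + r⁻¹.toReal / 2))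
    have := q3 (-1)
    refine add_le_add ?_ ?_ <;>
    · rw [← mul_assoc]
      gcongr
      linarith
  · intro q q'
    set W := Real.sqrt ‖q'.1 - q.1‖ + Real.sqrt |q'.2 - q.2| with hW
    have hW0 : 0 ≤ W := by positivity
    have := q1 (-(1 - r⁻¹.toReal / 2))
    have := q1 (-1 : ℝ)
    have h1 := hc' _ hts r hr.1 (fl z₁ v DH s) (U * X * s ^ (-(1 - r⁻¹.toReal / 2)))
      (by positivity) (h.memLInf_fl hs) (h.lr_fl hs) q q'
    have h2 := hc' _ hts ⊤ le_top (fl z₁ v DH s) (U * Y * s ^ (-1 : ℝ))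
      (by positivity) (h.memLInf_fl hs) (h.top_fl hs) q q'
    rw [inv_top_toReal, show (-3 / 4 - 0 / 2 : ℝ) = -(3 / 4) by norm_num, ← hW] at h2
    rw [show -3 / 4 - r⁻¹.toReal / 2 = -(3 / 4 + r⁻¹.toReal / 2) by ring, ← hW] at h1
    refine (half_split hs (P := c' * (U * X) * W) (Q := c' * (U * Y) * W) (by positivity)
      (by positivity) (e := 3 / 4 + r⁻¹.toReal / 2) (b := 1 - r⁻¹.toReal / 2) (a := 3 / 4) (g := 1)
      (by linarith) (by linarith) zero_le_one
      (by norm_num) (h1.trans (le_of_eq (by ring))) (h2.trans (le_of_eq (by ring)))).trans ?_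
    have := q2 (-(3 / 4 : ℝ))
    have := q3 (-(3 / 4 + r⁻¹.toReal / 2))
    have := q3 (-1)
    refine add_le_add ?_ ?_ <;>
    · rw [← mul_assoc, ← mul_assoc]
      gcongr
      linarith

/-- Hölder continuity in the interior of the time interval. -/
structure RegOn (z₀ z₁ t H Y : ℝ) (v : ℝ → Dom → Vec 𝕜) : Prop where
  hH : 0 ≤ H
  cont : ∀ s ∈ Ioo 0 t, ContinuousOn (v s) (univ ×ˢ Ioo z₀ z₁)
  holder : ∀ s ∈ Ioo 0 t, HolderHalf z₀ z₁ (v s) (H * s ^ (-3 / 4 : ℝ))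
  sup : ∀ s ∈ Ioo 0 t, ∀ q : Dom, q.2 ∈ Ioo z₀ z₁ → ‖v s q‖ ≤ Y * s ^ (-1 / 2 : ℝ)

variable (𝕜) in
-- For `s < t/2` the plain bound of order two suffices; for `s > t/2` the frozen estimate replaces
-- it. Its power `s^{-5/4}` is `s^{-1/2}` from the velocity times `s^{-3/4}` from the Hölder
-- constant.
theorem integrand_D_le (hz : z₀ < z₁) {T : ℝ} (hT : 0 < T) (d : Option (Fin 2)) :
    ∃ c : ℝ, 0 ≤ c ∧ ∀ (r : ℝ≥0∞) (t U X Y H : ℝ) (v : ℝ → Dom → Vec 𝕜)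
      (DH : ℝ → Fin 2 → Dom → Vec 𝕜), GoodExp r → t ≤ T → SolOn z₀ z₁ r t U X Y v DH →
      RegOn z₀ z₁ t H Y v → ∀ s ∈ Ioo 0 t, ∀ q : Dom, q.2 ∈ Ioo z₀ z₁ →
      ‖Nop z₀ z₁ (kD d) (mD z₀ z₁ d) (t - s) (fl z₁ v DH s) q‖ ≤
        c * (U * X) * t ^ (-(1 + r⁻¹.toReal / 2)) * s ^ (-(1 - r⁻¹.toReal / 2)) +
        c * (U * (H + Y)) * t ^ (-(5 / 4 : ℝ)) * (t - s) ^ (-(3 / 4 : ℝ)) := by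
  obtain ⟨c, hc0, hc⟩ := Nop_integrand_le (𝕜 := 𝕜) (isSystem_D hz hT d)
  obtain ⟨c', hc0', hc'⟩ := norm_Nop_freeze_le 𝕜 hz hT d
  -- The less singular contribution `(t-s)^{-1/2} s^{-1}` of the nonlocal part is brought to the
  -- same powers; each of the two factors costs `T^{1/4}`.
  set K := T ^ (1 / 4 : ℝ) with hK
  have hK0 : 0 < K := Real.rpow_pos_of_pos hT _
  refine ⟨4 * (c + c' * (1 + K * K)), by positivity,
    fun r t U X Y H v DH hr ht h hreg s hs q hq => ?_⟩
  have hU := h.hU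
  have hX := h.hX
  have hY := h.hY
  have hH := hreg.hH
  have hr2 := hr.mem
  have ht0 : 0 < t := hs.1.trans hs.2
  have hts : t - s ∈ Ioc 0 T := ⟨sub_pos.2 hs.2, by linarith [hs.1]⟩
  have q1 := fun x => Real.rpow_nonneg hs.1.le x
  have q2 := fun x => Real.rpow_nonneg hts.1.le x
  have q3 := fun x => Real.rpow_nonneg ht0.le x
  have h1 := (hc r t U X Y v DH hr.1 ht h s hs q).1
  rw [show ((2 : ℕ) : ℝ) / 2 = 1 by norm_num] at h1
  have h2 := hc' _ hts (v s) (DH s) _ (H * s ^ (-3 / 4 : ℝ)) (Y * s ^ (-1 / 2 : ℝ)) (h.slice s hs)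
    (mul_nonneg hH (q1 _)) (hreg.holder s hs) (mul_nonneg hY (q1 _)) (hreg.cont s hs)
    (hreg.sup s hs) q hq
  have r1 : (t - s) ^ (-1 / 2 : ℝ) ≤ K * (t - s) ^ (-(3 / 4) : ℝ) := by
    rw [show (-1 / 2 : ℝ) = 1 / 4 + -(3 / 4) by norm_num, Real.rpow_add hts.1]
    exact mul_le_mul_of_nonneg_right (Real.rpow_le_rpow hts.1.le hts.2 (by norm_num)) (q2 _)
  have r2 : s ^ (-1 / 2 : ℝ) * s ^ (-1 / 2 : ℝ) ≤ K * s ^ (-(5 / 4) : ℝ) := by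
    rw [← Real.rpow_add hs.1, show (-1 / 2 + -1 / 2 : ℝ) = 1 / 4 + -(5 / 4) by norm_num,
      Real.rpow_add hs.1]
    exact mul_le_mul_of_nonneg_right
      (Real.rpow_le_rpow hs.1.le (by linarith [hs.2]) (by norm_num)) (q1 _)
  have r3 : s ^ (-1 / 2 : ℝ) * s ^ (-3 / 4 : ℝ) = s ^ (-(5 / 4) : ℝ) := by
    rw [← Real.rpow_add hs.1]; norm_num
  set τa := (t - s) ^ (-(3 / 4) : ℝ) with hτa
  set sg := s ^ (-(5 / 4) : ℝ) with hsg
  have hτa0 : 0 ≤ τa := q2 _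
  have hsg0 : 0 ≤ sg := q1 _
  have h3 : ‖Nop z₀ z₁ (kD d) (mD z₀ z₁ d) (t - s) (fl z₁ v DH s) q‖ ≤
      c' * (1 + K * K) * (U * (H + Y)) * (τa * sg) := by
    refine h2.trans ?_
    rw [show (-3 / 4 : ℝ) = -(3 / 4) by norm_num] at r3 ⊢
    rw [← hτa]
    have e1 : U * s ^ (-1 / 2 : ℝ) * (H * s ^ (-(3 / 4) : ℝ)) = U * H * sg := by
      rw [← r3]; ring
    have e2 : U * s ^ (-1 / 2 : ℝ) * (Y * s ^ (-1 / 2 : ℝ)) =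
      U * Y * (s ^ (-1 / 2 : ℝ) * s ^ (-1 / 2 : ℝ)) := by ring
    rw [e1, e2]
    have e3 : (t - s) ^ (-1 / 2 : ℝ) * (U * Y * (s ^ (-1 / 2 : ℝ) * s ^ (-1 / 2 : ℝ))) ≤
        (K * τa) * (U * Y * (K * sg)) := by
      have := q1 (-1 / 2)
      gcongr
    have p1 : 0 ≤ U * H * (τa * sg) := by positivity
    have p2 : 0 ≤ U * Y * (τa * sg) := by positivity
    have p3 : 0 ≤ K * K := by positivity
    calc _ ≤ c' * (τa * (U * H * sg) + (K * τa) * (U * Y * (K * sg))) := by gcongr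
      _ = c' * (U * H * (τa * sg) + K * K * (U * Y * (τa * sg))) := by ring
      _ ≤ c' * ((1 + K * K) * (U * H * (τa * sg)) + (1 + K * K) * (U * Y * (τa * sg))) :=
          mul_le_mul_of_nonneg_left (by nlinarith [mul_nonneg p3 p1, p2]) hc0'
      _ = _ := by ring
  refine (half_split hs (by positivity) (by positivity) (by linarith) (by linarith)
    (by norm_num) (by norm_num) h1 h3).trans ?_
  have := q1 (-(1 - r⁻¹.toReal / 2))
  have := q3 (-(1 + r⁻¹.toReal / 2))
  have := q3 (-(5 / 4))
  have hKK : 0 ≤ c' * (1 + K * K) := by positivity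
  refine add_le_add ?_ ?_ <;>
  · rw [← mul_assoc]
    gcongr
    linarith

end Estimates

/-! ### The integral equation and the formula for its gradient -/

section Estimates

variable {𝕜 : Type*} [RCLike 𝕜] {z₀ z₁ : ℝ}

/-- The integral equation, at every point of the layer. -/
structure MildEq (z₀ z₁ T : ℝ) (a : Dom → Vec 𝕜) (V : ℝ → Dom → Vec 𝕜)
    (DH : ℝ → Fin 2 → Dom → Vec 𝕜) : Prop where
  data : MemLInf z₀ z₁ 1 a
  meas : ∀ t ∈ Ioo 0 T, ∀ q : Dom, q.2 ∈ Ioo z₀ z₁ → AEStronglyMeasurable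
    (fun s => Nop z₀ z₁ kN (mN z₀ z₁) (t - s) (fl z₁ V DH s) q) (volume.restrict (Ioo 0 t))
  eq : ∀ t ∈ Ioo 0 T, ∀ q : Dom, q.2 ∈ Ioo z₀ z₁ →
    V t q = Op z₀ z₁ (gaussPlane t) (reflKernel z₀ z₁ 0 1 1 t) a q -
      ∫ s in Ioo 0 t, Nop z₀ z₁ kN (mN z₀ z₁) (t - s) (fl z₁ V DH s) q

theorem integrableOn_of_le_singular {E : Type*} [NormedAddCommGroup E] {f : ℝ → E}
    {t P Q a b : ℝ} (ht : 0 < t) (hP : 0 ≤ P) (hQ : 0 ≤ Q) (ha : a ≤ 3 / 4) (hb : b ≤ 3 / 4)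
    (hm : AEStronglyMeasurable f (volume.restrict (Ioo 0 t)))
    (hf : ∀ s ∈ Ioo 0 t, ‖f s‖ ≤ P * s ^ (-b) + Q * (t - s) ^ (-a)) :
    IntegrableOn f (Ioo 0 t) :=
  (integral_singular ht hP hQ ha hb).1.mono' hm ((ae_restrict_mem measurableSet_Ioo).mono hf)

theorem mul_rpow_mul_rpow {t x y z c : ℝ} (ht : 0 < t) (h : x + y = z) :
    c * t ^ x * t ^ y = c * t ^ z := by
  rw [mul_assoc, ← Real.rpow_add ht, h]

variable (𝕜) in
-- After integration all powers of `t` combine to the scaling invariant ones, `-1/2` and `-3/4`.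
-- Only the data may keep a positive power, namely when `r > 1`.
theorem MildEq.estimate (hz : z₀ < z₁) {T : ℝ} (hT : 0 < T) :
    ∃ c : ℝ, 0 ≤ c ∧ ∀ (r : ℝ≥0∞) (t T₁ U X Y A : ℝ) (a : Dom → Vec 𝕜) (V : ℝ → Dom → Vec 𝕜)
      (DH : ℝ → Fin 2 → Dom → Vec 𝕜), GoodExp r → t ≤ T → t ∈ Ioo 0 T₁ →
      MildEq z₀ z₁ T₁ a V DH → SolOn z₀ z₁ r t U X Y V DH → 0 ≤ A →
      mixedNorm z₀ z₁ r a ≤ ENNReal.ofReal A →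
      (∀ q : Dom, q.2 ∈ Ioo z₀ z₁ → ‖V t q‖ ≤
        c * (A * t ^ (1 / 2 - r⁻¹.toReal / 2) + U * X + U * Y) * t ^ (-1 / 2 : ℝ)) ∧
      HolderHalf z₀ z₁ (V t)
        (c * (A * t ^ (1 / 2 - r⁻¹.toReal / 2) + U * X + U * Y) * t ^ (-3 / 4 : ℝ)) := by
  obtain ⟨c, hc0, hc⟩ := norm_heat_le 𝕜 hz hT
  obtain ⟨c', hc0', hc'⟩ := integrand_V_le 𝕜 hz hT
  refine ⟨c + 4 * c', by positivity, fun r t T₁ U X Y A a V DH hr htT ht hV h hA haA => ?_⟩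
  have hU := h.hU
  have hX := h.hX
  have hY := h.hY
  have hr2 := hr.mem
  have q3 := fun x => Real.rpow_nonneg ht.1.le x
  obtain ⟨d1, d2, -⟩ := hc t ⟨ht.1, htT⟩ r hr.1 a A hA hV.data haA
  have hI := fun s hs => hc' r t U X Y V DH hr htT h s hs
  set ρ := r⁻¹.toReal / 2 with hρ
  have e0 : 0 ≤ A * t ^ (1 / 2 - ρ) := mul_nonneg hA (q3 _)
  have e1 : 0 ≤ U * X := by positivity
  have e2 : 0 ≤ U * Y := by positivity
  have m1 := q3 (-1 / 2)
  have m2 := q3 (-3 / 4)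
  constructor
  · intro q hq
    have i1 := norm_integral_singular_le ht.1 (mul_nonneg (mul_nonneg hc0' e1) (q3 _))
      (mul_nonneg (mul_nonneg hc0' e2) (q3 _)) (by norm_num) (by linarith)
      (fun s hs => (hI s hs).1 q)
    rw [hV.eq t ht q hq]
    refine (norm_sub_le _ _).trans ((add_le_add (d1 q) i1).trans ?_)
    rw [← mul_assoc, ← mul_assoc, mul_rpow_mul_rpow ht.1 (z := -1 / 2) (by ring),
      ← mul_assoc, ← mul_assoc, mul_rpow_mul_rpow ht.1 (z := -1 / 2) (by norm_num)]
    rw [show c * t ^ (-ρ) * A = c * A * t ^ (1 / 2 - ρ) * t ^ (-1 / 2 : ℝ) by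
      rw [mul_rpow_mul_rpow ht.1 (z := -ρ) (by ring)]; ring]
    have : 0 ≤ (4 * c' * (A * t ^ (1 / 2 - ρ)) + c * (U * X + U * Y)) * t ^ (-1 / 2 : ℝ) := by
      positivity
    linarith
  · intro q q' hq hq'
    set W := Real.sqrt ‖q'.1 - q.1‖ + Real.sqrt |q'.2 - q.2| with hW
    have hW0 : 0 ≤ W := by positivity
    have i1 := norm_integral_singular_le ht.1
      (mul_nonneg (mul_nonneg (mul_nonneg hc0' e1) hW0) (q3 _))
      (mul_nonneg (mul_nonneg (mul_nonneg hc0' e2) hW0) (q3 _)) (by norm_num) (by linarith)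
      (fun s hs => (hI s hs).2 q q')
    have hint : ∀ q : Dom, q.2 ∈ Ioo z₀ z₁ → IntegrableOn
        (fun s => Nop z₀ z₁ kN (mN z₀ z₁) (t - s) (fl z₁ V DH s) q) (Ioo 0 t) := fun q hq =>
      integrableOn_of_le_singular ht.1 (mul_nonneg (mul_nonneg hc0' e1) (q3 _))
        (mul_nonneg (mul_nonneg hc0' e2) (q3 _)) (by norm_num) (by linarith)
        (hV.meas t ht q hq) (fun s hs => (hI s hs).1 q)
    rw [integral_sub (hint q hq) (hint q' hq')] at i1
    rw [hV.eq t ht q hq, hV.eq t ht q' hq', sub_sub_sub_comm, ← mul_add, ← hW]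
    refine (norm_sub_le _ _).trans ((add_le_add (d2 q q') i1).trans ?_)
    rw [← mul_assoc, ← mul_assoc, ← mul_assoc, mul_rpow_mul_rpow ht.1 (z := -3 / 4) (by ring),
      ← mul_assoc, ← mul_assoc, ← mul_assoc, mul_rpow_mul_rpow ht.1 (z := -3 / 4) (by norm_num)]
    rw [show c * t ^ (-1 / 4 - ρ) * A * W = c * A * W * t ^ (1 / 2 - ρ) * t ^ (-3 / 4 : ℝ) by
      rw [mul_rpow_mul_rpow ht.1 (z := -1 / 4 - ρ) (by ring)]; ring]
    have : 0 ≤ (4 * c' * (A * t ^ (1 / 2 - ρ)) + c * (U * X + U * Y)) * t ^ (-3 / 4 : ℝ) * W := by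
      positivity
    linarith

/-- The formula for the derivative of a solution. -/
def gradFormula (z₀ z₁ : ℝ) (a : Dom → Vec 𝕜) (V : ℝ → Dom → Vec 𝕜)
    (DH : ℝ → Fin 2 → Dom → Vec 𝕜) (d : Option (Fin 2)) (t : ℝ) (q : Dom) : Vec 𝕜 :=
  Op z₀ z₁ (kS d t) (mS z₀ z₁ d t) a q -
    ∫ s in Ioo 0 t, Nop z₀ z₁ (kD d) (mD z₀ z₁ d) (t - s) (fl z₁ V DH s) q

variable (𝕜) in
-- The same computation with `integrand_D_le`. The Hölder constant `H` now enters through the frozen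
-- part, and the scaling invariant power is `-1`.
theorem norm_gradFormula_le (hz : z₀ < z₁) {T : ℝ} (hT : 0 < T) (d : Option (Fin 2)) :
    ∃ c : ℝ, 0 ≤ c ∧ ∀ (r : ℝ≥0∞) (t U X Y H A : ℝ) (a : Dom → Vec 𝕜) (V : ℝ → Dom → Vec 𝕜)
      (DH : ℝ → Fin 2 → Dom → Vec 𝕜), GoodExp r → t ∈ Ioc 0 T → MemLInf z₀ z₁ 1 a →
      SolOn z₀ z₁ r t U X Y V DH → RegOn z₀ z₁ t H Y V → 0 ≤ A →
      mixedNorm z₀ z₁ r a ≤ ENNReal.ofReal A → ∀ q : Dom, q.2 ∈ Ioo z₀ z₁ →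
      ‖gradFormula z₀ z₁ a V DH d t q‖ ≤
        c * (A * t ^ (1 / 2 - r⁻¹.toReal / 2) + U * X + U * (H + Y)) * t ^ (-1 : ℝ) := by
  obtain ⟨c, hc0, hc⟩ := norm_heat_le 𝕜 hz hT
  obtain ⟨c', hc0', hc'⟩ := integrand_D_le 𝕜 hz hT d
  refine ⟨c + 4 * c', by positivity, fun r t U X Y H A a V DH hr ht ha h hreg hA haA q hq => ?_⟩
  have hU := h.hU
  have hX := h.hX
  have hY := h.hY
  have hH := hreg.hH
  have hr2 := hr.mem
  have q3 := fun x => Real.rpow_nonneg ht.1.le x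
  obtain ⟨-, -, d3⟩ := hc t ht r hr.1 a A hA ha haA
  have hI := fun s hs => hc' r t U X Y H V DH hr ht.2 h hreg s hs q hq
  set ρ := r⁻¹.toReal / 2 with hρ
  have e0 : 0 ≤ A * t ^ (1 / 2 - ρ) := mul_nonneg hA (q3 _)
  have e1 : 0 ≤ U * X := by positivity
  have e2 : 0 ≤ U * (H + Y) := by positivity
  have m1 := q3 (-1)
  have i1 := norm_integral_singular_le ht.1 (mul_nonneg (mul_nonneg hc0' e1) (q3 _))
    (mul_nonneg (mul_nonneg hc0' e2) (q3 _)) (by norm_num) (by linarith) hI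
  refine (norm_sub_le _ _).trans ((add_le_add (d3 d q) i1).trans ?_)
  rw [← mul_assoc, ← mul_assoc, mul_rpow_mul_rpow ht.1 (z := -1) (by ring),
    ← mul_assoc, ← mul_assoc, mul_rpow_mul_rpow ht.1 (z := -1) (by norm_num)]
  rw [show c * t ^ (-1 / 2 - ρ) * A = c * A * t ^ (1 / 2 - ρ) * t ^ (-1 : ℝ) by
    rw [mul_rpow_mul_rpow ht.1 (z := -1 / 2 - ρ) (by ring)]; ring]
  have : 0 ≤ (4 * c' * (A * t ^ (1 / 2 - ρ)) + c * (U * X + U * (H + Y))) * t ^ (-1 : ℝ) := by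
    positivity
  linarith

/-! ### The equation for the derivative -/

theorem eventually_mem_layer {q : Dom} (hq : q.2 ∈ Ioo z₀ z₁) (e : Dom) :
    ∀ᶠ x : ℝ in 𝓝 0, (q + x • e).2 ∈ Ioo z₀ z₁ := by
  have : Tendsto (fun x : ℝ => (q + x • e).2) (𝓝 0) (𝓝 q.2) := by
    have h : Continuous fun x : ℝ => (q + x • e).2 := by fun_prop
    simpa using h.tendsto 0
  exact this.eventually (isOpen_Ioo.mem_nhds hq)

theorem hasDerivAt_of_hasLineDerivAt {E F : Type*} [NormedAddCommGroup E] [NormedSpace ℝ E]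
    [NormedAddCommGroup F] [NormedSpace ℝ F] {f : E → F} {f' : F} {q e : E} {x : ℝ}
    (h : HasLineDerivAt ℝ f f' (q + x • e) e) : HasDerivAt (fun y : ℝ => f (q + y • e)) f' x := by
  have h1 : HasDerivAt (fun y : ℝ => f (q + x • e + y • e)) f' (x - x) := by
    rw [sub_self]; exact h
  have h2 := HasDerivAt.comp_sub_const x x h1
  refine h2.congr_of_eventuallyEq (Eventually.of_forall fun y => ?_)
  simp only [sub_smul]
  congr 1
  abel

/-- Difference quotients. -/
theorem tendsto_quotient {E F : Type*} [NormedAddCommGroup E] [NormedSpace ℝ E]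
    [NormedAddCommGroup F] [NormedSpace ℝ F] {f : E → F} {f' : F} {q e : E}
    (h : HasLineDerivAt ℝ f f' q e) {u : ℕ → ℝ} (hu : Tendsto u atTop (𝓝[≠] 0)) :
    Tendsto (fun n => (u n)⁻¹ • (f (q + u n • e) - f q)) atTop (𝓝 f') := by
  have h1 := (hasDerivAt_iff_tendsto_slope_zero.1 h).comp hu
  refine h1.congr fun n => ?_
  simp

theorem exists_seq_layer {q : Dom} (hq : q.2 ∈ Ioo z₀ z₁) (e : Dom) :
    ∃ u : ℕ → ℝ, Tendsto u atTop (𝓝[≠] 0) ∧ ∀ n, (q + u n • e).2 ∈ Ioo z₀ z₁ := by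
  have h1 : ∀ᶠ x : ℝ in 𝓝[≠] 0, (q + x • e).2 ∈ Ioo z₀ z₁ :=
    (eventually_mem_layer hq e).filter_mono nhdsWithin_le_nhds
  obtain ⟨u, hu⟩ := exists_seq_tendsto (𝓝[≠] (0 : ℝ))
  obtain ⟨N, hN⟩ := eventually_atTop.1 (hu.eventually h1)
  exact ⟨fun n => u (n + N), hu.comp (tendsto_add_atTop_nat N), fun n => hN _ (by omega)⟩

section

variable {r : ℝ≥0∞} {t T₁ U X Y H : ℝ} {a : Dom → Vec 𝕜} {V : ℝ → Dom → Vec 𝕜}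
  {DH : ℝ → Fin 2 → Dom → Vec 𝕜}

/-- Measurability in `s` is inherited from the undifferentiated integrand, through difference
quotients along a sequence that stays in the layer. -/
theorem MildEq.meas_grad (hz : z₀ < z₁) (hV : MildEq z₀ z₁ T₁ a V DH) (ht : t ∈ Ioo 0 T₁)
    (h : SolOn z₀ z₁ r t U X Y V DH) (d : Option (Fin 2)) {q : Dom} (hq : q.2 ∈ Ioo z₀ z₁) :
    AEStronglyMeasurable (fun s => Nop z₀ z₁ (kD d) (mD z₀ z₁ d) (t - s) (fl z₁ V DH s) q)
      (volume.restrict (Ioo 0 t)) := by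
  obtain ⟨u, hu, hul⟩ := exists_seq_layer hq (dir d)
  refine aestronglyMeasurable_of_tendsto_ae atTop (f := fun n s => (u n)⁻¹ •
    (Nop z₀ z₁ kN (mN z₀ z₁) (t - s) (fl z₁ V DH s) (q + u n • dir d) -
      Nop z₀ z₁ kN (mN z₀ z₁) (t - s) (fl z₁ V DH s) q)) (fun n =>
    ((hV.meas t ht _ (hul n)).sub (hV.meas t ht q hq)).const_smul (u n)⁻¹) ?_
  refine (ae_restrict_mem measurableSet_Ioo).mono fun s hs => ?_
  exact tendsto_quotient (hasLineDerivAt_Nop hz ⟨sub_pos.2 hs.2, le_rfl⟩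
    (h.memLInf_fl hs) d q) hu

/-- The derivative passes under the time integral, because `integrand_D_le` bounds the
differentiated integrand by an integrable function of `s`, uniformly on the layer. -/
theorem MildEq.hasLineDerivAt (hz : z₀ < z₁) (hV : MildEq z₀ z₁ T₁ a V DH) (ht : t ∈ Ioo 0 T₁)
    (hr : GoodExp r) (h : SolOn z₀ z₁ r t U X Y V DH) (hreg : RegOn z₀ z₁ t H Y V)
    (d : Option (Fin 2)) {q : Dom} (hq : q.2 ∈ Ioo z₀ z₁) :
    HasLineDerivAt ℝ (V t) (gradFormula z₀ z₁ a V DH d t q) q (dir d) := by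
  obtain ⟨c, hc0, hc⟩ := integrand_D_le 𝕜 hz ht.1 d
  obtain ⟨c', hc0', hc'⟩ := integrand_V_le 𝕜 hz ht.1
  have hU := h.hU
  have hX := h.hX
  have hY := h.hY
  have hH := hreg.hH
  have hr2 := hr.mem
  have q3 := fun x => Real.rpow_nonneg ht.1.le x
  have hev := eventually_mem_layer hq (dir d)
  have h1 : HasDerivAt (fun x : ℝ => ∫ s in Ioo 0 t,
      Nop z₀ z₁ kN (mN z₀ z₁) (t - s) (fl z₁ V DH s) (q + x • dir d))
      (∫ s in Ioo 0 t, Nop z₀ z₁ (kD d) (mD z₀ z₁ d) (t - s) (fl z₁ V DH s) (q + (0 : ℝ) • dir d))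
      0 := by
    refine (hasDerivAt_integral_of_dominated_loc_of_deriv_le hev
      (F := fun x s => Nop z₀ z₁ kN (mN z₀ z₁) (t - s) (fl z₁ V DH s) (q + x • dir d))
      (F' := fun x s => Nop z₀ z₁ (kD d) (mD z₀ z₁ d) (t - s) (fl z₁ V DH s) (q + x • dir d))
      (hev.mono fun x hx => hV.meas t ht _ hx) ?_ ?_ ?_
      (integral_singular (a := 3 / 4) (b := 1 - r⁻¹.toReal / 2)
      (P := c * (U * X) * t ^ (-(1 + r⁻¹.toReal / 2)))
      (Q := c * (U * (H + Y)) * t ^ (-(5 / 4 : ℝ))) ht.1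
      (mul_nonneg (mul_nonneg hc0 (mul_nonneg hU hX)) (q3 _))
      (mul_nonneg (mul_nonneg hc0 (mul_nonneg hU (add_nonneg hH hY))) (q3 _)) (by norm_num)
      (by linarith)).1 ?_).2
    · simp only [zero_smul, add_zero]
      exact integrableOn_of_le_singular ht.1 (mul_nonneg (mul_nonneg hc0' (mul_nonneg hU hX)) (q3 _))
        (mul_nonneg (mul_nonneg hc0' (mul_nonneg hU hY)) (q3 _)) (by norm_num) (by linarith)
        (hV.meas t ht q hq) (fun s hs => (hc' r t U X Y V DH hr le_rfl h s hs).1 q)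
    · simp only [zero_smul, add_zero]
      exact hV.meas_grad hz ht h d hq
    · exact (ae_restrict_mem measurableSet_Ioo).mono fun s hs x hx =>
        hc r t U X Y H V DH hr le_rfl h hreg s hs _ hx
    · exact (ae_restrict_mem measurableSet_Ioo).mono fun s hs x hx =>
        hasDerivAt_of_hasLineDerivAt (hasLineDerivAt_Nop hz ⟨sub_pos.2 hs.2, le_rfl⟩
          (h.memLInf_fl hs) d _)
  have h2 := (hasLineDerivAt_heat hz ht.1 hV.data d q)
  rw [HasLineDerivAt] at h2 ⊢
  have h3 := h2.sub h1
  simp only [zero_smul, add_zero] at h3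
  refine h3.congr_of_eventuallyEq (hev.mono fun x hx => ?_)
  exact hV.eq t ht _ hx

end

end Estimates

/-! ### Equicontinuity of the Duhamel integral -/

section Modulus

variable {𝕜 : Type*} [RCLike 𝕜] {z₀ z₁ : ℝ}

/-- On the last piece of length `d ≤ t₀/2` the factor `s^{-b}` is at most `(t₀/2)^{-b}`, and the
singular factor integrates to at most `4 d^{1-a} ≤ 4 d^{1/4}`. -/
theorem norm_tail_le {E : Type*} [NormedAddCommGroup E] [NormedSpace ℝ E] {f : ℝ → E}
    {t₀ t d P Q a b : ℝ} (ht : t₀ ≤ t) (hd : 0 < d) (hdt : d ≤ t₀ / 2) (hd1 : d ≤ 1)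
    (hb : 0 ≤ b) (ha : a ≤ 3 / 4) (hP : 0 ≤ P) (hQ : 0 ≤ Q)
    (hf : ∀ s ∈ Ioo 0 t, ‖f s‖ ≤ P * s ^ (-b) + Q * (t - s) ^ (-a)) :
    ‖∫ s in Ioo (t - d) t, f s‖ ≤ 4 * (P * (t₀ / 2) ^ (-b) + Q) * d ^ (1 / 4 : ℝ) := by
  have hK : 0 ≤ (t₀ / 2) ^ (-b) := Real.rpow_nonneg (by linarith) _
  have e : ∫ s in Ioo (t - d) t, f s = ∫ s in Ioo 0 d, f (s + (t - d)) := by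
    rw [← integral_Ioc_eq_integral_Ioo, ← integral_Ioc_eq_integral_Ioo,
      ← intervalIntegral.integral_of_le (by linarith), ← intervalIntegral.integral_of_le hd.le,
      intervalIntegral.integral_comp_add_right]
    congr 1 <;> ring
  rw [e]
  refine (norm_integral_singular_le (P := P * (t₀ / 2) ^ (-b)) (Q := Q) (b := 0) hd
    (mul_nonneg hP hK) hQ ha (by norm_num) fun s hs => ?_).trans ?_
  · refine (hf _ ⟨by linarith [hs.1], by linarith [hs.2]⟩).trans ?_
    rw [neg_zero, Real.rpow_zero, mul_one, show t - (s + (t - d)) = d - s by ring]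
    gcongr ?_ + _
    refine mul_le_mul_of_nonneg_left ?_ hP
    exact Real.rpow_le_rpow_of_nonpos (by linarith) (by linarith [hs.1]) (by linarith)
  · have h1 : d ^ (1 - 0 : ℝ) ≤ d ^ (1 / 4 : ℝ) :=
      Real.rpow_le_rpow_of_exponent_ge hd hd1 (by norm_num)
    have h2 : d ^ (1 - a) ≤ d ^ (1 / 4 : ℝ) :=
      Real.rpow_le_rpow_of_exponent_ge hd hd1 (by linarith)
    have h3 : 0 ≤ P * (t₀ / 2) ^ (-b) := mul_nonneg hP hK
    nlinarith [mul_le_mul_of_nonneg_left h1 h3, mul_le_mul_of_nonneg_left h2 hQ]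

theorem exists_rpow_le {K e ε d₀ : ℝ} (he : 0 < e) (hε : 0 < ε) (hd : 0 < d₀) :
    ∃ d > 0, d ≤ d₀ ∧ K * d ^ e ≤ ε := by
  have h : Tendsto (fun d : ℝ => K * d ^ e) (𝓝[>] 0) (𝓝 0) := by
    have h1 : ContinuousAt (fun d : ℝ => K * d ^ e) 0 :=
      (Real.continuousAt_rpow_const _ _ (Or.inr he.le)).const_mul K
    have h2 := h1.tendsto
    rw [Real.zero_rpow he.ne', mul_zero] at h2
    exact h2.mono_left nhdsWithin_le_nhds
  have h1 : ∀ᶠ d : ℝ in 𝓝[>] 0, d ∈ Ioc 0 d₀ := Ioc_mem_nhdsGT hd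
  obtain ⟨d, hd1, hd2⟩ := (h1.and (h.eventually (ge_mem_nhds hε))).exists
  exact ⟨d, hd1.1, hd1.2, hd2⟩

theorem setIntegral_Ioo_split {E : Type*} [NormedAddCommGroup E] [NormedSpace ℝ E] {f : ℝ → E}
    {t S : ℝ} (hS : 0 ≤ S) (hSt : S ≤ t) (hf : IntegrableOn f (Ioo 0 t)) :
    ∫ s in Ioo 0 t, f s = (∫ s in Ioo 0 S, f s) + ∫ s in Ioo S t, f s := by
  have hi : IntegrableOn f (Ioc 0 t) := by rwa [integrableOn_Ioc_iff_integrableOn_Ioo]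
  have h1 : IntervalIntegrable f volume 0 t := by
    rwa [intervalIntegrable_iff_integrableOn_Ioc_of_le (hS.trans hSt)]
  simp only [← integral_Ioc_eq_integral_Ioo]
  rw [← intervalIntegral.integral_of_le hS, ← intervalIntegral.integral_of_le hSt,
    ← intervalIntegral.integral_of_le (hS.trans hSt),
    intervalIntegral.integral_add_adjacent_intervals]
  · exact h1.mono_set (by rw [uIcc_of_le hS, uIcc_of_le (hS.trans hSt)]; exact Icc_subset_Icc_right hSt)
  · exact h1.mono_set (by rw [uIcc_of_le hSt, uIcc_of_le (hS.trans hSt)]; exact Icc_subset_Icc_left hS)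

/-- Near the final time the integral is small by the singular bound. On the rest the kernels have
age at least `d/2`, where `Nop_modulus` is uniform in `s`. -/
theorem duhamel_modulus {T : ℝ} {n : ℕ} {k : Idx → ℝ → Plane → ℝ} {m : Idx → ℝ → ℝ → ℝ → ℝ}
    (hs : IsSystem z₀ z₁ T n k m) {F : ℝ → Fin 3 → Dom → Vec 𝕜} {B t₀ t₁ P Q a b : ℝ}
    (ht₀ : 0 < t₀) (ht₁ : t₁ ≤ T) (hB : 0 ≤ B)
    (hFm : ∀ s ∈ Ioo 0 t₁, ∀ i, AEStronglyMeasurable (F s i) (layer z₀ z₁))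
    (hF : ∀ s ∈ Ioo 0 t₁, ∀ i, mixedNorm z₀ z₁ 1 (F s i) ≤ ENNReal.ofReal (B * s ^ (-(1 / 2 : ℝ))))
    (hP : 0 ≤ P) (hQ : 0 ≤ Q) (hb0 : 0 ≤ b) (hb : b ≤ 3 / 4) (ha : a ≤ 3 / 4)
    (hle : ∀ t ∈ Icc t₀ t₁, ∀ s ∈ Ioo 0 t, ∀ q : Dom, q.2 ∈ Ioo z₀ z₁ →
      ‖Nop z₀ z₁ k m (t - s) (F s) q‖ ≤ P * s ^ (-b) + Q * (t - s) ^ (-a))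
    (hm : ∀ t ∈ Icc t₀ t₁, ∀ q : Dom, q.2 ∈ Ioo z₀ z₁ → AEStronglyMeasurable
      (fun s => Nop z₀ z₁ k m (t - s) (F s) q) (volume.restrict (Ioo 0 t)))
    {ε : ℝ} (hε : 0 < ε) :
    ∃ η > 0, ∀ t ∈ Icc t₀ t₁, ∀ t' ∈ Icc t₀ t₁, ∀ q q' : Dom, q.2 ∈ Ioo z₀ z₁ → q'.2 ∈ Ioo z₀ z₁ →
      |t - t'| < η → dist q q' < η →
      ‖(∫ s in Ioo 0 t, Nop z₀ z₁ k m (t - s) (F s) q) -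
        ∫ s in Ioo 0 t', Nop z₀ z₁ k m (t' - s) (F s) q'‖ ≤ ε := by
  have hK : 0 ≤ (t₀ / 2) ^ (-b) := Real.rpow_nonneg (by linarith) _
  obtain ⟨d, hd0, hd, hdε⟩ := exists_rpow_le (K := 4 * (P * (t₀ / 2) ^ (-b) + Q)) (e := 1 / 4)
    (ε := ε / 3) (d₀ := min (t₀ / 2) 1) (by norm_num) (by positivity)
    (lt_min (by linarith) one_pos)
  have hd1 : d ≤ t₀ / 2 := hd.trans (min_le_left _ _)
  have hd2 : d ≤ 1 := hd.trans (min_le_right _ _)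
  -- Twelve is `3 * 4`: a third of `ε`, and the constant of `integral_singular`.
  set ε' := ε / (12 * (B * |t₁| ^ (1 / 2 : ℝ) + 1)) with hε'
  have hBt : 0 ≤ B * |t₁| ^ (1 / 2 : ℝ) := mul_nonneg hB (Real.rpow_nonneg (abs_nonneg _) _)
  have hε'0 : 0 < ε' := by positivity
  obtain ⟨η, hη, h⟩ := Nop_modulus (𝕜 := 𝕜) hs (δ := d / 2) (by positivity) hε'0
  refine ⟨min η (d / 2), lt_min hη (by positivity), fun t ht t' ht' q q' hq hq' htt hqq => ?_⟩
  have htt1 := htt.trans_le (min_le_left _ _)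
  have htt2 := abs_lt.1 (htt.trans_le (min_le_right _ _))
  have hqq1 := hqq.trans_le (min_le_left _ _)
  -- One cut for both times: `t - S` and `t' - S` lie between `d/2` and `d` as soon as `|t - t'| <
  -- d/2`.
  set S := min t t' - d / 2 with hS
  have hmt : min t t' ≤ t := min_le_left _ _
  have hmt' : min t t' ≤ t' := min_le_right _ _
  have hmt0 : t₀ ≤ min t t' := le_min ht.1 ht'.1
  have hmlt : t - d / 2 < min t t' := lt_min (by linarith) (by linarith)
  have hmlt' : t' - d / 2 < min t t' := lt_min (by linarith) (by linarith)
  have hS0 : 0 < S := by linarith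
  have hSt1 : S ≤ t₁ := by linarith [ht.2]
  have hint : ∀ t ∈ Icc t₀ t₁, ∀ q : Dom, q.2 ∈ Ioo z₀ z₁ →
      IntegrableOn (fun s => Nop z₀ z₁ k m (t - s) (F s) q) (Ioo 0 t) := fun t ht q hq =>
    integrableOn_of_le_singular (by linarith [ht.1]) hP hQ ha hb (hm t ht q hq)
      fun s hs => hle t ht s hs q hq
  have tail : ∀ t ∈ Icc t₀ t₁, ∀ q : Dom, q.2 ∈ Ioo z₀ z₁ → S < t → t - d ≤ S →
      ‖∫ s in Ioo S t, Nop z₀ z₁ k m (t - s) (F s) q‖ ≤ ε / 3 := by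
    intro t ht q hq hSt htS
    have := norm_tail_le (d := t - S) ht.1 (by linarith) (by linarith) (by linarith) hb0 ha hP hQ
      (fun s hs => hle t ht s hs q hq)
    rw [sub_sub_cancel] at this
    refine this.trans (le_trans ?_ hdε)
    have h4 : (t - S) ^ (1 / 4 : ℝ) ≤ d ^ (1 / 4 : ℝ) :=
      Real.rpow_le_rpow (by linarith) (by linarith) (by norm_num)
    exact mul_le_mul_of_nonneg_left h4 (by positivity)
  have hsub : ∀ t, S ≤ t → Ioo 0 S ⊆ Ioo 0 t := fun t h => Ioo_subset_Ioo_right h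
  have mid : ‖(∫ s in Ioo 0 S, Nop z₀ z₁ k m (t - s) (F s) q) -
      ∫ s in Ioo 0 S, Nop z₀ z₁ k m (t' - s) (F s) q'‖ ≤ ε / 3 := by
    rw [← integral_sub ((hint t ht q hq).mono_set (hsub t (by linarith)))
      ((hint t' ht' q' hq').mono_set (hsub t' (by linarith)))]
    refine (norm_integral_singular_le (P := ε' * B) (Q := 0) (b := 1 / 2) (a := 0) hS0
      (by positivity) le_rfl (by norm_num) (by norm_num) fun s hs => ?_).trans ?_
    · have hs1 : s ∈ Ioo 0 t₁ := ⟨hs.1, by linarith [hs.2]⟩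
      have := h (t - s) ⟨by linarith [hs.2], by linarith [hs.1, ht.2]⟩ (t' - s)
        ⟨by linarith [hs.2], by linarith [hs.1, ht'.2]⟩ q q' hq hq'
        (by rwa [sub_sub_sub_cancel_right]) hqq1 (F s) _
        (mul_nonneg hB (Real.rpow_nonneg hs.1.le _)) (hFm s hs1) (hF s hs1)
      linarith
    · have h5 : S ^ (1 - 1 / 2 : ℝ) ≤ |t₁| ^ (1 / 2 : ℝ) := by
        rw [show (1 - 1 / 2 : ℝ) = 1 / 2 by norm_num]
        exact Real.rpow_le_rpow hS0.le (hSt1.trans (le_abs_self _)) (by norm_num)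
      have h6 : 4 * (ε' * B) * S ^ (1 - 1 / 2 : ℝ) ≤ 4 * (ε' * B) * |t₁| ^ (1 / 2 : ℝ) :=
        mul_le_mul_of_nonneg_left h5 (by positivity)
      have h7 : ε' * (12 * (B * |t₁| ^ (1 / 2 : ℝ) + 1)) = ε := by
        rw [hε']; field_simp
      nlinarith
  rw [setIntegral_Ioo_split hS0.le (by linarith) (hint t ht q hq),
    setIntegral_Ioo_split hS0.le (by linarith) (hint t' ht' q' hq'), add_sub_add_comm]
  have t1 := tail t ht q hq (by linarith) (by linarith)
  have t2 := tail t' ht' q' hq' (by linarith) (by linarith)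
  refine (norm_add_le _ _).trans ?_
  have := norm_sub_le (∫ s in Ioo S t, Nop z₀ z₁ k m (t - s) (F s) q)
    (∫ s in Ioo S t', Nop z₀ z₁ k m (t' - s) (F s) q')
  linarith

/-! ### The classical gradient is the weak gradient -/

theorem integrable_smul_of_continuousOn {F : Type*} [NormedAddCommGroup F] [NormedSpace ℝ F]
    {U : Set Dom} (hU : IsOpen U) {φ : Dom → ℝ} (hφ : Continuous φ) (hc : HasCompactSupport φ)
    (hs : tsupport φ ⊆ U) {f : Dom → F} (hf : ContinuousOn f U) :
    Integrable fun x => φ x • f x := by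
  have h1 : Continuous fun x => φ x • f x := by
    refine continuous_of_tsupport fun x hx => ?_
    have hx' : x ∈ U := hs (tsupport_smul_subset_left φ f hx)
    exact hφ.continuousAt.smul (hf.continuousAt (hU.mem_nhds hx'))
  exact h1.integrable_of_hasCompactSupport (hc.smul_right)

theorem HasWeakDerivOn.ae_eq_of_hasLineDerivAt {F : Type*} [NormedAddCommGroup F] [NormedSpace ℝ F]
    [CompleteSpace F] {U : Set Dom} (hU : IsOpen U) {e : Dom} {f g g' : Dom → F}
    (h : HasWeakDerivOn U e f g) (hd : ∀ x ∈ U, HasLineDerivAt ℝ f (g' x) x e)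
    (hf : ContinuousOn f U) (hg : ContinuousOn g' U) : g =ᵐ[volume.restrict U] g' := by
  have hUm := hU.measurableSet
  have hgl : LocallyIntegrableOn g' U := hg.locallyIntegrableOn hUm
  -- The two derivatives have the same integrals against test functions: one by definition, the
  -- other by classical integration by parts.
  have key := hU.ae_eq_zero_of_integral_contDiff_smul_eq_zero (μ := (volume : Measure Dom))
    (f := fun x => g x - g' x) (h.2.1.sub hgl) ?_
  · rw [Filter.EventuallyEq, ae_restrict_iff' hUm]
    filter_upwards [key] with x hx hxU
    exact sub_eq_zero.1 (hx hxU)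
  intro φ hφ hc hs
  have i1 := integrable_smul_of_continuousOn hU hφ.continuous hc hs hg
  have i2 := integrable_smul_of_continuousOn hU hφ.continuous hc hs hf
  have hs' : tsupport (fun x => fderiv ℝ φ x e) ⊆ tsupport φ :=
    (closure_mono fun x hx => by
      intro h0
      exact hx (by simp [h0])).trans (tsupport_fderiv_subset ℝ)
  have i3 := integrable_smul_of_continuousOn hU (continuous_fderiv_apply hφ e)
    (hasCompactSupport_fderiv_apply hc e) (hs'.trans hs) hf
  have ibp := integral_bilinear_hasLineDerivAt_right_eq_neg_left_of_integrable
    (μ := (volume : Measure Dom)) (B := ContinuousLinearMap.lsmul ℝ ℝ)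
    (f := φ) (f' := fun x => fderiv ℝ φ x e) (g := f) (g' := g') (v := e) i3 i1 i2
    (fun x _ => hasLineDerivAt_of_fderiv hφ e x) (fun x hx => hd x (hs hx))
  simp only [ContinuousLinearMap.lsmul_apply] at ibp
  have hw := h.2.2 φ hφ hc hs
  have z1 : ∀ (ψ : Dom → ℝ) (k : Dom → F), tsupport ψ ⊆ U →
      ∫ x in U, ψ x • k x = ∫ x, ψ x • k x := fun ψ k hψ =>
    setIntegral_eq_integral_of_forall_compl_eq_zero fun x hx => by
      rw [image_eq_zero_of_notMem_tsupport (fun h => hx (hψ h)), zero_smul]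
  rw [z1 _ _ (hs'.trans hs), z1 _ _ hs] at hw
  have i4 : Integrable fun x => φ x • g x := by
    have h5 : IntegrableOn (fun x => φ x • g x) (tsupport φ) :=
      (h.2.1.integrableOn_compact_subset hs hc).continuousOn_smul hφ.continuous.continuousOn hc
    rw [← integrableOn_iff_integrable_of_support_subset (s := tsupport φ)]
    · exact h5
    · exact (Function.support_smul_subset_left φ g).trans (subset_tsupport φ)
  simp only [smul_sub]
  rw [integral_sub i4 i1, ibp, hw]
  simp

end Modulus

section Minkowski

/-- Minkowski's integral inequality, for a family with an explicit bound of the norms. -/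
theorem eLpNorm_integral_le {E α β : Type*} [NormedAddCommGroup E] [NormedSpace ℝ E]
    [MeasurableSpace α] [MeasurableSpace β] {μ : Measure α} {ν : Measure β} [SFinite μ] [SFinite ν]
    {g : α → β → E} (hg : StronglyMeasurable (Function.uncurry g)) {r K : ℝ≥0∞} (hr : 1 ≤ r)
    (hr' : r ≠ ⊤) {w : α → ℝ≥0∞} (hw : Measurable w) (hw0 : ∀ᵐ s ∂μ, w s ≠ 0 ∧ w s ≠ ⊤)
    (h : ∀ᵐ s ∂μ, eLpNorm (g s) r ν ≤ K * w s) :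
    eLpNorm (fun z => ∫ s, g s z ∂μ) r ν ≤ K * ∫⁻ s, w s ∂μ := by
  have hr0 : r ≠ 0 := (zero_lt_one.trans_le hr).ne'
  have hr1 : 1 ≤ r.toReal := by simpa using ENNReal.toReal_mono hr' hr
  have hrp : 0 < r.toReal := by linarith
  have hgs : ∀ z, StronglyMeasurable fun s => g s z := fun z =>
    hg.comp_measurable (measurable_id.prodMk measurable_const)
  have hnorm : ∀ (φ : β → E) (C : ℝ≥0∞), eLpNorm φ r ν ≤ C ↔
      ∫⁻ z, ‖φ z‖ₑ ^ r.toReal ∂ν ≤ C ^ r.toReal := fun φ C => by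
    rw [eLpNorm_eq_lintegral_rpow_enorm_toReal hr0 hr', one_div, ENNReal.rpow_inv_le_iff hrp]
  rw [hnorm]
  set W := ∫⁻ s, w s ∂μ with hW
  have hφ : Measurable (Function.uncurry fun s z => w s * (‖g s z‖ₑ / w s) ^ r.toReal) :=
    (hw.comp measurable_fst).mul
      ((hg.enorm.div (hw.comp measurable_fst)).pow_const _)
  have hφ' : Measurable (Function.uncurry fun z s => w s * (‖g s z‖ₑ / w s) ^ r.toReal) :=
    hφ.comp measurable_swap
  calc ∫⁻ z, ‖∫ s, g s z ∂μ‖ₑ ^ r.toReal ∂ν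
      ≤ ∫⁻ z, W ^ (r.toReal - 1) * ∫⁻ s, w s * (‖g s z‖ₑ / w s) ^ r.toReal ∂μ ∂ν := by
        refine lintegral_mono fun z => ?_
        -- Jensen's inequality for the measure `w μ` is applied to `‖g‖/w`. By hypothesis this ratio
        -- has `L^r` norm at most `K` for almost every `s`, so the powers of `w` cancel after
        -- Tonelli.
        refine le_trans ?_ (jensen_weight hw.aemeasurable
          ((hgs z).enorm.div hw).aemeasurable hr1)
        refine ENNReal.rpow_le_rpow ((enorm_integral_le_lintegral_enorm _).trans ?_) hrp.le
        refine lintegral_mono_ae (hw0.mono fun s hs => ?_)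
        exact (ENNReal.mul_div_cancel hs.1 hs.2).ge
    _ = W ^ (r.toReal - 1) * ∫⁻ s, ∫⁻ z, w s * (‖g s z‖ₑ / w s) ^ r.toReal ∂ν ∂μ := by
        have hm : Measurable fun z => ∫⁻ s, w s * (‖g s z‖ₑ / w s) ^ r.toReal ∂μ :=
          hφ'.lintegral_prod_right'
        rw [lintegral_const_mul _ hm, lintegral_lintegral_swap hφ'.aemeasurable]
    _ ≤ W ^ (r.toReal - 1) * ∫⁻ s, K ^ r.toReal * w s ∂μ := by
        refine mul_le_mul' le_rfl (lintegral_mono_ae ?_)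
        filter_upwards [hw0, h] with s hs h1
        have hw1 : w s ^ r.toReal ≠ 0 := by simp [hs.1, hs.2]
        have hw2 : w s ^ r.toReal ≠ ⊤ := by simp [hs.1, hs.2]
        have e : ∀ z, w s * (‖g s z‖ₑ / w s) ^ r.toReal =
            w s * (w s ^ r.toReal)⁻¹ * ‖g s z‖ₑ ^ r.toReal := fun z => by
          rw [ENNReal.div_rpow_of_nonneg _ _ hrp.le, div_eq_mul_inv]; ring
        simp only [e]
        have hgm : Measurable fun z => ‖g s z‖ₑ ^ r.toReal :=
          ((hg.comp_measurable (measurable_const.prodMk measurable_id)).enorm).pow_const _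
        rw [lintegral_const_mul _ hgm]
        calc _ ≤ w s * (w s ^ r.toReal)⁻¹ * (K * w s) ^ r.toReal :=
              mul_le_mul' le_rfl ((hnorm _ _).1 h1)
          _ = K ^ r.toReal * w s * ((w s ^ r.toReal)⁻¹ * w s ^ r.toReal) := by
              rw [ENNReal.mul_rpow_of_nonneg _ _ hrp.le]; ring
          _ = _ := by rw [ENNReal.inv_mul_cancel hw1 hw2, mul_one]
    _ = (K * W) ^ r.toReal := by
        rw [lintegral_const_mul _ hw, ENNReal.mul_rpow_of_nonneg _ _ hrp.le]
        have : W ^ r.toReal = W ^ (r.toReal - 1) * W := by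
          nth_rewrite 3 [← ENNReal.rpow_one W]
          rw [← ENNReal.rpow_add_of_nonneg _ _ (by linarith) zero_le_one, sub_add_cancel]
        rw [this]; ring

end Minkowski

/-! ### The `L^∞(L^r)` norm of a solution -/

section

variable {𝕜 : Type*} [RCLike 𝕜] {z₀ z₁ : ℝ}

theorem lintegral_beta_le {t ρ : ℝ} (ht : 0 < t) (h1 : 1 / 4 ≤ ρ) (h2 : ρ ≤ 1 / 2) :
    ∫⁻ s in Ioo 0 t, ENNReal.ofReal ((t - s) ^ (-(1 / 2 : ℝ)) * s ^ (-(1 - ρ))) ≤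
      ENNReal.ofReal (32 * t ^ (-(1 / 2 - ρ))) := by
  have q := fun x => Real.rpow_nonneg ht.le x
  obtain ⟨i1, i2⟩ := integral_singular (P := 4 * 1 * t ^ (-(1 / 2 : ℝ)))
    (Q := 4 * 1 * t ^ (-(1 - ρ))) (a := 1 / 2) (b := 1 - ρ) ht
    (mul_nonneg (by norm_num) (q _)) (mul_nonneg (by norm_num) (q _)) (by norm_num) (by linarith)
  have i3 : ∀ s ∈ Ioo 0 t, (t - s) ^ (-(1 / 2 : ℝ)) * s ^ (-(1 - ρ)) ≤
      4 * 1 * t ^ (-(1 / 2 : ℝ)) * s ^ (-(1 - ρ)) +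
        4 * 1 * t ^ (-(1 - ρ)) * (t - s) ^ (-(1 / 2 : ℝ)) := fun s hs =>
    half_split hs zero_le_one zero_le_one (by norm_num) (by norm_num) (by linarith) (by linarith)
      (one_mul _).ge (one_mul _).ge
  refine (setLIntegral_mono' measurableSet_Ioo fun s hs =>
    ENNReal.ofReal_le_ofReal (i3 s hs)).trans ?_
  rw [← ofReal_integral_eq_lintegral_ofReal i1]
  · refine ENNReal.ofReal_le_ofReal (i2.trans (le_of_eq ?_))
    have e1 : t ^ (-(1 / 2 : ℝ)) * t ^ (1 - (1 - ρ)) = t ^ (-(1 / 2 - ρ)) := by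
      rw [← Real.rpow_add ht]; ring_nf
    have e2 : t ^ (-(1 - ρ)) * t ^ (1 - 1 / 2 : ℝ) = t ^ (-(1 / 2 - ρ)) := by
      rw [← Real.rpow_add ht]; ring_nf
    linear_combination 16 * e1 + 16 * e2
  · refine (ae_restrict_mem measurableSet_Ioo).mono fun s hs => ?_
    have q1 := Real.rpow_nonneg hs.1.le (-(1 - ρ))
    have q2 := Real.rpow_nonneg (sub_pos.2 hs.2).le (-(1 / 2 : ℝ))
    have q3 := q (-(1 / 2 : ℝ))
    have q4 := q (-(1 - ρ))
    simp only [Pi.zero_apply]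
    positivity

variable (𝕜) in
-- From `L^r` to `L^r` the operator costs only `τ^{-1/2}`, which is integrable without recourse to
-- the supremum norm. The bound involves `X` but not `Y`, and so it can be closed first.
theorem MildEq.mixedNorm_le (hz : z₀ < z₁) {T : ℝ} (hT : 0 < T) :
    ∃ c : ℝ, 0 ≤ c ∧ ∀ (r : ℝ≥0∞) (t T₁ U X Y A : ℝ) (a : Dom → Vec 𝕜) (V : ℝ → Dom → Vec 𝕜)
      (DH : ℝ → Fin 2 → Dom → Vec 𝕜), GoodExp r → t ≤ T → t ∈ Ioo 0 T₁ →
      MildEq z₀ z₁ T₁ a V DH → SolOn z₀ z₁ r t U X Y V DH → 0 ≤ A →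
      mixedNorm z₀ z₁ r a ≤ ENNReal.ofReal A →
      mixedNorm z₀ z₁ r (V t) ≤ ENNReal.ofReal
        (c * (A * t ^ (1 / 2 - r⁻¹.toReal / 2) + U * X) * t ^ (-(1 / 2 - r⁻¹.toReal / 2))) := by
  obtain ⟨c, hc0, hc⟩ := eLpNorm_op_le (E := Vec 𝕜) hKernel_gaussPlane (by norm_num)
    (vKernel_reflKernel hz hT 0 (c₁ := 1) (c₂ := 1) (by simp) (by simp))
  obtain ⟨c', hc0', hc'⟩ := eLpNorm_Nop_le (𝕜 := 𝕜) (isSystem_N hz hT)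
  refine ⟨c + 32 * c', by positivity, fun r t T₁ U X Y A a V DH hr htT ht hV h hA haA => ?_⟩
  have hU := h.hU
  have hX := h.hX
  have hr2 := hr.mem
  set ρ := r⁻¹.toReal / 2 with hρ
  have hk := isSystem_N hz hT
  have hτ : ∀ s ∈ Ioo 0 t, t - s ∈ Ioc 0 T := fun s hs =>
    ⟨sub_pos.2 hs.2, by linarith [hs.1]⟩
  -- Minkowski's inequality needs joint measurability in time and space.
  obtain ⟨g, hg, hfg⟩ := exists_jointly_measurable hz (S := Ioo 0 t) measurableSet_Ioo
    (f := fun s => Nop z₀ z₁ kN (mN z₀ z₁) (t - s) (fl z₁ V DH s))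
    (fun s hs => continuous_Nop hk (hτ s hs) (h.memLInf_fl hs))
    (ae_layer_mem.mono fun q hq => hV.meas t ht q hq)
  have h0 : ∀ x, eLpNorm (fun z => Op z₀ z₁ (gaussPlane t) (reflKernel z₀ z₁ 0 1 1 t) a (x, z)) r
      (volume.restrict (Ioo z₀ z₁)) ≤ ENNReal.ofReal (c * A) := fun x => by
    have := hc t ⟨ht.1, htT⟩ r hr.1 hr.2.1 a A hA hV.data.1 haA x
    simpa using this
  have h1 : ∀ x, eLpNorm (fun z => ∫ s in Ioo 0 t, g s (x, z)) r (volume.restrict (Ioo z₀ z₁)) ≤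
      ENNReal.ofReal (c' * (U * X)) * ENNReal.ofReal (32 * t ^ (-(1 / 2 - ρ))) := by
    intro x
    refine le_trans (eLpNorm_integral_le (g := fun s z => g s (x, z))
      (w := fun s => ENNReal.ofReal ((t - s) ^ (-(1 / 2 : ℝ)) * s ^ (-(1 - ρ))))
      (K := ENNReal.ofReal (c' * (U * X)))
      (hg.comp_measurable (measurable_fst.prodMk (measurable_const.prodMk measurable_snd)))
      hr.1 hr.2.1 (by fun_prop) ?_ ?_) (mul_le_mul' le_rfl (lintegral_beta_le ht.1 hr2.1 hr2.2))
    · refine (ae_restrict_mem measurableSet_Ioo).mono fun s hs => ⟨?_, ENNReal.ofReal_ne_top⟩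
      have q1 := Real.rpow_pos_of_pos hs.1 (-(1 - ρ))
      have q2 := Real.rpow_pos_of_pos (sub_pos.2 hs.2) (-(1 / 2 : ℝ))
      exact (ENNReal.ofReal_pos.2 (by positivity)).ne'
    · filter_upwards [ae_restrict_mem measurableSet_Ioo, hfg] with s hs hsg
      have q1 := Real.rpow_nonneg hs.1.le (-(1 - ρ))
      have e : eLpNorm (fun z => g s (x, z)) r (volume.restrict (Ioo z₀ z₁)) =
          eLpNorm (fun z => Nop z₀ z₁ kN (mN z₀ z₁) (t - s) (fl z₁ V DH s) (x, z)) r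
            (volume.restrict (Ioo z₀ z₁)) :=
        eLpNorm_congr_ae ((ae_restrict_mem measurableSet_Ioo).mono fun z hz' =>
          (hsg (x, z) (Ioo_subset_Icc_self hz')).symm)
      rw [e]
      refine (hc' (t - s) (hτ s hs) r hr.1 hr.2.1 _ (U * X * s ^ (-(1 - ρ)))
        (by positivity) (h.memLInf_fl hs) (h.lr_fl hs) x).trans (le_of_eq ?_)
      rw [← ENNReal.ofReal_mul (by positivity)]
      congr 1
      rw [show -((1 : ℕ) : ℝ) / 2 = -(1 / 2) by norm_num]
      ring
  rw [mixedNorm_le_iff]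
  refine Eventually.of_forall fun x => ?_
  have e : eLpNorm (fun z => V t (x, z)) r (volume.restrict (Ioo z₀ z₁)) =
      eLpNorm ((fun z => Op z₀ z₁ (gaussPlane t) (reflKernel z₀ z₁ 0 1 1 t) a (x, z)) -
        fun z => ∫ s in Ioo 0 t, g s (x, z)) r (volume.restrict (Ioo z₀ z₁)) := by
    refine eLpNorm_congr_ae ((ae_restrict_mem measurableSet_Ioo).mono fun z hz' => ?_)
    simp only [Pi.sub_apply]
    rw [hV.eq t ht (x, z) hz']
    congr 1
    exact integral_congr_ae (hfg.mono fun s hs => hs (x, z) (Ioo_subset_Icc_self hz'))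
  rw [e]
  have m1 : Continuous (Op z₀ z₁ (gaussPlane t) (reflKernel z₀ z₁ 0 1 1 t) a) :=
    continuous_op hKernel_gaussPlane (by norm_num)
      (vKernel_reflKernel hz hT 0 (c₁ := 1) (c₂ := 1) (by simp) (by simp)) ⟨ht.1, htT⟩ hV.data
  have m2 : StronglyMeasurable fun z => ∫ s in Ioo 0 t, g s (x, z) :=
    StronglyMeasurable.integral_prod_left (f := fun (s : ℝ) (z : ℝ) => g s (x, z))
      (hg.comp_measurable (measurable_fst.prodMk (measurable_const.prodMk measurable_snd)))
  refine (eLpNorm_sub_le (m1.comp (by fun_prop : Continuous fun z : ℝ => ((x, z) : Dom))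
    ).aestronglyMeasurable m2.aestronglyMeasurable hr.1).trans
    ((add_le_add (h0 x) (h1 x)).trans ?_)
  have q := fun x => Real.rpow_nonneg ht.1.le x
  have q1 := q (-(1 / 2 - ρ))
  have q2 := q (1 / 2 - ρ)
  have hcA : 0 ≤ c * A := by positivity
  rw [← ENNReal.ofReal_mul (by positivity), ← ENNReal.ofReal_add hcA (by positivity)]
  refine ENNReal.ofReal_le_ofReal ?_
  have e2 : t ^ (1 / 2 - ρ) * t ^ (-(1 / 2 - ρ)) = 1 := by
    rw [← Real.rpow_add ht.1, add_neg_cancel, Real.rpow_zero]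
  have e3 : (c + 32 * c') * (A * t ^ (1 / 2 - ρ) + U * X) * t ^ (-(1 / 2 - ρ)) =
      c * A + 32 * c' * A + (c + 32 * c') * (U * X) * t ^ (-(1 / 2 - ρ)) := by
    linear_combination (c + 32 * c') * A * e2
  rw [e3]
  have : 0 ≤ 32 * c' * A + c * (U * X) * t ^ (-(1 / 2 - ρ)) := by positivity
  linarith

end

/-! ### Interpolation between `L^∞(L¹)` and bounded functions -/

section Interpolation

variable {E : Type*} [NormedAddCommGroup E] {z₀ z₁ : ℝ}

/-- Pointwise `|φ|^p ≤ B^{p-1}|φ|`. Written in terms of `1/p`, the bound also covers `p = ∞`. -/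
theorem eLpNorm_interpolation {α : Type*} [MeasurableSpace α] {μ : Measure α} {φ : α → E}
    {p : ℝ≥0∞} (hp : 1 ≤ p) {M B : ℝ} (hM : 0 ≤ M) (hB : 0 ≤ B)
    (h1 : eLpNorm φ 1 μ ≤ ENNReal.ofReal M) (h2 : ∀ᵐ x ∂μ, ‖φ x‖ ≤ B) :
    eLpNorm φ p μ ≤ ENNReal.ofReal (M ^ p⁻¹.toReal * B ^ (1 - p⁻¹.toReal)) := by
  have h2' : ∀ᵐ x ∂μ, ‖φ x‖ₑ ≤ ENNReal.ofReal B := h2.mono fun x hx => by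
    rw [← ofReal_norm]; exact ENNReal.ofReal_le_ofReal hx
  rcases eq_or_ne p ⊤ with rfl | hpt
  · rw [eLpNorm_exponent_top]
    refine (essSup_le_of_ae_le _ h2').trans ?_
    simp
  have hp0 : p ≠ 0 := (zero_lt_one.trans_le hp).ne'
  have hp1 : 1 ≤ p.toReal := by simpa using ENNReal.toReal_mono hpt hp
  have hpp : 0 < p.toReal := by linarith
  rw [eLpNorm_eq_lintegral_rpow_enorm_toReal hp0 hpt, one_div, ENNReal.rpow_inv_le_iff hpp]
  have e1 : ∫⁻ x, ‖φ x‖ₑ ^ p.toReal ∂μ ≤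
      ∫⁻ x, ENNReal.ofReal (B ^ (p.toReal - 1)) * ‖φ x‖ₑ ∂μ := by
    refine lintegral_mono_ae (h2'.mono fun x hx => ?_)
    calc ‖φ x‖ₑ ^ p.toReal = ‖φ x‖ₑ ^ (p.toReal - 1) * ‖φ x‖ₑ := by
          nth_rewrite 3 [← ENNReal.rpow_one ‖φ x‖ₑ]
          rw [← ENNReal.rpow_add_of_nonneg _ _ (by linarith) zero_le_one, sub_add_cancel]
      _ ≤ _ := by
          rw [← ENNReal.ofReal_rpow_of_nonneg hB (by linarith)]
          exact mul_le_mul' (ENNReal.rpow_le_rpow hx (by linarith)) le_rfl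
  refine e1.trans ?_
  rw [lintegral_const_mul' _ _ ENNReal.ofReal_ne_top, ← eLpNorm_one_eq_lintegral_enorm]
  refine (mul_le_mul' le_rfl h1).trans (le_of_eq ?_)
  have i1 : 0 ≤ M ^ p⁻¹.toReal := Real.rpow_nonneg hM _
  have i2 : 0 ≤ B ^ (1 - p⁻¹.toReal) := Real.rpow_nonneg hB _
  rw [← ENNReal.ofReal_mul (Real.rpow_nonneg hB _),
    ENNReal.ofReal_rpow_of_nonneg (mul_nonneg i1 i2) hpp.le, Real.mul_rpow i1 i2,
    ← Real.rpow_mul hM, ← Real.rpow_mul hB, ENNReal.toReal_inv, inv_mul_cancel₀ hpp.ne',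
    Real.rpow_one, sub_mul, inv_mul_cancel₀ hpp.ne', one_mul, mul_comm]

theorem mixedNorm_interpolation {f : Dom → E} {p : ℝ≥0∞} (hp : 1 ≤ p) {M B : ℝ} (hM : 0 ≤ M)
    (hB : 0 ≤ B) (h1 : mixedNorm z₀ z₁ 1 f ≤ ENNReal.ofReal M)
    (h2 : ∀ᵐ q ∂(layer z₀ z₁), ‖f q‖ ≤ B) :
    mixedNorm z₀ z₁ p f ≤ ENNReal.ofReal (M ^ p⁻¹.toReal * B ^ (1 - p⁻¹.toReal)) := by
  rw [mixedNorm_le_iff] at h1 ⊢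
  filter_upwards [h1, Measure.ae_ae_of_ae_prod h2] with x hx1 hx2
  exact eLpNorm_interpolation hp hM hB hx1 hx2

/-- A bounded function lies in every space of the scale. -/
theorem eLpNorm_le_of_bdd (z₀ z₁ : ℝ) {φ : ℝ → E} {p : ℝ≥0∞} (hp : 1 ≤ p) {B : ℝ} (hB : 0 ≤ B)
    (h : ∀ᵐ z ∂(volume.restrict (Ioo z₀ z₁)), ‖φ z‖ ≤ B) :
    eLpNorm φ p (volume.restrict (Ioo z₀ z₁)) ≤ ENNReal.ofReal (max 1 (z₁ - z₀) * B) := by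
  have hm : 1 ≤ max 1 (z₁ - z₀) := le_max_left _ _
  have h1 : eLpNorm φ 1 (volume.restrict (Ioo z₀ z₁)) ≤
      ENNReal.ofReal (max 1 (z₁ - z₀) * B) := by
    rw [eLpNorm_one_eq_lintegral_enorm]
    calc ∫⁻ z in Ioo z₀ z₁, ‖φ z‖ₑ ≤ ∫⁻ _ in Ioo z₀ z₁, ENNReal.ofReal B :=
          lintegral_mono_ae (h.mono fun z hz => by
            rw [← ofReal_norm]; exact ENNReal.ofReal_le_ofReal hz)
      _ = ENNReal.ofReal B * ENNReal.ofReal (z₁ - z₀) := by simp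
      _ ≤ _ := by
          rw [mul_comm, ENNReal.ofReal_mul (by positivity)]
          exact mul_le_mul' (ENNReal.ofReal_le_ofReal (le_max_right _ _)) le_rfl
  refine (eLpNorm_interpolation hp (by positivity) hB h1 h).trans (ENNReal.ofReal_le_ofReal ?_)
  have hi := inv_toReal_mem hp
  rw [Real.mul_rpow (by positivity) hB, mul_assoc,
    ← Real.rpow_add_of_nonneg hB hi.1 (by linarith [hi.2]), add_sub_cancel, Real.rpow_one]
  refine mul_le_mul_of_nonneg_right ?_ hB
  nth_rewrite 2 [← Real.rpow_one (max 1 (z₁ - z₀))]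
  exact Real.rpow_le_rpow_of_exponent_le hm hi.2

theorem mixedNorm_le_of_bdd (z₀ z₁ : ℝ) {f : Dom → E} {p : ℝ≥0∞} (hp : 1 ≤ p) {B : ℝ} (hB : 0 ≤ B)
    (h : ∀ᵐ q ∂(layer z₀ z₁), ‖f q‖ ≤ B) :
    mixedNorm z₀ z₁ p f ≤ ENNReal.ofReal (max 1 (z₁ - z₀) * B) := by
  rw [mixedNorm_le_iff]
  filter_upwards [Measure.ae_ae_of_ae_prod h] with x hx
  exact eLpNorm_le_of_bdd z₀ z₁ hp hB hx

end Interpolation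

/-! ### From a mild solution to a pointwise integral equation -/

section Solution

variable {𝕜 : Type*} [RCLike 𝕜] {z₀ z₁ : ℝ}

theorem MemLInf.congr {E : Type*} [NormedAddCommGroup E] {p : ℝ≥0∞} {f g : Dom → E}
    (hf : MemLInf z₀ z₁ p f) (h : f =ᵐ[layer z₀ z₁] g) : MemLInf z₀ z₁ p g :=
  ⟨hf.1.congr h, by rw [← mixedNorm_congr h]; exact hf.2⟩

theorem mean_congr {f g : Dom → Vec 𝕜} (h : f =ᵐ[layer z₀ z₁] g) :
    mean z₀ z₁ f =ᵐ[volume] mean z₀ z₁ g :=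
  (Measure.ae_ae_of_ae_prod h).mono fun x hx => by
    simp only [mean]
    rw [integral_congr_ae hx]

theorem Solenoidal.congr {f g : Dom → Vec 𝕜} (hf : Solenoidal z₀ z₁ f)
    (h : f =ᵐ[layer z₀ z₁] g) : Solenoidal z₀ z₁ g := fun φ dφ h1 h2 h3 => by
  rw [← hf φ dφ h1 h2 h3]
  refine integral_congr_ae ((mean_congr h).mono fun x hx => ?_)
  simp only [hx]

theorem IsSlice.congr {v w : Dom → Vec 𝕜} {DH : Fin 2 → Dom → Vec 𝕜} {U : ℝ}
    (h : IsSlice z₀ z₁ v DH U) (hvw : v =ᵐ[layer z₀ z₁] w) : IsSlice z₀ z₁ w DH U where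
  memv := h.memv.congr hvw
  memD := h.memD
  sol := h.sol.congr hvw
  weak i := (h.weak i).congr (by rwa [← layer_eq]) (by rfl)
    (h.memv.congr hvw).locallyIntegrableOn (h.weak i).2.1
  nonneg := h.nonneg
  bound := by filter_upwards [h.bound, hvw] with p h1 h2; rwa [← h2]
  div_le := h.div_le

theorem fl_congr {v w : ℝ → Dom → Vec 𝕜} {DH : ℝ → Fin 2 → Dom → Vec 𝕜} {s : ℝ}
    (h : v s =ᵐ[layer z₀ z₁] w s) (i : Fin 3) :
    fl z₁ v DH s i =ᵐ[layer z₀ z₁] fl z₁ w DH s i := by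
  filter_upwards [h] with p hp
  simp only [fl, flux]
  congr 1
  induction i using Fin.lastCases with
  | last => simp only [vel_last]
  | cast j => simp only [vel_castSucc, hp]

variable {C T : ℝ} {a₁ a₂ : Dom → Vec 𝕜} {v : ℝ → Dom → Vec 𝕜} {DH : ℝ → Fin 2 → Dom → Vec 𝕜}
  {Dz : ℝ → Dom → Vec 𝕜}

theorem rpow_neg_half_eq {t : ℝ} (ht : 0 < t) : t ^ (-1 / 2 : ℝ) = (Real.sqrt t)⁻¹ := by
  rw [Real.sqrt_eq_rpow, ← Real.rpow_neg ht.le]; norm_num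

theorem gradNorm_le {DH : Fin 2 → Dom → Vec 𝕜} {Dz : Dom → Vec 𝕜} {t G : ℝ} (ht : 0 < t)
    (h : ENNReal.ofReal (Real.sqrt t) * gradNorm z₀ z₁ 1 DH Dz ≤ ENNReal.ofReal G) :
    gradNorm z₀ z₁ 1 DH Dz ≤ ENNReal.ofReal (G * t ^ (-1 / 2 : ℝ)) := by
  have hs := Real.sqrt_pos.2 ht
  rw [rpow_neg_half_eq ht, mul_comm G, ENNReal.ofReal_mul (by positivity),
    ENNReal.ofReal_inv_of_pos hs]
  calc gradNorm z₀ z₁ 1 DH Dz = (ENNReal.ofReal (Real.sqrt t))⁻¹ *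
        (ENNReal.ofReal (Real.sqrt t) * gradNorm z₀ z₁ 1 DH Dz) := by
        rw [← mul_assoc, ENNReal.inv_mul_cancel (ENNReal.ofReal_pos.2 hs).ne'
          ENNReal.ofReal_ne_top, one_mul]
    _ ≤ _ := mul_le_mul' le_rfl h

/-- The one-dimensional Sobolev inequality bounds `v` by `(z₁ - z₀)⁻¹ M + G t^{-1/2}`. The first
summand is less singular, so close to `t = 0` the constant `U` can be taken close to the gradient
constant `G`. -/
theorem IsLocalMildSolution.isSlice (hz : z₀ < z₁) (h : IsLocalMildSolution z₀ z₁ C T a₁ a₂ v DH Dz)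
    {t M G U : ℝ} (ht : t ∈ Ioo 0 T) (hM : 0 ≤ M) (hG : 0 ≤ G)
    (h1 : mixedNorm z₀ z₁ 1 (v t) ≤ ENNReal.ofReal M)
    (h2 : ENNReal.ofReal (Real.sqrt t) * gradNorm z₀ z₁ 1 (DH t) (Dz t) ≤ ENNReal.ofReal G)
    (hU : (z₁ - z₀)⁻¹ * M * Real.sqrt t + G ≤ U) :
    IsSlice z₀ z₁ (v t) (DH t) (U * t ^ (-1 / 2 : ℝ)) := by
  obtain ⟨⟨w1, w2⟩, w3, w4⟩ := h.grad t ht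
  have hs := Real.sqrt_pos.2 ht.1
  have hz' : 0 ≤ (z₁ - z₀)⁻¹ := inv_nonneg.2 (by linarith)
  have h3 := gradNorm_le ht.1 h2
  have ht2 : 0 ≤ t ^ (-1 / 2 : ℝ) := Real.rpow_nonneg ht.1.le _
  have e1 : (z₁ - z₀)⁻¹ * M + G * t ^ (-1 / 2 : ℝ) ≤ U * t ^ (-1 / 2 : ℝ) := by
    refine le_trans (le_of_eq ?_) (mul_le_mul_of_nonneg_right hU ht2)
    rw [rpow_neg_half_eq ht.1]; field_simp
  have hc := h.cont.1 t ht
  have hGs : 0 ≤ G * t ^ (-1 / 2 : ℝ) := by positivity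
  have hMz : 0 ≤ (z₁ - z₀)⁻¹ * M := by positivity
  refine ⟨hc.2.1, w3, hc.2.2, w1, by linarith, ?_, ?_⟩
  · refine (norm_le_of_weakDeriv_vertical hz hc.2.1 w4 w2).mono fun q hq =>
      hq.trans (le_trans ?_ e1)
    refine add_le_add (mul_le_mul_of_nonneg_left (ENNReal.toReal_le_of_le_ofReal hM h1) hz')
      (ENNReal.toReal_le_of_le_ofReal hGs (le_trans ?_ h3))
    exact le_add_self
  · exact (memLInf_hdiv w3).2.trans ((le_trans le_self_add h3).trans
      (ENNReal.ofReal_le_ofReal (by linarith)))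

/-- The representative is the right-hand side of the equation, which is defined at every point. It
agrees with `v` almost everywhere and may thus replace `v` in the fluxes, which makes the equation
valid at every point of the layer. -/
theorem IsLocalMildSolution.exists_mildEq (hz : z₀ < z₁)
    (h : IsLocalMildSolution z₀ z₁ C T a₁ a₂ v DH Dz) (ha : MemLInf z₀ z₁ 1 (a₁ + a₂))
    (hF : ∀ s ∈ Ioo 0 T, ∀ i, MemLInf z₀ z₁ 1 (fl z₁ v DH s i)) :
    ∃ V : ℝ → Dom → Vec 𝕜, MildEq z₀ z₁ T (a₁ + a₂) V DH ∧
      ∀ t ∈ Ioo 0 T, v t =ᵐ[layer z₀ z₁] V t := by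
  set V : ℝ → Dom → Vec 𝕜 := fun t q =>
    Op z₀ z₁ (gaussPlane t) (reflKernel z₀ z₁ 0 1 1 t) (a₁ + a₂) q -
      ∫ s in Ioo 0 t, Nop z₀ z₁ kN (mN z₀ z₁) (t - s) (fl z₁ v DH s) q with hV
  have hs : ∀ t ∈ Ioo 0 T, ∀ s ∈ Ioo 0 t, s ∈ Ioo 0 T := fun t ht s hs => ⟨hs.1, hs.2.trans ht.2⟩
  have hnl : ∀ t ∈ Ioo 0 T, ∀ s ∈ Ioo 0 t, nonlin z₀ z₁ (t - s) (v s) (DH s) =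
      Nop z₀ z₁ kN (mN z₀ z₁) (t - s) (fl z₁ v DH s) := fun t ht s hst =>
    nonlin_eq_Nop hz (sub_pos.2 hst.2) (hF s (hs t ht s hst))
  have hvV : ∀ t ∈ Ioo 0 T, v t =ᵐ[layer z₀ z₁] V t := by
    intro t ht
    filter_upwards [h.mild t ht] with q hq
    rw [hq.2, stokes_eq_Op hz ht.1 ha]
    simp only [hV]
    congr 1
    exact setIntegral_congr_fun measurableSet_Ioo fun s hst => by rw [hnl t ht s hst]
  have hcg : ∀ t ∈ Ioo 0 T, ∀ s ∈ Ioo 0 t,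
      Nop z₀ z₁ kN (mN z₀ z₁) (t - s) (fl z₁ v DH s) =
        Nop z₀ z₁ kN (mN z₀ z₁) (t - s) (fl z₁ V DH s) := fun t ht s hst =>
    Nop_congr (fl_congr (hvV s (hs t ht s hst)))
  refine ⟨V, ⟨ha, fun t ht q hq => ?_, fun t ht q hq => ?_⟩, hvV⟩
  · obtain ⟨g, hg, hfg⟩ := exists_jointly_measurable hz (S := Ioo 0 t) measurableSet_Ioo
      (f := fun s => Nop z₀ z₁ kN (mN z₀ z₁) (t - s) (fl z₁ v DH s))
      (fun s hst => continuous_Nop (isSystem_N hz ht.1) ⟨sub_pos.2 hst.2, by linarith [hst.1]⟩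
        (hF s (hs t ht s hst)))
      ((h.mild t ht).mono fun q hq => hq.1.1.congr
        ((ae_restrict_mem measurableSet_Ioo).mono fun s hst => by
          simp only [hnl t ht s hst]))
    have h1 : StronglyMeasurable fun s => g s q :=
      hg.comp_measurable (measurable_id.prodMk measurable_const)
    refine h1.aestronglyMeasurable.congr ?_
    filter_upwards [hfg, ae_restrict_mem measurableSet_Ioo] with s h2 h3
    rw [← h2 q (Ioo_subset_Icc_self hq), hcg t ht s h3]
  · simp only [hV]
    congr 1
    exact setIntegral_congr_fun measurableSet_Ioo fun s hst => congrFun (hcg t ht s hst) q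

end Solution

/-! ### Smallness in the scaling invariant norms near the initial time -/

section Smallness

variable {𝕜 : Type*} [RCLike 𝕜] {z₀ z₁ : ℝ}

theorem HolderHalf.continuousOn {v : Dom → Vec 𝕜} {H : ℝ} (h : HolderHalf z₀ z₁ v H) :
    ContinuousOn v (univ ×ˢ Ioo z₀ z₁) := by
  intro q hq
  rw [ContinuousWithinAt, tendsto_iff_norm_sub_tendsto_zero]
  have hc : Continuous fun p : Dom =>
      H * Real.sqrt ‖q.1 - p.1‖ + H * Real.sqrt |q.2 - p.2| := by fun_prop
  have h0 : Tendsto (fun p : Dom => H * Real.sqrt ‖q.1 - p.1‖ + H * Real.sqrt |q.2 - p.2|)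
      (𝓝[univ ×ˢ Ioo z₀ z₁] q) (𝓝 0) := by
    have := (hc.tendsto q).mono_left (nhdsWithin_le_nhds (s := univ ×ˢ Ioo z₀ z₁))
    simpa using this
  refine squeeze_zero' (Eventually.of_forall fun _ => norm_nonneg _) ?_ h0
  filter_upwards [self_mem_nhdsWithin] with p hp
  exact h p q hp.2 hq.2

variable (𝕜) in
-- `MildEq.estimate` is applied at each time `s < t`; since the power of the data is nonnegative,
-- the constant at `t` serves for all `s`.
theorem MildEq.regOn (hz : z₀ < z₁) {T : ℝ} (hT : 0 < T) :
    ∃ c : ℝ, 0 ≤ c ∧ ∀ (r : ℝ≥0∞) (t T₁ U X Y A : ℝ) (a : Dom → Vec 𝕜) (V : ℝ → Dom → Vec 𝕜)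
      (DH : ℝ → Fin 2 → Dom → Vec 𝕜), GoodExp r → t ∈ Ioc 0 T → t ≤ T₁ →
      MildEq z₀ z₁ T₁ a V DH → SolOn z₀ z₁ r t U X Y V DH → 0 ≤ A →
      mixedNorm z₀ z₁ r a ≤ ENNReal.ofReal A →
      RegOn z₀ z₁ t (c * (A * t ^ (1 / 2 - r⁻¹.toReal / 2) + U * X + U * Y))
        (c * (A * t ^ (1 / 2 - r⁻¹.toReal / 2) + U * X + U * Y)) V := by
  obtain ⟨c, hc0, hc⟩ := MildEq.estimate 𝕜 hz hT
  refine ⟨c, hc0, fun r t T₁ U X Y A a V DH hr ht ht1 hV h hA haA => ?_⟩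
  have hU := h.hU
  have hX := h.hX
  have hY := h.hY
  have hr2 := hr.mem
  have hs : ∀ s ∈ Ioo 0 t, s ≤ T ∧ s ∈ Ioo 0 T₁ := fun s hs =>
    ⟨hs.2.le.trans ht.2, hs.1, hs.2.trans_le ht1⟩
  have hle : ∀ s ∈ Ioo 0 t, c * (A * s ^ (1 / 2 - r⁻¹.toReal / 2) + U * X + U * Y) ≤
      c * (A * t ^ (1 / 2 - r⁻¹.toReal / 2) + U * X + U * Y) := fun s hs => by
    have := Real.rpow_le_rpow hs.1.le hs.2.le (show 0 ≤ 1 / 2 - r⁻¹.toReal / 2 by linarith)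
    gcongr
  have key := fun s hst => hc r s T₁ U X Y A a V DH hr (hs s hst).1 (hs s hst).2 hV
    (h.mono hst.2.le) hA haA
  have q := Real.rpow_nonneg ht.1.le (1 / 2 - r⁻¹.toReal / 2)
  refine ⟨by positivity, fun s hst => (key s hst).2.continuousOn, fun s hst p p' hp hp' => ?_,
    fun s hst p hp => ((key s hst).1 p hp).trans
      (mul_le_mul_of_nonneg_right (hle s hst) (Real.rpow_nonneg hst.1.le _))⟩
  refine ((key s hst).2 p p' hp hp').trans ?_
  have := mul_le_mul_of_nonneg_right (hle s hst) (Real.rpow_nonneg hst.1.le (-3 / 4))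
  gcongr

theorem RegOn.solOn {r : ℝ≥0∞} {t U X Y H B : ℝ} {V : ℝ → Dom → Vec 𝕜}
    {DH : ℝ → Fin 2 → Dom → Vec 𝕜} (hB : 0 ≤ B) (h : RegOn z₀ z₁ t H B V)
    (hs : SolOn z₀ z₁ r t U X Y V DH) : SolOn z₀ z₁ r t U X B V DH :=
  ⟨hs.hU, hs.hX, hB, hs.slice, hs.lr, fun s hst => ae_layer_mem.mono fun p hp => h.sup s hst p hp⟩

variable (𝕜) in
theorem MildEq.gradient_le (hz : z₀ < z₁) {T : ℝ} (hT : 0 < T) :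
    ∃ c : ℝ, 0 ≤ c ∧ ∀ (r : ℝ≥0∞) (t U X Y H A : ℝ) (a : Dom → Vec 𝕜) (V : ℝ → Dom → Vec 𝕜)
      (DH : ℝ → Fin 2 → Dom → Vec 𝕜), GoodExp r → t ∈ Ioc 0 T → MemLInf z₀ z₁ 1 a →
      SolOn z₀ z₁ r t U X Y V DH → RegOn z₀ z₁ t H Y V → 0 ≤ A →
      mixedNorm z₀ z₁ r a ≤ ENNReal.ofReal A → ∀ d, ∀ s ∈ Ioo 0 t, ∀ q : Dom, q.2 ∈ Ioo z₀ z₁ →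
      ‖gradFormula z₀ z₁ a V DH d s q‖ ≤
        c * (A * t ^ (1 / 2 - r⁻¹.toReal / 2) + U * X + U * (H + Y)) * s ^ (-1 : ℝ) := by
  choose c hc0 hc using norm_gradFormula_le 𝕜 hz hT
  refine ⟨∑ d, c d, Finset.sum_nonneg fun d _ => hc0 d,
    fun r t U X Y H A a V DH hr ht ha h hreg hA haA d s hs q hq => ?_⟩
  have hU := h.hU
  have hX := h.hX
  have hY := h.hY
  have hH := hreg.hH
  have hr2 := hr.mem
  refine (hc d r s U X Y H A a V DH hr ⟨hs.1, hs.2.le.trans ht.2⟩ ha (h.mono hs.2.le)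
    ⟨hreg.hH, fun x hx => hreg.cont x ⟨hx.1, hx.2.trans hs.2⟩,
      fun x hx => hreg.holder x ⟨hx.1, hx.2.trans hs.2⟩,
      fun x hx => hreg.sup x ⟨hx.1, hx.2.trans hs.2⟩⟩ hA haA q hq).trans ?_
  have q1 := Real.rpow_nonneg hs.1.le (-1)
  have q2 := Real.rpow_le_rpow hs.1.le hs.2.le (show 0 ≤ 1 / 2 - r⁻¹.toReal / 2 by linarith)
  have q3 := Real.rpow_nonneg hs.1.le (1 / 2 - r⁻¹.toReal / 2)
  have q4 : c d ≤ ∑ d, c d := Finset.single_le_sum (fun d _ => hc0 d) (Finset.mem_univ d)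
  have q5 := hc0 d
  have q6 := q5.trans q4
  gcongr

/-- Iterating the improvement `n` times gives a constant of size at most `2b + x/2^n`. Finitely many
steps suffice, so `P` need not be stable under limits. -/
theorem exists_small_of_contraction {P : ℝ → Prop} {x b ε : ℝ} (hx : 0 ≤ x) (hb : 0 ≤ b)
    (hε : 2 * b < ε) (h0 : P x) (h : ∀ y, 0 ≤ y → P y → P (b + y / 2)) :
    ∃ y, 0 ≤ y ∧ y ≤ ε ∧ P y := by
  have key : ∀ n : ℕ, ∃ y, 0 ≤ y ∧ y ≤ 2 * b + x / 2 ^ n ∧ P y := by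
    intro n
    induction n with
    | zero => exact ⟨x, hx, by simp; linarith, h0⟩
    | succ n ih =>
      obtain ⟨y, h1, h2, h3⟩ := ih
      refine ⟨b + y / 2, by positivity, ?_, h y h1 h3⟩
      have : x / 2 ^ (n + 1) = x / 2 ^ n / 2 := by rw [pow_succ]; field_simp
      rw [this]
      linarith
  have hlim : Tendsto (fun n : ℕ => 2 * b + x / 2 ^ n) atTop (𝓝 (2 * b + 0)) := by
    refine tendsto_const_nhds.add (tendsto_const_nhds.div_atTop ?_)
    exact tendsto_pow_atTop_atTop_of_one_lt one_lt_two
  rw [add_zero] at hlim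
  obtain ⟨n, hn⟩ := (hlim.eventually (gt_mem_nhds hε)).exists
  obtain ⟨y, h1, h2, h3⟩ := key n
  exact ⟨y, h1, h2.trans hn.le, h3⟩

theorem mixedNorm_lt_top_of_le {E : Type*} [NormedAddCommGroup E] {f : Dom → E} {p r : ℝ≥0∞}
    (hr : r ≤ p) (hf : MemLInf z₀ z₁ p f) : mixedNorm z₀ z₁ r f < ⊤ := by
  rcases eq_or_ne r 0 with rfl | hr0
  · refine lt_of_le_of_lt (b := 0) ?_ (by simp)
    rw [mixedNorm_le_iff]
    simp
  have h : mixedNorm z₀ z₁ r f ≤ mixedNorm z₀ z₁ p f *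
      (ENNReal.ofReal (z₁ - z₀)) ^ (1 / r.toReal - 1 / p.toReal) := by
    rw [mixedNorm_le_iff]
    filter_upwards [mixedNorm_le_iff.1 (le_refl (mixedNorm z₀ z₁ p f)), hf.1.prodMk_left]
      with x hx hm
    refine (eLpNorm_le_eLpNorm_mul_rpow_measure_univ hr hm).trans ?_
    simp only [Measure.restrict_apply_univ, Real.volume_Ioo]
    exact mul_le_mul' hx le_rfl
  refine h.trans_lt (ENNReal.mul_lt_top hf.2 ?_)
  refine ENNReal.rpow_lt_top_of_nonneg ?_ ENNReal.ofReal_ne_top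
  rw [sub_nonneg]
  rcases eq_or_ne p ⊤ with rfl | hp
  · simp
  · exact one_div_le_one_div_of_le (ENNReal.toReal_pos hr0 (ne_top_of_le_ne_top hp hr))
      (ENNReal.toReal_mono hp hr)

/-- Lowering `p` to `min p 2` is harmless on a bounded interval, and it keeps the positive exponent
that expresses subcriticality. -/
theorem goodExp_min {p : ℝ≥0∞} (hp : 1 < p) :
    GoodExp (min p 2) ∧ 0 < 1 / 2 - (min p 2)⁻¹.toReal / 2 := by
  have h1 : 1 < min p 2 := lt_min hp (by norm_num)
  have h2 : min p 2 ≤ 2 := min_le_right _ _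
  have ht : min p 2 ≠ ⊤ := ne_top_of_le_ne_top (by norm_num) h2
  have h3 : 1 < (min p 2).toReal := by simpa using ENNReal.toReal_strict_mono ht h1
  have h4 : (min p 2).toReal ≤ 2 := by simpa using ENNReal.toReal_mono (by norm_num) h2
  rw [GoodExp, ENNReal.toReal_inv]
  refine ⟨⟨h1.le, ht, ?_⟩, ?_⟩
  · rw [one_div]; exact inv_anti₀ (by linarith) h4
  · have := inv_lt_one_of_one_lt₀ h3
    linarith

variable (z₀ z₁ 𝕜) in
set_option maxHeartbeats 1000000 in
/-- If the flow is small in the scaling invariant class near the initial time, and if the data are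
subcritical, then the solution vanishes in the scaling invariant class at the initial time. -/
theorem exists_smallness (hz : z₀ < z₁) : ∃ κ : ℝ, 0 < κ ∧
    ∀ (T₁ : ℝ) (a : Dom → Vec 𝕜) (V : ℝ → Dom → Vec 𝕜) (DH : ℝ → Fin 2 → Dom → Vec 𝕜)
      (p : ℝ≥0∞) (T₀ U M : ℝ), MildEq z₀ z₁ T₁ a V DH → 1 < p → MemLInf z₀ z₁ p a →
      0 < T₀ → T₀ ≤ T₁ → 0 ≤ U → U ≤ κ → 0 ≤ M →
      (∀ s ∈ Ioo 0 T₀, mixedNorm z₀ z₁ 1 (V s) ≤ ENNReal.ofReal M) →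
      (∀ s ∈ Ioo 0 T₀, IsSlice z₀ z₁ (V s) (DH s) (U * s ^ (-1 / 2 : ℝ))) →
      ∀ ε : ℝ, 0 < ε → ∃ T' : ℝ, 0 < T' ∧ T' ≤ T₀ ∧ ∀ s ∈ Ioo 0 T', ∀ q : Dom, q.2 ∈ Ioo z₀ z₁ →
        ‖V s q‖ ≤ ε * s ^ (-1 / 2 : ℝ) ∧
          ∀ d, ‖gradFormula z₀ z₁ a V DH d s q‖ ≤ ε * s ^ (-1 : ℝ) := by
  obtain ⟨c₁, hc10, hc1⟩ := MildEq.mixedNorm_le 𝕜 hz one_pos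
  obtain ⟨c₂, hc20, hc2⟩ := MildEq.regOn 𝕜 hz one_pos
  obtain ⟨c₃, hc30, hc3⟩ := MildEq.gradient_le 𝕜 hz one_pos
  -- This `κ` makes `c₁ U`, `c₂ U` and `U` at most `1/2`. The constants are taken for the time
  -- horizon one, so `κ` is independent of the solution.
  refine ⟨1 / (2 * (c₁ + c₂ + 1)), by positivity,
    fun T₁ a V DH p T₀ U M hV hp ha hT0 hT01 hU hUκ hM h1 hsl ε hε => ?_⟩
  have hU1 : U * (c₁ + c₂ + 1) ≤ 1 / 2 := by
    calc U * (c₁ + c₂ + 1) ≤ 1 / (2 * (c₁ + c₂ + 1)) * (c₁ + c₂ + 1) := by gcongr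
      _ = 1 / 2 := by field_simp
  have hUc1 : c₁ * U ≤ 1 / 2 := by nlinarith [mul_nonneg hc20 hU]
  have hUc2 : c₂ * U ≤ 1 / 2 := by nlinarith [mul_nonneg hc10 hU]
  have hU' : U ≤ 1 / 2 := by nlinarith [mul_nonneg hc10 hU, mul_nonneg hc20 hU]
  obtain ⟨hr, hθ⟩ := goodExp_min hp
  set r := min p 2 with hrdef
  set θ := 1 / 2 - r⁻¹.toReal / 2 with hθdef
  have hrt := mixedNorm_lt_top_of_le (min_le_left p 2) ha
  set A := (mixedNorm z₀ z₁ r a).toReal with hA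
  have hA0 : 0 ≤ A := ENNReal.toReal_nonneg
  have haA : mixedNorm z₀ z₁ r a ≤ ENNReal.ofReal A := (ENNReal.ofReal_toReal hrt.ne).ge
  -- In units of `δ`, these numbers bound in turn `X`, `Y`, the Hölder constant and the gradient
  -- constant. The summand `1` provides the strict inequality that the iteration needs.
  set k₁ := 2 * c₁ + 1 with hk1
  set k₂ := 2 * (c₂ * (1 + k₁)) + 1 with hk2
  set k₃ := c₂ * (1 + k₁ + k₂) with hk3
  set k₄ := c₃ * (1 + k₁ + (k₃ + k₃)) with hk4
  have hk10 : 0 ≤ k₁ := by positivity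
  have hk20 : 0 ≤ k₂ := by positivity
  have hk30 : 0 ≤ k₃ := by positivity
  have hk40 : 0 ≤ k₄ := by positivity
  set δ := ε / (k₃ + k₄ + 1) with hδ
  have hδ0 : 0 < δ := by positivity
  have hδε : (k₃ + k₄ + 1) * δ = ε := by rw [hδ]; field_simp
  -- The time is chosen so short that the data contribute at most `δ`; this is where `θ > 0` is
  -- needed.
  obtain ⟨T', hT'0, hT', hAT⟩ := exists_rpow_le (K := A) hθ hδ0 (lt_min hT0 one_pos)
  have hT'T0 : T' ≤ T₀ := hT'.trans (min_le_left _ _)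
  have hT'1 : T' ≤ 1 := hT'.trans (min_le_right _ _)
  have hAT0 : 0 ≤ A * T' ^ θ := mul_nonneg hA0 (Real.rpow_nonneg hT'0.le _)
  -- The iterations need some finite constants to start from: `U` itself for the supremum norm, and
  -- the interpolation of `M` with `U` for the `L^r` norm.
  have base : SolOn z₀ z₁ r T' U (M ^ r⁻¹.toReal * U ^ (1 - r⁻¹.toReal)) U V DH := by
    have hss : ∀ s ∈ Ioo 0 T', s ∈ Ioo 0 T₀ := fun s hs => ⟨hs.1, hs.2.trans_le hT'T0⟩
    refine ⟨hU, by positivity, hU, fun s hs => hsl s (hss s hs), fun s hs => ?_,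
      fun s hs => (hsl s (hss s hs)).bound⟩
    have hq := Real.rpow_nonneg hs.1.le (-1 / 2)
    refine (mixedNorm_interpolation hr.1 hM (by positivity) (h1 s (hss s hs))
      (hsl s (hss s hs)).bound).trans (le_of_eq (congrArg _ ?_))
    rw [Real.mul_rpow hU hq, ← Real.rpow_mul hs.1.le, ← mul_assoc]
    congr 2
    ring
  -- The `L^r` norm comes first, because its estimate does not contain `Y`.
  obtain ⟨X, hX0, hX, hXs⟩ := exists_small_of_contraction
    (P := fun X => SolOn z₀ z₁ r T' U X U V DH) (b := c₁ * (A * T' ^ θ)) (ε := k₁ * δ)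
    (by positivity) (by positivity) (by
      have := mul_le_mul_of_nonneg_left hAT hc10
      rw [hk1]; linarith) base (fun X hX h => by
      refine ⟨hU, by positivity, hU, h.slice, fun s hs => ?_, h.sup⟩
      refine (hc1 r s T₁ U X U A a V DH hr (hs.2.le.trans hT'1)
        ⟨hs.1, hs.2.trans_le (hT'T0.trans hT01)⟩ hV (h.mono hs.2.le) hA0 haA).trans
        (ENNReal.ofReal_le_ofReal ?_)
      refine mul_le_mul_of_nonneg_right ?_ (Real.rpow_nonneg hs.1.le _)
      have q2 := mul_le_mul_of_nonneg_left (Real.rpow_le_rpow hs.1.le hs.2.le hθ.le) hA0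
      have q3 := mul_le_mul_of_nonneg_left q2 hc10
      have q4 := mul_le_mul_of_nonneg_right hUc1 hX
      linarith)
  have hUX : U * X ≤ k₁ * δ := (mul_le_of_le_one_left hX0 (by linarith)).trans hX
  -- With `U X` already small, the supremum norm is improved in the same way.
  obtain ⟨Y, hY0, hY, hYs⟩ := exists_small_of_contraction
    (P := fun Y => SolOn z₀ z₁ r T' U X Y V DH) (b := c₂ * (A * T' ^ θ + U * X)) (ε := k₂ * δ)
    hU (by positivity) (by
      have := mul_le_mul_of_nonneg_left (add_le_add hAT hUX) hc20
      rw [hk2]; linarith) hXs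
    (fun Y hY h => by
      have hreg := hc2 r T' T₁ U X Y A a V DH hr ⟨hT'0, hT'1⟩ (hT'T0.trans hT01) hV h hA0 haA
      have := mul_le_mul_of_nonneg_right hUc2 hY
      refine ⟨hU, hX0, by positivity, h.slice, h.lr, fun s hs => ae_layer_mem.mono fun q hq => ?_⟩
      refine (hreg.sup s hs q hq).trans
        (mul_le_mul_of_nonneg_right ?_ (Real.rpow_nonneg hs.1.le _))
      linarith)
  have hUY : U * Y ≤ k₂ * δ := (mul_le_of_le_one_left hY0 (by linarith)).trans hY
  have hreg := hc2 r T' T₁ U X Y A a V DH hr ⟨hT'0, hT'1⟩ (hT'T0.trans hT01) hV hYs hA0 haA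
  rw [← hθdef] at hreg
  set H := c₂ * (A * T' ^ θ + U * X + U * Y) with hH
  have hH0 : 0 ≤ H := hreg.hH
  have hHδ : H ≤ k₃ * δ := by
    have := mul_le_mul_of_nonneg_left (add_le_add (add_le_add hAT hUX) hUY) hc20
    rw [hH, hk3]
    linarith
  have hgr := hc3 r T' U X H H A a V DH hr ⟨hT'0, hT'1⟩ hV.data (hreg.solOn hH0 hYs) hreg hA0 haA
  rw [← hθdef] at hgr
  have hUH : U * (H + H) ≤ (k₃ + k₃) * δ :=
    (mul_le_of_le_one_left (by positivity) (by linarith)).trans (by linarith)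
  have hG : c₃ * (A * T' ^ θ + U * X + U * (H + H)) ≤ k₄ * δ := by
    have := mul_le_mul_of_nonneg_left (add_le_add (add_le_add hAT hUX) hUH) hc30
    rw [hk4]
    linarith
  have e3 : k₃ * δ ≤ ε := by nlinarith [mul_nonneg hk40 hδ0.le]
  have e4 : k₄ * δ ≤ ε := by nlinarith [mul_nonneg hk30 hδ0.le]
  exact ⟨T', hT'0, hT'T0, fun s hs q hq =>
    ⟨(hreg.sup s hs q hq).trans
      (mul_le_mul_of_nonneg_right (hHδ.trans e3) (Real.rpow_nonneg hs.1.le _)),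
    fun d => (hgr d s hs q hq).trans
      (mul_le_mul_of_nonneg_right (hG.trans e4) (Real.rpow_nonneg hs.1.le _))⟩⟩

end Smallness

/-! ### Uniform continuity of the solution and of its gradient -/

section Regularity

variable {𝕜 : Type*} [RCLike 𝕜] {z₀ z₁ : ℝ}

/-- Uniform continuity on the layer, locally uniformly in time. -/
def UCFamily {E : Type*} [NormedAddCommGroup E] (z₀ z₁ T : ℝ) (G : ℝ → Dom → E) : Prop :=
  ∀ t₀ t₁ : ℝ, 0 < t₀ → t₁ < T → ∀ ε : ℝ, 0 < ε → ∃ η > 0, ∀ t ∈ Icc t₀ t₁, ∀ t' ∈ Icc t₀ t₁,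
    ∀ q q' : Dom, q.2 ∈ Ioo z₀ z₁ → q'.2 ∈ Ioo z₀ z₁ → |t - t'| < η → dist q q' < η →
    ‖G t q - G t' q'‖ ≤ ε

theorem UCFamily.uniformContinuousOn {E : Type*} [NormedAddCommGroup E] {T : ℝ} {G : ℝ → Dom → E}
    (h : UCFamily z₀ z₁ T G) {t : ℝ} (ht : t ∈ Ioo 0 T) {ε : ℝ} (hε : 0 < ε) :
    ∃ η > 0, ∀ q q' : Dom, q.2 ∈ Ioo z₀ z₁ → q'.2 ∈ Ioo z₀ z₁ → dist q q' < η →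
      ‖G t q - G t q'‖ ≤ ε := by
  obtain ⟨η, hη, h1⟩ := h t t ht.1 ht.2 ε hε
  exact ⟨η, hη, fun q q' hq hq' hd =>
    h1 t ⟨le_rfl, le_rfl⟩ t ⟨le_rfl, le_rfl⟩ q q' hq hq' (by simpa using hη) hd⟩

theorem UCFamily.continuousOn {E : Type*} [NormedAddCommGroup E] {T : ℝ} {G : ℝ → Dom → E}
    (h : UCFamily z₀ z₁ T G) {t : ℝ} (ht : t ∈ Ioo 0 T) :
    ContinuousOn (G t) (univ ×ˢ Ioo z₀ z₁) := by
  rw [Metric.continuousOn_iff]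
  intro q hq ε hε
  obtain ⟨η, hη, h1⟩ := h.uniformContinuousOn ht (half_pos hε)
  exact ⟨η, hη, fun p hp hd => by
    rw [dist_eq_norm]; exact (h1 p q hp.2 hq.2 hd).trans_lt (half_lt_self hε)⟩

theorem goodExp_one : GoodExp 1 := ⟨le_rfl, by simp, by norm_num⟩

section

variable {T U X Y H : ℝ} {a : Dom → Vec 𝕜} {V : ℝ → Dom → Vec 𝕜} {DH : ℝ → Fin 2 → Dom → Vec 𝕜}

theorem SolOn.one_fl (h : SolOn z₀ z₁ 1 T U X Y V DH) {s : ℝ} (hs : s ∈ Ioo 0 T) (i : Fin 3) :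
    mixedNorm z₀ z₁ 1 (fl z₁ V DH s i) ≤ ENNReal.ofReal (U * X * s ^ (-(1 / 2 : ℝ))) := by
  have := h.lr_fl hs i
  rwa [show -(1 - (1 : ℝ≥0∞)⁻¹.toReal / 2) = -(1 / 2 : ℝ) by norm_num] at this

/-- For times in `[t₀, t₁]` the negative powers of `t` are at most those of `t₀`. Then `op_modulus`
treats the data and `duhamel_modulus` the integral; the kernels are left general in order to cover
both the solution and its gradient. -/
theorem ucFamily_formula {a' b' n : ℕ} {d : ℝ} {k₀ : ℝ → Plane → ℝ} {m₀ : ℝ → ℝ → ℝ → ℝ}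
    (hk : HKernel a' d k₀) (hd : 2 < d) (hm : VKernel z₀ z₁ T b' m₀)
    {k : Idx → ℝ → Plane → ℝ} {m : Idx → ℝ → ℝ → ℝ → ℝ} (hs : IsSystem z₀ z₁ T n k m)
    (ha : MemLInf z₀ z₁ 1 a) (h : SolOn z₀ z₁ 1 T U X Y V DH) {P Q e b x y : ℝ}
    (hP : 0 ≤ P) (hQ : 0 ≤ Q) (hb0 : 0 ≤ b) (hb : b ≤ 3 / 4) (he : e ≤ 3 / 4) (hx : x ≤ 0)
    (hy : y ≤ 0)
    (hle : ∀ t ∈ Ioo 0 T, ∀ s ∈ Ioo 0 t, ∀ q : Dom, q.2 ∈ Ioo z₀ z₁ →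
      ‖Nop z₀ z₁ k m (t - s) (fl z₁ V DH s) q‖ ≤ P * t ^ x * s ^ (-b) + Q * t ^ y * (t - s) ^ (-e))
    (hmeas : ∀ t ∈ Ioo 0 T, ∀ q : Dom, q.2 ∈ Ioo z₀ z₁ → AEStronglyMeasurable
      (fun s => Nop z₀ z₁ k m (t - s) (fl z₁ V DH s) q) (volume.restrict (Ioo 0 t))) :
    UCFamily z₀ z₁ T (fun t q => Op z₀ z₁ (k₀ t) (m₀ t) a q -
      ∫ s in Ioo 0 t, Nop z₀ z₁ k m (t - s) (fl z₁ V DH s) q) := by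
  intro t₀ t₁ ht₀ ht₁ ε hε
  have hmem : ∀ t ∈ Icc t₀ t₁, t ∈ Ioo 0 T := fun t ht => ⟨ht₀.trans_le ht.1, ht.2.trans_lt ht₁⟩
  have hU := h.hU
  have hX := h.hX
  set A := (mixedNorm z₀ z₁ 1 a).toReal with hA
  have hA0 : 0 ≤ A := ENNReal.toReal_nonneg
  have haA : mixedNorm z₀ z₁ 1 a ≤ ENNReal.ofReal A := (ENNReal.ofReal_toReal ha.2.ne).ge
  obtain ⟨η₁, hη₁, h1⟩ := op_modulus (E := Vec 𝕜) hk hd hm ht₀ (ε := ε / (2 * (A + 1)))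
    (by positivity)
  have hss : ∀ s ∈ Ioo 0 t₁, s ∈ Ioo 0 T := fun s hs => ⟨hs.1, hs.2.trans ht₁⟩
  obtain ⟨η₂, hη₂, h2⟩ := duhamel_modulus hs (F := fl z₁ V DH) (B := U * X) (t₀ := t₀) (t₁ := t₁)
    (P := P * t₀ ^ x) (Q := Q * t₀ ^ y) (a := e) (b := b) ht₀ ht₁.le (by positivity)
    (fun s hs i => (h.memLInf_fl (hss s hs) i).1) (fun s hs i => h.one_fl (hss s hs) i)
    (by positivity) (by positivity) hb0 hb he (fun t ht s hs q hq => by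
      refine (hle t (hmem t ht) s hs q hq).trans ?_
      have q1 := Real.rpow_nonneg hs.1.le (-b)
      have q2 := Real.rpow_nonneg (sub_pos.2 hs.2).le (-e)
      have q3 := Real.rpow_le_rpow_of_nonpos ht₀ ht.1 hx
      have q4 := Real.rpow_le_rpow_of_nonpos ht₀ ht.1 hy
      gcongr) (fun t ht q hq => hmeas t (hmem t ht) q hq) (half_pos hε)
  refine ⟨min η₁ η₂, lt_min hη₁ hη₂, fun t ht t' ht' q q' hq hq' htt hqq => ?_⟩
  have i1 := h1 t ⟨ht.1, (hmem t ht).2.le⟩ t' ⟨ht'.1, (hmem t' ht').2.le⟩ q q' hq hq'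
    (htt.trans_le (min_le_left _ _)) (hqq.trans_le (min_le_left _ _)) a A hA0 ha.1 haA
  have i2 := h2 t ht t' ht' q q' hq hq' (htt.trans_le (min_le_right _ _))
    (hqq.trans_le (min_le_right _ _))
  have i3 : ε / (2 * (A + 1)) * A ≤ ε / 2 := by
    rw [div_mul_eq_mul_div, div_le_div_iff₀ (by positivity) (by positivity)]
    nlinarith
  rw [sub_sub_sub_comm]
  exact (norm_sub_le _ _).trans (by linarith)

theorem MildEq.ucFamily_gradFormula (hz : z₀ < z₁) (hV : MildEq z₀ z₁ T a V DH)
    (h : SolOn z₀ z₁ 1 T U X Y V DH) (hreg : RegOn z₀ z₁ T H Y V) (d : Option (Fin 2)) :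
    UCFamily z₀ z₁ T (gradFormula z₀ z₁ a V DH d) := by
  rcases le_or_gt T 0 with hT | hT
  · intro t₀ t₁ h0 h1 ε hε
    exact ⟨1, one_pos, fun t ht => by linarith [ht.1, ht.2]⟩
  obtain ⟨c, hc0, hc⟩ := integrand_D_le 𝕜 hz hT d
  obtain ⟨a', b', -, hk, hm⟩ := kernel_S hz hT d
  have hU := h.hU
  have hX := h.hX
  have hY := h.hY
  have hH := hreg.hH
  refine ucFamily_formula hk (by norm_num) hm (isSystem_D hz hT d) hV.data h
    (P := c * (U * X)) (Q := c * (U * (H + Y))) (e := 3 / 4) (b := 1 - (1 : ℝ≥0∞)⁻¹.toReal / 2)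
    (x := -(1 + (1 : ℝ≥0∞)⁻¹.toReal / 2)) (y := -(5 / 4)) (by positivity) (by positivity)
    (by norm_num) (by norm_num) (by norm_num) (by norm_num) (by norm_num)
    (fun t ht s hs q hq => hc 1 t U X Y H V DH goodExp_one ht.2.le (h.mono ht.2.le)
      ⟨hH, fun x hx => hreg.cont x ⟨hx.1, hx.2.trans ht.2⟩,
      fun x hx => hreg.holder x ⟨hx.1, hx.2.trans ht.2⟩,
      fun x hx => hreg.sup x ⟨hx.1, hx.2.trans ht.2⟩⟩ s hs q hq)
    (fun t ht q hq => hV.meas_grad hz ht (h.mono ht.2.le) d hq)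

theorem MildEq.ucFamily (hz : z₀ < z₁) (hV : MildEq z₀ z₁ T a V DH)
    (h : SolOn z₀ z₁ 1 T U X Y V DH) : UCFamily z₀ z₁ T V := by
  rcases le_or_gt T 0 with hT | hT
  · intro t₀ t₁ h0 h1 ε hε
    exact ⟨1, one_pos, fun t ht => by linarith [ht.1, ht.2]⟩
  obtain ⟨c, hc0, hc⟩ := integrand_V_le 𝕜 hz hT
  have hU := h.hU
  have hX := h.hX
  have hY := h.hY
  have := ucFamily_formula hKernel_gaussPlane (by norm_num)
    (vKernel_reflKernel hz hT 0 (c₁ := 1) (c₂ := 1) (by simp) (by simp))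
    (isSystem_N hz hT) hV.data h
    (P := c * (U * X)) (Q := c * (U * Y)) (e := 1 / 2) (b := 1 - (1 : ℝ≥0∞)⁻¹.toReal / 2)
    (x := -(1 / 2 + (1 : ℝ≥0∞)⁻¹.toReal / 2)) (y := -(1 : ℝ)) (by positivity) (by positivity)
    (by norm_num) (by norm_num) (by norm_num) (by norm_num) (by norm_num)
    (fun t ht s hs q _ => (hc 1 t U X Y V DH goodExp_one ht.2.le (h.mono ht.2.le) s hs).1 q)
    hV.meas
  intro t₀ t₁ h0 h1 ε hε
  obtain ⟨η, hη, h2⟩ := this t₀ t₁ h0 h1 ε hε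
  refine ⟨η, hη, fun t ht t' ht' q q' hq hq' h3 h4 => ?_⟩
  rw [hV.eq t ⟨h0.trans_le ht.1, ht.2.trans_lt h1⟩ q hq,
    hV.eq t' ⟨h0.trans_le ht'.1, ht'.2.trans_lt h1⟩ q' hq']
  exact h2 t ht t' ht' q q' hq hq' h3 h4

theorem RegOn.mono {t t' : ℝ} (h : RegOn z₀ z₁ t H Y V) (ht : t' ≤ t) : RegOn z₀ z₁ t' H Y V :=
  ⟨h.hH, fun x hx => h.cont x ⟨hx.1, hx.2.trans_le ht⟩,
    fun x hx => h.holder x ⟨hx.1, hx.2.trans_le ht⟩, fun x hx => h.sup x ⟨hx.1, hx.2.trans_le ht⟩⟩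

/-- The weak derivatives of a solution are given by the formula. -/
theorem MildEq.weakDeriv_ae_eq (hz : z₀ < z₁) (hV : MildEq z₀ z₁ T a V DH)
    (h : SolOn z₀ z₁ 1 T U X Y V DH) (hreg : RegOn z₀ z₁ T H Y V) (d : Option (Fin 2)) {t : ℝ}
    (ht : t ∈ Ioo 0 T) {v g : Dom → Vec 𝕜} (hv : v =ᵐ[layer z₀ z₁] V t)
    (hg : HasWeakDerivOn (univ ×ˢ Ioo z₀ z₁ : Set Dom) (dir d) v g) :
    g =ᵐ[layer z₀ z₁] gradFormula z₀ z₁ a V DH d t := by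
  have hc := (hV.ucFamily hz h).continuousOn ht
  have hw : HasWeakDerivOn (univ ×ˢ Ioo z₀ z₁ : Set Dom) (dir d) (V t) g :=
    hg.congr (by rwa [← layer_eq]) (by rfl)
      (hc.locallyIntegrableOn (measurableSet_dom z₀ z₁)) hg.2.1
  -- Both candidates are derivatives of the continuous representative `V t`, one weak and one
  -- classical.
  rw [layer_eq]
  exact hw.ae_eq_of_hasLineDerivAt (isOpen_dom z₀ z₁)
    (fun q hq => hV.hasLineDerivAt hz ht goodExp_one (h.mono ht.2.le) (hreg.mono ht.2.le) d hq.2) hc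
    ((hV.ucFamily_gradFormula hz h hreg d).continuousOn ht)

end

end Regularity

/-! ### Horizontal derivatives of solenoidal fields are solenoidal -/

section SolenoidalDerivative

variable {𝕜 : Type*} [RCLike 𝕜] {z₀ z₁ : ℝ}

theorem LocallyIntegrable.comp_sub {φ : Plane → ℝ} (h : LocallyIntegrable φ) (w : Plane) :
    LocallyIntegrable fun x => φ (x - w) := by
  intro x
  obtain ⟨s, hs, hi⟩ := h (x - w)
  refine ⟨(fun y => y - w) ⁻¹' s, (by fun_prop : Continuous fun y : Plane => y - w).continuousAt hs,
    ?_⟩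
  exact ((measurePreserving_sub_right volume w).integrableOn_comp_preimage
    (MeasurableEquiv.subRight w).measurableEmbedding).2 hi

theorem HasWeakDerivOn.comp_sub {e : Plane} {φ dφ : Plane → ℝ} (h : HasWeakDerivOn univ e φ dφ)
    (w : Plane) : HasWeakDerivOn univ e (fun x => φ (x - w)) (fun x => dφ (x - w)) := by
  refine ⟨locallyIntegrableOn_univ.2 (LocallyIntegrable.comp_sub (locallyIntegrableOn_univ.1 h.1) w),
    locallyIntegrableOn_univ.2 (LocallyIntegrable.comp_sub (locallyIntegrableOn_univ.1 h.2.1) w),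
    fun ψ h1 h2 _ => ?_⟩
  have hψ := h.2.2 (fun x => ψ (x + w)) (h1.comp (contDiff_id.add contDiff_const))
    (h2.comp_homeomorph (Homeomorph.addRight w)) (subset_univ _)
  simp only [setIntegral_univ, fderiv_comp_add_right] at hψ ⊢
  rw [← integral_add_right_eq_self (fun x => fderiv ℝ ψ x e • φ (x - w)) w,
    ← integral_add_right_eq_self (fun x => ψ x • dφ (x - w)) w]
  simpa only [add_sub_cancel_right] using hψ

theorem norm_mean_le (hz : z₀ < z₁) {f : Dom → Vec 𝕜} {B : ℝ}
    (h : ∀ q : Dom, q.2 ∈ Ioo z₀ z₁ → ‖f q‖ ≤ B) (x : Plane) : ‖mean z₀ z₁ f x‖ ≤ B := by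
  rw [mean, norm_smul, Real.norm_eq_abs, abs_of_pos (inv_pos.2 (sub_pos.2 hz))]
  have h1 := norm_setIntegral_le_of_norm_le_const (μ := volume) (s := Ioo z₀ z₁) (by simp)
    (fun z hz => h (x, z) hz)
  rw [Real.volume_real_Ioo_of_le hz.le] at h1
  rw [inv_mul_le_iff₀ (sub_pos.2 hz)]
  linarith

theorem aestronglyMeasurable_slice {f : Dom → Vec 𝕜} (hf : ContinuousOn f (univ ×ˢ Ioo z₀ z₁))
    (x : Plane) : AEStronglyMeasurable (fun z => f (x, z)) (volume.restrict (Ioo z₀ z₁)) :=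
  ContinuousOn.aestronglyMeasurable (hf.comp (f := fun z : ℝ => ((x, z) : Dom)) (s := Ioo z₀ z₁)
    (by fun_prop) fun _ hz => ⟨trivial, hz⟩) measurableSet_Ioo

theorem continuous_mean {f : Dom → Vec 𝕜} {B : ℝ} (hf : ContinuousOn f (univ ×ˢ Ioo z₀ z₁))
    (h : ∀ q : Dom, q.2 ∈ Ioo z₀ z₁ → ‖f q‖ ≤ B) : Continuous (mean z₀ z₁ f) := by
  suffices hc : Continuous fun x => ∫ z in Ioo z₀ z₁, f (x, z) from hc.const_smul (z₁ - z₀)⁻¹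
  refine continuous_of_dominated (bound := fun _ => B) (fun x => aestronglyMeasurable_slice hf x)
    (fun x => (ae_restrict_mem measurableSet_Ioo).mono fun z hz => h (x, z) hz)
    (integrable_const _) ((ae_restrict_mem measurableSet_Ioo).mono fun z hz => ?_)
  exact hf.comp_continuous (by fun_prop) fun x => ⟨trivial, hz⟩

theorem hasLineDerivAt_mean {f f' : Dom → Vec 𝕜} {B : ℝ} {e : Plane}
    (hf : ContinuousOn f (univ ×ˢ Ioo z₀ z₁)) (hf' : ContinuousOn f' (univ ×ˢ Ioo z₀ z₁))
    (h : ∀ q : Dom, q.2 ∈ Ioo z₀ z₁ → ‖f q‖ ≤ B) (h' : ∀ q : Dom, q.2 ∈ Ioo z₀ z₁ → ‖f' q‖ ≤ B)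
    (hd : ∀ q : Dom, q.2 ∈ Ioo z₀ z₁ → HasLineDerivAt ℝ f (f' q) q ((e, 0) : Dom)) (x : Plane) :
    HasLineDerivAt ℝ (mean z₀ z₁ f) (mean z₀ z₁ f' x) x e := by
  have key : HasDerivAt (fun y : ℝ => ∫ z in Ioo z₀ z₁, f (x + y • e, z))
      (∫ z in Ioo z₀ z₁, f' (x + (0 : ℝ) • e, z)) 0 := by
    refine (hasDerivAt_integral_of_dominated_loc_of_deriv_le univ_mem (bound := fun _ => B)
      (F := fun y z => f (x + y • e, z)) (F' := fun y z => f' (x + y • e, z))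
      (Eventually.of_forall fun y => aestronglyMeasurable_slice hf _) ?_
      (aestronglyMeasurable_slice hf' _) ?_ (integrable_const _) ?_).2
    · exact (integrable_const B).mono' (aestronglyMeasurable_slice hf _)
        ((ae_restrict_mem measurableSet_Ioo).mono fun z hz => h _ hz)
    · exact (ae_restrict_mem measurableSet_Ioo).mono fun z hz y _ => h' _ hz
    · refine (ae_restrict_mem measurableSet_Ioo).mono fun z hz y _ => ?_
      have := hasDerivAt_of_hasLineDerivAt (f := f) (f' := f' (x + y • e, z)) (q := (x, z))
        (e := ((e, 0) : Dom)) (x := y) (by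
          have := hd (x + y • e, z) hz
          simpa using this)
      simpa using this
  rw [zero_smul, add_zero] at key
  exact HasDerivAt.const_smul (z₁ - z₀)⁻¹ key

/-- Translating the test function shows that solenoidality is invariant under horizontal
translations, hence it holds for difference quotients of the mean. These are bounded by the bound of
the derivative, so dominated convergence against the integrable `dφ` gives the limit. -/
theorem Solenoidal.of_hasLineDerivAt (hz : z₀ < z₁) {f f' : Dom → Vec 𝕜} {B : ℝ} {e : Plane}
    (hs : Solenoidal z₀ z₁ f)
    (hf : ContinuousOn f (univ ×ˢ Ioo z₀ z₁)) (hf' : ContinuousOn f' (univ ×ˢ Ioo z₀ z₁))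
    (h : ∀ q : Dom, q.2 ∈ Ioo z₀ z₁ → ‖f q‖ ≤ B) (h' : ∀ q : Dom, q.2 ∈ Ioo z₀ z₁ → ‖f' q‖ ≤ B)
    (hd : ∀ q : Dom, q.2 ∈ Ioo z₀ z₁ → HasLineDerivAt ℝ f (f' q) q ((e, 0) : Dom)) :
    Solenoidal z₀ z₁ f' := by
  intro φ dφ hφ hi hw
  have hder := hasLineDerivAt_mean hf hf' h h' hd
  set m := mean z₀ z₁ f with hm
  have hmc : Continuous m := continuous_mean hf h
  have hmB : ∀ x, ‖m x‖ ≤ B := norm_mean_le hz h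
  have hint : ∀ w : Plane, Integrable fun x => ∑ i, dφ i x • m (x + w) i := fun w => by
    refine integrable_finsetSum _ fun i _ => ?_
    refine (hi i).smul_bdd B (Continuous.aestronglyMeasurable (by fun_prop)) (Eventually.of_forall fun x => ?_)
    exact (norm_coord_le _ i).trans (hmB _)
  have hzero : ∀ w : Plane, ∫ x, ∑ i, dφ i x • m (x + w) i = 0 := fun w => by
    have := hs (fun x => φ (x - w)) (fun i x => dφ i (x - w))
      (LocallyIntegrable.comp_sub hφ w) (fun i => (hi i).comp_sub_right w)
      (fun i => (hw i).comp_sub w)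
    rw [← integral_add_right_eq_self _ w] at this
    simpa only [add_sub_cancel_right] using this
  set u : ℕ → ℝ := fun n => 1 / ((n : ℝ) + 1) with hu
  have hu0 : ∀ n, 0 < u n := fun n => by simp only [hu]; positivity
  have hul : Tendsto u atTop (𝓝[≠] 0) :=
    tendsto_nhdsWithin_iff.2 ⟨tendsto_one_div_add_atTop_nhds_zero_nat,
      Eventually.of_forall fun n => (hu0 n).ne'⟩
  have hquot : ∀ n, ∫ x, ∑ i, dφ i x • ((u n)⁻¹ • (m (x + u n • e) - m x)) i = 0 := fun n => by
    have e1 : ∀ x, ∑ i, dφ i x • ((u n)⁻¹ • (m (x + u n • e) - m x)) i =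
        (u n)⁻¹ • (∑ i, dφ i x • m (x + u n • e) i - ∑ i, dφ i x • m (x + 0) i) := fun x => by
      rw [← Finset.sum_sub_distrib, Finset.smul_sum]
      refine Finset.sum_congr rfl fun i _ => ?_
      simp only [PiLp.smul_apply, PiLp.sub_apply, add_zero]
      rw [← smul_sub, smul_comm]
    simp only [e1]
    rw [integral_smul, integral_sub (hint _) (hint _), hzero, hzero]
    simp
  have hlip : ∀ n x, ‖(u n)⁻¹ • (m (x + u n • e) - m x)‖ ≤ B := fun n x => by
    have hmv := Convex.norm_image_sub_le_of_norm_hasDerivWithin_le (s := univ)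
      (f := fun y : ℝ => m (x + y • e)) (f' := fun y => mean z₀ z₁ f' (x + y • e)) (C := B)
      (fun y _ => (hasDerivAt_of_hasLineDerivAt (hder (x + y • e))).hasDerivWithinAt)
      (fun y _ => norm_mean_le hz h' _) convex_univ (mem_univ 0) (mem_univ (u n))
    simp only [zero_smul, add_zero, sub_zero, Real.norm_eq_abs, abs_of_pos (hu0 n)] at hmv
    rw [norm_smul, Real.norm_eq_abs, abs_of_pos (inv_pos.2 (hu0 n)), inv_mul_le_iff₀ (hu0 n)]
    linarith
  have hlim : Tendsto (fun n => ∫ x, ∑ i, dφ i x • ((u n)⁻¹ • (m (x + u n • e) - m x)) i) atTop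
      (𝓝 (∫ x, ∑ i, dφ i x • mean z₀ z₁ f' x i)) := by
    refine tendsto_integral_of_dominated_convergence (fun x => ∑ i, ‖dφ i x‖ * B) (fun n => ?_)
      (integrable_finsetSum _ fun i _ => (hi i).norm.mul_const _) (fun n => ?_) ?_
    · refine Finset.aestronglyMeasurable_fun_sum _ fun i _ => (hi i).1.smul ?_
      exact Continuous.aestronglyMeasurable (by fun_prop)
    · refine Eventually.of_forall fun x => (norm_sum_le _ _).trans (Finset.sum_le_sum fun i _ => ?_)
      rw [norm_smul]
      exact mul_le_mul_of_nonneg_left ((norm_coord_le _ i).trans (hlip n x)) (norm_nonneg _)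
    · refine Eventually.of_forall fun x => tendsto_finsetSum _ fun i _ => ?_
      have h1 := tendsto_quotient (hder x) hul
      have h2 : Continuous fun w : Vec 𝕜 => w i := by fun_prop
      exact ((h2.tendsto _).comp h1).const_smul _
  exact tendsto_nhds_unique hlim (by simp only [hquot]; exact tendsto_const_nhds)

end SolenoidalDerivative

/-! ### Weighted families in time and the function spaces of the statement -/

section Families

variable {E : Type*} [NormedAddCommGroup E] {z₀ z₁ T β γ : ℝ}

theorem UCFamily.smul [NormedSpace ℝ E] {G : ℝ → Dom → E} (h : UCFamily z₀ z₁ T G)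
    (hb : ∀ t₀ t₁ : ℝ, 0 < t₀ → t₁ < T → ∃ B, ∀ t ∈ Icc t₀ t₁, ∀ q : Dom, q.2 ∈ Ioo z₀ z₁ →
      ‖G t q‖ ≤ B) {w : ℝ → ℝ} (hw : ContinuousOn w (Ioi 0)) :
    UCFamily z₀ z₁ T (fun t => w t • G t) := by
  intro t₀ t₁ h0 h1 ε hε
  have hw' : ContinuousOn w (Icc t₀ t₁) := hw.mono fun t ht => h0.trans_le ht.1
  obtain ⟨W, hW⟩ := isCompact_Icc.exists_bound_of_continuousOn hw'
  obtain ⟨B, hB⟩ := hb t₀ t₁ h0 h1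
  have huc := isCompact_Icc.uniformContinuousOn_of_continuous hw'
  rw [Metric.uniformContinuousOn_iff] at huc
  obtain ⟨η₁, hη₁, h2⟩ := huc (ε / (2 * (|B| + 1))) (by positivity)
  obtain ⟨η₂, hη₂, h3⟩ := h t₀ t₁ h0 h1 (ε / (2 * (|W| + 1))) (by positivity)
  refine ⟨min η₁ η₂, lt_min hη₁ hη₂, fun t ht t' ht' q q' hq hq' htt hqq => ?_⟩
  have e : (w t • G t) q - (w t' • G t') q' = w t • (G t q - G t' q') + (w t - w t') • G t' q' := by
    simp only [Pi.smul_apply, smul_sub, sub_smul]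
    abel
  rw [e]
  have i1 : ‖w t • (G t q - G t' q')‖ ≤ |W| * (ε / (2 * (|W| + 1))) := by
    rw [norm_smul]
    exact mul_le_mul ((hW t ht).trans (le_abs_self _)) (h3 t ht t' ht' q q' hq hq'
      (htt.trans_le (min_le_right _ _)) (hqq.trans_le (min_le_right _ _))) (norm_nonneg _)
      (abs_nonneg _)
  have i2 : ‖(w t - w t') • G t' q'‖ ≤ ε / (2 * (|B| + 1)) * |B| := by
    rw [norm_smul]
    refine mul_le_mul ?_ ((hB t' ht' q' hq').trans (le_abs_self _)) (norm_nonneg _) (by positivity)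
    rw [← dist_eq_norm]
    exact (h2 t ht t' ht' (htt.trans_le (min_le_left _ _))).le
  have i3 : ∀ x : ℝ, 0 ≤ x → ε / (2 * (x + 1)) * x ≤ ε / 2 := fun x hx => by
    rw [div_mul_eq_mul_div, div_le_div_iff₀ (by positivity) (by positivity)]
    nlinarith
  refine (norm_add_le _ _).trans ?_
  have := i3 |W| (abs_nonneg _)
  have := i3 |B| (abs_nonneg _)
  linarith

theorem dist_slice (x y : Plane) (z : ℝ) : dist ((x, z) : Dom) (y, z) = dist x y := by
  rw [Prod.dist_eq]; simp

/-- `f` agrees with a bounded and uniformly continuous function. -/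
def IsUC (z₀ z₁ : ℝ) (f g : Dom → E) : Prop :=
  f =ᵐ[layer z₀ z₁] g ∧ (∃ B, 0 ≤ B ∧ ∀ q : Dom, q.2 ∈ Ioo z₀ z₁ → ‖g q‖ ≤ B) ∧
    ∀ ε : ℝ, 0 < ε → ∃ η > 0, ∀ q q' : Dom, q.2 ∈ Ioo z₀ z₁ → q'.2 ∈ Ioo z₀ z₁ → dist q q' < η →
      ‖g q - g q'‖ ≤ ε

theorem IsUC.continuousOn {f g : Dom → E} (h : IsUC z₀ z₁ f g) :
    ContinuousOn g (univ ×ˢ Ioo z₀ z₁) := by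
  rw [Metric.continuousOn_iff]
  intro q hq ε hε
  obtain ⟨η, hη, h1⟩ := h.2.2 (ε / 2) (half_pos hε)
  exact ⟨η, hη, fun p hp hd => by
    rw [dist_eq_norm]; exact (h1 p q hp.2 hq.2 hd).trans_lt (half_lt_self hε)⟩

theorem IsUC.memLInf {f g : Dom → E} (h : IsUC z₀ z₁ f g) {p : ℝ≥0∞} (hp : 1 ≤ p) :
    MemLInf z₀ z₁ p f := by
  have hm : AEStronglyMeasurable g (layer z₀ z₁) := by
    rw [layer_eq]
    exact h.continuousOn.aestronglyMeasurable (measurableSet_dom z₀ z₁)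
  refine ⟨hm.congr h.1.symm, ?_⟩
  obtain ⟨B, hB0, hB⟩ := h.2.1
  rw [mixedNorm_congr h.1]
  exact (mixedNorm_le_of_bdd z₀ z₁ hp hB0 (ae_layer_mem.mono hB)).trans_lt ENNReal.ofReal_lt_top

theorem IsUC.memBUC {f g : Dom → E} (h : IsUC z₀ z₁ f g) {p : ℝ≥0∞} (hp : 1 ≤ p) :
    MemBUC z₀ z₁ p f := by
  obtain ⟨B, hB0, hB⟩ := h.2.1
  have hae : ∀ {P : ℝ → Prop}, (∀ z ∈ Ioo z₀ z₁, P z) → ∀ᵐ z ∂(volume.restrict (Ioo z₀ z₁)), P z :=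
    fun hP => (ae_restrict_mem measurableSet_Ioo).mono hP
  refine ⟨(h.memLInf hp).1, g, h.1, fun x => ?_, ⟨_, fun x =>
    eLpNorm_le_of_bdd z₀ z₁ hp hB0 (hae fun z hz => hB (x, z) hz)⟩, fun ε hε => ?_⟩
  · exact ContinuousOn.aestronglyMeasurable (h.continuousOn.comp (f := fun z : ℝ => ((x, z) : Dom))
      (s := Ioo z₀ z₁) (by fun_prop) fun _ hz => ⟨trivial, hz⟩) measurableSet_Ioo
  · have hm : 0 < max 1 (z₁ - z₀) := lt_max_of_lt_left one_pos
    obtain ⟨η, hη, h1⟩ := h.2.2 (ε / max 1 (z₁ - z₀)) (by positivity)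
    refine ⟨η, hη, fun x y hxy => ?_⟩
    refine (eLpNorm_le_of_bdd z₀ z₁ hp (B := ε / max 1 (z₁ - z₀)) (by positivity)
      (hae fun z hz => h1 (x, z) (y, z) hz hz (by rwa [dist_slice]))).trans
      (ENNReal.ofReal_le_ofReal (le_of_eq ?_))
    field_simp

theorem IsUC.memBUCBUC {f g : Dom → E} (h : IsUC z₀ z₁ f g) : MemBUCBUC z₀ z₁ f := by
  obtain ⟨B, hB0, hB⟩ := h.2.1
  refine ⟨g, h.1, fun x => ?_, ⟨B, fun x z hz => hB (x, z) hz⟩, fun ε hε => ?_⟩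
  · rw [Metric.uniformContinuousOn_iff]
    intro ε hε
    obtain ⟨η, hη, h1⟩ := h.2.2 (ε / 2) (half_pos hε)
    refine ⟨η, hη, fun z hz z' hz' hd => ?_⟩
    rw [dist_eq_norm]
    refine (h1 (x, z) (x, z') hz hz' ?_).trans_lt (half_lt_self hε)
    rw [Prod.dist_eq]
    simpa using hd
  · obtain ⟨η, hη, h1⟩ := h.2.2 ε hε
    exact ⟨η, hη, fun x y hxy z hz => h1 (x, z) (y, z) hz hz (by rwa [dist_slice])⟩

theorem mixedNorm_zero (p : ℝ≥0∞) : mixedNorm z₀ z₁ p (0 : Dom → E) = 0 := by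
  have : mixedNorm z₀ z₁ p (0 : Dom → E) ≤ 0 := by
    rw [mixedNorm_le_iff]
    simp
  exact le_antisymm this bot_le

variable [NormedSpace ℝ E]

theorem mixedNorm_smul_le {f : Dom → E} {p : ℝ≥0∞} {c B : ℝ} (hc : 0 ≤ c)
    (h : mixedNorm z₀ z₁ p f ≤ ENNReal.ofReal B) :
    mixedNorm z₀ z₁ p (c • f) ≤ ENNReal.ofReal (c * B) := by
  rw [mixedNorm_le_iff] at h ⊢
  filter_upwards [h] with x hx
  refine (eLpNorm_const_smul_le (c := c) (f := fun z => f (x, z))).trans ?_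
  rw [ENNReal.ofReal_mul hc, Real.enorm_eq_ofReal hc]
  exact mul_le_mul' le_rfl hx

/-- A family of functions `f t` with uniformly continuous representatives `G t` and with bounds
of order `t^(-β)` and, in `L^∞(L¹)`, of order `t^(-γ)`. -/
structure GoodFamily (z₀ z₁ T β γ : ℝ) (f G : ℝ → Dom → E) : Prop where
  uc : UCFamily z₀ z₁ T G
  ae : ∀ t ∈ Ioo 0 T, f t =ᵐ[layer z₀ z₁] G t
  sup : ∃ K, 0 ≤ K ∧ ∀ t ∈ Ioo 0 T, ∀ q : Dom, q.2 ∈ Ioo z₀ z₁ → ‖G t q‖ ≤ K * t ^ (-β)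
  one : ∃ N, 0 ≤ N ∧ ∀ t ∈ Ioo 0 T, mixedNorm z₀ z₁ 1 (f t) ≤ ENNReal.ofReal (N * t ^ (-γ))

variable {f G : ℝ → Dom → E}

theorem GoodFamily.isUC (h : GoodFamily z₀ z₁ T β γ f G) {t : ℝ} (ht : t ∈ Ioo 0 T) (c : ℝ) :
    IsUC z₀ z₁ (c • f t) (c • G t) := by
  obtain ⟨K, hK0, hK⟩ := h.sup
  have hp := Real.rpow_nonneg ht.1.le (-β)
  refine ⟨(h.ae t ht).const_smul c, ⟨|c| * (K * t ^ (-β)), by positivity, fun q hq => ?_⟩,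
    fun ε hε => ?_⟩
  · rw [Pi.smul_apply, norm_smul]
    exact mul_le_mul_of_nonneg_left (hK t ht q hq) (abs_nonneg _)
  · obtain ⟨η, hη, h1⟩ := h.uc.uniformContinuousOn ht (ε := ε / (|c| + 1)) (by positivity)
    refine ⟨η, hη, fun q q' hq hq' hd => ?_⟩
    rw [Pi.smul_apply, Pi.smul_apply, ← smul_sub, norm_smul]
    refine (mul_le_mul_of_nonneg_left (h1 q q' hq hq' hd) (norm_nonneg _)).trans ?_
    rw [Real.norm_eq_abs, mul_div_assoc', div_le_iff₀ (by positivity)]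
    nlinarith [abs_nonneg c]

/-- Uniform continuity in time gives convergence in the supremum norm, which on a bounded vertical
interval controls every `L^∞(L^p)`. -/
theorem GoodFamily.tendsto (h : GoodFamily z₀ z₁ T β γ f G) {t : ℝ} (ht : t ∈ Ioo 0 T) (α : ℝ)
    {p : ℝ≥0∞} (hp : 1 ≤ p) :
    Tendsto (fun s => mixedNorm z₀ z₁ p (s ^ α • f s - t ^ α • f t)) (𝓝 t) (𝓝 0) := by
  obtain ⟨K, hK0, hK⟩ := h.sup
  have huc : UCFamily z₀ z₁ T (fun t => t ^ α • G t) := by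
    refine h.uc.smul (fun t₀ t₁ h0 h1 => ?_) fun s hs =>
      (Real.continuousAt_rpow_const s α (Or.inl (ne_of_gt hs))).continuousWithinAt
    have hc : ContinuousOn (fun s : ℝ => K * s ^ (-β)) (Icc t₀ t₁) := fun s hs =>
      ((Real.continuousAt_rpow_const s (-β) (Or.inl (h0.trans_le hs.1).ne')).const_mul
        K).continuousWithinAt
    obtain ⟨B, hB⟩ := isCompact_Icc.exists_bound_of_continuousOn hc
    exact ⟨B, fun s hs q hq => (hK s ⟨h0.trans_le hs.1, hs.2.trans_lt h1⟩ q hq).trans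
      ((le_abs_self _).trans (hB s hs))⟩
  rw [ENNReal.tendsto_nhds_zero]
  intro ε hε
  rcases eq_or_ne ε ⊤ with rfl | hεt
  · exact Eventually.of_forall fun _ => le_top
  set e := ε.toReal with he
  have he0 : 0 < e := ENNReal.toReal_pos hε.ne' hεt
  have hm : 0 < max 1 (z₁ - z₀) := lt_max_of_lt_left one_pos
  obtain ⟨t₀, h0, h0t⟩ := exists_between ht.1
  obtain ⟨t₁, h1t, h1⟩ := exists_between ht.2
  obtain ⟨η, hη, h2⟩ := huc t₀ t₁ h0 h1 (e / max 1 (z₁ - z₀)) (by positivity)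
  filter_upwards [Icc_mem_nhds h0t h1t, Metric.ball_mem_nhds t hη] with s hs hst
  have hsT : s ∈ Ioo 0 T := ⟨h0.trans_le hs.1, hs.2.trans_lt h1⟩
  have hcongr : s ^ α • f s - t ^ α • f t =ᵐ[layer z₀ z₁] s ^ α • G s - t ^ α • G t :=
    ((h.ae s hsT).const_smul _).sub ((h.ae t ht).const_smul _)
  rw [mixedNorm_congr hcongr]
  refine (mixedNorm_le_of_bdd z₀ z₁ hp (B := e / max 1 (z₁ - z₀)) (by positivity)
    (ae_layer_mem.mono fun q hq => h2 s hs t ⟨h0t.le, h1t.le⟩ q q hq hq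
      (by rwa [← Real.dist_eq]) (by simpa using hη))).trans ?_
  rw [mul_div_cancel₀ _ hm.ne', he, ENNReal.ofReal_toReal hεt]

/-- The weight `α` is the one for which all powers of `t` cancel in the interpolation. The constants
`N` and `K` are free, so that a small `K` can be inserted near the initial time. -/
theorem GoodFamily.mixedNorm_le (h : GoodFamily z₀ z₁ T β γ f G) {N K : ℝ} (hN : 0 ≤ N)
    (hK : 0 ≤ K) {p : ℝ≥0∞} (hp : 1 ≤ p) {α : ℝ} (hα : α = γ * p⁻¹.toReal + β * (1 - p⁻¹.toReal))
    {t : ℝ} (ht : t ∈ Ioo 0 T) (h1 : mixedNorm z₀ z₁ 1 (f t) ≤ ENNReal.ofReal (N * t ^ (-γ)))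
    (h2 : ∀ q : Dom, q.2 ∈ Ioo z₀ z₁ → ‖G t q‖ ≤ K * t ^ (-β)) :
    mixedNorm z₀ z₁ p (t ^ α • f t) ≤ ENNReal.ofReal (N ^ p⁻¹.toReal * K ^ (1 - p⁻¹.toReal)) := by
  have q := fun x => Real.rpow_nonneg ht.1.le x
  have i1 := mixedNorm_interpolation hp (mul_nonneg hN (q (-γ))) (mul_nonneg hK (q (-β))) h1
    (by filter_upwards [h.ae t ht, ae_layer_mem (z₀ := z₀) (z₁ := z₁)] with x hx hx'
        rw [hx]; exact h2 x hx')
  refine (mixedNorm_smul_le (q α) i1).trans (ENNReal.ofReal_le_ofReal (le_of_eq ?_))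
  rw [Real.mul_rpow hN (q _), Real.mul_rpow hK (q _), ← Real.rpow_mul ht.1.le,
    ← Real.rpow_mul ht.1.le]
  have e : t ^ α * (t ^ (-γ * p⁻¹.toReal) * t ^ (-β * (1 - p⁻¹.toReal))) = 1 := by
    rw [← Real.rpow_add ht.1, ← Real.rpow_add ht.1, hα]
    ring_nf
    exact Real.rpow_zero _
  linear_combination N ^ p⁻¹.toReal * K ^ (1 - p⁻¹.toReal) * e

/-- Strong measurability comes from continuity on `(0, T)`: the simple functions take the values of
the family at the nearest among the first points of a dense sequence. -/
theorem GoodFamily.memLInfTime (h : GoodFamily z₀ z₁ T β γ f G) (hT : 0 < T) {p : ℝ≥0∞}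
    (hp : 1 ≤ p) {α : ℝ} (hα : α = γ * p⁻¹.toReal + β * (1 - p⁻¹.toReal))
    {X : (Dom → E) → Prop} (hX : ∀ t ∈ Ioo 0 T, X (t ^ α • f t)) :
    MemLInfTime z₀ z₁ p X T (fun t => t ^ α • f t) := by
  refine ⟨(ae_restrict_mem measurableSet_Ioo).mono hX, ?_, ?_⟩
  · have : Nonempty (Ioo 0 T) := ⟨⟨T / 2, by constructor <;> linarith⟩⟩
    set e : ℕ → ℝ := fun n => (TopologicalSpace.denseSeq (Ioo 0 T) n : ℝ) with he
    have hmem : ∀ n t, SimpleFunc.nearestPt e n t ∈ Ioo 0 T := by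
      intro n t
      exact Subtype.coe_prop (TopologicalSpace.denseSeq (Ioo 0 T) (SimpleFunc.nearestPtInd e n t))
    refine ⟨fun n => (SimpleFunc.nearestPt e n).map fun t => t ^ α • f t, fun n t => ?_, ?_⟩
    · exact (h.isUC (hmem n t) _).memLInf hp
    · refine (ae_restrict_mem measurableSet_Ioo).mono fun t ht => ?_
      have hcl : t ∈ closure (range e) := by
        have h1 : (⟨t, ht⟩ : Ioo 0 T) ∈ closure (range (TopologicalSpace.denseSeq (Ioo 0 T))) :=
          TopologicalSpace.denseRange_denseSeq (Ioo 0 T) _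
        have h2 := image_closure_subset_closure_image continuous_subtype_val ⟨_, h1, rfl⟩
        rwa [← range_comp] at h2
      exact (h.tendsto ht α hp).comp (SimpleFunc.tendsto_nearestPt hcl)
  · obtain ⟨K, hK0, hK⟩ := h.sup
    obtain ⟨N, hN0, hN⟩ := h.one
    exact ⟨_, (ae_restrict_mem measurableSet_Ioo).mono fun t ht =>
      h.mixedNorm_le hN0 hK0 hp hα ht (hN t ht) (hK t ht)⟩

/-- At `t = 0` the interpolation yields `N^{1/p} ε^{1-1/p}`, which is small with `ε` because `p >
1`. At the other times `GoodFamily.tendsto` applies. -/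
theorem GoodFamily.memCTime (h : GoodFamily z₀ z₁ T β γ f G) (hT : 0 < T) {p : ℝ≥0∞}
    (hp : 1 < p) {α : ℝ} (hα : α = γ * p⁻¹.toReal + β * (1 - p⁻¹.toReal)) (hα0 : α ≠ 0)
    {X : (Dom → E) → Prop} (hX : ∀ t ∈ Ioo 0 T, X (t ^ α • f t)) (hX0 : X 0)
    (hs : ∀ ε : ℝ, 0 < ε → ∃ T' : ℝ, 0 < T' ∧ ∀ t ∈ Ioo 0 T', ∀ q : Dom, q.2 ∈ Ioo z₀ z₁ →
      ‖G t q‖ ≤ ε * t ^ (-β)) :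
    MemCTime z₀ z₁ p X (Ico 0 T) (fun t => t ^ α • f t) := by
  have hI : Ico 0 T = insert 0 (Ioo 0 T) := (Ioo_insert_left hT).symm
  have h0 : (0 : ℝ) ^ α • f 0 = 0 := by rw [Real.zero_rpow hα0, zero_smul]
  constructor
  · intro t ht
    rw [hI] at ht
    rcases ht with rfl | ht
    · simpa only [h0] using hX0
    · exact hX t ht
  intro t ht
  rw [hI] at ht ⊢
  rcases ht with rfl | ht
  · simp only [h0, sub_zero]
    rw [nhdsWithin_insert, tendsto_sup]
    refine ⟨?_, ?_⟩
    · rw [tendsto_pure_left]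
      intro s hs
      simp only [h0, mixedNorm_zero]
      exact mem_of_mem_nhds hs
    · obtain ⟨N, hN0, hN⟩ := h.one
      rw [ENNReal.tendsto_nhds_zero]
      intro ε hε
      rcases eq_or_ne ε ⊤ with rfl | hεt
      · exact Eventually.of_forall fun _ => le_top
      have he0 : 0 < ε.toReal := ENNReal.toReal_pos hε.ne' hεt
      have hp1 : p⁻¹.toReal < 1 := by
        have := ENNReal.toReal_strict_mono ENNReal.one_ne_top (ENNReal.inv_lt_one.2 hp)
        simpa using this
      obtain ⟨d, hd0, -, hd⟩ := exists_rpow_le (K := N ^ p⁻¹.toReal) (e := 1 - p⁻¹.toReal)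
        (by linarith) he0 one_pos
      obtain ⟨T', hT', h1⟩ := hs d hd0
      have hmem : Iio T' ∈ 𝓝 (0 : ℝ) := Iio_mem_nhds hT'
      filter_upwards [self_mem_nhdsWithin, mem_nhdsWithin_of_mem_nhds hmem] with s hs1 hs2
      refine (h.mixedNorm_le hN0 hd0.le hp.le hα hs1 (hN s hs1) (h1 s ⟨hs1.1, hs2⟩)).trans ?_
      rw [← ENNReal.ofReal_toReal hεt]
      exact ENNReal.ofReal_le_ofReal hd
  · exact (h.tendsto ht α hp.le).mono_left nhdsWithin_le_nhds

end Families

/-! ### Local mild solutions as good families -/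

section Assembly

variable {𝕜 : Type*} [RCLike 𝕜] {z₀ z₁ : ℝ}

theorem MemLInf.add {E : Type*} [NormedAddCommGroup E] {p : ℝ≥0∞} (hp : 1 ≤ p) {f g : Dom → E}
    (hf : MemLInf z₀ z₁ p f) (hg : MemLInf z₀ z₁ p g) : MemLInf z₀ z₁ p (f + g) := by
  refine ⟨hf.1.add hg.1, lt_of_le_of_lt (b := mixedNorm z₀ z₁ p f + mixedNorm z₀ z₁ p g) ?_
    (ENNReal.add_lt_top.2 ⟨hf.2, hg.2⟩)⟩
  rw [mixedNorm_le_iff]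
  filter_upwards [hf.1.prodMk_left, hg.1.prodMk_left,
    mixedNorm_le_iff.1 (le_refl (mixedNorm z₀ z₁ p f)),
    mixedNorm_le_iff.1 (le_refl (mixedNorm z₀ z₁ p g))] with x h1 h2 h3 h4
  exact (eLpNorm_add_le h1 h2 hp).trans (add_le_add h3 h4)

theorem Solenoidal.smul {f : Dom → Vec 𝕜} (hf : Solenoidal z₀ z₁ f) (c : ℝ) :
    Solenoidal z₀ z₁ (c • f) := fun φ dφ h1 h2 h3 => by
  have e : ∀ x, ∑ i, dφ i x • mean z₀ z₁ (c • f) x i = c • ∑ i, dφ i x • mean z₀ z₁ f x i := by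
    intro x
    rw [Finset.smul_sum]
    refine Finset.sum_congr rfl fun i _ => ?_
    have : mean z₀ z₁ (c • f) x = c • mean z₀ z₁ f x := by
      simp only [mean, Pi.smul_apply]
      rw [integral_smul, smul_comm]
    rw [this, PiLp.smul_apply, smul_comm]
  simp only [e]
  rw [integral_smul, hf φ dφ h1 h2 h3, smul_zero]

/-- A local mild solution, together with what is known of its representative. -/
structure IsRegular (z₀ z₁ T : ℝ) (a : Dom → Vec 𝕜) (v : ℝ → Dom → Vec 𝕜)
    (DH : ℝ → Fin 2 → Dom → Vec 𝕜) (Dz : ℝ → Dom → Vec 𝕜) (V : ℝ → Dom → Vec 𝕜)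
    (D : Option (Fin 2) → ℝ → Dom → Vec 𝕜) : Prop where
  vel : GoodFamily z₀ z₁ T (1 / 2) 0 v V
  hor : ∀ i, GoodFamily z₀ z₁ T 1 (1 / 2) (fun t => DH t i) (D (some i))
  ver : GoodFamily z₀ z₁ T 1 (1 / 2) Dz (D none)
  sol : ∀ t ∈ Ioo 0 T, Solenoidal z₀ z₁ (v t)
  sol_hor : ∀ t ∈ Ioo 0 T, ∀ i, Solenoidal z₀ z₁ (DH t i)

variable {C T : ℝ} {a₁ a₂ : Dom → Vec 𝕜} {v : ℝ → Dom → Vec 𝕜} {DH : ℝ → Fin 2 → Dom → Vec 𝕜}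
  {Dz : ℝ → Dom → Vec 𝕜}

theorem IsLocalMildSolution.isRegular (hz : z₀ < z₁) (hT : 0 < T)
    (h : IsLocalMildSolution z₀ z₁ C T a₁ a₂ v DH Dz) (ha : MemLInf z₀ z₁ 1 (a₁ + a₂)) :
    ∃ V : ℝ → Dom → Vec 𝕜, MildEq z₀ z₁ T (a₁ + a₂) V DH ∧
      (∀ t ∈ Ioo 0 T, v t =ᵐ[layer z₀ z₁] V t) ∧
      IsRegular z₀ z₁ T (a₁ + a₂) v DH Dz V (gradFormula z₀ z₁ (a₁ + a₂) V DH) := by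
  obtain ⟨M', hM'⟩ := h.bdd
  set M := |M'| with hMdef
  have hM0 : 0 ≤ M := abs_nonneg _
  have hM1 : ∀ t ∈ Ioo 0 T, mixedNorm z₀ z₁ 1 (v t) ≤ ENNReal.ofReal M := fun t ht =>
    (hM' t ht).1.trans (ENNReal.ofReal_le_ofReal (le_abs_self _))
  have hM2 : ∀ t ∈ Ioo 0 T, ENNReal.ofReal (Real.sqrt t) * gradNorm z₀ z₁ 1 (DH t) (Dz t) ≤
      ENNReal.ofReal M := fun t ht =>
    (hM' t ht).2.trans (ENNReal.ofReal_le_ofReal (le_abs_self _))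
  have hz' : 0 ≤ (z₁ - z₀)⁻¹ := inv_nonneg.2 (by linarith)
  -- A crude constant for the whole interval `(0, T)`: regularity at positive times requires no
  -- smallness.
  set U := (z₁ - z₀)⁻¹ * M * Real.sqrt T + M with hU
  have hU0 : 0 ≤ U := by positivity
  have hsl : ∀ t ∈ Ioo 0 T, IsSlice z₀ z₁ (v t) (DH t) (U * t ^ (-1 / 2 : ℝ)) := fun t ht =>
    h.isSlice hz ht hM0 hM0 (hM1 t ht) (hM2 t ht) (by
      have := Real.sqrt_le_sqrt ht.2.le
      rw [hU]
      gcongr)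
  obtain ⟨V, hV, hvV⟩ := h.exists_mildEq hz ha
    (fun s hs i => (hsl s hs).memLInf_flux (hsl s hs).memv i)
  refine ⟨V, hV, hvV, ?_⟩
  -- For `r = 1` the time weight of the `L^r` norm is trivial, so the bound `M` of the class is all
  -- that is needed.
  have hS : SolOn z₀ z₁ 1 T U M U V DH := by
    refine ⟨hU0, hM0, hU0, fun s hs => (hsl s hs).congr (hvV s hs), fun s hs => ?_,
      fun s hs => ((hsl s hs).congr (hvV s hs)).bound⟩
    rw [← mixedNorm_congr (hvV s hs)]
    simpa using hM1 s hs
  set A := (mixedNorm z₀ z₁ 1 (a₁ + a₂)).toReal with hA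
  have hA0 : 0 ≤ A := ENNReal.toReal_nonneg
  have haA : mixedNorm z₀ z₁ 1 (a₁ + a₂) ≤ ENNReal.ofReal A := (ENNReal.ofReal_toReal ha.2.ne).ge
  obtain ⟨c₂, -, hc2⟩ := MildEq.regOn 𝕜 hz hT
  obtain ⟨c₃, hc30, hc3⟩ := MildEq.gradient_le 𝕜 hz hT
  have hreg := hc2 1 T T U M U A _ V DH goodExp_one ⟨hT, le_rfl⟩ le_rfl hV hS hA0 haA
  set B := c₂ * (A * T ^ (1 / 2 - (1 : ℝ≥0∞)⁻¹.toReal / 2) + U * M + U * U) with hB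
  have hB0 : 0 ≤ B := hreg.hH
  have hS' := hreg.solOn hB0 hS
  have hgr := hc3 1 T U M B B A _ V DH goodExp_one ⟨hT, le_rfl⟩ ha hS' hreg hA0 haA
  set K := c₃ * (A * T ^ (1 / 2 - (1 : ℝ≥0∞)⁻¹.toReal / 2) + U * M + U * (B + B)) with hK
  have hK0 : 0 ≤ K := by
    have := Real.rpow_nonneg hT.le (1 / 2 - (1 : ℝ≥0∞)⁻¹.toReal / 2)
    positivity
  have hder : ∀ t (ht : t ∈ Ioo 0 T) d (q : Dom), q.2 ∈ Ioo z₀ z₁ → HasLineDerivAt ℝ (V t)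
      (gradFormula z₀ z₁ (a₁ + a₂) V DH d t q) q (dir d) := fun t ht d q hq =>
    hV.hasLineDerivAt hz ht goodExp_one (hS'.mono ht.2.le) (hreg.mono ht.2.le) d hq
  have hae : ∀ t ∈ Ioo 0 T, ∀ i, DH t i =ᵐ[layer z₀ z₁]
      gradFormula z₀ z₁ (a₁ + a₂) V DH (some i) t := fun t ht i =>
    hV.weakDeriv_ae_eq hz hS' hreg (some i) ht (hvV t ht) ((h.grad t ht).1.1 i)
  have hgn : ∀ t ∈ Ioo 0 T, gradNorm z₀ z₁ 1 (DH t) (Dz t) ≤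
      ENNReal.ofReal (M * t ^ (-(1 / 2 : ℝ))) := fun t ht => by
    rw [show (-(1 / 2) : ℝ) = -1 / 2 by norm_num]
    exact gradNorm_le ht.1 (hM2 t ht)
  have hVK : ∀ t ∈ Ioo 0 T, ∀ q : Dom, q.2 ∈ Ioo z₀ z₁ → ‖V t q‖ ≤ B * t ^ (-(1 / 2 : ℝ)) := by
    rw [show (-(1 / 2) : ℝ) = -1 / 2 by norm_num]
    exact hreg.sup
  refine ⟨⟨hV.ucFamily hz hS', hvV, ⟨B, hB0, hVK⟩, M, hM0, fun t ht => by simpa using hM1 t ht⟩,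
    fun i => ⟨hV.ucFamily_gradFormula hz hS' hreg _, fun t ht => hae t ht i,
      ⟨K, hK0, hgr (some i)⟩, M, hM0, fun t ht => le_trans ?_ (hgn t ht)⟩,
    ⟨hV.ucFamily_gradFormula hz hS' hreg _, fun t ht =>
      hV.weakDeriv_ae_eq hz hS' hreg none ht (hvV t ht) (h.grad t ht).1.2,
      ⟨K, hK0, hgr none⟩, M, hM0, fun t ht => le_trans le_add_self (hgn t ht)⟩,
    fun t ht => (hsl t ht).sol, fun t ht i => ?_⟩
  · exact le_trans (Finset.single_le_sum (f := fun i => mixedNorm z₀ z₁ 1 (DH t i))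
      (fun _ _ => bot_le) (Finset.mem_univ i)) le_self_add
  -- The weak derivative is replaced by the gradient formula, which is the classical derivative of
  -- the solenoidal field `V t`.
  · refine Solenoidal.congr (f := gradFormula z₀ z₁ (a₁ + a₂) V DH (some i) t) ?_ (hae t ht i).symm
    refine Solenoidal.of_hasLineDerivAt hz
      (B := max (B * t ^ (-(1 / 2 : ℝ))) (K * t ^ (-1 : ℝ)))
      ((hsl t ht).congr (hvV t ht)).sol ((hV.ucFamily hz hS').continuousOn ht)
      ((hV.ucFamily_gradFormula hz hS' hreg (some i)).continuousOn ht)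
      (fun q hq => (hVK t ht q hq).trans (le_max_left _ _))
      (fun q hq => (hgr (some i) t ht q hq).trans (le_max_right _ _))
      (fun q hq => hder t ht (some i) q hq)

/-- One half of `κ` comes from the limit superior of the gradient, the other from `(z₁ - z₀)⁻¹ M
√t`, which tends to zero. -/
theorem IsLocalMildSolution.exists_isSlice_small (hz : z₀ < z₁) (hT : 0 < T)
    (h : IsLocalMildSolution z₀ z₁ C T a₁ a₂ v DH Dz) {κ : ℝ} (hκ : 0 < κ)
    (ha : ENNReal.ofReal C * mixedNorm z₀ z₁ 1 a₂ < ENNReal.ofReal (κ / 2)) :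
    ∃ T₀ M : ℝ, 0 < T₀ ∧ T₀ ≤ T ∧ 0 ≤ M ∧
      (∀ s ∈ Ioo 0 T₀, mixedNorm z₀ z₁ 1 (v s) ≤ ENNReal.ofReal M) ∧
      ∀ s ∈ Ioo 0 T₀, IsSlice z₀ z₁ (v s) (DH s) (κ * s ^ (-1 / 2 : ℝ)) := by
  obtain ⟨M', hM'⟩ := h.bdd
  set M := |M'| with hMdef
  have hM0 : 0 ≤ M := abs_nonneg _
  have hM1 : ∀ t ∈ Ioo 0 T, mixedNorm z₀ z₁ 1 (v t) ≤ ENNReal.ofReal M := fun t ht =>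
    (hM' t ht).1.trans (ENNReal.ofReal_le_ofReal (le_abs_self _))
  have e1 := eventually_lt_of_limsup_lt (h.limsup_grad.trans_lt ha)
  have e2 : ∀ᶠ t : ℝ in 𝓝[>] 0, (z₁ - z₀)⁻¹ * M * Real.sqrt t < κ / 2 := by
    have hc : Continuous fun t : ℝ => (z₁ - z₀)⁻¹ * M * Real.sqrt t := by fun_prop
    have := (hc.tendsto 0).mono_left (nhdsWithin_le_nhds (s := Ioi 0))
    rw [Real.sqrt_zero, mul_zero] at this
    exact this.eventually (gt_mem_nhds (by positivity))
  obtain ⟨u, hu, hsub⟩ := mem_nhdsGT_iff_exists_Ioo_subset.1 (e1.and e2)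
  have hu0 : 0 < u := hu
  have hmem : ∀ s ∈ Ioo 0 (min u T), s ∈ Ioo 0 u ∧ s ∈ Ioo 0 T := fun s hs =>
    ⟨⟨hs.1, hs.2.trans_le (min_le_left _ _)⟩, ⟨hs.1, hs.2.trans_le (min_le_right _ _)⟩⟩
  refine ⟨min u T, M, lt_min hu0 hT, min_le_right _ _, hM0, fun s hs => hM1 s (hmem s hs).2,
    fun s hs => ?_⟩
  obtain ⟨h1, h2⟩ := hsub (hmem s hs).1
  exact h.isSlice hz (hmem s hs).2 hM0 (by positivity) (hM1 s (hmem s hs).2) h1.le (by linarith)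

end Assembly

end Primitive

end

/-! ### The proposition -/

theorem proposition2p3 {𝕜 : Type*} [RCLike 𝕜] (z₀ z₁ : ℝ) (hz : z₀ < z₁)
    (C R : ℝ) (hC : 0 < C) :
    ∃ ε₀ : ℝ, 0 < ε₀ ∧
      ∀ a₁ a₂ : Primitive.Dom → Primitive.Vec 𝕜,
        Primitive.MemBUCSigma z₀ z₁ 1 a₁ → Primitive.MemLInfSigma z₀ z₁ 1 a₂ →
        Primitive.mixedNorm z₀ z₁ 1 a₁ ≤ ENNReal.ofReal R →
        Primitive.mixedNorm z₀ z₁ 1 a₂ < ENNReal.ofReal ε₀ →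
        ∀ (T : ℝ) (v : ℝ → Primitive.Dom → Primitive.Vec 𝕜)
          (DH : ℝ → Fin 2 → Primitive.Dom → Primitive.Vec 𝕜)
          (Dz : ℝ → Primitive.Dom → Primitive.Vec 𝕜),
          0 < T → Primitive.IsLocalMildSolution z₀ z₁ C T a₁ a₂ v DH Dz →
          -- data in `L^∞_σ(L^p)`
          (∀ p : ℝ≥0∞, 1 < p → Primitive.MemLInfSigma z₀ z₁ p (a₁ + a₂) →
            Primitive.MemLInfTime z₀ z₁ p (Primitive.MemLInfSigma z₀ z₁ p) T
              (fun t => t ^ (1 / 2 - p⁻¹.toReal / 2) • v t) ∧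
            (∀ i, Primitive.MemLInfTime z₀ z₁ p (Primitive.MemLInfSigma z₀ z₁ p) T
              (fun t => t ^ (1 - p⁻¹.toReal / 2) • DH t i)) ∧
            Primitive.MemLInfTime z₀ z₁ p (Primitive.MemLInf z₀ z₁ p) T
              (fun t => t ^ (1 - p⁻¹.toReal / 2) • Dz t)) ∧
          -- data in `BUC_σ(L^p)`
          (∀ p : ℝ≥0∞, 1 < p → Primitive.MemBUCSigma z₀ z₁ p (a₁ + a₂) →
            Primitive.MemCTime z₀ z₁ p (Primitive.MemBUCSigma z₀ z₁ p) (Ico 0 T)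
              (fun t => t ^ (1 / 2 - p⁻¹.toReal / 2) • v t) ∧
            (∀ i, Primitive.MemCTime z₀ z₁ p (Primitive.MemBUCSigma z₀ z₁ p) (Ico 0 T)
              (fun t => t ^ (1 - p⁻¹.toReal / 2) • DH t i)) ∧
            Primitive.MemCTime z₀ z₁ p (Primitive.MemBUC z₀ z₁ p) (Ico 0 T)
              (fun t => t ^ (1 - p⁻¹.toReal / 2) • Dz t)) ∧
          -- data in `BUC_σ(BUC)`
          (Primitive.MemBUCBUCSigma z₀ z₁ (a₁ + a₂) →
            Primitive.MemCTime z₀ z₁ ⊤ (Primitive.MemBUCBUCSigma z₀ z₁) (Ico 0 T)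
              (fun t => t ^ (1 / 2 : ℝ) • v t) ∧
            (∀ i, Primitive.MemCTime z₀ z₁ ⊤ (Primitive.MemBUCBUCSigma z₀ z₁) (Ico 0 T)
              (fun t => t • DH t i)) ∧
            Primitive.MemCTime z₀ z₁ ⊤ (Primitive.MemBUCBUC z₀ z₁) (Ico 0 T)
              (fun t => t • Dz t)) := by
  obtain ⟨κ, hκ, hsmall⟩ := Primitive.exists_smallness 𝕜 z₀ z₁ hz
  -- With this `ε₀` the limit superior, at most `C ‖a₂‖`, lies below `κ/2`.
  refine ⟨κ / 2 / C, by positivity,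
    fun a₁ a₂ ha1 ha2 _ hε T v DH Dz hT hsol => ?_⟩
  have ha : Primitive.MemLInf z₀ z₁ 1 (a₁ + a₂) := ha1.2.1.add le_rfl ha2.1
  have hε' : ENNReal.ofReal C * Primitive.mixedNorm z₀ z₁ 1 a₂ < ENNReal.ofReal (κ / 2) := by
    have := ENNReal.mul_lt_mul_right (ENNReal.ofReal_pos.2 hC).ne' ENNReal.ofReal_ne_top hε
    rwa [← ENNReal.ofReal_mul hC.le, mul_div_cancel₀ _ hC.ne'] at this
  obtain ⟨V, hV, hvV, hreg⟩ := hsol.isRegular hz hT ha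
  obtain ⟨T₀, M, hT0, hT0T, hM0, hM, hsl⟩ := hsol.exists_isSlice_small hz hT hκ hε'
  have hmem : ∀ s ∈ Ioo 0 T₀, s ∈ Ioo 0 T := fun s hs => ⟨hs.1, hs.2.trans_le hT0T⟩
  have small : ∀ p : ℝ≥0∞, 1 < p → Primitive.MemLInf z₀ z₁ p (a₁ + a₂) → ∀ ε : ℝ, 0 < ε →
      ∃ T' : ℝ, 0 < T' ∧ ∀ s ∈ Ioo 0 T', ∀ q : Primitive.Dom, q.2 ∈ Ioo z₀ z₁ →
        ‖V s q‖ ≤ ε * s ^ (-(1 / 2) : ℝ) ∧ ∀ d,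
          ‖Primitive.gradFormula z₀ z₁ (a₁ + a₂) V DH d s q‖ ≤ ε * s ^ (-1 : ℝ) := by
    intro p hp hap ε hε
    obtain ⟨T', hT', -, h1⟩ := hsmall T (a₁ + a₂) V DH p T₀ κ M hV hp hap hT0 hT0T hκ.le le_rfl hM0
      (fun s hs => by rw [← Primitive.mixedNorm_congr (hvV s (hmem s hs))]; exact hM s hs)
      (fun s hs => (hsl s hs).congr (hvV s (hmem s hs))) ε hε
    rw [show (-1 / 2 : ℝ) = -(1 / 2) by norm_num] at h1
    exact ⟨T', hT', h1⟩
  have hp1 : ∀ p : ℝ≥0∞, 1 < p → p⁻¹.toReal < 1 := fun p hp => by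
    have := ENNReal.toReal_strict_mono ENNReal.one_ne_top (ENNReal.inv_lt_one.2 hp)
    simpa using this
  have hmid : T / 2 ∈ Ioo 0 T := ⟨by positivity, by linarith⟩
  -- Parts b) and c) differ only in the spaces of values, which are therefore left abstract: `X` for
  -- `v` and `∂_i v`, `Y` for `∂_z v`.
  have ctime : ∀ p : ℝ≥0∞, 1 < p → Primitive.MemLInf z₀ z₁ p (a₁ + a₂) →
      ∀ X Y : (Primitive.Dom → Primitive.Vec 𝕜) → Prop,
      (∀ f g, Primitive.IsUC z₀ z₁ f g → Primitive.Solenoidal z₀ z₁ f → X f) →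
      (∀ f g, Primitive.IsUC z₀ z₁ f g → Y f) →
      Primitive.MemCTime z₀ z₁ p X (Ico 0 T) (fun t => t ^ (1 / 2 - p⁻¹.toReal / 2) • v t) ∧
      (∀ i, Primitive.MemCTime z₀ z₁ p X (Ico 0 T)
        (fun t => t ^ (1 - p⁻¹.toReal / 2) • DH t i)) ∧
      Primitive.MemCTime z₀ z₁ p Y (Ico 0 T) (fun t => t ^ (1 - p⁻¹.toReal / 2) • Dz t) := by
    intro p hp hap X Y hX hY
    have := hp1 p hp
    -- Zero belongs to the space as zero times the value at an arbitrary positive time.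
    have hX0 : X 0 := by
      have := hX _ _ (hreg.vel.isUC hmid 0) ((hreg.sol _ hmid).smul 0)
      rwa [zero_smul] at this
    have hY0 : Y 0 := by
      have := hY _ _ (hreg.vel.isUC hmid 0)
      rwa [zero_smul] at this
    -- The weights are those of the interpolation: `1/2 - 1/(2p)` from `β = 1/2`, `γ = 0`, and `1 -
    -- 1/(2p)` from `β = 1`, `γ = 1/2`.
    refine ⟨hreg.vel.memCTime hT hp (by ring) (by linarith)
      (fun t ht => hX _ _ (hreg.vel.isUC ht _) ((hreg.sol t ht).smul _)) hX0 fun ε hε => ?_,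
      fun i => (hreg.hor i).memCTime hT hp (by ring) (by linarith)
      (fun t ht => hX _ _ ((hreg.hor i).isUC ht _) ((hreg.sol_hor t ht i).smul _)) hX0
        fun ε hε => ?_,
      hreg.ver.memCTime hT hp (by ring) (by linarith)
      (fun t ht => hY _ _ (hreg.ver.isUC ht _)) hY0 fun ε hε => ?_⟩
    · obtain ⟨T', hT', h1⟩ := small p hp hap ε hε
      exact ⟨T', hT', fun s hs q hq => (h1 s hs q hq).1⟩
    · obtain ⟨T', hT', h1⟩ := small p hp hap ε hε
      exact ⟨T', hT', fun s hs q hq => (h1 s hs q hq).2 _⟩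
    · obtain ⟨T', hT', h1⟩ := small p hp hap ε hε
      exact ⟨T', hT', fun s hs q hq => (h1 s hs q hq).2 _⟩
  refine ⟨fun p hp hap => ?_, fun p hp hap => ?_, fun hap => ?_⟩
  · exact ⟨hreg.vel.memLInfTime hT hp.le (by ring)
      fun t ht => ⟨(hreg.vel.isUC ht _).memLInf hp.le, (hreg.sol t ht).smul _⟩,
      fun i => (hreg.hor i).memLInfTime hT hp.le (by ring)
      fun t ht => ⟨((hreg.hor i).isUC ht _).memLInf hp.le, (hreg.sol_hor t ht i).smul _⟩,
      hreg.ver.memLInfTime hT hp.le (by ring) fun t ht => (hreg.ver.isUC ht _).memLInf hp.le⟩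
  · exact ctime p hp hap.2.1 _ _ (fun f g h hs => ⟨h.memBUC hp.le, h.memLInf hp.le, hs⟩)
      fun f g h => h.memBUC hp.le
  -- Part c) is the case `p = ∞`, in which the exponents become `1/2` and `1`.
  · have := ctime ⊤ ENNReal.one_lt_top hap.2.1 (Primitive.MemBUCBUCSigma z₀ z₁)
      (Primitive.MemBUCBUC z₀ z₁) (fun f g h hs => ⟨h.memBUCBUC, h.memLInf le_top, hs⟩)
      fun f g h => h.memBUCBUC
    simpa using this
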